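/- Let $d\in\{2,3\}$, $\mathbb T^d=\mathbb R^d/\mathbb Z^d$, and let $s\ge [d/2]+2$ be real. For $\epsilon>0$, the Euler–Poisson system $(EP_\epsilon)$ on $\mathbb T^d$ is $$\partial_t\rho+\nabla\cdot(\rho v)=0,\qquad \partial_t v+v\cdot\nabla v=\frac{\nabla\phi}{\epsilon},\qquad \epsilon\Delta\phi=\rho-1,$$ and the incompressible Euler system $(E)$ is $$\partial_t v+v\cdot\nabla v=\nabla p,\qquad \nabla\cdot v=0.$$ For a vector field $v\in L^2(\mathbb T^d)$ write $v=\Pi v+\nabla q$ with $q$ periodic and $\nabla\cdot\Pi v=0$; $\Pi v$ is the solenoidal part and $\nabla q$ the potential part of $v$. Let $\epsilon$ range over a sequence of positive numbers tending to $0$, and let $(\rho_0^\epsilon,v_0^\epsilon)$ be initial data such that $\int_{\mathbb T^d}\rho_0^\epsilon=1$, $v_0^\epsilon$ is bounded in $H^s(\mathbb T^d)$, and $\epsilon^{-1}(\rho_0^\epsilon-1)$ is bounded in $H^{s-1}(\mathbb T^d)$. Then there exist $T>0$, independent of $\epsilon$, and solutions $(\rho^\epsilon,v^\epsilon)$ of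 $(EP_\epsilon)$ on $[0,T]$ with initial data $(\rho_0^\epsilon,v_0^\epsilon)$, such that $\rho^\epsilon\ge0$ whenever $\rho_0^\epsilon\ge 0$, and: 1. the sequence $(\epsilon^{-1}(\rho^\epsilon-1),v^\epsilon)$ is bounded in $L^\infty([0,T],H^{s-1}\times H^s(\mathbb T^d))$; 2. the potential part of $v^\epsilon$ converges weakly to $0$ in $L^2([0,T]\times\mathbb T^d)$; 3. if $\Pi v_0^\epsilon$ converges weakly in $L^2(\mathbb T^d)$ to some $\bar v_0$, then there is a unique solution $\bar v\in L^\infty([0,T],H^s(\mathbb T^d))$ of $(E)$ on $[0,T]$ with initial datum $\bar v_0$, and for all $s'<s$, $\Pi v^\epsilon$ converges to $\bar v$ in $C([0,T],H^{s'}(\mathbb T^d))$. Here the momentum equations, the Poisson equation and $\nabla\cdot v=0$ hold pointwise on $[0,T]\times\mathbb T^d$, with $v$, $\nabla v$, $\rho$, $\nabla\phi$ (resp. $\nabla p$) continuous there; the continuity equation holds in the sense of distributions. -/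

import Mathlib

open MeasureTheory Filter Topology Set
open scoped ENNReal NNReal ContDiff

noncomputable section

/-- The flat torus `ℝ^d / ℤ^d`. -/
abbrev Torus (d : ℕ) : Type := UnitAddTorus (Fin d)

/-- Lebesgue measure on the torus, of total mass one (the measure underlying
`UnitAddTorus.mFourierCoeff`). -/
def torusMeasure (d : ℕ) : Measure (Torus d) :=
  Measure.pi fun _ => (AddCircle.haarAddCircle : Measure UnitAddCircle)

/-- The `ℤ^d`-periodic function on `ℝ^d` that corresponds to a function on the torus. -/
def perLift {d : ℕ} {E : Type*} (f : Torus d → E) : (Fin d → ℝ) → E :=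
  fun y => f fun i => (y i : UnitAddCircle)

/-- The partial derivative `∂_i f` of a function on the torus. -/
def pd {d : ℕ} (i : Fin d) (f : Torus d → ℝ) (x : Torus d) : ℝ :=
  deriv (fun h : ℝ => f (x + Pi.single i (h : UnitAddCircle))) 0

/-- Smooth functions on the torus (the test functions). -/
def IsTest {d : ℕ} (ψ : Torus d → ℝ) : Prop :=
  ContDiff ℝ ∞ (perLift ψ)

/-- The `H^s` norm, `s` real, of an integrable function on the torus:
`(∑_k (1 + |k|²)^s |f̂(k)|²)^{1/2}`, with values in `[0, ∞]`. -/
def hsNorm {d : ℕ} (s : ℝ) (f : Torus d → ℝ) : ℝ≥0∞ :=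
  (∑' k : Fin d → ℤ, ENNReal.ofReal ((1 + ∑ i, (k i : ℝ) ^ 2) ^ s) *
    ‖UnitAddTorus.mFourierCoeff (fun x => (f x : ℂ)) k‖ₑ ^ 2) ^ (1 / 2 : ℝ)

/-- The `H^s` norm of a vector field on the torus. -/
def hsNormVec {d : ℕ} (s : ℝ) (u : Torus d → Fin d → ℝ) : ℝ≥0∞ :=
  (∑ i, hsNorm s (fun x => u x i) ^ 2) ^ (1 / 2 : ℝ)

/-- The time-dependent vector field `u`, square integrable at each time, belongs to
`C([0,T], H^s)`. -/
def IsContinuousInHs {d : ℕ} (s T : ℝ) (u : ℝ → Torus d → Fin d → ℝ) : Prop :=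
  ∀ t ∈ Icc 0 T, MemLp (u t) 2 (torusMeasure d) ∧ hsNormVec s (u t) < ⊤ ∧
    Tendsto (fun τ => hsNormVec s (u τ - u t)) (𝓝[Icc 0 T] t) (𝓝 0)

/-- Weak convergence in `L²(μ; ℝ^d)`. -/
def TendstoWeakL2 {d : ℕ} {X : Type*} [MeasurableSpace X] (μ : Measure X)
    (f : ℕ → X → Fin d → ℝ) (g : X → Fin d → ℝ) : Prop :=
  (∀ n, MemLp (f n) 2 μ) ∧ MemLp g 2 μ ∧
    ∀ h : X → Fin d → ℝ, MemLp h 2 μ →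
      Tendsto (fun n => ∫ x, ∑ i, f n x i * h x i ∂μ) atTop (𝓝 (∫ x, ∑ i, g x i * h x i ∂μ))

/-- `u = w + g` is the decomposition of the square integrable field `u` into its solenoidal part
`w` and its potential part `g`: `w` is divergence free and `g = ∇q` with `q` a function on the
torus, both in the sense of distributions. This determines `w` and `g` up to null sets. -/
structure IsHelmholtz {d : ℕ} (u w g : Torus d → Fin d → ℝ) : Prop where
  memLp_sol : MemLp w 2 (torusMeasure d)
  memLp_pot : MemLp g 2 (torusMeasure d)
  sum_eq : ∀ᵐ x ∂torusMeasure d, u x = w x + g x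
  div_free : ∀ ψ : Torus d → ℝ, IsTest ψ → ∫ x, ∑ i, w x i * pd i ψ x ∂torusMeasure d = 0
  gradient : ∃ q : Torus d → ℝ, MemLp q 2 (torusMeasure d) ∧
    ∀ ψ : Torus d → ℝ, IsTest ψ → ∀ i,
      ∫ x, q x * pd i ψ x ∂torusMeasure d = -∫ x, g x i * ψ x ∂torusMeasure d

/-- `f` is of class `C^1` in the space variable at each time of `[0,T]`, and `f` and its first
order space derivatives are continuous on `[0,T] × 𝕋^d`. -/
structure IsC1Slab {d : ℕ} (T : ℝ) (f : ℝ → Torus d → ℝ) : Prop where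
  contDiff : ∀ t ∈ Icc 0 T, ContDiff ℝ 1 (perLift (f t))
  continuousOn : ContinuousOn (fun z : ℝ × Torus d => f z.1 z.2) (Icc 0 T ×ˢ univ)
  continuousOn_pd : ∀ i,
    ContinuousOn (fun z : ℝ × Torus d => pd i (f z.1) z.2) (Icc 0 T ×ˢ univ)

/-- `(ρ, v)` is a solution on `[0,T]`, with initial data `(ρ₀, v₀)`, of the Euler–Poisson system
`∂ₜρ + ∇·(ρv) = 0`, `∂ₜv + v·∇v = ∇φ/ε`, `ε Δφ = ρ - 1`.
The last two equations hold at every point of `[0,T] × 𝕋^d`. The first one holds in the sense of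
distributions, `d/dt ∫ ρψ = ∫ ρ v·∇ψ` for every test function `ψ`, since for `ρ` in `H^{s-1}`
the derivatives of `ρ` need not be continuous. -/
structure IsEulerPoissonSolution {d : ℕ} (ε T : ℝ) (ρ₀ : Torus d → ℝ) (v₀ : Torus d → Fin d → ℝ)
    (ρ : ℝ → Torus d → ℝ) (v : ℝ → Torus d → Fin d → ℝ) : Prop where
  density_continuousOn : ContinuousOn (fun z : ℝ × Torus d => ρ z.1 z.2) (Icc 0 T ×ˢ univ)
  velocity_regular : ∀ i, IsC1Slab T (fun t x => v t x i)
  density_init : ∀ᵐ x ∂torusMeasure d, ρ 0 x = ρ₀ x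
  velocity_init : ∀ᵐ x ∂torusMeasure d, v 0 x = v₀ x
  continuity_eq : ∀ ψ : Torus d → ℝ, IsTest ψ → ∀ t ∈ Icc 0 T,
    HasDerivWithinAt (fun τ => ∫ x, ρ τ x * ψ x ∂torusMeasure d)
      (∫ x, ρ t x * ∑ j, v t x j * pd j ψ x ∂torusMeasure d) (Icc 0 T) t
  momentum_poisson : ∃ φ : ℝ → Torus d → ℝ, IsC1Slab T φ ∧
    (∀ t ∈ Icc 0 T, ContDiff ℝ 2 (perLift (φ t))) ∧
    (∀ t ∈ Icc 0 T, ∀ x, ∀ i, HasDerivWithinAt (fun τ => v τ x i)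
      (-(∑ j, v t x j * pd j (fun y => v t y i) x) + pd i (φ t) x / ε) (Icc 0 T) t) ∧
    (∀ t ∈ Icc 0 T, ∀ x, ε * ∑ i, pd i (pd i (φ t)) x = ρ t x - 1)

/-- `v` is a solution on `[0,T]`, in `L^∞([0,T], H^s)` and with initial datum `v₀`, of the
incompressible Euler system `∂ₜv + v·∇v = ∇p`, `∇·v = 0`; the equations hold at every point of
`[0,T] × 𝕋^d`. -/
structure IsEulerSolution {d : ℕ} (s T : ℝ) (v₀ : Torus d → Fin d → ℝ)
    (v : ℝ → Torus d → Fin d → ℝ) : Prop where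
  regular : ∀ i, IsC1Slab T (fun t x => v t x i)
  bounded : ∃ M : ℝ≥0, ∀ t ∈ Icc 0 T, hsNormVec s (v t) ≤ M
  init : ∀ᵐ x ∂torusMeasure d, v 0 x = v₀ x
  div_free : ∀ t ∈ Icc 0 T, ∀ x, ∑ i, pd i (fun y => v t y i) x = 0
  momentum : ∃ p : ℝ → Torus d → ℝ, IsC1Slab T p ∧
    ∀ t ∈ Icc 0 T, ∀ x, ∀ i, HasDerivWithinAt (fun τ => v τ x i)
      (-(∑ j, v t x j * pd j (fun y => v t y i) x) + pd i (p t) x) (Icc 0 T) t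

end

open scoped ComplexConjugate

noncomputable section

variable {d : ℕ}

/-! Put `σ = (ρ - 1)/ε` and take as unknowns the Fourier coefficients of `v` and of `|∇|⁻¹ σ`; the
latter is the `none` component of `u`, so that `σ̂(k) = 2π|k| u k none`. In these variables the
singular term, of size `1/ε`, couples the density variable to the component of `v` along `k/|k|`
through `i` times a real symmetric matrix. It therefore does no work at any frequency, hence in no
Sobolev norm (`re_linTerm_eq_zero`). The quadratic terms are transport by `v` up to an operator of
order zero: in the density equation the multiplier is `|l| k/|k|` instead of `l`, and the two differ
by at most `2 min(|k-l|, |l|)`. The commutator estimate `abs_re_trilinear_le` then yields a Riccati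
inequality for the `H^s` energy whose constant depends neither on `ε` nor on a frequency truncation.
It needs the coefficients of `∇v` in `ℓ¹`, which holds because `s ≥ 3` and `d ≤ 3`.

Solutions come from Galerkin truncations (`exists_galerkin`), which live on a common time interval,
and from coefficientwise compactness (`exists_epField_solution`). All the coefficients that occur
are continuous in time with values in `ℓ¹`, so products of functions are convolutions and the
coefficient equations can be summed to equations that hold at every point. For the sign of `ρ`, the
integral of `min(ρ, 0)⁴` obeys a Grönwall inequality; since `ρ` need not be differentiable in space,
this is done for truncated densities, with an error that vanishes in the limit
(`IsFourierEP.density_nonneg`).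

For the limit `ε → 0`, the density equation expresses the time integral of `v̂(k)·k/|k|` as `ε`
times a bounded quantity (`IsFourierEP.norm_integral_radial_le`): the potential part oscillates and
tends weakly to zero. The solenoidal projection annihilates the singular term, so the coefficients
of `Πv` are Lipschitz in time uniformly in `ε` and converge along a subsequence. Split `v` into
solenoidal and potential parts in `Π(v·∇v)`. The interaction of the potential part with itself is a
gradient (`solPart_advect_potPart`), and the mixed ones pair an oscillating factor with a uniformly
convergent one (`Oscillates.tendsto_integral_mul`). What remains is the Euler equation
(`exists_subseq_tendsto_euler`). Uniqueness by the `L²` energy method (`IsEulerSolution.unique`)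
removes the subsequence, and the uniform `H^s` bound upgrades coefficientwise convergence to
`H^{s'}` for `s' < s`. -/

/-! ### Frequencies and pointwise inequalities for multipliers -/

/-- Frequencies on the torus. -/
abbrev Freq (d : ℕ) : Type := Fin d → ℤ

/-- The Euclidean length `|k|` of a frequency. -/
def freqNorm (k : Freq d) : ℝ := √(∑ i, (k i : ℝ) ^ 2)

/-- The weight `1 + |k|²`. -/
def jap (k : Freq d) : ℝ := 1 + ∑ i, (k i : ℝ) ^ 2

/-- The bracket `(1 + |k|²)^{1/2}`. -/
def bra (k : Freq d) : ℝ := √(jap k)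

lemma one_le_jap (k : Freq d) : 1 ≤ jap k := by
  unfold jap; linarith [Finset.sum_nonneg (fun i (_ : i ∈ Finset.univ) => sq_nonneg (k i : ℝ))]

lemma jap_pos (k : Freq d) : 0 < jap k := lt_of_lt_of_le one_pos (one_le_jap k)

lemma freqNorm_nonneg (k : Freq d) : 0 ≤ freqNorm k := Real.sqrt_nonneg _

lemma freqNorm_sq (k : Freq d) : freqNorm k ^ 2 = ∑ i, (k i : ℝ) ^ 2 :=
  Real.sq_sqrt (Finset.sum_nonneg fun _ _ => sq_nonneg _)

lemma one_le_bra (k : Freq d) : 1 ≤ bra k := Real.one_le_sqrt.2 (one_le_jap k)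

lemma bra_pos (k : Freq d) : 0 < bra k := lt_of_lt_of_le one_pos (one_le_bra k)

lemma bra_sq (k : Freq d) : bra k ^ 2 = jap k := Real.sq_sqrt (jap_pos k).le

lemma jap_eq (k : Freq d) : jap k = 1 + freqNorm k ^ 2 := by rw [freqNorm_sq, jap]

lemma bra_rpow (k : Freq d) (s : ℝ) : bra k ^ s = jap k ^ (s / 2) := by
  rw [bra, Real.sqrt_eq_rpow, ← Real.rpow_mul (jap_pos k).le]; congr 1; ring

lemma freqNorm_le_bra (k : Freq d) : freqNorm k ≤ bra k :=
  Real.sqrt_le_sqrt (by unfold jap; linarith)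

lemma freqNorm_eq_norm (k : Freq d) : freqNorm k = ‖WithLp.toLp 2 (fun i => (k i : ℝ))‖ := by
  rw [EuclideanSpace.norm_eq]; simp [freqNorm]

lemma freqNorm_neg (k : Freq d) : freqNorm (-k) = freqNorm k := by simp [freqNorm]

lemma freqNorm_add_le (k l : Freq d) : freqNorm (k + l) ≤ freqNorm k + freqNorm l := by
  simp only [freqNorm_eq_norm]
  have e : WithLp.toLp 2 (fun i => ((k + l) i : ℝ)) =
      WithLp.toLp 2 (fun i => (k i : ℝ)) + WithLp.toLp 2 (fun i => (l i : ℝ)) := by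
    ext i; simp
  rw [e]
  exact norm_add_le _ _

lemma freqNorm_le_sub_add (k l : Freq d) : freqNorm k ≤ freqNorm (k - l) + freqNorm l := by
  simpa using freqNorm_add_le (k - l) l

lemma abs_coord_le_freqNorm (k : Freq d) (i : Fin d) : |(k i : ℝ)| ≤ freqNorm k := by
  rw [← Real.sqrt_sq_eq_abs]
  exact Real.sqrt_le_sqrt
    (Finset.single_le_sum (f := fun i => (k i : ℝ) ^ 2) (fun _ _ => sq_nonneg _) (Finset.mem_univ i))

lemma freqNorm_eq_zero {k : Freq d} : freqNorm k = 0 ↔ k = 0 := by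
  constructor
  · intro h
    ext i
    have := abs_coord_le_freqNorm k i
    rw [h] at this
    exact_mod_cast abs_nonpos_iff.1 this
  · rintro rfl; simp [freqNorm]

/-- The bracket is the Euclidean length of the vector `(1, k)`, so this is the reverse triangle
inequality. -/
lemma abs_bra_sub_bra_le (k l : Freq d) : |bra k - bra l| ≤ freqNorm (k - l) := by
  have key : ∀ k l : Freq d, bra k - bra l ≤ freqNorm (k - l) := by
    intro k l
    rw [sub_le_iff_le_add]
    refine Real.sqrt_le_iff.2 ⟨by linarith [freqNorm_nonneg (k - l), bra_pos l], ?_⟩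
    have h1 := freqNorm_le_sub_add k l
    have h2 := freqNorm_nonneg (k - l)
    have h3 := freqNorm_le_bra l
    have h4 := bra_sq l
    have h5 := freqNorm_nonneg k
    have h6 := freqNorm_nonneg l
    rw [jap_eq] at h4 ⊢
    nlinarith
  rw [abs_le]
  constructor
  · have := key l k
    rw [← neg_sub k l, freqNorm_neg] at this
    linarith
  · exact key k l

lemma bra_le_sub_add (k l : Freq d) : bra k ≤ bra (k - l) + bra l := by
  have := (abs_le.1 (abs_bra_sub_bra_le k l)).2
  linarith [freqNorm_le_bra (k - l)]

lemma add_rpow_le_two_rpow {a b s : ℝ} (ha : 0 ≤ a) (hb : 0 ≤ b) (hs : 0 ≤ s) :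
    (a + b) ^ s ≤ 2 ^ s * (a ^ s + b ^ s) := by
  have h : (a + b) ^ s ≤ (2 * max a b) ^ s :=
    Real.rpow_le_rpow (by positivity) (by linarith [le_max_left a b, le_max_right a b]) hs
  rw [Real.mul_rpow (by norm_num) (by positivity)] at h
  refine h.trans (mul_le_mul_of_nonneg_left ?_ (by positivity))
  rcases max_choice a b with h | h <;> rw [h] <;>
    linarith [Real.rpow_nonneg ha s, Real.rpow_nonneg hb s]

lemma abs_rpow_sub_rpow_le {a b s : ℝ} (ha : 1 ≤ a) (hb : 1 ≤ b) (hs : 1 ≤ s) :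
    |a ^ s - b ^ s| ≤ s * |a - b| * (max a b) ^ (s - 1) := by
  wlog h : b ≤ a generalizing a b
  · rw [abs_sub_comm, abs_sub_comm a, max_comm]; exact this hb ha (not_le.1 h).le
  have hm := Convex.norm_image_sub_le_of_norm_hasDerivWithin_le (𝕜 := ℝ) (f := fun x : ℝ => x ^ s)
    (f' := fun x => s * x ^ (s - 1)) (s := Icc b a) (C := s * a ^ (s - 1)) (x := b) (y := a)
    (fun x hx => (Real.hasDerivAt_rpow_const (Or.inr hs)).hasDerivWithinAt)
    (fun x hx => by
      have hx0 : 0 < x := by linarith [hx.1]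
      rw [Real.norm_of_nonneg (by positivity)]
      exact mul_le_mul_of_nonneg_left (Real.rpow_le_rpow hx0.le hx.2 (by linarith)) (by linarith))
    (convex_Icc b a) ⟨le_rfl, h⟩ ⟨h, le_rfl⟩
  rw [max_eq_left h]
  simp only [Real.norm_eq_abs] at hm
  linarith

/-- Commutator of the weight with a derivative. The mean value theorem trades the difference of the
weights for one factor `|k - l|` and a weight of order `s - 1`, which is then given to `k - l` or to
`l`. Each resulting term has `s` powers on one frequency and only one on the other. -/
lemma abs_bra_rpow_sub_le {s : ℝ} (hs : 1 ≤ s) (k l : Freq d) :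
    |bra k ^ s - bra l ^ s| * freqNorm l ≤
      s * 2 ^ s * (bra (k - l) ^ s * bra l + bra (k - l) * bra l ^ s) := by
  have hk := bra_pos (k - l)
  have hl := bra_pos l
  have h1 := abs_rpow_sub_rpow_le (one_le_bra k) (one_le_bra l) hs
  have h2 : max (bra k) (bra l) ^ (s - 1) ≤
      2 ^ (s - 1) * (bra (k - l) ^ (s - 1) + bra l ^ (s - 1)) := by
    refine le_trans (Real.rpow_le_rpow ?_ ?_ (by linarith))
      (add_rpow_le_two_rpow hk.le hl.le (by linarith))
    · exact le_max_of_le_right hl.le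
    · exact max_le (bra_le_sub_add k l) (by linarith)
  have h3 := (abs_bra_sub_bra_le k l).trans (freqNorm_le_bra (k - l))
  have h4 : (2 : ℝ) ^ (s - 1) ≤ 2 ^ s := Real.rpow_le_rpow_of_exponent_le (by norm_num) (by linarith)
  have e1 : bra (k - l) ^ s = bra (k - l) * bra (k - l) ^ (s - 1) := by
    rw [← Real.rpow_one_add' hk.le (by linarith)]; congr 1; ring
  have e2 : bra l ^ s = bra l * bra l ^ (s - 1) := by
    rw [← Real.rpow_one_add' hl.le (by linarith)]; congr 1; ring
  calc |bra k ^ s - bra l ^ s| * freqNorm l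
      ≤ (s * bra (k - l) * (2 ^ s * (bra (k - l) ^ (s - 1) + bra l ^ (s - 1)))) * bra l := by
        refine mul_le_mul (h1.trans ?_) (freqNorm_le_bra l) (freqNorm_nonneg l) (by positivity)
        refine mul_le_mul (mul_le_mul_of_nonneg_left h3 (by linarith))
          (h2.trans (mul_le_mul_of_nonneg_right h4 (by positivity)))
          (Real.rpow_nonneg (le_max_of_le_right hl.le) _) (by positivity)
    _ = _ := by rw [e1, e2]; ring

/-- The unit vector `k / |k|`, zero at the zero frequency. -/
def dir (k : Freq d) (j : Fin d) : ℝ := k j / freqNorm k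

lemma dir_neg (k : Freq d) (j : Fin d) : dir (-k) j = -dir k j := by
  simp [dir, freqNorm_neg, neg_div]

lemma freqNorm_mul_dir (k : Freq d) (j : Fin d) : freqNorm k * dir k j = k j := by
  by_cases h : freqNorm k = 0
  · have := freqNorm_eq_zero.1 h; subst this; simp [dir]
  · rw [dir]; field_simp

lemma abs_dir_le_one (k : Freq d) (j : Fin d) : |dir k j| ≤ 1 := by
  rw [dir, abs_div, abs_of_nonneg (freqNorm_nonneg k)]
  exact div_le_one_of_le₀ (abs_coord_le_freqNorm k j) (freqNorm_nonneg k)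

lemma sum_dir_sq {k : Freq d} (hk : k ≠ 0) : ∑ j, dir k j ^ 2 = 1 := by
  have h : freqNorm k ≠ 0 := fun h => hk (freqNorm_eq_zero.1 h)
  simp only [dir, div_pow, ← Finset.sum_div]
  rw [← freqNorm_sq]; field_simp

/-- The multiplier of the density equation is transport up to order zero: `|l| k/|k| - l = (|l| -
|k|) k/|k| + (k - l)`, and both terms are at most `|k - l|`. The bound by `2|l|` is trivial and
serves when `l` is the low frequency. -/
lemma abs_freqNorm_mul_dir_sub_le (k l : Freq d) (j : Fin d) :
    |freqNorm l * dir k j - l j| ≤ 2 * min (freqNorm (k - l)) (freqNorm l) := by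
  have hl := freqNorm_nonneg l
  rw [mul_min_of_nonneg _ _ (by norm_num)]
  refine le_min ?_ ?_
  · have e : freqNorm l * dir k j - l j = (freqNorm l - freqNorm k) * dir k j + ((k - l) j : ℤ) := by
      have := freqNorm_mul_dir k j
      push_cast [Pi.sub_apply]
      linarith
    rw [e]
    have h1 : |freqNorm l - freqNorm k| ≤ freqNorm (k - l) := by
      rw [abs_le]
      constructor
      · linarith [freqNorm_le_sub_add k l]
      · have := freqNorm_le_sub_add l k
        rw [← neg_sub k l, freqNorm_neg] at this
        linarith
    have h2 := abs_coord_le_freqNorm (k - l) j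
    calc _ ≤ |freqNorm l - freqNorm k| * |dir k j| + |(((k - l) j : ℤ) : ℝ)| := by
          rw [← abs_mul]; exact abs_add_le _ _
      _ ≤ freqNorm (k - l) * 1 + freqNorm (k - l) :=
          add_le_add (mul_le_mul h1 (abs_dir_le_one k j) (abs_nonneg _) (freqNorm_nonneg _)) h2
      _ = _ := by ring
  · calc _ ≤ |freqNorm l * dir k j| + |(l j : ℝ)| := abs_sub _ _
      _ ≤ freqNorm l * 1 + freqNorm l := by
          rw [abs_mul, abs_of_nonneg hl]
          exact add_le_add (mul_le_mul_of_nonneg_left (abs_dir_le_one k j) hl)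
            (abs_coord_le_freqNorm l j)
      _ = _ := by ring

/-- The weight of order `s` goes to one of `k - l`, `l`, and the minimum can be charged to the other
one. -/
lemma bra_rpow_mul_min_le {s : ℝ} (hs : 0 ≤ s) (k l : Freq d) :
    bra k ^ s * min (freqNorm (k - l)) (freqNorm l) ≤
      2 ^ s * (bra (k - l) ^ s * bra l + bra (k - l) * bra l ^ s) := by
  have hk := bra_pos (k - l)
  have hl := bra_pos l
  have h0 : 0 ≤ min (freqNorm (k - l)) (freqNorm l) := le_min (freqNorm_nonneg _) (freqNorm_nonneg _)
  have h1 : bra k ^ s ≤ 2 ^ s * (bra (k - l) ^ s + bra l ^ s) :=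
    (Real.rpow_le_rpow (bra_pos k).le (bra_le_sub_add k l) hs).trans
      (add_rpow_le_two_rpow hk.le hl.le hs)
  have h2 : min (freqNorm (k - l)) (freqNorm l) ≤ bra (k - l) :=
    (min_le_left _ _).trans (freqNorm_le_bra _)
  have h3 : min (freqNorm (k - l)) (freqNorm l) ≤ bra l :=
    (min_le_right _ _).trans (freqNorm_le_bra _)
  have p1 : 0 ≤ bra (k - l) ^ s := by positivity
  have p2 : 0 ≤ bra l ^ s := by positivity
  have p3 : (0:ℝ) ≤ 2 ^ s := by positivity
  calc _ ≤ 2 ^ s * (bra (k - l) ^ s + bra l ^ s) * min (freqNorm (k - l)) (freqNorm l) :=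
        mul_le_mul_of_nonneg_right h1 h0
    _ = 2 ^ s * (bra (k - l) ^ s * min (freqNorm (k - l)) (freqNorm l) +
          min (freqNorm (k - l)) (freqNorm l) * bra l ^ s) := by ring
    _ ≤ _ := by gcongr

/-- In dimension at most three the weights `(1 + |k|²)^{-7/4}` are summable. -/
lemma summable_jap_rpow (hd : d ≤ 3) : Summable fun k : Freq d => jap k ^ (-(7 / 4) : ℝ) := by
  let b := Pi.basisFun ℝ (Fin d)
  let Λ := Submodule.span ℤ (Set.range b)
  have hr : Module.finrank ℤ Λ = d := by
    have := ZLattice.rank ℝ Λ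
    simpa using this
  -- The exponent `-7/2` lies below `-3`, which covers every rank up to three; halving it gives the
  -- exponent of `1 + |k|²`, which dominates the squared norm.
  have hs := ZLattice.summable_norm_rpow Λ (-(7 / 2) : ℝ)
    (by rw [hr]; have : (d : ℝ) ≤ 3 := by exact_mod_cast hd
        linarith)
  have hmem : ∀ k : Freq d, (fun i => (k i : ℝ)) ∈ Λ := by
    intro k
    have : (fun i => (k i : ℝ)) = ∑ i, k i • b i := by
      ext j
      simp [b, Finset.sum_apply, Pi.single_apply]
    rw [this]
    exact Submodule.sum_mem _ fun i _ => Submodule.smul_mem _ _ (Submodule.subset_span ⟨i, rfl⟩)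
  let f : Freq d → Λ := fun k => ⟨fun i => (k i : ℝ), hmem k⟩
  have hf : Function.Injective f := by
    intro k l h
    have := congrArg Subtype.val h
    ext i
    have h2 : (k i : ℝ) = l i := congrFun this i
    exact_mod_cast h2
  have h1 := hs.comp_injective hf
  refine Summable.of_norm_bounded_eventually h1 ?_
  have : ∀ᶠ k : Freq d in cofinite, k ≠ 0 := by
    simp [Filter.eventually_cofinite]
  filter_upwards [this] with k hk
  rw [Real.norm_of_nonneg (Real.rpow_nonneg (jap_pos k).le _)]
  have hn : 0 < ‖f k‖ := by
    rw [norm_pos_iff]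
    intro h
    apply hk
    ext i
    have := congrFun (congrArg Subtype.val h) i
    simpa [f] using this
  have hle : ‖f k‖ ^ (2 : ℕ) ≤ jap k := by
    have h0 : ‖f k‖ ≤ freqNorm k := by
      change ‖(fun i => (k i : ℝ))‖ ≤ _
      exact (pi_norm_le_iff_of_nonneg (freqNorm_nonneg k)).2 fun i => abs_coord_le_freqNorm k i
    rw [jap_eq]
    nlinarith
  have : ‖f k‖ ^ (-(7 / 2) : ℝ) = (‖f k‖ ^ (2 : ℕ)) ^ (-(7 / 4) : ℝ) := by
    rw [← Real.rpow_natCast, ← Real.rpow_mul hn.le]; norm_num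
  simp only [Function.comp]
  rw [this]
  exact Real.rpow_le_rpow_of_nonpos (by positivity) hle (by norm_num)

/-! ### Weighted sequence spaces -/

section Weighted

variable {E E' : Type*} [NormedAddCommGroup E] [NormedAddCommGroup E']

/-- The square of the `H^s` norm of the sequence `u` of coefficients is at most `M`. -/
def HsBound (s M : ℝ) (u : Freq d → E) : Prop :=
  ∀ F : Finset (Freq d), ∑ k ∈ F, jap k ^ s * ‖u k‖ ^ 2 ≤ M

lemma jap_rpow_nonneg (k : Freq d) (s : ℝ) : 0 ≤ jap k ^ s := Real.rpow_nonneg (jap_pos k).le s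

lemma jap_rpow_pos (k : Freq d) (s : ℝ) : 0 < jap k ^ s := Real.rpow_pos_of_pos (jap_pos k) s

lemma one_le_jap_rpow (k : Freq d) {s : ℝ} (hs : 0 ≤ s) : 1 ≤ jap k ^ s :=
  Real.one_le_rpow (one_le_jap k) hs

lemma jap_rpow_half (k : Freq d) : jap k ^ (1 / 2 : ℝ) = bra k := by
  rw [bra, Real.sqrt_eq_rpow]

namespace HsBound

variable {s M : ℝ} {u : Freq d → E}

lemma nonneg (h : HsBound s M u) : 0 ≤ M := by simpa using h ∅

lemma of_le {s' C : ℝ} {w : Freq d → E'} (hu : HsBound s M u) (hC : 0 ≤ C)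
    (h : ∀ k, jap k ^ s' * ‖w k‖ ^ 2 ≤ C * (jap k ^ s * ‖u k‖ ^ 2)) : HsBound s' (C * M) w := by
  intro F
  calc _ ≤ ∑ k ∈ F, C * (jap k ^ s * ‖u k‖ ^ 2) := Finset.sum_le_sum fun k _ => h k
    _ = C * ∑ k ∈ F, jap k ^ s * ‖u k‖ ^ 2 := by rw [Finset.mul_sum]
    _ ≤ _ := mul_le_mul_of_nonneg_left (hu F) hC

lemma of_norm_le {C : ℝ} {w : Freq d → E'} (hu : HsBound s M u)
    (h : ∀ k, ‖w k‖ ≤ C * ‖u k‖) : HsBound s (C ^ 2 * M) w := by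
  refine hu.of_le (sq_nonneg C) fun k => ?_
  have := pow_le_pow_left₀ (norm_nonneg _) (h k) 2
  rw [mul_pow] at this
  nlinarith [jap_rpow_nonneg k s]

lemma of_norm_le_one {w : Freq d → E'} (hu : HsBound s M u)
    (h : ∀ k, ‖w k‖ ≤ ‖u k‖) : HsBound s M w := by
  simpa using hu.of_norm_le (C := 1) (by simpa using h)

lemma mono_exp {s' : ℝ} (hu : HsBound s M u) (h : s' ≤ s) : HsBound s' M u := by
  simpa using hu.of_le (s' := s') (C := 1) (w := u) one_pos.le fun k => by
    rw [one_mul]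
    exact mul_le_mul_of_nonneg_right (Real.rpow_le_rpow_of_exponent_le (one_le_jap k) h)
      (sq_nonneg _)

lemma mono {M' : ℝ} (hu : HsBound s M u) (h : M ≤ M') : HsBound s M' u :=
  fun F => (hu F).trans h

lemma norm_sq_le (hu : HsBound s M u) (hs : 0 ≤ s) (k : Freq d) : ‖u k‖ ^ 2 ≤ M := by
  have := hu {k}
  rw [Finset.sum_singleton] at this
  nlinarith [one_le_jap_rpow k hs, sq_nonneg ‖u k‖]

lemma norm_le (hu : HsBound s M u) (hs : 0 ≤ s) (k : Freq d) : ‖u k‖ ≤ √M :=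
  Real.le_sqrt_of_sq_le (hu.norm_sq_le hs k)

lemma add {N : ℝ} {w : Freq d → E} (hu : HsBound s M u) (hw : HsBound s N w) :
    HsBound s (2 * M + 2 * N) (fun k => u k + w k) := by
  intro F
  have h1 := hu F
  have h2 := hw F
  calc _ ≤ ∑ k ∈ F, (2 * (jap k ^ s * ‖u k‖ ^ 2) + 2 * (jap k ^ s * ‖w k‖ ^ 2)) := by
        refine Finset.sum_le_sum fun k _ => ?_
        have h3 := norm_add_le (u k) (w k)
        have h4 := pow_le_pow_left₀ (norm_nonneg _) h3 2
        have h5 : ‖u k + w k‖ ^ 2 ≤ 2 * ‖u k‖ ^ 2 + 2 * ‖w k‖ ^ 2 := by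
          nlinarith [sq_nonneg (‖u k‖ - ‖w k‖)]
        nlinarith [jap_rpow_nonneg k s]
    _ = 2 * ∑ k ∈ F, jap k ^ s * ‖u k‖ ^ 2 + 2 * ∑ k ∈ F, jap k ^ s * ‖w k‖ ^ 2 := by
        rw [Finset.sum_add_distrib, Finset.mul_sum, Finset.mul_sum]
    _ ≤ _ := by linarith

lemma sub {N : ℝ} {w : Freq d → E} (hu : HsBound s M u) (hw : HsBound s N w) :
    HsBound s (2 * M + 2 * N) (fun k => u k - w k) := by
  simpa [sub_eq_add_neg] using hu.add (hw.of_norm_le_one (w := fun k => -w k) (by simp))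

/-- The bound constrains finite sums only, so it is closed under coefficientwise limits; this is the
lower semicontinuity used in every compactness argument below. -/
lemma of_tendsto {ι : Type*} {ℱ : Filter ι} [NeBot ℱ] {x : ι → Freq d → E}
    (hx : ∀ᶠ n in ℱ, HsBound s M (x n)) (hu : ∀ k, Tendsto (fun n => x n k) ℱ (𝓝 (u k))) :
    HsBound s M u := by
  intro F
  refine le_of_tendsto (f := fun n => ∑ k ∈ F, jap k ^ s * ‖x n k‖ ^ 2) (x := ℱ) ?_
    (hx.mono fun n h => h F)
  exact tendsto_finsetSum _ fun k _ => ((hu k).norm.pow 2).const_mul _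

end HsBound

/-- The sum of the weights `(1 + |k|²)^{-7/4}`. -/
def latticeConst (d : ℕ) : ℝ := ∑' k : Freq d, jap k ^ (-(7 / 4) : ℝ)

lemma latticeConst_nonneg : 0 ≤ latticeConst d := tsum_nonneg fun k => jap_rpow_nonneg k _

namespace HsBound

variable {s M : ℝ} {u : Freq d → E}

/-- Cauchy–Schwarz against the summable weights `(1 + |k|²)^{-7/4}`. It plays the part of the
Sobolev embedding, at the price of `7/4 > 3/2` derivatives; the factor `jap k ^ r` counts for `2r`
of them. -/
lemma sum_le (hd : d ≤ 3) {r : ℝ} (hu : HsBound s M u) (hr : 2 * r + 7 / 4 ≤ s)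
    (F : Finset (Freq d)) : ∑ k ∈ F, jap k ^ r * ‖u k‖ ≤ √(latticeConst d) * √M := by
  have hu' := hu.mono_exp hr
  have h := Finset.sum_mul_sq_le_sq_mul_sq F (fun k => jap k ^ (-(7 / 8) : ℝ))
    (fun k => jap k ^ (r + 7 / 8) * ‖u k‖)
  have e1 : ∀ k : Freq d, jap k ^ (-(7 / 8) : ℝ) * (jap k ^ (r + 7 / 8) * ‖u k‖) =
      jap k ^ r * ‖u k‖ := by
    intro k
    rw [← mul_assoc, ← Real.rpow_add (jap_pos k)]; congr 2; ring
  have e2 : ∀ k : Freq d, (jap k ^ (-(7 / 8) : ℝ)) ^ 2 = jap k ^ (-(7 / 4) : ℝ) := by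
    intro k
    rw [← Real.rpow_natCast, ← Real.rpow_mul (jap_pos k).le]; congr 1; norm_num
  have e3 : ∀ k : Freq d, (jap k ^ (r + 7 / 8) * ‖u k‖) ^ 2 =
      jap k ^ (2 * r + 7 / 4) * ‖u k‖ ^ 2 := by
    intro k
    rw [mul_pow, ← Real.rpow_natCast, ← Real.rpow_mul (jap_pos k).le]; congr 2; push_cast; ring
  simp only [e1, e2, e3] at h
  rw [← Real.sqrt_mul latticeConst_nonneg]
  refine Real.le_sqrt_of_sq_le (h.trans ?_)
  refine mul_le_mul ?_ (hu' F) ?_ latticeConst_nonneg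
  · exact (summable_jap_rpow hd).sum_le_tsum F fun k _ => jap_rpow_nonneg k _
  · exact Finset.sum_nonneg fun k _ => mul_nonneg (jap_rpow_nonneg k _) (sq_nonneg _)

lemma summable_rpow (hd : d ≤ 3) {r : ℝ} (hu : HsBound s M u) (hr : 2 * r + 7 / 4 ≤ s) :
    Summable fun k => jap k ^ r * ‖u k‖ :=
  summable_of_sum_le (fun k => mul_nonneg (jap_rpow_nonneg k _) (norm_nonneg _))
    (hu.sum_le hd hr)

lemma tsum_rpow_le (hd : d ≤ 3) {r : ℝ} (hu : HsBound s M u) (hr : 2 * r + 7 / 4 ≤ s) :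
    ∑' k, jap k ^ r * ‖u k‖ ≤ √(latticeConst d) * √M :=
  (hu.summable_rpow hd hr).tsum_le_of_sum_le (hu.sum_le hd hr)

lemma summable_norm (hd : d ≤ 3) (hu : HsBound s M u) (hs : 7 / 4 ≤ s) :
    Summable fun k => ‖u k‖ := by
  simpa using hu.summable_rpow hd (r := 0) (by linarith)

lemma tsum_norm_le (hd : d ≤ 3) (hu : HsBound s M u) (hs : 7 / 4 ≤ s) :
    ∑' k, ‖u k‖ ≤ √(latticeConst d) * √M := by
  simpa using hu.tsum_rpow_le hd (r := 0) (by linarith)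

lemma summable_bra (hd : d ≤ 3) (hu : HsBound s M u) (hs : 11 / 4 ≤ s) :
    Summable fun k => bra k * ‖u k‖ := by
  simpa only [jap_rpow_half] using hu.summable_rpow hd (r := 1 / 2) (by linarith)

lemma sum_bra_le (hd : d ≤ 3) (hu : HsBound s M u) (hs : 11 / 4 ≤ s) (F : Finset (Freq d)) :
    ∑ k ∈ F, bra k * ‖u k‖ ≤ √(latticeConst d) * √M := by
  simpa only [jap_rpow_half] using hu.sum_le hd (r := 1 / 2) (by linarith) F

end HsBound

lemma ofReal_jap_mul_enorm_sq (s : ℝ) (u : Freq d → E) (k : Freq d) :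
    ENNReal.ofReal (jap k ^ s) * ‖u k‖ₑ ^ 2 = ENNReal.ofReal (jap k ^ s * ‖u k‖ ^ 2) := by
  rw [← ofReal_norm, ← ENNReal.ofReal_pow (norm_nonneg _), ENNReal.ofReal_mul (jap_rpow_nonneg _ _)]

lemma hsBound_iff_tsum_le {s M : ℝ} (hM : 0 ≤ M) (u : Freq d → E) :
    HsBound s M u ↔ ∑' k, ENNReal.ofReal (jap k ^ s) * ‖u k‖ₑ ^ 2 ≤ ENNReal.ofReal M := by
  simp only [ofReal_jap_mul_enorm_sq, ENNReal.tsum_eq_iSup_sum, iSup_le_iff]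
  refine forall_congr' fun F => ?_
  rw [← ENNReal.ofReal_sum_of_nonneg fun k _ => mul_nonneg (jap_rpow_nonneg _ _) (sq_nonneg _),
    ENNReal.ofReal_le_ofReal_iff hM]

/-- Coefficientwise convergence to zero with a bound in `H^s` implies convergence in `H^{s'}` for
`s' < s`. -/
lemma tendsto_hs_zero {ι : Type*} {ℱ : Filter ι} {s s' M : ℝ} (hs : s' < s)
    {x : ι → Freq d → E} (hb : ∀ᶠ n in ℱ, HsBound s M (x n))
    (hx : ∀ k, Tendsto (fun n => x n k) ℱ (𝓝 0)) :
    Tendsto (fun n => ∑' k, ENNReal.ofReal (jap k ^ s') * ‖x n k‖ₑ ^ 2) ℱ (𝓝 0) := by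
  rw [ENNReal.tendsto_nhds_zero]
  intro δ hδ
  have hM : 0 ≤ max M 0 := le_max_right _ _
  -- `η` is the gain `jap k ^ (s' - s)` demanded of the tail, chosen so that the tail contributes at
  -- most `δ / 2`. The sign of `M` is not known before the eventual bound is used, whence the
  -- maximum with `0`.
  obtain ⟨η, hη, hηδ⟩ : ∃ η : ℝ, 0 < η ∧ ENNReal.ofReal (η * max M 0) ≤ δ / 2 := by
    have ht : Tendsto (fun η : ℝ => ENNReal.ofReal (η * max M 0)) (𝓝[>] 0) (𝓝 0) := by
      have : Tendsto (fun η : ℝ => ENNReal.ofReal (η * max M 0)) (𝓝 0)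
          (𝓝 (ENNReal.ofReal (0 * max M 0))) :=
        (ENNReal.continuous_ofReal.comp (continuous_id.mul continuous_const)).tendsto 0
      simpa using this.mono_left nhdsWithin_le_nhds
    have h2 : 0 < δ / 2 := ENNReal.half_pos hδ.ne'
    obtain ⟨η, h3, h4⟩ := ((ENNReal.tendsto_nhds_zero.1 ht _ h2).and self_mem_nhdsWithin).exists
    exact ⟨η, h4, h3⟩
  -- As `s' - s` is negative, only the frequencies of a bounded box can violate the demand.
  have hfin : {k : Freq d | ¬ jap k ^ (s' - s) ≤ η}.Finite := by
    have hsub : {k : Freq d | ¬ jap k ^ (s' - s) ≤ η} ⊆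
        (Set.univ.pi fun _ : Fin d => {z : ℤ | |(z : ℝ)| ≤ max 1 (η⁻¹ ^ (1 / (s - s')))}) := by
      intro k hk i _
      simp only [mem_ofPred_eq, not_le] at hk ⊢
      have h1 : jap k < η⁻¹ ^ (1 / (s - s')) := by
        have h2 : jap k ^ (s - s') < η⁻¹ := by
          rw [lt_inv_comm₀ (jap_rpow_pos _ _) hη, ← Real.rpow_neg (jap_pos k).le, neg_sub]
          exact hk
        have h3 := Real.rpow_lt_rpow (jap_rpow_nonneg _ _) h2 (z := 1 / (s - s'))
          (by have : 0 < s - s' := by linarith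
              positivity)
        rwa [← Real.rpow_mul (jap_pos k).le, mul_one_div_cancel (by linarith), Real.rpow_one] at h3
      have h4 := abs_coord_le_freqNorm k i
      have h5 : freqNorm k ≤ jap k := by rw [jap_eq]; nlinarith [sq_nonneg (freqNorm k - 1)]
      exact le_max_of_le_right (by linarith)
    refine Set.Finite.subset (Set.Finite.pi fun _ => ?_) hsub
    set B := max 1 (η⁻¹ ^ (1 / (s - s')))
    refine (Set.finite_Icc (-⌈B⌉) ⌈B⌉).subset fun z hz => ?_
    have := abs_le.1 (show |(z : ℝ)| ≤ B from hz)
    have hc := Int.le_ceil B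
    constructor
    · have : (-(⌈B⌉ : ℝ)) ≤ z := by linarith [this.1]
      exact_mod_cast this
    · have : (z : ℝ) ≤ ⌈B⌉ := by linarith [this.2]
      exact_mod_cast this
  set F : Finset (Freq d) := hfin.toFinset with hF
  have hmain : Tendsto (fun n => ∑ k ∈ F, ENNReal.ofReal (jap k ^ s') * ‖x n k‖ₑ ^ 2) ℱ (𝓝 0) := by
    have : Tendsto (fun n => ∑ k ∈ F, ENNReal.ofReal (jap k ^ s') * ‖x n k‖ₑ ^ 2) ℱ
        (𝓝 (∑ k ∈ F, ENNReal.ofReal (jap k ^ s') * ‖(0 : E)‖ₑ ^ 2)) := by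
      refine tendsto_finsetSum _ fun k _ => ?_
      refine ENNReal.Tendsto.const_mul ?_ (Or.inr ENNReal.ofReal_ne_top)
      exact ((ENNReal.continuous_pow 2).tendsto _).comp (hx k).enorm
    simpa using this
  have h2 : 0 < δ / 2 := ENNReal.half_pos hδ.ne'
  filter_upwards [hb, ENNReal.tendsto_nhds_zero.1 hmain _ h2] with n hn hFn
  have htail : ∀ k, ENNReal.ofReal (jap k ^ s') * ‖x n k‖ₑ ^ 2 ≤
      (if k ∈ F then ENNReal.ofReal (jap k ^ s') * ‖x n k‖ₑ ^ 2 else 0) +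
        ENNReal.ofReal (η * (jap k ^ s * ‖x n k‖ ^ 2)) := by
    intro k
    by_cases hk : k ∈ F
    · simp [hk]
    · rw [if_neg hk, zero_add]
      have hk' : jap k ^ (s' - s) ≤ η := by
        by_contra hc; exact hk (by simpa [hF] using hc)
      rw [ofReal_jap_mul_enorm_sq]
      refine ENNReal.ofReal_le_ofReal ?_
      have : jap k ^ s' = jap k ^ (s' - s) * jap k ^ s := by
        rw [← Real.rpow_add (jap_pos k)]; congr 1; ring
      rw [this, mul_assoc]
      exact mul_le_mul_of_nonneg_right hk' (mul_nonneg (jap_rpow_nonneg _ _) (sq_nonneg _))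
  calc _ ≤ ∑' k, ((if k ∈ F then ENNReal.ofReal (jap k ^ s') * ‖x n k‖ₑ ^ 2 else 0) +
        ENNReal.ofReal (η * (jap k ^ s * ‖x n k‖ ^ 2))) := ENNReal.tsum_le_tsum htail
    _ = ∑ k ∈ F, ENNReal.ofReal (jap k ^ s') * ‖x n k‖ₑ ^ 2 +
        ∑' k, ENNReal.ofReal (η * (jap k ^ s * ‖x n k‖ ^ 2)) := by
        rw [ENNReal.tsum_add]
        congr 1
        rw [tsum_eq_sum (s := F) (fun k hk => if_neg hk)]
        exact Finset.sum_congr rfl fun k hk => if_pos hk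
    _ ≤ δ / 2 + δ / 2 := by
        refine add_le_add hFn (le_trans ?_ hηδ)
        rw [ENNReal.tsum_eq_iSup_sum]
        refine iSup_le fun G => ?_
        rw [← ENNReal.ofReal_sum_of_nonneg fun k _ => mul_nonneg hη.le
          (mul_nonneg (jap_rpow_nonneg _ _) (sq_nonneg _)), ← Finset.mul_sum]
        exact ENNReal.ofReal_le_ofReal
          (mul_le_mul_of_nonneg_left ((hn G).trans (le_max_left _ _)) hη.le)
    _ = δ := ENNReal.add_halves δ


/-- Coefficientwise convergence to zero with a bound in `H^s` implies convergence in weighted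
`ℓ¹` spaces. -/
lemma tendsto_l1_zero (hd : d ≤ 3) {ι : Type*} {ℱ : Filter ι} {s r M : ℝ} (hr : 2 * r + 7 / 4 < s)
    {x : ι → Freq d → E} (hb : ∀ᶠ n in ℱ, HsBound s M (x n))
    (hx : ∀ k, Tendsto (fun n => x n k) ℱ (𝓝 0)) :
    Tendsto (fun n => ∑' k, jap k ^ r * ‖x n k‖) ℱ (𝓝 0) := by
  have h := tendsto_hs_zero hr hb hx
  set τ := fun n => ∑' k, ENNReal.ofReal (jap k ^ (2 * r + 7 / 4)) * ‖x n k‖ₑ ^ 2 with hτ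
  have h1 : Tendsto (fun n => √(latticeConst d) * √((τ n).toReal)) ℱ (𝓝 0) := by
    have h2 := (ENNReal.tendsto_toReal ENNReal.zero_ne_top).comp h
    have h3 := ((Real.continuous_sqrt.tendsto _).comp h2).const_mul √(latticeConst d)
    simpa using h3
  refine squeeze_zero' (Eventually.of_forall fun n => tsum_nonneg fun k =>
    mul_nonneg (jap_rpow_nonneg _ _) (norm_nonneg _)) ?_ h1
  have h4 : ∀ᶠ n in ℱ, τ n < 1 := h.eventually_lt_const (by norm_num)
  filter_upwards [h4] with n hn
  have : HsBound (2 * r + 7 / 4) (τ n).toReal (x n) := by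
    rw [hsBound_iff_tsum_le ENNReal.toReal_nonneg, ENNReal.ofReal_toReal (hn.trans_le le_top).ne]
  exact this.tsum_rpow_le hd le_rfl

lemma tendsto_tsum_norm_zero (hd : d ≤ 3) {ι : Type*} {ℱ : Filter ι} {s M : ℝ} (hs : 7 / 4 < s)
    {x : ι → Freq d → E} (hb : ∀ᶠ n in ℱ, HsBound s M (x n))
    (hx : ∀ k, Tendsto (fun n => x n k) ℱ (𝓝 0)) :
    Tendsto (fun n => ∑' k, ‖x n k‖) ℱ (𝓝 0) := by
  simpa using tendsto_l1_zero hd (r := 0) (by linarith) hb hx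

/-- Coefficientwise convergence with a bound in `H^s` implies convergence of the sums. -/
lemma tendsto_tsum_of_hsBound [CompleteSpace E] (hd : d ≤ 3) {ι : Type*} {ℱ : Filter ι} [NeBot ℱ]
    {s M : ℝ} (hs : 7 / 4 < s) {x : ι → Freq d → E} {y : Freq d → E}
    (hb : ∀ᶠ n in ℱ, HsBound s M (x n)) (hx : ∀ k, Tendsto (fun n => x n k) ℱ (𝓝 (y k))) :
    Tendsto (fun n => ∑' k, x n k) ℱ (𝓝 (∑' k, y k)) := by
  have hy : HsBound s M y := HsBound.of_tendsto hb hx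
  have hb' : ∀ᶠ n in ℱ, HsBound s (2 * M + 2 * M) (fun k => x n k - y k) :=
    hb.mono fun n hn => hn.sub hy
  have h := tendsto_tsum_norm_zero hd hs hb' fun k => by simpa using (hx k).sub_const (y k)
  rw [tendsto_iff_norm_sub_tendsto_zero]
  refine squeeze_zero' (Eventually.of_forall fun n => norm_nonneg _) ?_ h
  filter_upwards [hb, hb'] with n hn hn'
  rw [← Summable.tsum_sub (hn.summable_norm hd hs.le).of_norm (hy.summable_norm hd hs.le).of_norm]
  exact norm_tsum_le_tsum_norm (hn'.summable_norm hd hs.le)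

end Weighted

/-! ### Trilinear sums and the commutator estimate -/

/-- Schur's test: `2ac ≤ a² + c²` leaves the row and column sums of the kernel `b (k - l)`, both
bounded by the `ℓ¹` norm of `b`. -/
lemma sum_kernel_le_of_l1_left (S : Finset (Freq d)) {a b c : Freq d → ℝ} {A B : ℝ}
    (hb0 : ∀ k, 0 ≤ b k) (hb : ∀ F : Finset (Freq d), ∑ k ∈ F, b k ≤ B)
    (ha : ∑ k ∈ S, a k ^ 2 ≤ A) (hc : ∑ k ∈ S, c k ^ 2 ≤ A) :
    ∑ k ∈ S, ∑ l ∈ S, a k * b (k - l) * c l ≤ B * A := by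
  have hB : 0 ≤ B := by simpa using hb ∅
  have hb1 : ∀ k, ∑ l ∈ S, b (k - l) ≤ B := fun k => by
    rw [← Finset.sum_image (f := b) (g := fun l => k - l) (fun x _ y _ h => by simpa using h)]
    exact hb _
  have hb2 : ∀ l, ∑ k ∈ S, b (k - l) ≤ B := fun l => by
    rw [← Finset.sum_image (f := b) (g := fun k => k - l) (fun x _ y _ h => by simpa using h)]
    exact hb _
  calc _ ≤ ∑ k ∈ S, ∑ l ∈ S, (a k ^ 2 / 2 * b (k - l) + c l ^ 2 / 2 * b (k - l)) := by
        refine Finset.sum_le_sum fun k _ => Finset.sum_le_sum fun l _ => ?_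
        nlinarith [mul_nonneg (hb0 (k - l)) (sq_nonneg (a k - c l))]
    _ = ∑ k ∈ S, a k ^ 2 / 2 * ∑ l ∈ S, b (k - l) + ∑ l ∈ S, c l ^ 2 / 2 * ∑ k ∈ S, b (k - l) := by
        simp only [Finset.sum_add_distrib, Finset.mul_sum]
        congr 1
        exact Finset.sum_comm
    _ ≤ ∑ k ∈ S, a k ^ 2 / 2 * B + ∑ l ∈ S, c l ^ 2 / 2 * B := by
        refine add_le_add (Finset.sum_le_sum fun k _ => ?_) (Finset.sum_le_sum fun l _ => ?_)
        · exact mul_le_mul_of_nonneg_left (hb1 k) (by positivity)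
        · exact mul_le_mul_of_nonneg_left (hb2 l) (by positivity)
    _ = B * ((∑ k ∈ S, a k ^ 2 + ∑ l ∈ S, c l ^ 2) / 2) := by
        rw [← Finset.sum_mul, ← Finset.sum_mul, ← Finset.sum_div, ← Finset.sum_div]; ring
    _ ≤ _ := mul_le_mul_of_nonneg_left (by linarith) hB

/-- Companion of the previous bound, for when the right factor is the summable one: for each `l` the
sum over `k` is a product of two square-summable sequences. -/
lemma sum_kernel_le_of_l1_right (S : Finset (Freq d)) {a b c : Freq d → ℝ} {A B : ℝ}
    (hc0 : ∀ k, 0 ≤ c k) (hb : ∀ F : Finset (Freq d), ∑ k ∈ F, b k ^ 2 ≤ A)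
    (ha : ∑ k ∈ S, a k ^ 2 ≤ A) (hc : ∑ k ∈ S, c k ≤ B) :
    ∑ k ∈ S, ∑ l ∈ S, a k * b (k - l) * c l ≤ B * A := by
  have hA : 0 ≤ A := by simpa using hb ∅
  have hb2 : ∀ l, ∑ k ∈ S, b (k - l) ^ 2 ≤ A := fun l => by
    rw [← Finset.sum_image (f := fun m => b m ^ 2) (g := fun k => k - l)
      (fun x _ y _ h => by simpa using h)]
    exact hb _
  have hl : ∀ l, ∑ k ∈ S, a k * b (k - l) ≤ A := fun l => by
    calc _ ≤ ∑ k ∈ S, (a k ^ 2 + b (k - l) ^ 2) / 2 :=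
          Finset.sum_le_sum fun k _ => by nlinarith [sq_nonneg (a k - b (k - l))]
      _ = (∑ k ∈ S, a k ^ 2 + ∑ k ∈ S, b (k - l) ^ 2) / 2 := by
          rw [← Finset.sum_div, Finset.sum_add_distrib]
      _ ≤ _ := by linarith [hb2 l]
  rw [Finset.sum_comm]
  calc _ = ∑ l ∈ S, c l * ∑ k ∈ S, a k * b (k - l) := by
        refine Finset.sum_congr rfl fun l _ => ?_
        rw [Finset.mul_sum]; exact Finset.sum_congr rfl fun k _ => by ring
    _ ≤ ∑ l ∈ S, c l * A := Finset.sum_le_sum fun l _ => mul_le_mul_of_nonneg_left (hl l) (hc0 l)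
    _ ≤ _ := by rw [← Finset.sum_mul]; exact mul_le_mul_of_nonneg_right hc hA

/-- The multipliers of the quadratic terms: `|l| k / |k|` in the equation of the density and `l` in
the equations of the velocity. -/
def mult (a : Option (Fin d)) (k l : Freq d) (j : Fin d) : ℝ :=
  match a with
  | none => freqNorm l * dir k j
  | some _ => l j

lemma abs_mult_le (a : Option (Fin d)) (k l : Freq d) (j : Fin d) : |mult a k l j| ≤ freqNorm l := by
  cases a with
  | none =>
    simp only [mult, abs_mul, abs_of_nonneg (freqNorm_nonneg l)]
    exact mul_le_of_le_one_right (freqNorm_nonneg l) (abs_dir_le_one k j)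
  | some i => exact abs_coord_le_freqNorm l j

lemma abs_mult_sub_le (a : Option (Fin d)) (k l : Freq d) (j : Fin d) :
    |mult a k l j - l j| ≤ 2 * min (freqNorm (k - l)) (freqNorm l) := by
  cases a with
  | none => exact abs_freqNorm_mul_dir_sub_le k l j
  | some i =>
    simp only [mult, sub_self, abs_zero]
    exact mul_nonneg (by norm_num) (le_min (freqNorm_nonneg _) (freqNorm_nonneg _))

lemma mult_neg (a : Option (Fin d)) (k l : Freq d) (j : Fin d) :
    mult a (-k) (-l) j = -mult a k l j := by
  cases a <;> simp [mult, dir_neg, freqNorm_neg]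

/-- Two commutators in one: the multiplier is first replaced by `l` under the weight at `k`, then
the weight is moved from `k` to `l`. -/
lemma abs_weighted_mult_sub_le {s : ℝ} (hs : 1 ≤ s) (a : Option (Fin d)) (k l : Freq d)
    (j : Fin d) : |bra k ^ s * mult a k l j - bra l ^ s * l j| ≤
      (s + 2) * 2 ^ s * (bra (k - l) ^ s * bra l + bra (k - l) * bra l ^ s) := by
  have h1 := abs_bra_rpow_sub_le hs k l
  have h2 := bra_rpow_mul_min_le (by linarith : 0 ≤ s) k l
  have h3 := abs_mult_sub_le a k l j
  have h4 := abs_coord_le_freqNorm l j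
  have hk : 0 ≤ bra k ^ s := Real.rpow_nonneg (bra_pos k).le s
  have e : bra k ^ s * mult a k l j - bra l ^ s * l j =
      bra k ^ s * (mult a k l j - l j) + (bra k ^ s - bra l ^ s) * l j := by ring
  rw [e]
  calc _ ≤ bra k ^ s * |mult a k l j - l j| + |bra k ^ s - bra l ^ s| * |(l j : ℝ)| := by
        refine (abs_add_le _ _).trans ?_
        rw [abs_mul, abs_mul, abs_of_nonneg hk]
    _ ≤ bra k ^ s * (2 * min (freqNorm (k - l)) (freqNorm l)) +
          |bra k ^ s - bra l ^ s| * freqNorm l :=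
        add_le_add (mul_le_mul_of_nonneg_left h3 hk) (mul_le_mul_of_nonneg_left h4 (abs_nonneg _))
    _ ≤ _ := by nlinarith

/-- The constant in the energy estimate. -/
def energyConst (d : ℕ) (s : ℝ) : ℝ :=
  d * √(latticeConst d) * (1 + 2 * ((s + 2) * 2 ^ s))

lemma energyConst_nonneg (d : ℕ) {s : ℝ} (hs : 0 ≤ s) : 0 ≤ energyConst d s := by
  unfold energyConst; positivity

/-- The commutator estimate behind the uniform energy bound. -/
lemma abs_re_trilinear_le (hd : d ≤ 3) {s E : ℝ} (hs : 11 / 4 ≤ s) (a : Option (Fin d))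
    (S : Finset (Freq d)) {V : Freq d → Fin d → ℂ} {f : Freq d → ℂ}
    (hV : HsBound s E V) (hf : HsBound s E f) (hreal : ∀ k j, V (-k) j = conj (V k j)) :
    |(∑ k ∈ S, ∑ l ∈ S, ∑ j, (jap k ^ s : ℝ) * conj (f k) *
      (-Complex.I * (mult a k l j : ℝ) * V (k - l) j * f l)).re| ≤ energyConst d s * (√E * E) := by
  set g : Freq d → ℝ := fun k => bra k ^ s * ‖f k‖ with hg
  set G : Freq d → ℂ := fun k => (bra k ^ s : ℝ) * f k with hG
  set K : ℝ := (s + 2) * 2 ^ s with hK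
  have hK0 : 0 ≤ K := by have : 0 ≤ s := by linarith
                         positivity
  have hE := hf.nonneg
  have hGn : ∀ k, ‖G k‖ = g k := fun k => by
    simp [hG, hg, abs_of_nonneg (Real.rpow_nonneg (bra_pos k).le s)]
  have hg0 : ∀ k, 0 ≤ g k := fun k => by rw [← hGn]; exact norm_nonneg _
  have hbs : ∀ k : Freq d, (bra k ^ s) ^ 2 = jap k ^ s := fun k => by
    rw [bra_rpow, ← Real.rpow_natCast, ← Real.rpow_mul (jap_pos k).le]; congr 1; push_cast; ring
  have hgS : ∑ k ∈ S, g k ^ 2 ≤ E := by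
    simpa only [hg, mul_pow, hbs] using hf S
  have hbV : ∀ F : Finset (Freq d), ∑ k ∈ F, (bra k ^ s * ‖V k‖) ^ 2 ≤ E := fun F => by
    simpa only [mul_pow, hbs] using hV F
  have h1V := hV.sum_bra_le hd hs
  have h1f := hf.sum_bra_le hd hs S
  set B := √(latticeConst d) * √E with hB
  -- `T1` is the exact transport of the weighted sequence `G`, and `T2` collects the commutators.
  set T1 : ℂ := ∑ k ∈ S, ∑ l ∈ S, ∑ j, conj (G k) * (-Complex.I * (l j : ℝ) * V (k - l) j * G l)
    with hT1
  set T2 : ℂ := ∑ k ∈ S, ∑ l ∈ S, ∑ j, conj (G k) * (-Complex.I *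
    ((bra k ^ s * mult a k l j - bra l ^ s * l j : ℝ) : ℂ) * V (k - l) j * f l) with hT2
  have hT : (∑ k ∈ S, ∑ l ∈ S, ∑ j, (jap k ^ s : ℝ) * conj (f k) *
      (-Complex.I * (mult a k l j : ℝ) * V (k - l) j * f l)) = T1 + T2 := by
    rw [hT1, hT2]
    simp only [← Finset.sum_add_distrib]
    refine Finset.sum_congr rfl fun k _ => Finset.sum_congr rfl fun l _ =>
      Finset.sum_congr rfl fun j _ => ?_
    simp only [hG, map_mul, Complex.conj_ofReal, ← hbs]
    push_cast
    ring
  have hT2le : ‖T2‖ ≤ d * K * (B * E + B * E) := by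
    have hterm : ∀ k l, ‖∑ j, conj (G k) * (-Complex.I *
        ((bra k ^ s * mult a k l j - bra l ^ s * l j : ℝ) : ℂ) * V (k - l) j * f l)‖ ≤
        d * K * (g k * (bra (k - l) ^ s * ‖V (k - l)‖) * (bra l * ‖f l‖) +
          g k * (bra (k - l) * ‖V (k - l)‖) * g l) := by
      intro k l
      have hj : ∀ j, ‖conj (G k) * (-Complex.I *
          ((bra k ^ s * mult a k l j - bra l ^ s * l j : ℝ) : ℂ) * V (k - l) j * f l)‖ ≤
          g k * (K * (bra (k - l) ^ s * bra l + bra (k - l) * bra l ^ s)) * ‖V (k - l)‖ * ‖f l‖ := by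
        intro j
        simp only [norm_mul, RCLike.norm_conj, hGn, norm_neg, Complex.norm_I, one_mul,
          Complex.norm_real, Real.norm_eq_abs]
        have h1 := abs_weighted_mult_sub_le (by linarith : 1 ≤ s) a k l j
        have h2 := norm_le_pi_norm (V (k - l)) j
        rw [mul_assoc (g k), mul_assoc (g k)]
        refine mul_le_mul_of_nonneg_left ?_ (hg0 k)
        have h0 : 0 ≤ K * (bra (k - l) ^ s * bra l + bra (k - l) * bra l ^ s) :=
          (abs_nonneg _).trans h1
        gcongr
      refine (norm_sum_le _ _).trans ((Finset.sum_le_sum fun j _ => hj j).trans (le_of_eq ?_))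
      rw [Finset.sum_const, Finset.card_univ, Fintype.card_fin, nsmul_eq_mul]
      simp only [hg]
      ring
    calc ‖T2‖ ≤ ∑ k ∈ S, ∑ l ∈ S, d * K * (g k * (bra (k - l) ^ s * ‖V (k - l)‖) * (bra l * ‖f l‖) +
          g k * (bra (k - l) * ‖V (k - l)‖) * g l) :=
          (norm_sum_le _ _).trans (Finset.sum_le_sum fun k _ => (norm_sum_le _ _).trans
            (Finset.sum_le_sum fun l _ => hterm k l))
      _ = d * K * (∑ k ∈ S, ∑ l ∈ S, g k * (bra (k - l) ^ s * ‖V (k - l)‖) * (bra l * ‖f l‖) +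
          ∑ k ∈ S, ∑ l ∈ S, g k * (bra (k - l) * ‖V (k - l)‖) * g l) := by
          simp only [← Finset.mul_sum, ← Finset.sum_add_distrib]
      _ ≤ _ := by
          -- The factor that carries a single bracket is the one measured in `ℓ¹`: it is `f` in the
          -- first sum and `V` in the second. This is where `11/4 ≤ s` enters.
          refine mul_le_mul_of_nonneg_left (add_le_add ?_ ?_) (by positivity)
          · exact sum_kernel_le_of_l1_right S (b := fun m => bra m ^ s * ‖V m‖)
              (fun k => mul_nonneg (bra_pos k).le (norm_nonneg _)) hbV hgS h1f
          · exact sum_kernel_le_of_l1_left S (b := fun m => bra m * ‖V m‖)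
              (fun k => mul_nonneg (bra_pos k).le (norm_nonneg _)) h1V hgS hgS
  -- Integration by parts in Fourier variables. Exchanging `k` and `l` and using that `V` is real
  -- turns `conj T1` into the same sum with `-l` replaced by `k`, so the real part of `T1` only
  -- involves `k - l`: the derivative falls on `V`.
  have hconj : T1 + conj T1 = ∑ k ∈ S, ∑ l ∈ S, ∑ j, conj (G k) * (Complex.I *
      (((k - l) j : ℤ) : ℝ) * V (k - l) j * G l) := by
    have : conj T1 = ∑ k ∈ S, ∑ l ∈ S, ∑ j, conj (G k) * (Complex.I * (k j : ℝ) *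
        V (k - l) j * G l) := by
      rw [hT1, Finset.sum_comm]
      simp only [map_sum]
      refine Finset.sum_congr rfl fun k _ => Finset.sum_congr rfl fun l _ =>
        Finset.sum_congr rfl fun j _ => ?_
      have h : V (l - k) j = conj (V (k - l) j) := by rw [← hreal, neg_sub]
      simp only [map_mul, map_neg, Complex.conj_I, Complex.conj_conj, Complex.conj_ofReal, h]
      ring
    rw [this, hT1]
    simp only [← Finset.sum_add_distrib]
    refine Finset.sum_congr rfl fun k _ => Finset.sum_congr rfl fun l _ =>
      Finset.sum_congr rfl fun j _ => ?_
    push_cast [Pi.sub_apply]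
    ring
  have hT1le : |T1.re| ≤ d * (B * E) := by
    have h2 : ‖T1 + conj T1‖ ≤ d * (B * E) := by
      rw [hconj]
      calc _ ≤ ∑ k ∈ S, ∑ l ∈ S, d * (g k * (bra (k - l) * ‖V (k - l)‖) * g l) := by
            refine (norm_sum_le _ _).trans (Finset.sum_le_sum fun k _ => (norm_sum_le _ _).trans
              (Finset.sum_le_sum fun l _ => (norm_sum_le _ _).trans ?_))
            have hj : ∀ j ∈ Finset.univ, ‖conj (G k) * (Complex.I * (((k - l) j : ℤ) : ℝ) *
                V (k - l) j * G l)‖ ≤ g k * (bra (k - l) * ‖V (k - l)‖) * g l := by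
              intro j _
              simp only [norm_mul, RCLike.norm_conj, hGn, Complex.norm_I, one_mul,
                Complex.norm_real, Real.norm_eq_abs]
              have h1 := (abs_coord_le_freqNorm (k - l) j).trans (freqNorm_le_bra _)
              have h2 := norm_le_pi_norm (V (k - l)) j
              have := bra_pos (k - l)
              rw [mul_assoc (g k)]
              exact mul_le_mul_of_nonneg_left (mul_le_mul_of_nonneg_right
                (mul_le_mul h1 h2 (norm_nonneg _) this.le) (hg0 l)) (hg0 k)
            refine (Finset.sum_le_card_nsmul _ _ _ hj).trans (le_of_eq ?_)
            rw [Finset.card_univ, Fintype.card_fin, nsmul_eq_mul]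
        _ = d * ∑ k ∈ S, ∑ l ∈ S, g k * (bra (k - l) * ‖V (k - l)‖) * g l := by
            simp only [Finset.mul_sum]
        _ ≤ _ := mul_le_mul_of_nonneg_left (sum_kernel_le_of_l1_left S
            (b := fun m => bra m * ‖V m‖) (fun k => mul_nonneg (bra_pos k).le (norm_nonneg _))
            h1V hgS hgS) (by positivity)
    have h3 : T1 + conj T1 = ((2 * T1.re : ℝ) : ℂ) := by
      rw [Complex.add_conj]
    rw [h3, Complex.norm_real, Real.norm_eq_abs, abs_mul, abs_two] at h2
    linarith [abs_nonneg T1.re]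
  rw [hT, Complex.add_re]
  calc _ ≤ |T1.re| + |T2.re| := abs_add_le _ _
    _ ≤ d * (B * E) + d * K * (B * E + B * E) :=
        add_le_add hT1le ((Complex.abs_re_le_norm _).trans hT2le)
    _ = _ := by rw [hB, energyConst, ← hK]; ring

/-! ### The truncated system and its energy -/

/-- A `C^1` vector field on a finite dimensional space, cut off outside a ball, has integral curves
on any time interval. -/
lemma exists_integralCurve_cutoff {X : Type*} [NormedAddCommGroup X] [NormedSpace ℝ X]
    [FiniteDimensional ℝ X] {F : X → X} (hF : ContDiff ℝ 1 F) {R T : ℝ} (hR : 0 < R) (hT : 0 ≤ T)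
    (x₀ : X) : ∃ (θ : X → ℝ) (α : ℝ → X), (∀ x, 0 ≤ θ x ∧ θ x ≤ 1) ∧ (∀ x, ‖x‖ ≤ R → θ x = 1) ∧
      α 0 = x₀ ∧ ∀ t ∈ Icc 0 T, HasDerivWithinAt α (θ (α t) • F (α t)) (Icc 0 T) t := by
  let θ : ContDiffBump (0 : X) := ⟨R, R + 1, hR, by linarith⟩
  have hsm : ContDiff ℝ 1 fun x => θ x • F x := θ.contDiff.smul hF
  have hcs : HasCompactSupport fun x => θ x • F x := θ.hasCompactSupport.smul_right
  obtain ⟨K, hK⟩ := hsm.lipschitzWith_of_hasCompactSupport hcs one_ne_zero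
  obtain ⟨B, hB⟩ := hcs.exists_bound_of_continuous hsm.continuous
  have hB0 : 0 ≤ B := (norm_nonneg _).trans (hB 0)
  -- The cut-off field is bounded by `B` and globally Lipschitz, so a ball of radius `B * T` is
  -- never left and one application covers all of `[0, T]`.
  have hpl : IsPicardLindelof (fun _ : ℝ => fun x => θ x • F x) (tmin := 0) (tmax := T)
      ⟨0, le_rfl, hT⟩ x₀ (⟨B * T, by positivity⟩ : ℝ≥0) 0 ⟨B, hB0⟩ K :=
    IsPicardLindelof.of_time_independent (fun x _ => hB x) hK.lipschitzOnWith (by simp only [sub_zero, sub_self, max_eq_left hT, NNReal.coe_zero]; exact le_rfl)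
  obtain ⟨α, h0, hα⟩ := hpl.exists_eq_forall_mem_Icc_hasDerivWithinAt₀
  refine ⟨θ, α, fun x => ⟨θ.nonneg, θ.le_one⟩, fun x hx => ?_, h0, hα⟩
  exact θ.one_of_mem_closedBall (by simpa using hx)

/-- The skew-adjoint linear part of the system. -/
def linTerm (u : Freq d → Option (Fin d) → ℂ) (k : Freq d) : Option (Fin d) → ℂ
  | none => ∑ j, (dir k j : ℂ) * u k (some j)
  | some i => (dir k i : ℂ) * u k none

/-- The Euler–Poisson vector field in Fourier variables, with frequencies truncated to `S`. -/
def truncField (S : Finset (Freq d)) (ε : ℝ) (u : Freq d → Option (Fin d) → ℂ) (k : Freq d)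
    (a : Option (Fin d)) : ℂ :=
  -Complex.I * (ε⁻¹ : ℝ) * linTerm u k a +
    (2 * Real.pi : ℝ) * ∑ l ∈ S, ∑ j, -Complex.I * (mult a k l j : ℝ) * u (k - l) (some j) * u l a

/-- Reality of the functions with Fourier coefficients `u`. -/
def IsRealSeq (u : Freq d → ℂ) : Prop := ∀ k, u (-k) = conj (u k)

/-- Every multiplier is odd in the frequencies and comes with a factor `i`, which is why the field
respects the symmetry of the coefficients of real functions. The reindexing `l ↦ -l` requires `S` to
be symmetric. -/
lemma truncField_neg {S : Finset (Freq d)} (hS : ∀ k ∈ S, -k ∈ S) (ε : ℝ)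
    {u : Freq d → Option (Fin d) → ℂ} (hu : ∀ a, IsRealSeq fun k => u k a) (k : Freq d)
    (a : Option (Fin d)) : truncField S ε u (-k) a = conj (truncField S ε u k a) := by
  have hu' : ∀ k a, u (-k) a = conj (u k a) := fun k a => hu a k
  have hlin : linTerm u (-k) a = -conj (linTerm u k a) := by
    cases a with
    | none => simp [linTerm, hu', dir_neg]
    | some i => simp [linTerm, hu', dir_neg]
  have hsum : ∑ l ∈ S, ∑ j, -Complex.I * (mult a (-k) l j : ℝ) * u (-k - l) (some j) * u l a =
      conj (∑ l ∈ S, ∑ j, -Complex.I * (mult a k l j : ℝ) * u (k - l) (some j) * u l a) := by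
    simp only [map_sum]
    refine Finset.sum_nbij' (fun l => -l) (fun l => -l) hS hS (by simp) (by simp) fun l _ => ?_
    refine Finset.sum_congr rfl fun j _ => ?_
    have h1 : mult a (-k) l j = -mult a k (-l) j := by rw [← mult_neg, neg_neg]
    have h2 : -k - l = -(k - -l) := by abel
    have h3 : u l a = conj (u (-l) a) := by rw [← hu', neg_neg]
    rw [h1, h2, hu', h3]
    simp
  simp only [truncField, hlin, hsum, map_add, map_mul, Complex.conj_ofReal, map_neg,
    Complex.conj_I]
  ring

/-- The matrix that couples the density variable to the velocity along `dir k` is real and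
symmetric, so `i` times it is skew-adjoint. The factor `c` is arbitrary: with `c = ε⁻¹`, this
removes `ε` from all energy estimates. -/
lemma re_linTerm_eq_zero (c : ℝ) (u : Freq d → Option (Fin d) → ℂ) (k : Freq d) :
    ∑ a, (conj (u k a) * (-Complex.I * c * linTerm u k a)).re = 0 := by
  rw [Fintype.sum_option, ← Complex.re_sum, ← Complex.add_re]
  simp only [linTerm]
  have : conj (u k none) * (-Complex.I * c * ∑ j, (dir k j : ℂ) * u k (some j)) +
      ∑ i, conj (u k (some i)) * (-Complex.I * c * ((dir k i : ℂ) * u k none)) =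
      -Complex.I * ((∑ j, c * dir k j * (2 * (conj (u k none) * u k (some j)).re) : ℝ) : ℂ) := by
    rw [Finset.mul_sum, Finset.mul_sum, ← Finset.sum_add_distrib]
    rw [Complex.ofReal_sum, Finset.mul_sum]
    refine Finset.sum_congr rfl fun j _ => ?_
    have h := Complex.add_conj (conj (u k none) * u k (some j))
    simp only [map_mul, Complex.conj_conj] at h
    rw [Complex.ofReal_mul, ← h]
    push_cast
    ring
  rw [this]
  simp

lemma sum_energy_le_of_support {s E : ℝ} {S : Finset (Freq d)} {u : Freq d → Option (Fin d) → ℂ}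
    (h0 : ∀ k ∉ S, u k = 0) (hE : ∑ k ∈ S, ∑ a, jap k ^ s * ‖u k a‖ ^ 2 ≤ E)
    (F : Finset (Freq d)) : ∑ k ∈ F, ∑ a, jap k ^ s * ‖u k a‖ ^ 2 ≤ E := by
  refine le_trans ?_ hE
  have hnn : ∀ k, 0 ≤ ∑ a, jap k ^ s * ‖u k a‖ ^ 2 := fun k =>
    Finset.sum_nonneg fun a _ => mul_nonneg (jap_rpow_nonneg _ _) (sq_nonneg _)
  calc _ = ∑ k ∈ F with k ∈ S, ∑ a, jap k ^ s * ‖u k a‖ ^ 2 := by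
        rw [Finset.sum_filter]
        refine Finset.sum_congr rfl fun k _ => ?_
        split_ifs with h
        · rfl
        · simp [h0 k h]
    _ ≤ _ := Finset.sum_le_sum_of_subset_of_nonneg (fun k hk => (Finset.mem_filter.1 hk).2)
        fun k _ _ => hnn k

lemma pi_norm_sq_le_sum {ι : Type*} [Fintype ι] (x : ι → ℂ) : ‖x‖ ^ 2 ≤ ∑ a, ‖x a‖ ^ 2 := by
  have hnn : 0 ≤ ∑ a, ‖x a‖ ^ 2 := Finset.sum_nonneg fun a _ => sq_nonneg _
  rw [← Real.le_sqrt (norm_nonneg _) hnn]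
  refine (pi_norm_le_iff_of_nonneg (Real.sqrt_nonneg _)).2 fun j => Real.le_sqrt_of_sq_le ?_
  exact Finset.single_le_sum (f := fun a => ‖x a‖ ^ 2) (fun _ _ => sq_nonneg _)
    (Finset.mem_univ j)

lemma hsBound_of_sum_energy_le {s E : ℝ} {u : Freq d → Option (Fin d) → ℂ}
    (hu : ∀ F : Finset (Freq d), ∑ k ∈ F, ∑ a, jap k ^ s * ‖u k a‖ ^ 2 ≤ E) : HsBound s E u := by
  intro F
  refine (Finset.sum_le_sum fun k _ => ?_).trans (hu F)
  rw [← Finset.mul_sum]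
  exact mul_le_mul_of_nonneg_left (pi_norm_sq_le_sum (u k)) (jap_rpow_nonneg _ _)

lemma HsBound.velocity {s E : ℝ} {u : Freq d → Option (Fin d) → ℂ} (hu : HsBound s E u) :
    HsBound s E fun k j => u k (some j) :=
  hu.of_norm_le_one fun k => (pi_norm_le_iff_of_nonneg (norm_nonneg _)).2 fun j =>
    norm_le_pi_norm (u k) (some j)

lemma HsBound.component {s E : ℝ} {ι : Type*} [Fintype ι] {u : Freq d → ι → ℂ}
    (hu : HsBound s E u) (a : ι) : HsBound s E fun k => u k a :=
  hu.of_norm_le_one fun k => norm_le_pi_norm (u k) a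

lemma energy_truncField_eq (s : ℝ) (S : Finset (Freq d)) (ε : ℝ)
    (u : Freq d → Option (Fin d) → ℂ) :
    ∑ k ∈ S, ∑ a, jap k ^ s * (conj (u k a) * truncField S ε u k a).re =
      ∑ a, (2 * Real.pi) * (∑ k ∈ S, ∑ l ∈ S, ∑ j, ((jap k ^ s : ℝ) : ℂ) * conj (u k a) *
        (-Complex.I * (mult a k l j : ℝ) * u (k - l) (some j) * u l a)).re := by
  have h1 : ∀ k, ∑ a, jap k ^ s * (conj (u k a) * truncField S ε u k a).re =
      ∑ a, (2 * Real.pi) * (∑ l ∈ S, ∑ j, ((jap k ^ s : ℝ) : ℂ) * conj (u k a) *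
      (-Complex.I * (mult a k l j : ℝ) * u (k - l) (some j) * u l a)).re := by
    intro k
    have h2 := re_linTerm_eq_zero ε⁻¹ u k
    have h3 : ∀ a, jap k ^ s * (conj (u k a) * truncField S ε u k a).re =
        jap k ^ s * (conj (u k a) * (-Complex.I * (ε⁻¹ : ℝ) * linTerm u k a)).re +
        (2 * Real.pi) * (∑ l ∈ S, ∑ j, ((jap k ^ s : ℝ) : ℂ) * conj (u k a) *
      (-Complex.I * (mult a k l j : ℝ) * u (k - l) (some j) * u l a)).re := by
      intro a
      generalize hq : (jap k ^ s : ℝ) = q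
      have h4 : ∑ l ∈ S, ∑ j, (q : ℂ) * conj (u k a) *
          (-Complex.I * (mult a k l j : ℝ) * u (k - l) (some j) * u l a) =
          q * (conj (u k a) *
          ∑ l ∈ S, ∑ j, -Complex.I * (mult a k l j : ℝ) * u (k - l) (some j) * u l a) := by
        rw [← mul_assoc, Finset.mul_sum]
        exact Finset.sum_congr rfl fun l _ => (Finset.mul_sum _ _ _).symm
      rw [h4, truncField]
      generalize (∑ l ∈ S, ∑ j, -Complex.I * (mult a k l j : ℝ) * u (k - l) (some j) * u l a) = Q
      generalize -Complex.I * ((ε⁻¹ : ℝ) : ℂ) * linTerm u k a = R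
      rw [Complex.re_ofReal_mul, mul_add, Complex.add_re,
        show conj (u k a) * (((2 * Real.pi : ℝ) : ℂ) * Q) =
          ((2 * Real.pi : ℝ) : ℂ) * (conj (u k a) * Q) by ring, Complex.re_ofReal_mul]
      ring
    rw [Finset.sum_congr rfl fun a _ => h3 a, Finset.sum_add_distrib, ← Finset.mul_sum, h2,
      mul_zero, zero_add]
  rw [Finset.sum_congr rfl fun k _ => h1 k, Finset.sum_comm]
  refine Finset.sum_congr rfl fun a _ => ?_
  rw [← Finset.mul_sum, Complex.re_sum]

/-- The energy estimate for the truncated system; the constant depends neither on the truncation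
nor on `ε`. -/
lemma abs_energy_truncField_le (hd : d ≤ 3) {s E : ℝ} (hs : 11 / 4 ≤ s) (S : Finset (Freq d))
    (ε : ℝ) {u : Freq d → Option (Fin d) → ℂ} (hu : ∀ a, IsRealSeq fun k => u k a)
    (hE : HsBound s E u) :
    |∑ k ∈ S, ∑ a, jap k ^ s * (conj (u k a) * truncField S ε u k a).re| ≤
      (d + 1) * (2 * Real.pi) * energyConst d s * (√E * E) := by
  have h : ∀ a, |(∑ k ∈ S, ∑ l ∈ S, ∑ j, ((jap k ^ s : ℝ) : ℂ) * conj (u k a) *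
      (-Complex.I * (mult a k l j : ℝ) * u (k - l) (some j) * u l a)).re| ≤
      energyConst d s * (√E * E) := fun a =>
    abs_re_trilinear_le hd hs a S (V := fun k j => u k (some j)) (f := fun k => u k a)
      hE.velocity (hE.component a) fun k j => hu (some j) k
  rw [energy_truncField_eq]
  refine (Finset.abs_sum_le_sum_abs _ _).trans
    ((Finset.sum_le_card_nsmul _ _ (2 * Real.pi * (energyConst d s * (√E * E)))
      fun a _ => ?_).trans (le_of_eq ?_))
  · rw [abs_mul, abs_of_pos Real.two_pi_pos]
    exact mul_le_mul_of_nonneg_left (h a) Real.two_pi_pos.le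
  · rw [Finset.card_univ, Fintype.card_option, Fintype.card_fin, nsmul_eq_mul]
    push_cast; ring

/-- A nonnegative solution of `y' ≤ C y²` on `[0,T]`, `y(0) ≤ Y`, `2 C Y T ≤ 1`, stays below
`2 Y`. -/
lemma le_two_mul_of_riccati {y y' : ℝ → ℝ} {C Y T : ℝ} (hy : ∀ t ∈ Icc 0 T, 0 < y t)
    (hder : ∀ t ∈ Icc 0 T, HasDerivWithinAt y (y' t) (Icc 0 T) t)
    (hle : ∀ t ∈ Icc 0 T, y' t ≤ C * y t ^ 2) (hC : 0 ≤ C) (h0 : y 0 ≤ Y)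
    (hT : 2 * C * Y * T ≤ 1) : ∀ t ∈ Icc 0 T, y t ≤ 2 * Y := by
  intro t ht
  have h0m : (0 : ℝ) ∈ Icc 0 T := ⟨le_rfl, ht.1.trans ht.2⟩
  have hY : 0 < Y := (hy 0 h0m).trans_le h0
  -- The differential inequality says that `(1/y)' ≥ -C`, i.e. that `1/y + C t` is nondecreasing.
  have hd : ∀ x ∈ Icc 0 T, HasDerivWithinAt (fun x => (y x)⁻¹ + C * x)
      (-(y' x) / y x ^ 2 + C * 1) (Icc 0 T) x := fun x hx =>
    ((hder x hx).inv (hy x hx).ne').add ((hasDerivWithinAt_id x _).const_mul C)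
  have hmono : MonotoneOn (fun x => (y x)⁻¹ + C * x) (Icc 0 T) := by
    refine monotoneOn_of_deriv_nonneg (convex_Icc 0 T) (fun x hx => (hd x hx).continuousWithinAt)
      (fun x hx => ?_) fun x hx => ?_
    · exact ((hd x (interior_subset hx)).mono interior_subset).differentiableWithinAt
    · have hx' := interior_subset hx
      rw [((hd x hx').hasDerivAt (mem_interior_iff_mem_nhds.1 hx)).deriv]
      have hp : 0 < y x ^ 2 := by have := hy x hx'; positivity
      have : y' x / y x ^ 2 ≤ C := by rw [div_le_iff₀ hp]; exact hle x hx'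
      rw [neg_div]; linarith
  have h1 := hmono h0m ht ht.1
  simp only [mul_zero, add_zero] at h1
  have h2 : Y⁻¹ ≤ (y 0)⁻¹ := inv_anti₀ (hy 0 h0m) h0
  have h3 : C * t ≤ C * T := mul_le_mul_of_nonneg_left ht.2 hC
  have h4 : C * T ≤ (2 * Y)⁻¹ := by
    rw [← one_div, le_div_iff₀ (by positivity)]; linarith
  have h5 : (2 * Y)⁻¹ ≤ (y t)⁻¹ := by
    have : (2 * Y)⁻¹ = Y⁻¹ - (2 * Y)⁻¹ := by field_simp; ring
    linarith
  exact (inv_le_inv₀ (by positivity) (hy t ht)).1 h5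

/-- Extension by zero of a family of coefficients indexed by `S`. -/
def extendZero {ι : Type*} (S : Finset (Freq d)) (x : S → ι → ℂ) (k : Freq d) (a : ι) : ℂ :=
  if h : k ∈ S then x ⟨k, h⟩ a else 0

/-- The coefficients of the real part of the functions with coefficients `w`. -/
def realCoeffs {ι : Type*} (w : Freq d → ι → ℂ) (k : Freq d) (a : ι) : ℂ :=
  (w k a + conj (w (-k) a)) / 2

lemma isRealSeq_realCoeffs {ι : Type*} (w : Freq d → ι → ℂ) (a : ι) :
    IsRealSeq fun k => realCoeffs w k a := by
  intro k
  simp [realCoeffs, add_comm, Complex.conj_ofNat]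

lemma realCoeffs_eq_self {ι : Type*} {w : Freq d → ι → ℂ} (hw : ∀ a, IsRealSeq fun k => w k a) :
    realCoeffs w = w := by
  ext k a
  have := hw a k
  simp only at this
  simp [realCoeffs, this]

lemma contDiff_extendZero {ι : Type*} [Fintype ι] (S : Finset (Freq d)) (k : Freq d) (a : ι) :
    ContDiff ℝ 1 fun x : S → ι → ℂ => extendZero S x k a := by
  by_cases h : k ∈ S
  · simp only [extendZero, h, dite_true]
    exact contDiff_apply_apply ℝ ℂ _ _
  · simp only [extendZero, h, dite_false]
    exact contDiff_const

lemma contDiff_realCoeffs_extendZero {ι : Type*} [Fintype ι] (S : Finset (Freq d)) (k : Freq d)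
    (a : ι) : ContDiff ℝ 1 fun x : S → ι → ℂ => realCoeffs (extendZero S x) k a := by
  unfold realCoeffs
  exact ((contDiff_extendZero S k a).add
    (Complex.conjCLE.contDiff.comp (contDiff_extendZero S (-k) a))).div_const 2

lemma contDiff_truncField (S : Finset (Freq d)) (ε : ℝ) :
    ContDiff ℝ 1 fun (x : S → Option (Fin d) → ℂ) (k : S) (a : Option (Fin d)) =>
      truncField S ε (realCoeffs (extendZero S x)) k a := by
  have h := contDiff_realCoeffs_extendZero (ι := Option (Fin d)) S
  refine contDiff_pi.2 fun k => contDiff_pi.2 fun a => ?_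
  unfold truncField
  refine ContDiff.add (contDiff_const.mul ?_) (contDiff_const.mul ?_)
  · cases a with
    | none => exact ContDiff.sum fun j _ => contDiff_const.mul (h _ _)
    | some i => exact contDiff_const.mul (h _ _)
  · exact ContDiff.sum fun l _ => ContDiff.sum fun j _ =>
      (contDiff_const.mul (h _ _)).mul (h _ _)

/-- The constant in the differential inequality for the energy. -/
def growthConst (d : ℕ) (s : ℝ) : ℝ := 2 * ((d + 1) * (2 * Real.pi) * energyConst d s)

lemma growthConst_nonneg (d : ℕ) {s : ℝ} (hs : 0 ≤ s) : 0 ≤ growthConst d s := by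
  have := energyConst_nonneg d hs
  have := Real.pi_pos
  unfold growthConst; positivity

/-- Solutions of the truncated system exist on a time interval that depends only on the size of the
data. -/
theorem exists_galerkin (hd : d ≤ 3) {s : ℝ} (hs : 11 / 4 ≤ s) {S : Finset (Freq d)}
    (hS : ∀ k ∈ S, -k ∈ S) (ε : ℝ) {u₀ : Freq d → Option (Fin d) → ℂ}
    (hu₀ : ∀ a, IsRealSeq fun k => u₀ k a) {Y T : ℝ}
    (hY : ∑ k ∈ S, ∑ a, jap k ^ s * ‖u₀ k a‖ ^ 2 + 1 ≤ Y) (hT0 : 0 ≤ T)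
    (hT : 2 * growthConst d s * Y * T ≤ 1) :
    ∃ u : ℝ → Freq d → Option (Fin d) → ℂ, (∀ t, ∀ k ∉ S, u t k = 0) ∧ (∀ k ∈ S, u 0 k = u₀ k) ∧
      ∀ t ∈ Icc 0 T, (∀ a, IsRealSeq fun k => u t k a) ∧ HsBound s (2 * Y) (u t) ∧
        ∀ k ∈ S, ∀ a, HasDerivWithinAt (fun τ => u τ k a) (truncField S ε (u t) k a)
          (Icc 0 T) t := by
  have hs0 : 0 ≤ s := by linarith
  have hY1 : 1 ≤ Y := by
    have : 0 ≤ ∑ k ∈ S, ∑ a, jap k ^ s * ‖u₀ k a‖ ^ 2 := Finset.sum_nonneg fun k _ =>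
      Finset.sum_nonneg fun a _ => mul_nonneg (jap_rpow_nonneg _ _) (sq_nonneg _)
    linarith
  -- The field is evaluated at the real part of the state, so its values have the conjugation
  -- symmetry before the solution is known to have it. The radius `√(2Y)` dominates every
  -- coefficient of a state of energy at most `2Y`.
  obtain ⟨θ, α, hθ, hθ1, hα0, hα⟩ := exists_integralCurve_cutoff (contDiff_truncField S ε)
    (R := √(2 * Y)) (by positivity) hT0 (fun k a => u₀ k a)
  set u : ℝ → Freq d → Option (Fin d) → ℂ := fun t => extendZero S (α t) with hu
  have huS : ∀ t, ∀ k (h : k ∈ S), ∀ a, u t k a = α t ⟨k, h⟩ a := fun t k h a => by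
    simp [hu, extendZero, h]
  have huS' : ∀ t, ∀ k ∉ S, u t k = 0 := fun t k h => by
    ext a; simp [hu, extendZero, h]
  have hder : ∀ t ∈ Icc 0 T, ∀ k ∈ S, ∀ a, HasDerivWithinAt (fun τ => u τ k a)
      (θ (α t) * truncField S ε (realCoeffs (u t)) k a) (Icc 0 T) t := by
    intro t ht k hk a
    have h1 := hasDerivWithinAt_pi.1 (hasDerivWithinAt_pi.1 (hα t ht) ⟨k, hk⟩) a
    simp only [huS _ k hk]
    simpa using h1
  have hreal : ∀ t ∈ Icc 0 T, ∀ a, IsRealSeq fun k => u t k a := by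
    intro t ht a k
    by_cases hk : k ∈ S
    swap
    · have hk' : -k ∉ S := fun h => hk (by simpa using hS _ h)
      simp [huS' t k hk, huS' t (-k) hk']
    -- The defect of reality is constant in time, hence zero, because it vanishes for the data.
    have hz : ∀ τ ∈ Icc 0 T, HasDerivWithinAt (fun τ => u τ (-k) a - conj (u τ k a)) 0
        (Icc 0 T) τ := by
      intro τ hτ
      have h1 := hder τ hτ (-k) (hS k hk) a
      have h2 := (hder τ hτ k hk a).star
      have h3 := h1.fun_sub h2
      rw [truncField_neg hS ε (isRealSeq_realCoeffs (u τ))] at h3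
      simpa using h3
    have h0 : u 0 (-k) a - conj (u 0 k a) = 0 := by
      have := hu₀ a k
      simp only at this
      rw [huS 0 k hk, huS 0 (-k) (hS k hk), hα0]
      simp [this]
    have := constant_of_has_deriv_right_zero (f := fun τ => u τ (-k) a - conj (u τ k a))
      (a := 0) (b := T) (fun τ hτ => (hz τ hτ).continuousWithinAt)
      (fun τ hτ => ((hz τ ⟨hτ.1, hτ.2.le⟩).mono_of_mem_nhdsWithin
        (Icc_mem_nhdsGE_of_mem hτ))) t ht
    simp only [h0] at this
    exact sub_eq_zero.1 this
  set En : ℝ → ℝ := fun t => ∑ k ∈ S, ∑ a, jap k ^ s * ‖u t k a‖ ^ 2 with hEn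
  have hEn0 : ∀ t, 0 ≤ En t := fun t => Finset.sum_nonneg fun k _ =>
      Finset.sum_nonneg fun a _ => mul_nonneg (jap_rpow_nonneg _ _) (sq_nonneg _)
  have hbd : ∀ t, HsBound s (En t) (u t) := fun t =>
    hsBound_of_sum_energy_le (sum_energy_le_of_support (huS' t) le_rfl)
  -- The shift by `1` keeps the Riccati variable positive and lets `√E · E` be absorbed into `(E +
  -- 1)²`. The cutoff only multiplies the derivative by a factor in `[0, 1]`.
  have hEnder : ∀ t ∈ Icc 0 T, HasDerivWithinAt (fun t => En t + 1)
      (θ (α t) * (2 * ∑ k ∈ S, ∑ a, jap k ^ s * (conj (u t k a) * truncField S ε (u t) k a).re))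
      (Icc 0 T) t := by
    intro t ht
    have h1 : HasDerivWithinAt En (∑ k ∈ S, ∑ a, jap k ^ s *
        (2 * inner ℝ (u t k a) (θ (α t) * truncField S ε (realCoeffs (u t)) k a))) (Icc 0 T) t :=
      HasDerivWithinAt.fun_sum fun k hk => HasDerivWithinAt.fun_sum fun a _ =>
        (hder t ht k hk a).norm_sq.const_mul _
    rw [realCoeffs_eq_self (hreal t ht)] at h1
    refine (h1.add_const 1).congr_deriv ?_
    simp only [Finset.mul_sum]
    refine Finset.sum_congr rfl fun k _ => Finset.sum_congr rfl fun a _ => ?_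
    rw [Complex.inner, mul_assoc, Complex.re_ofReal_mul, mul_comm (conj (u t k a))]
    ring
  have hRic : ∀ t ∈ Icc 0 T, En t + 1 ≤ 2 * Y := by
    refine le_two_mul_of_riccati (C := growthConst d s) (fun t _ => by linarith [hEn0 t]) hEnder
      (fun t ht => ?_) (growthConst_nonneg d hs0) ?_ hT
    · have h1 := abs_energy_truncField_le hd hs S ε (hreal t ht) (hbd t)
      have h2 := hθ (α t)
      have h3 : √(En t) * En t ≤ (En t + 1) ^ 2 := by
        have h4 : √(En t) ≤ En t + 1 := by
          rw [Real.sqrt_le_left (by linarith [hEn0 t])]; nlinarith [hEn0 t]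
        rw [pow_two]
        exact mul_le_mul h4 (by linarith) (hEn0 t) (by linarith [hEn0 t])
      have h5 := energyConst_nonneg d hs0
      have hpi := Real.pi_pos
      calc _ ≤ |θ (α t) * (2 * ∑ k ∈ S, ∑ a, jap k ^ s *
            (conj (u t k a) * truncField S ε (u t) k a).re)| := le_abs_self _
        _ = θ (α t) * (2 * |∑ k ∈ S, ∑ a, jap k ^ s *
            (conj (u t k a) * truncField S ε (u t) k a).re|) := by
            rw [abs_mul, abs_mul, abs_two, abs_of_nonneg h2.1]
        _ ≤ 1 * (2 * ((d + 1) * (2 * Real.pi) * energyConst d s * (En t + 1) ^ 2)) := by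
            refine mul_le_mul h2.2 ?_ (by positivity) one_pos.le
            refine mul_le_mul_of_nonneg_left (h1.trans ?_) (by norm_num)
            exact mul_le_mul_of_nonneg_left h3 (by positivity)
        _ = _ := by rw [growthConst]; ring
    · refine le_trans (le_of_eq ?_) hY
      simp only [hEn]
      congr 1
      refine Finset.sum_congr rfl fun k hk => Finset.sum_congr rfl fun a _ => ?_
      rw [huS 0 k hk, hα0]
  refine ⟨u, huS', fun k hk => ?_, fun t ht => ⟨hreal t ht, (hbd t).mono (by linarith [hRic t ht]),
    fun k hk a => ?_⟩⟩
  · ext a; rw [huS 0 k hk, hα0]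
  · have h1 := hder t ht k hk a
    -- The energy bound keeps the state in the ball where the cutoff equals `1`, so the curve solves
    -- the original system.
    rw [realCoeffs_eq_self (hreal t ht), hθ1 (α t) ?_] at h1
    · simpa using h1
    refine (pi_norm_le_iff_of_nonneg (Real.sqrt_nonneg _)).2 fun k => ?_
    refine (pi_norm_le_iff_of_nonneg (Real.sqrt_nonneg _)).2 fun a => ?_
    rw [← huS t k k.2]
    exact (norm_le_pi_norm (u t k) a).trans (((hbd t).norm_le hs0 k).trans
      (Real.sqrt_le_sqrt (by linarith [hRic t ht])))

/-! ### Compactness and existence for the full system in Fourier variables -/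

/-- Arzelà–Ascoli for countably many sequences of equi-Lipschitz functions at once. The limit is
extended to all times by its values at the end points. -/
lemma exists_subseq_tendstoUniformlyOn {J : Type*} [Countable J] {T : ℝ} (hT : 0 ≤ T)
    {f : ℕ → ℝ → J → ℂ} {B L : J → ℝ}
    (hB : ∀ n, ∀ t ∈ Icc 0 T, ∀ j, ‖f n t j‖ ≤ B j)
    (hL : ∀ n, ∀ t ∈ Icc 0 T, ∀ t' ∈ Icc 0 T, ∀ j, ‖f n t j - f n t' j‖ ≤ L j * |t - t'|) :
    ∃ (φ : ℕ → ℕ) (g : ℝ → J → ℂ), StrictMono φ ∧ (∀ j, Continuous fun t => g t j) ∧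
      (∀ t, g t = g (projIcc 0 T hT t)) ∧
      ∀ j, TendstoUniformlyOn (fun n t => f (φ n) t j) (fun t => g t j) atTop (Icc 0 T) := by
  let A : J → Set (BoundedContinuousFunction (Icc (0 : ℝ) T) ℂ) := fun j =>
    {h | (∀ x, ‖h x‖ ≤ B j) ∧ ∀ x y, dist (h x) (h y) ≤ L j * dist x y}
  have hAc : ∀ j, IsCompact (A j) := by
    intro j
    refine BoundedContinuousFunction.arzela_ascoli₂ (Metric.closedBall 0 (B j))
      (isCompact_closedBall _ _) _ ?_ (fun h x hh => by simpa using hh.1 x) ?_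
    · have hev : ∀ x : Icc (0 : ℝ) T,
          Continuous fun h : BoundedContinuousFunction (Icc (0 : ℝ) T) ℂ => h x :=
        fun x => continuous_eval_const x
      have e : A j = (⋂ x, {h | ‖h x‖ ≤ B j}) ∩ ⋂ x, ⋂ y, {h | dist (h x) (h y) ≤ L j * dist x y} := by
        ext h; simp only [A, mem_inter_iff, mem_iInter, mem_ofPred_eq]
      rw [e]
      exact (isClosed_iInter fun x => isClosed_le (hev x).norm continuous_const).inter
        (isClosed_iInter fun x => isClosed_iInter fun y =>
          isClosed_le ((hev x).dist (hev y)) continuous_const)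
    · refine Metric.equicontinuous_of_continuity_modulus (fun r => L j * r) ?_ _
        fun x y h => h.2.2 x y
      simpa using (continuous_const_mul (L j)).tendsto (0 : ℝ)
  have hcont : ∀ n j, Continuous fun t : Icc (0 : ℝ) T => f n t j := by
    intro n j
    have : LipschitzWith (L j).toNNReal fun t : Icc (0 : ℝ) T => f n t j := by
      refine LipschitzWith.of_dist_le_mul fun x y => ?_
      rw [dist_eq_norm]
      refine (hL n x x.2 y y.2 j).trans ?_
      exact mul_le_mul_of_nonneg_right (Real.le_coe_toNNReal _) (abs_nonneg _)
    exact this.continuous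
  let F : ℕ → J → BoundedContinuousFunction (Icc (0 : ℝ) T) ℂ := fun n j =>
    BoundedContinuousFunction.mkOfCompact ⟨fun t => f n t j, hcont n j⟩
  have hF : ∀ n, F n ∈ Set.univ.pi A := fun n j _ =>
    ⟨fun x => hB n x x.2 j, fun x y => by
      rw [dist_eq_norm]; exact hL n x x.2 y y.2 j⟩
  -- Tychonoff's theorem in place of a diagonal extraction; countability of `J` makes the product
  -- first countable, hence compactness sequential.
  obtain ⟨G, -, φ, hφ, hG⟩ := (isCompact_univ_pi hAc).tendsto_subseq hF
  refine ⟨φ, fun t j => G j (projIcc 0 T hT t), hφ, fun j => ?_, fun t => ?_, fun j => ?_⟩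
  · exact (G j).continuous.comp continuous_projIcc
  · ext j; simp
  · have h1 := tendsto_pi_nhds.1 hG j
    have h2 := BoundedContinuousFunction.tendsto_iff_tendstoUniformly.1 h1
    rw [Metric.tendstoUniformlyOn_iff]
    intro δ hδ
    filter_upwards [Metric.tendstoUniformly_iff.1 h2 δ hδ] with n hn t ht
    have := hn ⟨t, ht⟩
    rw [projIcc_of_mem hT ht]
    exact this

/-- The quadratic terms of the system in Fourier variables. -/
def bilin (a : Option (Fin d)) (V : Freq d → Fin d → ℂ) (f : Freq d → ℂ) (k : Freq d) : ℂ :=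
  ∑' l, ∑ j, -Complex.I * (mult a k l j : ℝ) * V (k - l) j * f l

lemma norm_bilin_term_le (a : Option (Fin d)) (V : Freq d → Fin d → ℂ) (f : Freq d → ℂ)
    (k l : Freq d) : ‖∑ j, -Complex.I * (mult a k l j : ℝ) * V (k - l) j * f l‖ ≤
      d * (bra l * (‖V (k - l)‖ * ‖f l‖)) := by
  refine (norm_sum_le _ _).trans ((Finset.sum_le_card_nsmul _ _ (bra l * (‖V (k - l)‖ * ‖f l‖))
    fun j _ => ?_).trans (le_of_eq ?_))
  · simp only [norm_mul, norm_neg, Complex.norm_I, one_mul, Complex.norm_real, Real.norm_eq_abs]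
    rw [mul_assoc]
    have h1 := (abs_mult_le a k l j).trans (freqNorm_le_bra l)
    have h2 := norm_le_pi_norm (V (k - l)) j
    have := bra_pos l
    gcongr
  · rw [Finset.card_univ, Fintype.card_fin, nsmul_eq_mul]

lemma jap_rpow_two_mul_bra_sq (l : Freq d) : jap l ^ (2 : ℝ) * bra l ^ 2 = jap l ^ (3 : ℝ) := by
  rw [bra_sq, ← Real.rpow_add_one (jap_pos l).ne']; norm_num

/-- For a fixed output frequency it is enough that `V` is bounded, while the derivative costs `f`
one order. The summands thus stay in `H²`, above the threshold `7/4` for `ℓ¹`, with a bound that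
does not depend on `k`. -/
lemma hsBound_bilin_term {M : ℝ} {V : Freq d → Fin d → ℂ} {f : Freq d → ℂ}
    (hV : HsBound 3 M V) (hf : HsBound 3 M f) (a : Option (Fin d)) (k : Freq d) :
    HsBound 2 ((d * √M) ^ 2 * M)
      (fun l => ∑ j, -Complex.I * (mult a k l j : ℝ) * V (k - l) j * f l) := by
  refine hf.of_le (sq_nonneg _) fun l => ?_
  have h1 := norm_bilin_term_le a V f k l
  have h2 := hV.norm_le (by norm_num) (k - l)
  have h3 : ‖∑ j, -Complex.I * (mult a k l j : ℝ) * V (k - l) j * f l‖ ≤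
      (d * √M) * (bra l * ‖f l‖) := by
    refine h1.trans ?_
    have := bra_pos l
    calc _ ≤ d * (bra l * (√M * ‖f l‖)) := by gcongr
      _ = _ := by ring
  have h4 := pow_le_pow_left₀ (norm_nonneg _) h3 2
  rw [mul_pow, mul_pow (bra l)] at h4
  rw [← jap_rpow_two_mul_bra_sq]
  calc _ ≤ jap l ^ (2 : ℝ) * ((d * √M) ^ 2 * (bra l ^ 2 * ‖f l‖ ^ 2)) :=
        mul_le_mul_of_nonneg_left h4 (jap_rpow_nonneg _ _)
    _ = _ := by ring

/-- A bound for the quadratic terms. -/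
def bilinBound (d : ℕ) (M : ℝ) : ℝ := √(latticeConst d) * √((d * √M) ^ 2 * M)

lemma bilinBound_nonneg (M : ℝ) : 0 ≤ bilinBound d M := by unfold bilinBound; positivity

lemma norm_bilin_le (hd : d ≤ 3) {M : ℝ} {V : Freq d → Fin d → ℂ} {f : Freq d → ℂ}
    (hV : HsBound 3 M V) (hf : HsBound 3 M f) (a : Option (Fin d)) (k : Freq d) :
    ‖bilin a V f k‖ ≤ bilinBound d M := by
  have h := hsBound_bilin_term hV hf a k
  have h1 := h.summable_norm hd (by norm_num)
  have h2 := h.tsum_norm_le hd (by norm_num)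
  rw [bilinBound, bilin]
  exact (norm_tsum_le_tsum_norm h1).trans h2

/-- The quadratic terms are continuous for coefficientwise convergence on bounded sets, so the
convergence supplied by compactness suffices to pass to the limit. -/
lemma tendsto_bilin (hd : d ≤ 3) {M : ℝ} {ι : Type*} {ℱ : Filter ι} [NeBot ℱ]
    {V : ι → Freq d → Fin d → ℂ} {f : ι → Freq d → ℂ} {V' : Freq d → Fin d → ℂ} {f' : Freq d → ℂ}
    (hV : ∀ᶠ n in ℱ, HsBound 3 M (V n)) (hf : ∀ᶠ n in ℱ, HsBound 3 M (f n))
    (hV' : ∀ k j, Tendsto (fun n => V n k j) ℱ (𝓝 (V' k j)))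
    (hf' : ∀ k, Tendsto (fun n => f n k) ℱ (𝓝 (f' k))) (a : Option (Fin d)) (k : Freq d) :
    Tendsto (fun n => bilin a (V n) (f n) k) ℱ (𝓝 (bilin a V' f' k)) := by
  refine tendsto_tsum_of_hsBound hd (s := 2) (by norm_num)
    ((hV.and hf).mono fun n hn => hsBound_bilin_term hn.1 hn.2 a k) fun l => ?_
  exact tendsto_finsetSum _ fun j _ => ((hV' _ _).const_mul _).mul (hf' _)

/-- The Euler–Poisson vector field in Fourier variables. -/
def epField (ε : ℝ) (u : Freq d → Option (Fin d) → ℂ) (k : Freq d) (a : Option (Fin d)) : ℂ :=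
  -Complex.I * (ε⁻¹ : ℝ) * linTerm u k a +
    (2 * Real.pi : ℝ) * bilin a (fun k j => u k (some j)) (fun k => u k a) k

/-- On states supported in `S` the truncation of the inner sum loses nothing. The Galerkin system
differs from the full one only in that outputs outside `S` are discarded. -/
lemma truncField_eq_epField {S : Finset (Freq d)} {u : Freq d → Option (Fin d) → ℂ}
    (hu : ∀ k ∉ S, u k = 0) (ε : ℝ) (k : Freq d) (a : Option (Fin d)) :
    truncField S ε u k a = epField ε u k a := by
  rw [truncField, epField, bilin, tsum_eq_sum (s := S)]
  intro l hl
  simp [hu l hl]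

lemma norm_linTerm_le (u : Freq d → Option (Fin d) → ℂ) (k : Freq d) (a : Option (Fin d)) :
    ‖linTerm u k a‖ ≤ (d + 1) * ‖u k‖ := by
  have hj : ∀ j b, ‖(dir k j : ℂ) * u k b‖ ≤ ‖u k‖ := fun j b => by
    rw [norm_mul, Complex.norm_real, Real.norm_eq_abs]
    exact (mul_le_of_le_one_left (norm_nonneg _) (abs_dir_le_one k j)).trans (norm_le_pi_norm _ _)
  cases a with
  | none =>
    refine (norm_sum_le _ _).trans ((Finset.sum_le_card_nsmul _ _ ‖u k‖ fun j _ => hj j _).trans ?_)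
    rw [Finset.card_univ, Fintype.card_fin, nsmul_eq_mul]
    nlinarith [norm_nonneg (u k)]
  | some i =>
    refine (hj i none).trans ?_
    have : (0 : ℝ) ≤ d := by positivity
    nlinarith [norm_nonneg (u k)]

/-- This bound degenerates as `ε → 0`. It provides the Lipschitz bounds in time of the Galerkin
approximations, where `ε` is fixed. -/
lemma norm_epField_le (hd : d ≤ 3) {M : ℝ} (ε : ℝ) {u : Freq d → Option (Fin d) → ℂ}
    (hu : HsBound 3 M u) (k : Freq d) (a : Option (Fin d)) :
    ‖epField ε u k a‖ ≤ |ε⁻¹| * ((d + 1) * √M) + 2 * Real.pi * bilinBound d M := by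
  refine (norm_add_le _ _).trans (add_le_add ?_ ?_)
  · rw [norm_mul, norm_mul, norm_neg, Complex.norm_I, one_mul, Complex.norm_real, Real.norm_eq_abs]
    refine mul_le_mul_of_nonneg_left ((norm_linTerm_le u k a).trans ?_) (abs_nonneg _)
    exact mul_le_mul_of_nonneg_left (hu.norm_le (by norm_num) k) (by positivity)
  · rw [norm_mul, Complex.norm_real, Real.norm_eq_abs, abs_of_pos Real.two_pi_pos]
    exact mul_le_mul_of_nonneg_left (norm_bilin_le hd hu.velocity (hu.component a) a k)
      Real.two_pi_pos.le

lemma tendsto_epField (hd : d ≤ 3) {M : ℝ} {ι : Type*} {ℱ : Filter ι} [NeBot ℱ] (ε : ℝ)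
    {u : ι → Freq d → Option (Fin d) → ℂ} {u' : Freq d → Option (Fin d) → ℂ}
    (hu : ∀ᶠ n in ℱ, HsBound 3 M (u n))
    (hu' : ∀ k a, Tendsto (fun n => u n k a) ℱ (𝓝 (u' k a))) (k : Freq d) (a : Option (Fin d)) :
    Tendsto (fun n => epField ε (u n) k a) ℱ (𝓝 (epField ε u' k a)) := by
  refine Tendsto.add (Tendsto.const_mul _ ?_) (Tendsto.const_mul _ ?_)
  · cases a with
    | none => exact tendsto_finsetSum _ fun j _ => (hu' _ _).const_mul _
    | some i => exact (hu' _ _).const_mul _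
  · exact tendsto_bilin hd (hu.mono fun n h => h.velocity) (hu.mono fun n h => h.component a)
      (fun k j => hu' k _) (fun k => hu' k a) a k

/-- The frequencies with coordinates at most `N`. -/
def freqBox (d N : ℕ) : Finset (Freq d) := Finset.Icc (fun _ => -(N : ℤ)) (fun _ => (N : ℤ))

lemma neg_mem_freqBox {N : ℕ} (k : Freq d) (hk : k ∈ freqBox d N) : -k ∈ freqBox d N := by
  simp only [freqBox, Finset.mem_Icc, Pi.le_def, Pi.neg_apply] at hk ⊢
  exact ⟨fun i => by linarith [hk.2 i], fun i => by linarith [hk.1 i]⟩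

lemma eventually_mem_freqBox (k : Freq d) : ∀ᶠ N in atTop, k ∈ freqBox d N := by
  filter_upwards [eventually_ge_atTop (∑ i, (k i).natAbs)] with N hN
  simp only [freqBox, Finset.mem_Icc, Pi.le_def]
  have : ∀ i, (k i).natAbs ≤ N := fun i =>
    (Finset.single_le_sum (f := fun i => (k i).natAbs) (fun _ _ => zero_le) (Finset.mem_univ i)).trans hN
  exact ⟨fun i => by have := this i; omega, fun i => by have := this i; omega⟩

lemma continuousOn_epField (hd : d ≤ 3) {M : ℝ} (ε : ℝ) {I : Set ℝ}
    {u : ℝ → Freq d → Option (Fin d) → ℂ} (hu : ∀ t ∈ I, HsBound 3 M (u t))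
    (hc : ∀ k a, ContinuousOn (fun t => u t k a) I) (k : Freq d) (a : Option (Fin d)) :
    ContinuousOn (fun t => epField ε (u t) k a) I := by
  intro t ht
  have : NeBot (𝓝[I] t) := mem_closure_iff_nhdsWithin_neBot.1 (subset_closure ht)
  exact tendsto_epField hd ε (eventually_mem_nhdsWithin.mono hu) (fun k a => hc k a t ht) k a

/-- The Euler–Poisson system in Fourier variables has solutions on a time interval that depends
only on the size of the data. The solution is extended to all times by its values at the end
points of the interval. -/
theorem exists_epField_solution (hd : d ≤ 3) {s : ℝ} (hs : 3 ≤ s) (ε : ℝ)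
    {u₀ : Freq d → Option (Fin d) → ℂ} (hu₀ : ∀ a, IsRealSeq fun k => u₀ k a) {Y T : ℝ}
    (hY : ∀ F : Finset (Freq d), ∑ k ∈ F, ∑ a, jap k ^ s * ‖u₀ k a‖ ^ 2 + 1 ≤ Y) (hT0 : 0 ≤ T)
    (hT : 2 * growthConst d s * Y * T ≤ 1) :
    ∃ u : ℝ → Freq d → Option (Fin d) → ℂ, (∀ t a, IsRealSeq fun k => u t k a) ∧
      (∀ t, HsBound s (2 * Y) (u t)) ∧ (∀ k a, Continuous fun t => u t k a) ∧ u 0 = u₀ ∧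
      ∀ t ∈ Icc 0 T, ∀ k a, u t k a = u₀ k a + ∫ τ in (0)..t, epField ε (u τ) k a := by
  have h0m : (0 : ℝ) ∈ Icc 0 T := ⟨le_rfl, hT0⟩
  choose w hwS hw0 hw using fun N : ℕ => exists_galerkin hd (by linarith : 11 / 4 ≤ s)
    (S := freqBox d N) neg_mem_freqBox ε hu₀ (hY _) hT0 hT
  have hw3 : ∀ N, ∀ t ∈ Icc 0 T, HsBound 3 (2 * Y) (w N t) := fun N t ht =>
    ((hw N t ht).2.1).mono_exp hs
  set B := |ε⁻¹| * ((d + 1) * √(2 * Y)) + 2 * Real.pi * bilinBound d (2 * Y) with hB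
  have hder : ∀ N, ∀ k ∈ freqBox d N, ∀ a, ∀ t ∈ Icc 0 T,
      HasDerivWithinAt (fun τ => w N τ k a) (epField ε (w N t) k a) (Icc 0 T) t := by
    intro N k hk a t ht
    rw [← truncField_eq_epField (hwS N t)]
    exact (hw N t ht).2.2 k hk a
  have hLip : ∀ N, ∀ t ∈ Icc 0 T, ∀ t' ∈ Icc 0 T, ∀ j : Freq d × Option (Fin d),
      ‖w N t j.1 j.2 - w N t' j.1 j.2‖ ≤ B * |t - t'| := by
    rintro N t ht t' ht' ⟨k, a⟩
    by_cases hk : k ∈ freqBox d N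
    · exact Convex.norm_image_sub_le_of_norm_hasDerivWithin_le (hder N k hk a)
        (fun x hx => norm_epField_le hd ε (hw3 N x hx) k a) (convex_Icc 0 T) ht' ht
    · have : 0 ≤ B := by
        have := bilinBound_nonneg (d := d) (2 * Y)
        have := Real.pi_pos
        positivity
      simp only [hwS N _ k hk, Pi.zero_apply, sub_self, norm_zero]
      positivity
  obtain ⟨φ, g, hφ, hgc, hgp, hg⟩ := exists_subseq_tendstoUniformlyOn hT0
    (f := fun N t (j : Freq d × Option (Fin d)) => w N t j.1 j.2) (B := fun _ => √(2 * Y))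
    (L := fun _ => B) (fun N t ht j => (norm_le_pi_norm (w N t j.1) j.2).trans
      ((hw3 N t ht).norm_le (by norm_num) j.1)) hLip
  set u : ℝ → Freq d → Option (Fin d) → ℂ := fun t k a => g t (k, a) with hu
  have hup : ∀ t, u t = u (projIcc 0 T hT0 t) := fun t => by
    ext k a; simp only [hu]; rw [hgp t]
  have hlim : ∀ t ∈ Icc 0 T, ∀ k a, Tendsto (fun n => w (φ n) t k a) atTop (𝓝 (u t k a)) :=
    fun t ht k a => (hg (k, a)).tendsto_at ht
  have hreal' : ∀ t ∈ Icc 0 T, ∀ a, IsRealSeq fun k => u t k a := by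
    intro t ht a k
    refine tendsto_nhds_unique (hlim t ht (-k) a) ?_
    have h1 := (Complex.continuous_conj.tendsto _).comp (hlim t ht k a)
    refine h1.congr fun n => ?_
    exact ((hw (φ n) t ht).1 a k).symm
  have hbd' : ∀ t ∈ Icc 0 T, HsBound s (2 * Y) (u t) := fun t ht =>
    HsBound.of_tendsto (ℱ := atTop) (x := fun n => w (φ n) t)
      (Eventually.of_forall fun n => (hw (φ n) t ht).2.1)
      (fun k => tendsto_pi_nhds.2 fun a => hlim t ht k a)
  have hu0 : u 0 = u₀ := by
    ext k a
    refine tendsto_nhds_unique (hlim 0 h0m k a) (tendsto_const_nhds.congr' ?_)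
    filter_upwards [hφ.tendsto_atTop.eventually (eventually_mem_freqBox k)] with n hn
    rw [hw0 (φ n) k hn]
  refine ⟨u, fun t => ?_, fun t => ?_, fun k a => hgc (k, a), hu0, fun t ht k a => ?_⟩
  · rw [hup t]; exact hreal' _ (projIcc 0 T hT0 t).2
  · rw [hup t]; exact hbd' _ (projIcc 0 T hT0 t).2
  have hsub : Icc 0 t ⊆ Icc 0 T := Icc_subset_Icc le_rfl ht.2
  -- The limit is taken in the integrated equation, where coefficientwise convergence and the
  -- constant bound `B` are enough. A given `k` lies in all but finitely many boxes.
  have hinteg : Tendsto (fun n => ∫ τ in (0)..t, epField ε (w (φ n) τ) k a) atTop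
      (𝓝 (∫ τ in (0)..t, epField ε (u τ) k a)) := by
    refine intervalIntegral.tendsto_integral_filter_of_dominated_convergence (fun _ => B) ?_ ?_
      intervalIntegrable_const ?_
    · refine (hφ.tendsto_atTop.eventually (eventually_mem_freqBox k)).mono fun n hn => ?_
      rw [uIoc_of_le ht.1]
      have : ContinuousOn (fun τ => epField ε (w (φ n) τ) k a) (Icc 0 T) := by
        refine continuousOn_epField hd ε (hw3 (φ n)) (fun k a => ?_) k a
        by_cases hk : k ∈ freqBox d (φ n)
        · exact fun τ hτ => (hder (φ n) k hk a τ hτ).continuousWithinAt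
        · simp only [hwS (φ n) _ k hk]; exact continuousOn_const
      exact (this.mono (Ioc_subset_Icc_self.trans hsub)).aestronglyMeasurable measurableSet_Ioc
    · refine Eventually.of_forall fun n => Eventually.of_forall fun τ hτ => ?_
      rw [uIoc_of_le ht.1] at hτ
      exact norm_epField_le hd ε (hw3 (φ n) τ (hsub (Ioc_subset_Icc_self hτ))) k a
    · refine Eventually.of_forall fun τ hτ => ?_
      rw [uIoc_of_le ht.1] at hτ
      have hτ' := hsub (Ioc_subset_Icc_self hτ)
      exact tendsto_epField hd ε (Eventually.of_forall fun n => hw3 (φ n) τ hτ')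
        (hlim τ hτ') k a
  refine tendsto_nhds_unique (hlim t ht k a) ((hinteg.const_add (u₀ k a)).congr' ?_)
  filter_upwards [hφ.tendsto_atTop.eventually (eventually_mem_freqBox k)] with n hn
  have hd' := hder (φ n) k hn a
  have hcf : ContinuousOn (fun τ => epField ε (w (φ n) τ) k a) (Icc 0 T) := by
    refine continuousOn_epField hd ε (hw3 (φ n)) (fun k a => ?_) k a
    by_cases hk : k ∈ freqBox d (φ n)
    · exact fun τ hτ => (hder (φ n) k hk a τ hτ).continuousWithinAt
    · simp only [hwS (φ n) _ k hk]; exact continuousOn_const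
  rw [intervalIntegral.integral_eq_sub_of_hasDerivAt_of_le ht.1
    (fun τ hτ => (hd' τ (hsub hτ)).continuousWithinAt.mono hsub)
    (fun τ hτ => (hd' τ (hsub (Ioo_subset_Icc_self hτ))).hasDerivAt
      (Icc_mem_nhds hτ.1 (hτ.2.trans_le ht.2)))
    ((hcf.mono hsub).intervalIntegrable_of_Icc ht.1), hw0 (φ n) k hn]
  ring

/-! ### Partial derivatives and Fourier coefficients on the torus -/

instance : IsProbabilityMeasure (torusMeasure d) := by unfold torusMeasure; infer_instance

instance : (torusMeasure d).IsAddHaarMeasure := by unfold torusMeasure; infer_instance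

/-- Fourier coefficients of a real function on the torus. -/
def fcoeff (f : Torus d → ℝ) (k : Freq d) : ℂ :=
  UnitAddTorus.mFourierCoeff (fun x => (f x : ℂ)) k

lemma fcoeff_eq_integral (f : Torus d → ℝ) (k : Freq d) :
    fcoeff f k = ∫ x, UnitAddTorus.mFourier (-k) x * f x ∂torusMeasure d := rfl

lemma norm_mFourier_apply (k : Freq d) (x : Torus d) : ‖UnitAddTorus.mFourier k x‖ = 1 := by
  simp only [UnitAddTorus.mFourier, fourier_apply, ContinuousMap.coe_mk, norm_prod,
    Circle.norm_coe, Finset.prod_const_one]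

/-- The projection of `ℝ^d` onto the torus. -/
def toTorus (y : Fin d → ℝ) : Torus d := fun i => (y i : UnitAddCircle)

lemma perLift_apply {E : Type*} (f : Torus d → E) (y : Fin d → ℝ) :
    perLift f y = f (toTorus y) := rfl

lemma isOpenQuotientMap_toTorus : IsOpenQuotientMap (toTorus (d := d)) :=
  IsOpenQuotientMap.piMap fun _ => QuotientAddGroup.isOpenQuotientMap_mk

lemma continuous_of_perLift {E : Type*} [TopologicalSpace E] {f : Torus d → E}
    (hf : Continuous (perLift f)) : Continuous f :=
  isOpenQuotientMap_toTorus.isQuotientMap.continuous_iff.2 hf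

lemma toTorus_add_single (y : Fin d → ℝ) (i : Fin d) (h : ℝ) :
    toTorus (y + h • Pi.single i 1) = toTorus y + Pi.single i (h : UnitAddCircle) := by
  ext j
  by_cases hj : j = i
  · subst hj; simp [toTorus]
  · simp [toTorus, hj]

lemma hasDerivAt_perLift_line {f : Torus d → ℝ} (hf : Differentiable ℝ (perLift f))
    (y : Fin d → ℝ) (i : Fin d) (h : ℝ) :
    HasDerivAt (fun h : ℝ => f (toTorus y + Pi.single i (h : UnitAddCircle)))
      (fderiv ℝ (perLift f) (y + h • Pi.single i 1) (Pi.single i 1)) h := by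
  have h1 : HasDerivAt (fun h : ℝ => y + h • (Pi.single i 1 : Fin d → ℝ)) (Pi.single i 1) h := by
    simpa using ((hasDerivAt_id h).smul_const (Pi.single i (1 : ℝ) : Fin d → ℝ)).const_add y
  have h2 := (hf (y + h • Pi.single i 1)).hasFDerivAt.comp_hasDerivAt h h1
  refine h2.congr_of_eventuallyEq (Eventually.of_forall fun h => ?_)
  simp [perLift_apply, toTorus_add_single]

lemma pd_toTorus {f : Torus d → ℝ} (hf : Differentiable ℝ (perLift f)) (y : Fin d → ℝ)
    (i : Fin d) : pd i f (toTorus y) = fderiv ℝ (perLift f) y (Pi.single i 1) := by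
  have := (hasDerivAt_perLift_line hf y i 0).deriv
  simpa [pd] using this

lemma hasDerivAt_pd {f : Torus d → ℝ} (hf : Differentiable ℝ (perLift f)) (x : Torus d)
    (i : Fin d) (h : ℝ) :
    HasDerivAt (fun h : ℝ => f (x + Pi.single i (h : UnitAddCircle)))
      (pd i f (x + Pi.single i (h : UnitAddCircle))) h := by
  obtain ⟨y, rfl⟩ := isOpenQuotientMap_toTorus.surjective x
  rw [← toTorus_add_single, pd_toTorus hf]
  exact hasDerivAt_perLift_line hf y i h

lemma hasDerivAt_pd_zero {f : Torus d → ℝ} (hf : Differentiable ℝ (perLift f)) (x : Torus d)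
    (i : Fin d) : HasDerivAt (fun h : ℝ => f (x + Pi.single i (h : UnitAddCircle)))
      (pd i f x) 0 := by
  simpa using hasDerivAt_pd hf x i 0

lemma continuous_of_contDiff_perLift {f : Torus d → ℝ} (hf : ContDiff ℝ 1 (perLift f)) :
    Continuous f := continuous_of_perLift hf.continuous

lemma continuous_pd {f : Torus d → ℝ} (hf : ContDiff ℝ 1 (perLift f)) (i : Fin d) :
    Continuous (pd i f) := by
  apply continuous_of_perLift
  have : perLift (pd i f) = fun y => fderiv ℝ (perLift f) y (Pi.single i 1) := by
    ext y; exact pd_toTorus (hf.differentiable one_ne_zero) y i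
  rw [this]
  exact (hf.continuous_fderiv one_ne_zero).clm_apply continuous_const

lemma pd_mul {f g : Torus d → ℝ} (hf : ContDiff ℝ 1 (perLift f)) (hg : ContDiff ℝ 1 (perLift g))
    (i : Fin d) (x : Torus d) : pd i (fun x => f x * g x) x = pd i f x * g x + f x * pd i g x := by
  have h := (hasDerivAt_pd_zero (hf.differentiable one_ne_zero) x i).fun_mul
    (hasDerivAt_pd_zero (hg.differentiable one_ne_zero) x i)
  simpa [pd] using h.deriv

lemma integrable_of_continuous {E : Type*} [NormedAddCommGroup E] {f : Torus d → E}
    (hf : Continuous f) : Integrable f (torusMeasure d) :=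
  hf.integrable_of_hasCompactSupport (HasCompactSupport.of_compactSpace f)

lemma memLp_of_continuous {E : Type*} [NormedAddCommGroup E] {f : Torus d → E}
    (hf : Continuous f) (p : ℝ≥0∞) : MemLp f p (torusMeasure d) :=
  hf.memLp_of_hasCompactSupport (HasCompactSupport.of_compactSpace f)

lemma mFourier_toTorus (k : Freq d) (y : Fin d → ℝ) :
    UnitAddTorus.mFourier k (toTorus y) =
      Complex.exp (∑ j, ((2 * Real.pi * k j : ℝ) * Complex.I) * y j) := by
  simp only [UnitAddTorus.mFourier, ContinuousMap.coe_mk, toTorus, fourier_coe_apply,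
    Complex.exp_sum]
  refine Finset.prod_congr rfl fun j _ => ?_
  congr 1
  push_cast
  ring

lemma mFourier_add_apply (k : Freq d) (x y : Torus d) :
    UnitAddTorus.mFourier k (x + y) = UnitAddTorus.mFourier k x * UnitAddTorus.mFourier k y := by
  simp [UnitAddTorus.mFourier, fourier_apply, smul_add, AddCircle.toCircle_add,
    Finset.prod_mul_distrib]

lemma mFourier_single_apply (k : Freq d) (i : Fin d) (h : ℝ) :
    UnitAddTorus.mFourier k (Pi.single i (h : UnitAddCircle)) =
      Complex.exp (((2 * Real.pi * k i : ℝ) * Complex.I) * h) := by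
  have : (Pi.single i (h : UnitAddCircle) : Torus d) = toTorus (h • Pi.single i 1) := by
    have := toTorus_add_single (0 : Fin d → ℝ) i h
    rw [zero_add] at this
    rw [this]
    ext j; simp [toTorus]
  rw [this, mFourier_toTorus]
  congr 1
  rw [Finset.sum_eq_single i]
  · simp
  · intro j _ hj; simp [hj]
  · simp

/-- The Fourier multiplier of `∂_i`. -/
def dsym (i : Fin d) (k : Freq d) : ℂ := (2 * Real.pi * k i : ℝ) * Complex.I

/-- Translating `f` by `h` along the `i`-th axis multiplies its coefficient by `exp (dsym i k * h)`,
by invariance of the measure. Differentiating at `h = 0`, under the integral on the other side,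
gives the formula; integration by parts on the torus is then deduced from the frequency zero. -/
lemma fcoeff_pd {f : Torus d → ℝ} (hf : ContDiff ℝ 1 (perLift f)) (i : Fin d) (k : Freq d) :
    fcoeff (pd i f) k = dsym i k * fcoeff f k := by
  have hdf := hf.differentiable one_ne_zero
  have hcf := continuous_of_contDiff_perLift hf
  have hcp := continuous_pd hf i
  obtain ⟨C, hC⟩ : ∃ C, ∀ x, ‖pd i f x‖ ≤ C := by
    obtain ⟨C, hC⟩ := isCompact_univ.exists_bound_of_continuousOn hcp.continuousOn
    exact ⟨C, fun x => hC x (mem_univ x)⟩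
  have h1 : HasDerivAt (fun h : ℝ => ∫ x, UnitAddTorus.mFourier (-k) x *
      f (x + Pi.single i (h : UnitAddCircle)) ∂torusMeasure d)
      (∫ x, UnitAddTorus.mFourier (-k) x * (pd i f x : ℂ) ∂torusMeasure d) 0 := by
    have := (hasDerivAt_integral_of_dominated_loc_of_deriv_le (μ := torusMeasure d) (𝕜 := ℝ)
      (F := fun (h : ℝ) x => UnitAddTorus.mFourier (-k) x *
        (f (x + Pi.single i (h : UnitAddCircle)) : ℂ))
      (F' := fun (h : ℝ) x => UnitAddTorus.mFourier (-k) x *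
        (pd i f (x + Pi.single i (h : UnitAddCircle)) : ℂ))
      (x₀ := 0) (s := univ) (bound := fun _ => C) univ_mem ?_ ?_ ?_ ?_ ?_ ?_).2
    · simpa using this
    · refine Eventually.of_forall fun h => Continuous.aestronglyMeasurable ?_
      fun_prop
    · apply integrable_of_continuous; fun_prop
    · apply Continuous.aestronglyMeasurable; fun_prop
    · refine Eventually.of_forall fun x h _ => ?_
      rw [norm_mul, norm_mFourier_apply, one_mul, Complex.norm_real]
      exact hC _
    · exact integrable_const _
    · refine Eventually.of_forall fun x h _ => ?_
      exact (hasDerivAt_pd hdf x i h).ofReal_comp.const_mul _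
  have h2 : ∀ h : ℝ, ∫ x, UnitAddTorus.mFourier (-k) x *
      f (x + Pi.single i (h : UnitAddCircle)) ∂torusMeasure d =
      Complex.exp (dsym i k * h) * fcoeff f k := by
    intro h
    symm
    rw [fcoeff_eq_integral, ← integral_const_mul,
      ← integral_add_right_eq_self _ (Pi.single i (h : UnitAddCircle))]
    refine integral_congr_ae (Eventually.of_forall fun x => ?_)
    simp only
    have he : Complex.exp (dsym i k * h) *
        Complex.exp (((2 * Real.pi * ((-k) i : ℤ) : ℝ) : ℂ) * Complex.I * h) = 1 := by
      rw [← Complex.exp_add, dsym]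
      simp
    rw [mFourier_add_apply, mFourier_single_apply]
    linear_combination (UnitAddTorus.mFourier (-k) x * f (x + Pi.single i (h : UnitAddCircle))) * he
  have h3 : HasDerivAt (fun h : ℝ => Complex.exp (dsym i k * h) * fcoeff f k)
      (dsym i k * fcoeff f k) 0 := by
    have := (((hasDerivAt_id (0 : ℝ)).ofReal_comp.const_mul (dsym i k)).cexp).mul_const (fcoeff f k)
    simpa using this
  rw [funext h2] at h1
  exact h1.unique h3

lemma integral_pd {f : Torus d → ℝ} (hf : ContDiff ℝ 1 (perLift f)) (i : Fin d) :
    ∫ x, pd i f x ∂torusMeasure d = 0 := by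
  have h := fcoeff_pd hf i 0
  rw [fcoeff_eq_integral] at h
  simp only [neg_zero, UnitAddTorus.mFourier_zero, ContinuousMap.one_apply, one_mul, dsym,
    Pi.zero_apply, Int.cast_zero, mul_zero, Complex.ofReal_zero, zero_mul] at h
  rw [integral_complex_ofReal] at h
  exact_mod_cast h

lemma integral_mul_pd {f g : Torus d → ℝ} (hf : ContDiff ℝ 1 (perLift f))
    (hg : ContDiff ℝ 1 (perLift g)) (i : Fin d) :
    ∫ x, f x * pd i g x ∂torusMeasure d = -∫ x, pd i f x * g x ∂torusMeasure d := by
  have h := integral_pd (f := fun x => f x * g x) (hf.mul hg) i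
  have hcf := continuous_of_contDiff_perLift hf
  have hcg := continuous_of_contDiff_perLift hg
  simp only [pd_mul hf hg] at h
  have hcpf := continuous_pd hf i
  have hcpg := continuous_pd hg i
  rw [integral_add (integrable_of_continuous (by fun_prop))
    (integrable_of_continuous (by fun_prop))] at h
  linarith

lemma ae_eq_of_fcoeff_eq {f g : Torus d → ℝ} (hf : MemLp f 2 (torusMeasure d))
    (hg : MemLp g 2 (torusMeasure d)) (h : ∀ k, fcoeff f k = fcoeff g k) :
    f =ᵐ[torusMeasure d] g := by
  have hf' := hf.ofReal (K := ℂ)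
  have hg' := hg.ofReal (K := ℂ)
  have key : ∀ (u : Torus d → ℝ) (hu : MemLp (fun x => (u x : ℂ)) 2 (torusMeasure d)) (k : Freq d),
      (UnitAddTorus.mFourierBasis (d := Fin d)).repr (hu.toLp _) k = fcoeff u k := by
    intro u hu k
    refine (UnitAddTorus.mFourierBasis_repr _ k).trans ?_
    refine integral_congr_ae ?_
    filter_upwards [hu.coeFn_toLp] with x hx
    exact congrArg (fun z => UnitAddTorus.mFourier (-k) x • z) hx
  have : hf'.toLp _ = hg'.toLp _ := by
    apply (UnitAddTorus.mFourierBasis (d := Fin d)).repr.injective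
    ext k
    exact (key f hf' k).trans ((h k).trans (key g hg' k).symm)
  have h2 := (MemLp.toLp_eq_toLp_iff hf' hg').1 this
  filter_upwards [h2] with x hx
  exact_mod_cast hx

/-! ### Convolutions and `ℓ¹`-valued continuity in time -/

/-- The convolution of two sequences of Fourier coefficients. -/
def conv (a b : Freq d → ℂ) (k : Freq d) : ℂ := ∑' l, a (k - l) * b l

/-- The shear `(k, l) ↦ (k - l, l)` of pairs of frequencies. -/
def shear (d : ℕ) : Freq d × Freq d ≃ Freq d × Freq d where
  toFun p := (p.1 - p.2, p.2)
  invFun p := (p.1 + p.2, p.2)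
  left_inv p := by simp
  right_inv p := by simp

lemma summable_conv_pair {a b : Freq d → ℂ} (ha : Summable fun k => ‖a k‖)
    (hb : Summable fun k => ‖b k‖) :
    Summable fun p : Freq d × Freq d => ‖a (p.1 - p.2) * b p.2‖ := by
  have h := ha.mul_of_nonneg hb (fun _ => norm_nonneg _) (fun _ => norm_nonneg _)
  have h2 := (shear d).summable_iff.2 h
  simpa [Function.comp_def, shear] using h2

lemma tsum_conv_pair {a b : Freq d → ℂ} (ha : Summable fun k => ‖a k‖)
    (hb : Summable fun k => ‖b k‖) :
    ∑' p : Freq d × Freq d, ‖a (p.1 - p.2) * b p.2‖ = (∑' k, ‖a k‖) * ∑' k, ‖b k‖ := by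
  rw [ha.tsum_mul_tsum hb (ha.mul_of_nonneg hb (fun _ => norm_nonneg _) (fun _ => norm_nonneg _)),
    ← (shear d).tsum_eq fun z : Freq d × Freq d => ‖a z.1‖ * ‖b z.2‖]
  simp [shear]

lemma summable_conv_term {a b : Freq d → ℂ} (ha : Summable fun k => ‖a k‖)
    (hb : Summable fun k => ‖b k‖) (k : Freq d) : Summable fun l => ‖a (k - l) * b l‖ :=
  (summable_conv_pair ha hb).prod_factor k

lemma norm_conv_le_tsum {a b : Freq d → ℂ} (ha : Summable fun k => ‖a k‖)
    (hb : Summable fun k => ‖b k‖) (k : Freq d) : ‖conv a b k‖ ≤ ∑' l, ‖a (k - l) * b l‖ :=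
  norm_tsum_le_tsum_norm (summable_conv_term ha hb k)

lemma summable_norm_conv {a b : Freq d → ℂ} (ha : Summable fun k => ‖a k‖)
    (hb : Summable fun k => ‖b k‖) : Summable fun k => ‖conv a b k‖ :=
  Summable.of_nonneg_of_le (fun _ => norm_nonneg _) (norm_conv_le_tsum ha hb)
    (summable_conv_pair ha hb).prod

lemma tsum_norm_conv_le {a b : Freq d → ℂ} (ha : Summable fun k => ‖a k‖)
    (hb : Summable fun k => ‖b k‖) :
    ∑' k, ‖conv a b k‖ ≤ (∑' k, ‖a k‖) * ∑' k, ‖b k‖ := by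
  rw [← tsum_conv_pair ha hb, (summable_conv_pair ha hb).tsum_prod]
  exact (summable_norm_conv ha hb).tsum_le_tsum (norm_conv_le_tsum ha hb)
    (summable_conv_pair ha hb).prod

lemma conv_sub_conv {a b a' b' : Freq d → ℂ} (ha : Summable fun k => ‖a k‖)
    (hb : Summable fun k => ‖b k‖) (ha' : Summable fun k => ‖a' k‖)
    (hb' : Summable fun k => ‖b' k‖) (k : Freq d) :
    conv a b k - conv a' b' k =
      conv (fun k => a k - a' k) b k + conv a' (fun k => b k - b' k) k := by
  have h1 : Summable fun k => ‖a k - a' k‖ := (ha.of_norm.sub ha'.of_norm).norm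
  have h2 : Summable fun k => ‖b k - b' k‖ := (hb.of_norm.sub hb'.of_norm).norm
  unfold conv
  rw [← Summable.tsum_sub (summable_conv_term ha hb k).of_norm
    (summable_conv_term ha' hb' k).of_norm,
    ← Summable.tsum_add (summable_conv_term h1 hb k).of_norm (summable_conv_term ha' h2 k).of_norm]
  exact tsum_congr fun l => by ring

/-- Continuity in time with values in `ℓ¹`. -/
def L1Cont (c : ℝ → Freq d → ℂ) : Prop :=
  (∀ t, Summable fun k => ‖c t k‖) ∧
    ∀ t, Tendsto (fun τ => ∑' k, ‖c τ k - c t k‖) (𝓝 t) (𝓝 0)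

namespace L1Cont

variable {c b : ℝ → Freq d → ℂ}

lemma summable_sub (hc : L1Cont c) (τ t : ℝ) : Summable fun k => ‖c τ k - c t k‖ :=
  ((hc.1 τ).of_norm.sub (hc.1 t).of_norm).norm

lemma of_le {b : ℝ → Freq d → ℂ} {C : ℝ} (hc : L1Cont c)
    (h0 : ∀ t k, ‖b t k‖ ≤ C * ‖c t k‖) (h : ∀ τ t k, ‖b τ k - b t k‖ ≤ C * ‖c τ k - c t k‖) :
    L1Cont b := by
  refine ⟨fun t => Summable.of_nonneg_of_le (fun _ => norm_nonneg _) (h0 t) ((hc.1 t).mul_left C),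
    fun t => ?_⟩
  have h1 := (hc.2 t).const_mul C
  rw [mul_zero] at h1
  refine squeeze_zero (fun τ => tsum_nonneg fun _ => norm_nonneg _) (fun τ => ?_) h1
  rw [← tsum_mul_left]
  exact (Summable.of_nonneg_of_le (fun _ => norm_nonneg _) (h τ t)
    ((hc.summable_sub τ t).mul_left C)).tsum_le_tsum (h τ t) ((hc.summable_sub τ t).mul_left C)

lemma mul_bounded {p : Freq d → ℂ} {C : ℝ} (hc : L1Cont c) (hp : ∀ k, ‖p k‖ ≤ C) :
    L1Cont fun t k => p k * c t k := by
  refine hc.of_le (C := C) (fun t k => ?_) fun τ t k => ?_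
  · rw [norm_mul]; exact mul_le_mul_of_nonneg_right (hp k) (norm_nonneg _)
  · rw [← mul_sub, norm_mul]; exact mul_le_mul_of_nonneg_right (hp k) (norm_nonneg _)

lemma add (hc : L1Cont c) (hb : L1Cont b) : L1Cont fun t k => c t k + b t k := by
  have hs : ∀ τ t k, ‖c τ k + b τ k - (c t k + b t k)‖ ≤ ‖c τ k - c t k‖ + ‖b τ k - b t k‖ :=
    fun τ t k => by rw [add_sub_add_comm]; exact norm_add_le _ _
  refine ⟨fun t => ((hc.1 t).of_norm.add (hb.1 t).of_norm).norm, fun t => ?_⟩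
  have h1 := (hc.2 t).add (hb.2 t)
  rw [add_zero] at h1
  refine squeeze_zero (fun τ => tsum_nonneg fun _ => norm_nonneg _) (fun τ => ?_) h1
  have h2 := (hc.summable_sub τ t).add (hb.summable_sub τ t)
  rw [← (hc.summable_sub τ t).tsum_add (hb.summable_sub τ t)]
  exact (Summable.of_nonneg_of_le (fun _ => norm_nonneg _) (hs τ t) h2).tsum_le_tsum (hs τ t) h2

lemma zero : L1Cont fun (_ : ℝ) (_ : Freq d) => (0 : ℂ) := by
  refine ⟨fun t => by simp, fun t => by simp⟩

lemma sum {ι : Type*} (s : Finset ι) {c : ι → ℝ → Freq d → ℂ} (hc : ∀ i ∈ s, L1Cont (c i)) :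
    L1Cont fun t k => ∑ i ∈ s, c i t k := by
  classical
  induction s using Finset.induction_on with
  | empty => simpa using zero
  | insert i s hi ih =>
    simp only [Finset.sum_insert hi]
    exact (hc i (Finset.mem_insert_self _ _)).add
      (ih fun j hj => hc j (Finset.mem_insert_of_mem hj))

lemma continuous_tsum_norm (hc : L1Cont c) : Continuous fun t => ∑' k, ‖c t k‖ := by
  refine continuous_iff_continuousAt.2 fun t => ?_
  refine tendsto_iff_norm_sub_tendsto_zero.2 ?_
  refine squeeze_zero (fun τ => norm_nonneg _) (fun τ => ?_) (hc.2 t)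
  rw [← (hc.1 τ).tsum_sub (hc.1 t)]
  have h : ∀ k, ‖‖c τ k‖ - ‖c t k‖‖ ≤ ‖c τ k - c t k‖ := fun k => abs_norm_sub_norm_le _ _
  have hs := Summable.of_nonneg_of_le (fun _ => norm_nonneg _) h (hc.summable_sub τ t)
  exact (norm_tsum_le_tsum_norm hs).trans (hs.tsum_le_tsum h (hc.summable_sub τ t))

lemma continuous_tsum (hc : L1Cont c) : Continuous fun t => ∑' k, c t k := by
  refine continuous_iff_continuousAt.2 fun t => ?_
  refine tendsto_iff_norm_sub_tendsto_zero.2 ?_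
  refine squeeze_zero (fun τ => norm_nonneg _) (fun τ => ?_) (hc.2 t)
  rw [← (hc.1 τ).of_norm.tsum_sub (hc.1 t).of_norm]
  exact norm_tsum_le_tsum_norm (hc.summable_sub τ t)

lemma continuous_coeff (hc : L1Cont c) (k : Freq d) : Continuous fun t => c t k := by
  refine continuous_iff_continuousAt.2 fun t => ?_
  refine tendsto_iff_norm_sub_tendsto_zero.2 ?_
  refine squeeze_zero (fun τ => norm_nonneg _) (fun τ => ?_) (hc.2 t)
  exact (hc.summable_sub τ t).le_tsum k fun _ _ => norm_nonneg _

/-- Convolution is a bounded bilinear operation on `ℓ¹`; the increment is split as in the product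
rule. -/
lemma convolution (hc : L1Cont c) (hb : L1Cont b) : L1Cont fun t => conv (c t) (b t) := by
  refine ⟨fun t => summable_norm_conv (hc.1 t) (hb.1 t), fun t => ?_⟩
  have h1 : Tendsto (fun τ => (∑' k, ‖c τ k - c t k‖) * (∑' k, ‖b τ k‖) +
      (∑' k, ‖c t k‖) * ∑' k, ‖b τ k - b t k‖) (𝓝 t) (𝓝 0) := by
    have := ((hc.2 t).mul (hb.continuous_tsum_norm.tendsto t)).add ((hb.2 t).const_mul
      (∑' k, ‖c t k‖))
    simpa using this
  refine squeeze_zero (fun τ => tsum_nonneg fun _ => norm_nonneg _) (fun τ => ?_) h1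
  have hs1 := summable_norm_conv (hc.summable_sub τ t) (hb.1 τ)
  have hs2 := summable_norm_conv (hc.1 t) (hb.summable_sub τ t)
  have hle : ∀ k, ‖conv (c τ) (b τ) k - conv (c t) (b t) k‖ ≤
      ‖conv (fun k => c τ k - c t k) (b τ) k‖ + ‖conv (c t) (fun k => b τ k - b t k) k‖ := by
    intro k
    rw [conv_sub_conv (hc.1 τ) (hb.1 τ) (hc.1 t) (hb.1 t)]
    exact norm_add_le _ _
  refine ((Summable.of_nonneg_of_le (fun _ => norm_nonneg _) hle (hs1.add hs2)).tsum_le_tsum hle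
    (hs1.add hs2)).trans ?_
  rw [hs1.tsum_add hs2]
  exact add_le_add (tsum_norm_conv_le (hc.summable_sub τ t) (hb.1 τ))
    (tsum_norm_conv_le (hc.1 t) (hb.summable_sub τ t))

/-- A uniform `H^s` bound with room to spare upgrades continuity of each coefficient to continuity
in `ℓ¹`, even after a multiplier of order `2r`. The inequality on `r` is strict because a bounded
family need not be continuous in the norm that bounds it. -/
lemma of_hsBound (hd : d ≤ 3) {s M r : ℝ} (hr : 2 * r + 7 / 4 < s) (hM : ∀ t, HsBound s M (c t))
    (hc : ∀ k, Continuous fun t => c t k) {p : Freq d → ℂ} {C : ℝ}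
    (hp : ∀ k, ‖p k‖ ≤ C * jap k ^ r) : L1Cont fun t k => p k * c t k := by
  have hs : ∀ t, Summable fun k => ‖p k * c t k‖ := fun t => by
    refine Summable.of_nonneg_of_le (fun _ => norm_nonneg _) (fun k => ?_)
      (((hM t).summable_rpow hd hr.le).mul_left C)
    rw [norm_mul, ← mul_assoc]
    exact mul_le_mul_of_nonneg_right (hp k) (norm_nonneg _)
  refine ⟨hs, fun t => ?_⟩
  have hb : ∀ τ, HsBound s (2 * M + 2 * M) fun k => c τ k - c t k := fun τ => (hM τ).sub (hM t)
  have h1 := (tendsto_l1_zero hd hr (Eventually.of_forall hb) (ℱ := 𝓝 t)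
    (fun k => by simpa using ((hc k).tendsto t).sub_const (c t k))).const_mul C
  rw [mul_zero] at h1
  refine squeeze_zero (fun τ => tsum_nonneg fun _ => norm_nonneg _) (fun τ => ?_) h1
  rw [← tsum_mul_left]
  refine ((hs τ).of_norm.sub (hs t).of_norm).norm.tsum_le_tsum (fun k => ?_)
    (((hb τ).summable_rpow hd hr.le).mul_left C)
  rw [← mul_sub, norm_mul, ← mul_assoc]
  exact mul_le_mul_of_nonneg_right (hp k) (norm_nonneg _)

end L1Cont

/-- Term by term differentiation in time. -/
lemma hasDerivWithinAt_tsum_of_integral {T : ℝ} {c h : ℝ → Freq d → ℂ} (hh : L1Cont h)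
    (hc : ∀ t ∈ Icc 0 T, Summable fun k => ‖c t k‖)
    (heq : ∀ t ∈ Icc 0 T, ∀ k, c t k = c 0 k + ∫ τ in (0)..t, h τ k) {t : ℝ} (ht : t ∈ Icc 0 T) :
    HasDerivWithinAt (fun t => ∑' k, c t k) (∑' k, h t k) (Icc 0 T) t := by
  have h0m : (0 : ℝ) ∈ Icc 0 T := ⟨le_rfl, ht.1.trans ht.2⟩
  -- The integrated equations are summed first; the sum is then a primitive of a continuous
  -- function, and the individual terms are never differentiated.
  have hsum : ∀ t ∈ Icc 0 T, ∑' k, c t k = ∑' k, c 0 k + ∫ τ in (0)..t, ∑' k, h τ k := by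
    intro t ht
    have h1 : HasSum (fun k => ∫ τ in (0)..t, h τ k) (∫ τ in (0)..t, ∑' k, h τ k) := by
      refine intervalIntegral.hasSum_integral_of_dominated_convergence (fun k τ => ‖h τ k‖)
        (fun k => (hh.continuous_coeff k).aestronglyMeasurable)
        (fun k => Eventually.of_forall fun τ _ => le_rfl)
        (Eventually.of_forall fun τ _ => hh.1 τ)
        (hh.continuous_tsum_norm.intervalIntegrable _ _)
        (Eventually.of_forall fun τ _ => (hh.1 τ).of_norm.hasSum)
    have h2 := (hc 0 h0m).of_norm.hasSum.add h1
    rw [← h2.tsum_eq]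
    exact tsum_congr fun k => heq t ht k
  have h3 : HasDerivAt (fun t => ∑' k, c 0 k + ∫ τ in (0)..t, ∑' k, h τ k) (∑' k, h t k) t :=
    ((hh.continuous_tsum.integral_hasStrictDerivAt 0 t).hasDerivAt).const_add _
  exact h3.hasDerivWithinAt.congr hsum (hsum t ht)

/-! ### Functions with summable Fourier coefficients -/

/-- The function on the torus with Fourier coefficients `c`. -/
def syn (c : Freq d → ℂ) (x : Torus d) : ℂ := ∑' k, c k * UnitAddTorus.mFourier k x

/-- The real function on the torus with Fourier coefficients `c`. -/
def rsyn (c : Freq d → ℂ) (x : Torus d) : ℝ := (syn c x).re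

lemma norm_syn_term (c : Freq d → ℂ) (k : Freq d) (x : Torus d) :
    ‖c k * UnitAddTorus.mFourier k x‖ = ‖c k‖ := by
  rw [norm_mul, norm_mFourier_apply, mul_one]

lemma summable_syn {c : Freq d → ℂ} (hc : Summable fun k => ‖c k‖) (x : Torus d) :
    Summable fun k => c k * UnitAddTorus.mFourier k x :=
  Summable.of_norm (by simpa only [norm_syn_term] using hc)

lemma norm_syn_le {c : Freq d → ℂ} (hc : Summable fun k => ‖c k‖) (x : Torus d) :
    ‖syn c x‖ ≤ ∑' k, ‖c k‖ := by
  have := norm_tsum_le_tsum_norm (f := fun k => c k * UnitAddTorus.mFourier k x)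
    (by simpa only [norm_syn_term] using hc)
  simp only [norm_syn_term] at this
  exact this

lemma syn_sub {c b : Freq d → ℂ} (hc : Summable fun k => ‖c k‖) (hb : Summable fun k => ‖b k‖)
    (x : Torus d) : syn (fun k => c k - b k) x = syn c x - syn b x := by
  unfold syn
  rw [← (summable_syn hc x).tsum_sub (summable_syn hb x)]
  exact tsum_congr fun k => by ring

lemma syn_add {c b : Freq d → ℂ} (hc : Summable fun k => ‖c k‖) (hb : Summable fun k => ‖b k‖)
    (x : Torus d) : syn (fun k => c k + b k) x = syn c x + syn b x := by
  unfold syn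
  rw [← (summable_syn hc x).tsum_add (summable_syn hb x)]
  exact tsum_congr fun k => by ring

lemma syn_const_mul (c : Freq d → ℂ) (z : ℂ) (x : Torus d) :
    syn (fun k => z * c k) x = z * syn c x := by
  unfold syn
  rw [← tsum_mul_left]
  exact tsum_congr fun k => by ring

lemma syn_sum {ι : Type*} (s : Finset ι) {c : ι → Freq d → ℂ}
    (hc : ∀ i ∈ s, Summable fun k => ‖c i k‖) (x : Torus d) :
    syn (fun k => ∑ i ∈ s, c i k) x = ∑ i ∈ s, syn (c i) x := by
  unfold syn
  rw [← Summable.tsum_finsetSum fun i hi => summable_syn (hc i hi) x]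
  exact tsum_congr fun k => by rw [Finset.sum_mul]

lemma continuous_syn {c : Freq d → ℂ} (hc : Summable fun k => ‖c k‖) : Continuous (syn c) :=
  continuous_tsum (fun k => continuous_const.mul (UnitAddTorus.mFourier k).continuous) hc
    fun k x => (norm_syn_term c k x).le

lemma continuous_rsyn {c : Freq d → ℂ} (hc : Summable fun k => ‖c k‖) : Continuous (rsyn c) :=
  Complex.continuous_re.comp (continuous_syn hc)

lemma L1Cont.continuous_syn {c : ℝ → Freq d → ℂ} (hc : L1Cont c) :
    Continuous fun z : ℝ × Torus d => syn (c z.1) z.2 := by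
  refine continuous_iff_continuousAt.2 fun ⟨t, x⟩ => ?_
  have h1 : Tendsto (fun z : ℝ × Torus d => ∑' k, ‖c z.1 k - c t k‖ +
      ‖syn (c t) z.2 - syn (c t) x‖) (𝓝 (t, x)) (𝓝 0) := by
    have h2 := (hc.2 t).comp (continuous_fst.tendsto (t, x))
    have h3 : Tendsto (fun z : ℝ × Torus d => ‖syn (c t) z.2 - syn (c t) x‖) (𝓝 (t, x)) (𝓝 0) := by
      have := tendsto_iff_norm_sub_tendsto_zero.1
        (((_root_.continuous_syn (hc.1 t)).comp continuous_snd).tendsto (t, x))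
      exact this
    simpa using h2.add h3
  refine tendsto_iff_norm_sub_tendsto_zero.2 (squeeze_zero (fun _ => norm_nonneg _) (fun z => ?_) h1)
  have e : syn (c z.1) z.2 - syn (c t) x = syn (fun k => c z.1 k - c t k) z.2 +
      (syn (c t) z.2 - syn (c t) x) := by
    rw [syn_sub (hc.1 z.1) (hc.1 t)]; ring
  rw [e]
  exact (norm_add_le _ _).trans (add_le_add_left (norm_syn_le (hc.summable_sub _ _) _) _)

lemma L1Cont.continuous_rsyn {c : ℝ → Freq d → ℂ} (hc : L1Cont c) :
    Continuous fun z : ℝ × Torus d => rsyn (c z.1) z.2 :=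
  Complex.continuous_re.comp hc.continuous_syn

lemma conj_syn {c : Freq d → ℂ} (hr : IsRealSeq c) (x : Torus d) : conj (syn c x) = syn c x := by
  unfold syn
  rw [Complex.conj_tsum, ← (Equiv.neg (Freq d)).tsum_eq]
  refine tsum_congr fun k => ?_
  simp [hr k, UnitAddTorus.mFourier_neg]

lemma ofReal_rsyn {c : Freq d → ℂ} (hr : IsRealSeq c) (x : Torus d) : (rsyn c x : ℂ) = syn c x :=
  Complex.conj_eq_iff_re.1 (conj_syn hr x)

lemma integral_mFourier (k : Freq d) :
    ∫ x, UnitAddTorus.mFourier k x ∂torusMeasure d = if k = 0 then 1 else 0 := by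
  have h := orthonormal_iff_ite.1 (UnitAddTorus.orthonormal_mFourier (d := Fin d)) 0 k
  rw [ContinuousMap.inner_toLp] at h
  simp only [UnitAddTorus.mFourier_zero, ContinuousMap.one_apply, map_one, mul_one] at h
  exact h.trans (by simp only [eq_comm])

lemma integral_syn_mul {c : Freq d → ℂ} (hc : Summable fun k => ‖c k‖) {ψ : Torus d → ℂ}
    (hψ : Continuous ψ) : ∫ x, syn c x * ψ x ∂torusMeasure d =
      ∑' k, c k * ∫ x, UnitAddTorus.mFourier k x * ψ x ∂torusMeasure d := by
  obtain ⟨C, hC⟩ : ∃ C, ∀ x, ‖ψ x‖ ≤ C := by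
    obtain ⟨C, hC⟩ := isCompact_univ.exists_bound_of_continuousOn hψ.continuousOn
    exact ⟨C, fun x => hC x (mem_univ x)⟩
  have hcont : ∀ k : Freq d, Continuous fun x => c k * UnitAddTorus.mFourier k x * ψ x :=
    fun k => (continuous_const.mul (UnitAddTorus.mFourier k).continuous).mul hψ
  have h := hasSum_integral_of_dominated_convergence (μ := torusMeasure d)
    (F := fun k x => c k * UnitAddTorus.mFourier k x * ψ x) (f := fun x => syn c x * ψ x)
    (fun k _ => ‖c k‖ * C) (fun k => (hcont k).aestronglyMeasurable)
    (fun k => Eventually.of_forall fun x => by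
      rw [norm_mul, norm_syn_term]; exact mul_le_mul_of_nonneg_left (hC x) (norm_nonneg _))
    (Eventually.of_forall fun x => hc.mul_right C)
    (integrable_const _)
    (Eventually.of_forall fun x => (summable_syn hc x).hasSum.mul_right _)
  rw [← h.tsum_eq]
  refine tsum_congr fun k => ?_
  rw [← integral_const_mul]
  exact integral_congr_ae (Eventually.of_forall fun x => by simp only; ring)

lemma integral_rsyn_mul {c : Freq d → ℂ} (hc : Summable fun k => ‖c k‖) (hr : IsRealSeq c)
    {ψ : Torus d → ℝ} (hψ : Continuous ψ) :
    ((∫ x, rsyn c x * ψ x ∂torusMeasure d : ℝ) : ℂ) = ∑' k, c k * fcoeff ψ (-k) := by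
  rw [← integral_complex_ofReal]
  have h := integral_syn_mul hc (ψ := fun x => (ψ x : ℂ)) (by fun_prop)
  simp only [fcoeff_eq_integral, neg_neg]
  rw [← h]
  refine integral_congr_ae (Eventually.of_forall fun x => ?_)
  simp only
  push_cast
  rw [ofReal_rsyn hr]

lemma fcoeff_rsyn {c : Freq d → ℂ} (hc : Summable fun k => ‖c k‖) (hr : IsRealSeq c)
    (k : Freq d) : fcoeff (rsyn c) k = c k := by
  have h := integral_syn_mul hc (UnitAddTorus.mFourier (-k)).continuous
  simp only [← UnitAddTorus.mFourier_add, integral_mFourier] at h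
  rw [fcoeff_eq_integral]
  simp only [ofReal_rsyn hr, mul_comm (UnitAddTorus.mFourier (-k) _)]
  rw [h, tsum_eq_single k]
  · simp
  · intro l hl
    rw [if_neg, mul_zero]
    rwa [add_neg_eq_zero]

/-- The Cauchy product of two absolutely convergent series, regrouped by total frequency through
`shear`. -/
lemma syn_mul_syn {a b : Freq d → ℂ} (ha : Summable fun k => ‖a k‖)
    (hb : Summable fun k => ‖b k‖) (x : Torus d) : syn a x * syn b x = syn (conv a b) x := by
  have h1 : Summable fun k => ‖a k * UnitAddTorus.mFourier k x‖ := by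
    simpa only [norm_syn_term] using ha
  have h2 : Summable fun k => ‖b k * UnitAddTorus.mFourier k x‖ := by
    simpa only [norm_syn_term] using hb
  unfold syn
  rw [tsum_mul_tsum_of_summable_norm h1 h2, ← (shear d).tsum_eq]
  have e : ∀ p : Freq d × Freq d, a (shear d p).1 * UnitAddTorus.mFourier (shear d p).1 x *
      (b (shear d p).2 * UnitAddTorus.mFourier (shear d p).2 x) =
      a (p.1 - p.2) * b p.2 * UnitAddTorus.mFourier p.1 x := by
    intro p
    have : UnitAddTorus.mFourier p.1 x =
        UnitAddTorus.mFourier (p.1 - p.2) x * UnitAddTorus.mFourier p.2 x := by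
      rw [← UnitAddTorus.mFourier_add, sub_add_cancel]
    rw [this]
    simp only [shear, Equiv.coe_fn_mk]
    ring
  rw [tsum_congr e, Summable.tsum_prod]
  · exact tsum_congr fun k => by rw [conv, ← tsum_mul_right]
  · refine Summable.of_norm ((summable_conv_pair ha hb).congr fun p => ?_)
    rw [norm_mul _ (UnitAddTorus.mFourier p.1 x), norm_mFourier_apply, mul_one]

/-! ### Space derivatives -/

lemma norm_dsym_le (i : Fin d) (k : Freq d) : ‖dsym i k‖ ≤ 2 * Real.pi * bra k := by
  rw [dsym, norm_mul, Complex.norm_I, mul_one, Complex.norm_real, Real.norm_eq_abs, abs_mul,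
    abs_of_pos Real.two_pi_pos]
  exact mul_le_mul_of_nonneg_left ((abs_coord_le_freqNorm k i).trans (freqNorm_le_bra k))
    Real.two_pi_pos.le

lemma isRealSeq_dsym {c : Freq d → ℂ} (hr : IsRealSeq c) (i : Fin d) :
    IsRealSeq fun k => dsym i k * c k := by
  intro k
  simp [hr k, dsym, Complex.conj_ofNat]

/-- The differential of `ξ ↦ ∑ j, dsym j k ξ_j`. -/
def dsymCLM (k : Freq d) : (Fin d → ℝ) →L[ℝ] ℂ :=
  ∑ j, (ContinuousLinearMap.proj (R := ℝ) (φ := fun _ : Fin d => ℝ) j).smulRight (dsym j k)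

lemma dsymCLM_apply (k : Freq d) (y : Fin d → ℝ) : dsymCLM k y = ∑ j, y j • dsym j k := by
  simp [dsymCLM]

lemma norm_dsymCLM_le (k : Freq d) : ‖dsymCLM k‖ ≤ d * (2 * Real.pi) * bra k := by
  have hb := bra_pos k
  have hpi := Real.pi_pos
  refine ContinuousLinearMap.opNorm_le_bound _ (by positivity) fun y => ?_
  rw [dsymCLM_apply]
  refine (norm_sum_le _ _).trans ((Finset.sum_le_card_nsmul _ _ (2 * Real.pi * bra k * ‖y‖)
    fun j _ => ?_).trans (le_of_eq ?_))
  · rw [norm_smul, mul_comm]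
    exact mul_le_mul (norm_dsym_le j k) (norm_le_pi_norm y j) (norm_nonneg _) (by positivity)
  · rw [Finset.card_univ, Fintype.card_fin, nsmul_eq_mul]; ring

lemma hasFDerivAt_mFourier (k : Freq d) (y : Fin d → ℝ) :
    HasFDerivAt (fun y => UnitAddTorus.mFourier k (toTorus y))
      (UnitAddTorus.mFourier k (toTorus y) • dsymCLM k) y := by
  have e : (fun y => UnitAddTorus.mFourier k (toTorus y)) = fun y => Complex.exp (dsymCLM k y) := by
    ext y
    rw [mFourier_toTorus, dsymCLM_apply]
    congr 1
    exact Finset.sum_congr rfl fun j _ => by rw [dsym, Complex.real_smul]; ring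
  rw [e]
  have := congrFun e y
  rw [this]
  exact (dsymCLM k).hasFDerivAt.cexp

lemma summable_norm_of_bra {c : Freq d → ℂ} {n : ℕ} (hc : Summable fun k => bra k ^ n * ‖c k‖) :
    Summable fun k => ‖c k‖ :=
  Summable.of_nonneg_of_le (fun _ => norm_nonneg _)
    (fun k => le_mul_of_one_le_left (norm_nonneg _) (one_le_pow₀ (one_le_bra k))) hc

lemma summable_bra_dsym {c : Freq d → ℂ} {n : ℕ}
    (hc : Summable fun k => bra k ^ (n + 1) * ‖c k‖) (i : Fin d) :
    Summable fun k => bra k ^ n * ‖dsym i k * c k‖ := by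
  refine Summable.of_nonneg_of_le (fun k => mul_nonneg (pow_nonneg (bra_pos k).le _)
    (norm_nonneg _)) (fun k => ?_) (hc.mul_left (2 * Real.pi))
  have := bra_pos k
  rw [norm_mul]
  calc _ ≤ bra k ^ n * (2 * Real.pi * bra k * ‖c k‖) := by
        gcongr; exact norm_dsym_le i k
    _ = _ := by ring

lemma hasFDerivAt_syn {c : Freq d → ℂ} (hc : Summable fun k => bra k ^ 1 * ‖c k‖)
    (y : Fin d → ℝ) : HasFDerivAt (fun y => syn c (toTorus y))
      (∑ j, (ContinuousLinearMap.proj (R := ℝ) (φ := fun _ : Fin d => ℝ) j).smulRight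
        (syn (fun k => dsym j k * c k) (toTorus y))) y := by
  have hc0 := summable_norm_of_bra hc
  have h := hasFDerivAt_tsum (𝕜 := ℝ) (f := fun k y => c k * UnitAddTorus.mFourier k (toTorus y))
    (f' := fun k y => c k • (UnitAddTorus.mFourier k (toTorus y) • dsymCLM k))
    (u := fun k => d * (2 * Real.pi) * (bra k ^ 1 * ‖c k‖)) (x₀ := 0) (hc.mul_left _)
    (fun k y => (hasFDerivAt_mFourier k y).const_mul (c k))
    (fun k y => by
      rw [norm_smul, norm_smul, norm_mFourier_apply, one_mul, pow_one, mul_comm]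
      refine (mul_le_mul_of_nonneg_right (norm_dsymCLM_le k) (norm_nonneg _)).trans (le_of_eq ?_)
      ring)
    (summable_syn hc0 _) y
  have e : ∑' k, c k • (UnitAddTorus.mFourier k (toTorus y) • dsymCLM k) =
      ∑ j, (ContinuousLinearMap.proj (R := ℝ) (φ := fun _ : Fin d => ℝ) j).smulRight
        (syn (fun k => dsym j k * c k) (toTorus y)) := by
    have hs : ∀ j, Summable fun k => dsym j k * c k * UnitAddTorus.mFourier k (toTorus y) :=
      fun j => summable_syn (by simpa using summable_bra_dsym (n := 0) (by simpa using hc) j) _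
    have hsum : Summable fun k => c k • (UnitAddTorus.mFourier k (toTorus y) • dsymCLM k) := by
      refine Summable.of_norm (Summable.of_nonneg_of_le (fun _ => norm_nonneg _) (fun k => ?_)
        (hc.mul_left (d * (2 * Real.pi))))
      rw [norm_smul, norm_smul, norm_mFourier_apply, one_mul, pow_one, mul_comm]
      refine (mul_le_mul_of_nonneg_right (norm_dsymCLM_le k) (norm_nonneg _)).trans (le_of_eq ?_)
      ring
    ext z
    have hz := (ContinuousLinearMap.apply ℝ ℂ z).map_tsum hsum
    simp only [ContinuousLinearMap.apply_apply] at hz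
    rw [hz]
    simp only [_root_.sum_apply, ContinuousLinearMap.smulRight_apply,
      ContinuousLinearMap.proj_apply, _root_.smul_apply, dsymCLM_apply, syn]
    have h1 : ∀ j, z j • ∑' k, dsym j k * c k * UnitAddTorus.mFourier k (toTorus y) =
        ∑' k, z j • (dsym j k * c k * UnitAddTorus.mFourier k (toTorus y)) := fun j =>
      ((hs j).tsum_const_smul (z j)).symm
    rw [Finset.sum_congr rfl fun j _ => h1 j,
      ← Summable.tsum_finsetSum fun j _ => (hs j).const_smul (z j)]
    refine tsum_congr fun k => ?_
    simp only [smul_eq_mul, Finset.mul_sum, Complex.real_smul]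
    exact Finset.sum_congr rfl fun j _ => by ring
  rw [e] at h
  exact h

lemma contDiff_syn (n : ℕ) {c : Freq d → ℂ} (hc : Summable fun k => bra k ^ n * ‖c k‖) :
    ContDiff ℝ n fun y : Fin d → ℝ => syn c (toTorus y) := by
  induction n generalizing c with
  | zero =>
    exact contDiff_zero.2 ((continuous_syn (summable_norm_of_bra hc)).comp
      isOpenQuotientMap_toTorus.continuous)
  | succ n ih =>
    have h1 : Summable fun k => bra k ^ 1 * ‖c k‖ := by
      refine Summable.of_nonneg_of_le (fun k => mul_nonneg (pow_nonneg (bra_pos k).le _)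
        (norm_nonneg _)) (fun k => ?_) hc
      exact mul_le_mul_of_nonneg_right (pow_le_pow_right₀ (one_le_bra k) (by omega)) (norm_nonneg _)
    have hf := hasFDerivAt_syn h1
    push_cast
    refine contDiff_succ_iff_fderiv.2 ⟨fun y => (hf y).differentiableAt, by simp, ?_⟩
    rw [funext fun y => (hf y).fderiv]
    exact ContDiff.sum fun j _ => contDiff_const.smulRight (ih (summable_bra_dsym hc j))

lemma contDiff_perLift_rsyn (n : ℕ) {c : Freq d → ℂ} (hc : Summable fun k => bra k ^ n * ‖c k‖) :
    ContDiff ℝ n (perLift (rsyn c)) :=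
  Complex.reCLM.contDiff.comp (contDiff_syn n hc)

lemma pd_rsyn {c : Freq d → ℂ} (hc : Summable fun k => bra k * ‖c k‖) (i : Fin d) (x : Torus d) :
    pd i (rsyn c) x = rsyn (fun k => dsym i k * c k) x := by
  obtain ⟨y, rfl⟩ := isOpenQuotientMap_toTorus.surjective x
  have hc' : Summable fun k => bra k ^ 1 * ‖c k‖ := by simpa using hc
  have hd := contDiff_perLift_rsyn 1 hc'
  rw [pd_toTorus (hd.differentiable (by simp))]
  have h := Complex.reCLM.hasFDerivAt.comp y (hasFDerivAt_syn hc' y)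
  have e : perLift (rsyn c) = fun y => Complex.reCLM (syn c (toTorus y)) := rfl
  rw [e]
  rw [show (fun y => Complex.reCLM (syn c (toTorus y))) = Complex.reCLM ∘ fun y => syn c (toTorus y)
    from rfl, h.fderiv]
  simp [Pi.single_apply, rsyn]

/-! ### Sobolev norms -/

lemma hsNorm_eq (s : ℝ) (f : Torus d → ℝ) : hsNorm s f =
    (∑' k, ENNReal.ofReal (jap k ^ s) * ‖fcoeff f k‖ₑ ^ 2) ^ (1 / 2 : ℝ) := rfl

lemma hsNorm_sq (s : ℝ) (f : Torus d → ℝ) : hsNorm s f ^ 2 =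
    ∑' k, ENNReal.ofReal (jap k ^ s) * ‖fcoeff f k‖ₑ ^ 2 := by
  rw [hsNorm_eq, ← ENNReal.rpow_natCast, ← ENNReal.rpow_mul]; norm_num

lemma hsNormVec_eq (s : ℝ) (u : Torus d → Fin d → ℝ) : hsNormVec s u =
    (∑ i, ∑' k, ENNReal.ofReal (jap k ^ s) * ‖fcoeff (fun x => u x i) k‖ₑ ^ 2) ^ (1 / 2 : ℝ) := by
  simp only [hsNormVec, hsNorm_sq]

lemma hsBound_of_hsNorm_le {s : ℝ} {f : Torus d → ℝ} {C : ℝ≥0} (h : hsNorm s f ≤ C) :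
    HsBound s (C ^ 2) (fcoeff f) := by
  rw [hsBound_iff_tsum_le (by positivity), ← hsNorm_sq]
  refine (pow_le_pow_left₀ zero_le h 2).trans (le_of_eq ?_)
  rw [← NNReal.coe_pow, ENNReal.ofReal_coe_nnreal, ENNReal.coe_pow]

lemma hsBound_of_hsNormVec_le {s : ℝ} {u : Torus d → Fin d → ℝ} {C : ℝ≥0}
    (h : hsNormVec s u ≤ C) (i : Fin d) : HsBound s (C ^ 2) (fcoeff fun x => u x i) := by
  rw [hsBound_iff_tsum_le (by positivity)]
  refine (Finset.single_le_sum (f := fun i => ∑' k, ENNReal.ofReal (jap k ^ s) *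
    ‖fcoeff (fun x => u x i) k‖ₑ ^ 2) (fun _ _ => zero_le) (Finset.mem_univ i)).trans ?_
  have h2 := pow_le_pow_left₀ zero_le h 2
  rw [hsNormVec_eq, ← ENNReal.rpow_natCast, ← ENNReal.rpow_mul] at h2
  norm_num at h2
  refine h2.trans (le_of_eq ?_)
  rw [← NNReal.coe_pow, ENNReal.ofReal_coe_nnreal, ENNReal.coe_pow]

lemma hsNorm_le_of_hsBound {s M : ℝ} {f : Torus d → ℝ} (h : HsBound s M (fcoeff f)) :
    hsNorm s f ≤ ENNReal.ofReal √M := by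
  rw [hsNorm_eq]
  have h1 := (hsBound_iff_tsum_le h.nonneg _).1 h
  refine (ENNReal.rpow_le_rpow h1 (by norm_num)).trans (le_of_eq ?_)
  rw [ENNReal.ofReal_rpow_of_nonneg h.nonneg (by norm_num), Real.sqrt_eq_rpow]

lemma hsNormVec_le_of_hsBound {s M : ℝ} (hM : 0 ≤ M) {u : Torus d → Fin d → ℝ}
    (h : ∀ i, HsBound s M (fcoeff fun x => u x i)) :
    hsNormVec s u ≤ ENNReal.ofReal √(d * M) := by
  rw [hsNormVec_eq]
  have h1 : ∑ i, ∑' k, ENNReal.ofReal (jap k ^ s) * ‖fcoeff (fun x => u x i) k‖ₑ ^ 2 ≤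
      ENNReal.ofReal (d * M) := by
    refine (Finset.sum_le_card_nsmul _ _ _
      fun i _ => (hsBound_iff_tsum_le hM _).1 (h i)).trans (le_of_eq ?_)
    rw [Finset.card_univ, Fintype.card_fin, nsmul_eq_mul, ENNReal.ofReal_mul (by positivity),
      ENNReal.ofReal_natCast]
  refine (ENNReal.rpow_le_rpow h1 (by norm_num)).trans (le_of_eq ?_)
  rw [ENNReal.ofReal_rpow_of_nonneg (by positivity) (by norm_num), Real.sqrt_eq_rpow]

lemma tendsto_hsNormVec_zero {ι : Type*} {ℱ : Filter ι} {s s' M : ℝ} (hs : s' < s)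
    {u : ι → Torus d → Fin d → ℝ}
    (hb : ∀ i, ∀ᶠ n in ℱ, HsBound s M (fcoeff fun x => u n x i))
    (hu : ∀ i k, Tendsto (fun n => fcoeff (fun x => u n x i) k) ℱ (𝓝 0)) :
    Tendsto (fun n => hsNormVec s' (u n)) ℱ (𝓝 0) := by
  simp only [hsNormVec_eq]
  have h1 : Tendsto (fun n => ∑ i, ∑' k, ENNReal.ofReal (jap k ^ s') *
      ‖fcoeff (fun x => u n x i) k‖ₑ ^ 2) ℱ (𝓝 (∑ _i : Fin d, 0)) :=
    tendsto_finsetSum _ fun i _ => tendsto_hs_zero hs (hb i) (hu i)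
  rw [Finset.sum_const_zero] at h1
  have h2 := (ENNReal.continuous_rpow_const (y := 1 / 2)).tendsto 0
  rw [ENNReal.zero_rpow_of_pos (by norm_num)] at h2
  exact h2.comp h1

/-! ### Slabs -/

lemma isC1Slab_rsyn (T : ℝ) {c : ℝ → Freq d → ℂ} (hs : ∀ t, Summable fun k => bra k * ‖c t k‖)
    (hc : L1Cont c) (hd : ∀ i, L1Cont fun t k => dsym i k * c t k) :
    IsC1Slab T fun t => rsyn (c t) where
  contDiff t _ := contDiff_perLift_rsyn 1 (by simpa using hs t)
  continuousOn := hc.continuous_rsyn.continuousOn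
  continuousOn_pd i := by
    simp only [pd_rsyn (hs _)]
    exact (hd i).continuous_rsyn.continuousOn

/-! ### The quadratic terms as convolutions -/

lemma bilin_some_eq {V : Freq d → Fin d → ℂ} {f : Freq d → ℂ}
    (hV : ∀ j, Summable fun k => ‖V k j‖) (hf : ∀ j, Summable fun k => ‖dsym j k * f k‖)
    (i : Fin d) (k : Freq d) : (2 * Real.pi : ℝ) * bilin (some i) V f k =
      -∑ j, conv (fun k => V k j) (fun k => dsym j k * f k) k := by
  unfold bilin conv
  rw [← Summable.tsum_finsetSum fun j _ => (summable_conv_term (hV j) (hf j) k).of_norm,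
    ← tsum_mul_left, ← tsum_neg]
  refine tsum_congr fun l => ?_
  rw [Finset.mul_sum, ← Finset.sum_neg_distrib]
  refine Finset.sum_congr rfl fun j _ => ?_
  simp only [mult, dsym]
  push_cast
  ring

/-! ### From Fourier variables to the Euler–Poisson system -/

/-- The Fourier coefficients of the density fluctuation `(ρ - 1) / ε`. -/
def sigCoeff (u : Freq d → Option (Fin d) → ℂ) (k : Freq d) : ℂ :=
  (2 * Real.pi * freqNorm k : ℝ) * u k none

/-- The factor `2π|l|` restores `σ` from the density variable, so the series is the divergence of
`-σv` divided by `2π|k|`. -/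
lemma bilin_none_eq {u : Freq d → Option (Fin d) → ℂ}
    (hV : ∀ j, Summable fun k => ‖u k (some j)‖) (hf : Summable fun k => ‖sigCoeff u k‖)
    (k : Freq d) :
    (2 * Real.pi : ℝ) * bilin none (fun k j => u k (some j)) (fun k => u k none) k =
      ∑ j, -Complex.I * (dir k j : ℝ) * conv (fun k => u k (some j)) (sigCoeff u) k := by
  unfold bilin conv
  simp only [← tsum_mul_left]
  rw [← Summable.tsum_finsetSum fun j _ =>
    ((summable_conv_term (hV j) hf k).of_norm.mul_left (-Complex.I * (dir k j : ℝ)))]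
  refine tsum_congr fun l => ?_
  rw [Finset.mul_sum]
  refine Finset.sum_congr rfl fun j _ => ?_
  simp only [mult, sigCoeff]
  push_cast
  ring

/-- `u` is a bounded family in `H^s`, `s ≥ 3`, of coefficients of real functions, that satisfies the
Euler–Poisson system in Fourier variables on `[0,T]`. -/
structure IsFourierEP (ε T s M : ℝ) (u : ℝ → Freq d → Option (Fin d) → ℂ) : Prop where
  dim_le : d ≤ 3
  three_le : 3 ≤ s
  real : ∀ t a, IsRealSeq fun k => u t k a
  bound : ∀ t, HsBound s M (u t)
  cont : ∀ k a, Continuous fun t => u t k a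
  eqn : ∀ t ∈ Icc 0 T, ∀ k a, u t k a = u 0 k a + ∫ τ in (0)..t, epField ε (u τ) k a

/-- The velocity field with Fourier coefficients `u`. -/
def velField (u : Freq d → Option (Fin d) → ℂ) (x : Torus d) (i : Fin d) : ℝ :=
  rsyn (fun k => u k (some i)) x

/-- The density with Fourier variables `u`. -/
def density (ε : ℝ) (u : Freq d → Option (Fin d) → ℂ) (x : Torus d) : ℝ :=
  1 + ε * rsyn (sigCoeff u) x

/-- The Fourier coefficients of the electric potential. -/
def potCoeff (u : Freq d → Option (Fin d) → ℂ) (k : Freq d) : ℂ :=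
  -((2 * Real.pi * freqNorm k : ℝ) : ℂ)⁻¹ * u k none

lemma one_le_freqNorm {k : Freq d} (hk : k ≠ 0) : 1 ≤ freqNorm k := by
  obtain ⟨i, hi⟩ := Function.ne_iff.1 hk
  have h1 : (1 : ℝ) ≤ |(k i : ℝ)| := by
    have := Int.one_le_abs (z := k i) (by simpa using hi)
    exact_mod_cast this
  exact h1.trans (abs_coord_le_freqNorm k i)

lemma isRealSeq_sigCoeff {u : Freq d → Option (Fin d) → ℂ} (h : IsRealSeq fun k => u k none) :
    IsRealSeq (sigCoeff u) := by
  intro k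
  have := h k
  simp only at this
  simp [sigCoeff, freqNorm_neg, this, Complex.conj_ofNat]

lemma isRealSeq_potCoeff {u : Freq d → Option (Fin d) → ℂ} (h : IsRealSeq fun k => u k none) :
    IsRealSeq (potCoeff u) := by
  intro k
  have := h k
  simp only at this
  simp [potCoeff, freqNorm_neg, this, Complex.conj_ofNat]

lemma norm_two_pi_freqNorm_le (k : Freq d) :
    ‖((2 * Real.pi * freqNorm k : ℝ) : ℂ)‖ ≤ 2 * Real.pi * jap k ^ (1 / 2 : ℝ) := by
  have := Real.pi_pos
  rw [Complex.norm_real, Real.norm_of_nonneg (mul_nonneg Real.two_pi_pos.le (freqNorm_nonneg k)),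
    jap_rpow_half]
  exact mul_le_mul_of_nonneg_left (freqNorm_le_bra k) (by positivity)

/-- `|∇|⁻¹` gains one derivative. At the zero frequency the inverse is zero by convention, and
elsewhere `bra k ≤ 2|k|` is absorbed by `2π`. -/
lemma bra_mul_norm_inv_le (k : Freq d) :
    bra k * ‖-((2 * Real.pi * freqNorm k : ℝ) : ℂ)⁻¹‖ ≤ 1 := by
  have hpi := Real.pi_gt_three
  rw [norm_neg, norm_inv, Complex.norm_real, Real.norm_of_nonneg
    (mul_nonneg Real.two_pi_pos.le (freqNorm_nonneg k))]
  by_cases hk : k = 0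
  · have : freqNorm k = 0 := freqNorm_eq_zero.2 hk
    simp [this]
  · have h1 := one_le_freqNorm hk
    rw [← div_eq_mul_inv, div_le_one (by positivity)]
    have h2 : bra k ≤ 2 * freqNorm k := by
      refine Real.sqrt_le_iff.2 ⟨by linarith, ?_⟩
      rw [jap_eq]; nlinarith
    nlinarith

lemma norm_inv_two_pi_freqNorm_le (k : Freq d) :
    ‖-((2 * Real.pi * freqNorm k : ℝ) : ℂ)⁻¹‖ ≤ 1 := by
  have h := bra_mul_norm_inv_le k
  have := one_le_bra k
  nlinarith [norm_nonneg (-((2 * Real.pi * freqNorm k : ℝ) : ℂ)⁻¹)]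

lemma dsym_mul_potCoeff (u : Freq d → Option (Fin d) → ℂ) (i : Fin d) (k : Freq d) :
    dsym i k * potCoeff u k = -Complex.I * (dir k i : ℝ) * u k none := by
  simp only [dsym, potCoeff, dir]
  by_cases hk : freqNorm k = 0
  · simp [hk]
  · have h1 : (freqNorm k : ℂ) ≠ 0 := by exact_mod_cast hk
    have h2 : (Real.pi : ℂ) ≠ 0 := by exact_mod_cast Real.pi_ne_zero
    push_cast
    field_simp

lemma sum_dsym_dsym_potCoeff (u : Freq d → Option (Fin d) → ℂ) (k : Freq d) :
    ∑ i, dsym i k * (dsym i k * potCoeff u k) = sigCoeff u k := by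
  simp only [dsym_mul_potCoeff]
  have h : ∀ i, dsym i k * (-Complex.I * (dir k i : ℝ) * u k none) =
      (2 * Real.pi * (k i * dir k i) : ℝ) * u k none := by
    intro i
    simp only [dsym]
    push_cast
    linear_combination (-2 * Real.pi * k i * dir k i * u k none : ℂ) * Complex.I_sq
  rw [Finset.sum_congr rfl fun i _ => h i, ← Finset.sum_mul, sigCoeff, ← Complex.ofReal_sum,
    ← Finset.mul_sum]
  congr 3
  by_cases hk : freqNorm k = 0
  · have := freqNorm_eq_zero.1 hk
    subst this
    simp [freqNorm]
  · simp only [dir, mul_div_assoc', ← Finset.sum_div, ← pow_two]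
    rw [← freqNorm_sq]
    field_simp

namespace IsFourierEP

variable {ε T s M : ℝ} {u : ℝ → Freq d → Option (Fin d) → ℂ}

lemma bound_comp (h : IsFourierEP ε T s M u) (t : ℝ) (a : Option (Fin d)) :
    HsBound 3 M fun k => u t k a := ((h.bound t).component a).mono_exp h.three_le

lemma l1Cont_mul (h : IsFourierEP ε T s M u) (a : Option (Fin d)) {p : Freq d → ℂ} {C : ℝ}
    (hp : ∀ k, ‖p k‖ ≤ C * jap k ^ (1 / 2 : ℝ)) : L1Cont fun t k => p k * u t k a :=
  L1Cont.of_hsBound h.dim_le (r := 1 / 2) (by norm_num) (fun t => h.bound_comp t a)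
    (fun k => h.cont k a) hp

lemma l1Cont (h : IsFourierEP ε T s M u) (a : Option (Fin d)) : L1Cont fun t k => u t k a := by
  simpa using h.l1Cont_mul a (p := fun _ => 1) (C := 1)
    (fun k => by simpa using one_le_jap_rpow k (s := 1 / 2) (by norm_num))

lemma l1Cont_dsym (h : IsFourierEP ε T s M u) (a : Option (Fin d)) (i : Fin d) :
    L1Cont fun t k => dsym i k * u t k a :=
  h.l1Cont_mul a (C := 2 * Real.pi) fun k => by rw [jap_rpow_half]; exact norm_dsym_le i k

lemma l1Cont_sig (h : IsFourierEP ε T s M u) : L1Cont fun t => sigCoeff (u t) :=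
  h.l1Cont_mul none norm_two_pi_freqNorm_le

lemma summable_bra (h : IsFourierEP ε T s M u) (t : ℝ) (a : Option (Fin d)) :
    Summable fun k => bra k * ‖u t k a‖ :=
  (h.bound_comp t a).summable_bra h.dim_le (by norm_num)

/-- The potential is one derivative smoother than the density variable. Two summable brackets make
it `C²`, so that the Poisson equation makes sense at every point. -/
lemma summable_bra_pot (h : IsFourierEP ε T s M u) (t : ℝ) :
    Summable fun k => bra k ^ 2 * ‖potCoeff (u t) k‖ := by
  refine Summable.of_nonneg_of_le (fun k => mul_nonneg (sq_nonneg _) (norm_nonneg _)) (fun k => ?_)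
    (h.summable_bra t none)
  have h1 := bra_mul_norm_inv_le k
  have h2 := bra_pos k
  rw [potCoeff, norm_mul]
  calc _ = bra k * ‖-((2 * Real.pi * freqNorm k : ℝ) : ℂ)⁻¹‖ * (bra k * ‖u t k none‖) := by ring
    _ ≤ 1 * (bra k * ‖u t k none‖) := mul_le_mul_of_nonneg_right h1 (by positivity)
    _ = _ := one_mul _

lemma summable_bra_pot' (h : IsFourierEP ε T s M u) (t : ℝ) :
    Summable fun k => bra k * ‖potCoeff (u t) k‖ := by
  refine Summable.of_nonneg_of_le (fun k => mul_nonneg (bra_pos k).le (norm_nonneg _)) (fun k => ?_)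
    (h.summable_bra_pot t)
  exact mul_le_mul_of_nonneg_right (by nlinarith [one_le_bra k]) (norm_nonneg _)

lemma isC1Slab_vel (h : IsFourierEP ε T s M u) (i : Fin d) :
    IsC1Slab T fun t x => velField (u t) x i :=
  isC1Slab_rsyn T (c := fun t k => u t k (some i)) (fun t => h.summable_bra t _) (h.l1Cont _)
    (h.l1Cont_dsym _)

lemma l1Cont_grad_pot (h : IsFourierEP ε T s M u) (i : Fin d) :
    L1Cont fun t k => dsym i k * potCoeff (u t) k := by
  simp only [dsym_mul_potCoeff]
  refine (h.l1Cont none).mul_bounded (C := 1) fun k => ?_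
  simpa using abs_dir_le_one k i

lemma isC1Slab_pot (h : IsFourierEP ε T s M u) : IsC1Slab T fun t => rsyn (potCoeff (u t)) :=
  isC1Slab_rsyn T h.summable_bra_pot'
    ((h.l1Cont none).mul_bounded (p := fun k => -((2 * Real.pi * freqNorm k : ℝ) : ℂ)⁻¹)
      norm_inv_two_pi_freqNorm_le) h.l1Cont_grad_pot

lemma l1Cont_quad (h : IsFourierEP ε T s M u) (i : Fin d) : L1Cont fun t k =>
    (2 * Real.pi : ℝ) * bilin (some i) (fun k j => u t k (some j)) (fun k => u t k (some i)) k := by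
  have e : ∀ t k, (2 * Real.pi : ℝ) * bilin (some i) (fun k j => u t k (some j))
      (fun k => u t k (some i)) k =
      -1 * ∑ j, conv (fun k => u t k (some j)) (fun k => dsym j k * u t k (some i)) k := by
    intro t k
    rw [bilin_some_eq (fun j => (h.l1Cont (some j)).1 t) (fun j => (h.l1Cont_dsym (some i) j).1 t)]
    ring
  simp only [e]
  exact (L1Cont.sum _ fun j _ => (h.l1Cont (some j)).convolution
    (h.l1Cont_dsym (some i) j)).mul_bounded (p := fun _ => -1) (C := 1) (by simp)

lemma syn_quad (h : IsFourierEP ε T s M u) (i : Fin d) (t : ℝ) (x : Torus d) :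
    syn (fun k => (2 * Real.pi : ℝ) * bilin (some i) (fun k j => u t k (some j))
      (fun k => u t k (some i)) k) x =
      ((-∑ j, velField (u t) x j * pd j (fun y => velField (u t) y i) x : ℝ) : ℂ) := by
  have hV := fun j => (h.l1Cont (some j)).1 t
  have hD := fun j => (h.l1Cont_dsym (some i) j).1 t
  have e : (fun k => (2 * Real.pi : ℝ) * bilin (some i) (fun k j => u t k (some j))
      (fun k => u t k (some i)) k) = fun k =>
      -1 * ∑ j, conv (fun k => u t k (some j)) (fun k => dsym j k * u t k (some i)) k := by
    ext k
    rw [bilin_some_eq hV hD]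
    ring
  rw [e, syn_const_mul, syn_sum _ fun j _ => summable_norm_conv (hV j) (hD j)]
  push_cast
  rw [neg_one_mul]
  congr 1
  refine Finset.sum_congr rfl fun j _ => ?_
  rw [← syn_mul_syn (hV j) (hD j), velField, ofReal_rsyn (h.real t _)]
  congr 1
  have : (fun y => velField (u t) y i) = rsyn fun k => u t k (some i) := rfl
  rw [this, pd_rsyn (h.summable_bra t _), ofReal_rsyn (isRealSeq_dsym (h.real t _) j)]

lemma momentum (h : IsFourierEP ε T s M u) {t : ℝ} (ht : t ∈ Icc 0 T) (x : Torus d) (i : Fin d) :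
    HasDerivWithinAt (fun τ => velField (u τ) x i)
      (-(∑ j, velField (u t) x j * pd j (fun y => velField (u t) y i) x) +
        pd i (rsyn (potCoeff (u t))) x / ε) (Icc 0 T) t := by
  have hlin : L1Cont fun t k => -Complex.I * (ε⁻¹ : ℝ) * linTerm (u t) k (some i) := by
    have := (h.l1Cont none).mul_bounded (p := fun k => -Complex.I * (ε⁻¹ : ℝ) * (dir k i : ℝ))
      (C := |ε⁻¹|) fun k => by
        simp only [norm_mul, norm_neg, Complex.norm_I, one_mul, Complex.norm_real, Real.norm_eq_abs]
        exact mul_le_of_le_one_right (abs_nonneg _) (abs_dir_le_one k i)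
    simpa only [linTerm, mul_assoc] using this
  have hfield : L1Cont fun t k => epField ε (u t) k (some i) := hlin.add (h.l1Cont_quad i)
  -- The point `x` is fixed: multiplying by plane waves preserves the `ℓ¹` continuity of the field,
  -- and the integrated coefficient equations can be summed.
  have hder := hasDerivWithinAt_tsum_of_integral (T := T)
    (c := fun t k => UnitAddTorus.mFourier k x * u t k (some i))
    (h := fun t k => UnitAddTorus.mFourier k x * epField ε (u t) k (some i))
    (hfield.mul_bounded (C := 1) fun k => (norm_mFourier_apply k x).le)
    (fun t _ => ((h.l1Cont (some i)).mul_bounded (C := 1)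
      fun k => (norm_mFourier_apply k x).le).1 t)
    (fun t ht k => by
      rw [h.eqn t ht k (some i), mul_add, intervalIntegral.integral_const_mul]) ht
  have hre := Complex.reCLM.hasFDerivAt.comp_hasDerivWithinAt t hder
  have e1 : ∑' k, UnitAddTorus.mFourier k x * epField ε (u t) k (some i) =
      ((-(∑ j, velField (u t) x j * pd j (fun y => velField (u t) y i) x) +
        pd i (rsyn (potCoeff (u t))) x / ε : ℝ) : ℂ) := by
    have e2 : ∑' k, UnitAddTorus.mFourier k x * epField ε (u t) k (some i) =
        syn (fun k => -Complex.I * (ε⁻¹ : ℝ) * linTerm (u t) k (some i) +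
          (2 * Real.pi : ℝ) * bilin (some i) (fun k j => u t k (some j))
            (fun k => u t k (some i)) k) x :=
      tsum_congr fun k => mul_comm _ _
    rw [e2, syn_add (hlin.1 t) ((h.l1Cont_quad i).1 t), h.syn_quad i t x, Complex.ofReal_add,
      add_comm]
    congr 1
    have e3 : (fun k => -Complex.I * (ε⁻¹ : ℝ) * linTerm (u t) k (some i)) =
        fun k => ((ε⁻¹ : ℝ) : ℂ) * (dsym i k * potCoeff (u t) k) := by
      ext k
      rw [dsym_mul_potCoeff, linTerm]
      push_cast
      ring
    beta_reduce
    rw [e3, syn_const_mul, pd_rsyn (h.summable_bra_pot' t), div_eq_inv_mul, Complex.ofReal_mul,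
      ofReal_rsyn (isRealSeq_dsym (isRealSeq_potCoeff (h.real t none)) i)]
  rw [e1] at hre
  simp only [Complex.reCLM_apply, Complex.ofReal_re] at hre
  refine hre.congr_of_mem (fun τ _ => ?_) ht
  simp only [Function.comp, Complex.reCLM_apply, velField, rsyn, syn]
  congr 1
  exact tsum_congr fun k => mul_comm _ _

lemma poisson (h : IsFourierEP ε T s M u) (t : ℝ) (x : Torus d) :
    ε * ∑ i, pd i (pd i (rsyn (potCoeff (u t)))) x = density ε (u t) x - 1 := by
  have h1 : ∀ i, pd i (rsyn (potCoeff (u t))) = rsyn fun k => dsym i k * potCoeff (u t) k :=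
    fun i => funext fun y => pd_rsyn (h.summable_bra_pot' t) i y
  have h2 : ∀ i, Summable fun k => bra k * ‖dsym i k * potCoeff (u t) k‖ := fun i => by
    simpa using summable_bra_dsym (n := 1) (h.summable_bra_pot t) i
  have h3 : ∀ i, Summable fun k => ‖dsym i k * (dsym i k * potCoeff (u t) k)‖ := fun i => by
    simpa using summable_bra_dsym (n := 0) (c := fun k => dsym i k * potCoeff (u t) k)
      (by simpa using h2 i) i
  rw [density, add_sub_cancel_left]
  congr 1
  simp only [h1]
  rw [Finset.sum_congr rfl fun i _ => pd_rsyn (h2 i) i x]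
  simp only [rsyn]
  rw [← Complex.re_sum, ← syn_sum _ fun i _ => h3 i]
  congr 2
  ext k
  exact sum_dsym_dsym_potCoeff (u t) k

end IsFourierEP

lemma IsTest.contDiff_one {ψ : Torus d → ℝ} (hψ : IsTest ψ) : ContDiff ℝ 1 (perLift ψ) :=
  ContDiff.of_le hψ (by exact_mod_cast le_top)

lemma norm_fcoeff_le {f : Torus d → ℝ} (hf : Continuous f) :
    ∃ C, ∀ k, ‖fcoeff f k‖ ≤ C := by
  obtain ⟨C, hC⟩ := isCompact_univ.exists_bound_of_continuousOn hf.continuousOn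
  refine ⟨C, fun k => ?_⟩
  rw [fcoeff_eq_integral]
  have := norm_integral_le_of_norm_le_const (μ := torusMeasure d) (C := C)
    (f := fun x => UnitAddTorus.mFourier (-k) x * (f x : ℂ)) (Eventually.of_forall fun x => by
      rw [norm_mul, norm_mFourier_apply, one_mul, Complex.norm_real]
      exact hC x (mem_univ x))
  simpa using this

lemma dsym_neg (j : Fin d) (k : Freq d) : dsym j (-k) = -dsym j k := by simp [dsym]

namespace IsFourierEP

variable {ε T s M : ℝ} {u : ℝ → Freq d → Option (Fin d) → ℂ}

/-- The Fourier coefficients of `ρ v_j / ε`. -/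
def fluxCoeff (ε : ℝ) (u : Freq d → Option (Fin d) → ℂ) (j : Fin d) (k : Freq d) : ℂ :=
  (ε⁻¹ : ℝ) * u k (some j) + conv (fun k => u k (some j)) (sigCoeff u) k

lemma l1Cont_flux (h : IsFourierEP ε T s M u) (j : Fin d) : L1Cont fun t => fluxCoeff ε (u t) j :=
  ((h.l1Cont (some j)).mul_bounded (p := fun _ => ((ε⁻¹ : ℝ) : ℂ)) (C := ‖((ε⁻¹ : ℝ) : ℂ)‖)
    fun _ => le_rfl).add ((h.l1Cont (some j)).convolution h.l1Cont_sig)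

/-- Multiplication by `2π|k|` undoes the symmetrization and returns the equation of `σ` to
divergence form, with flux `ρv/ε`. At `k = 0` both sides vanish, which is conservation of mass. -/
lemma freqNorm_mul_epField (h : IsFourierEP ε T s M u) (t : ℝ) (k : Freq d) :
    (2 * Real.pi * freqNorm k : ℝ) * epField ε (u t) k none =
      -∑ j, dsym j k * fluxCoeff ε (u t) j k := by
  rw [epField, bilin_none_eq (fun j => (h.l1Cont (some j)).1 t) (h.l1Cont_sig.1 t), linTerm,
    Finset.mul_sum, ← Finset.sum_add_distrib, Finset.mul_sum, ← Finset.sum_neg_distrib]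
  refine Finset.sum_congr rfl fun j _ => ?_
  have := freqNorm_mul_dir k j
  have h2 : (freqNorm k : ℂ) * dir k j = k j := by exact_mod_cast this
  simp only [fluxCoeff, dsym]
  push_cast
  linear_combination (-Complex.I * (2 * Real.pi) * ((ε : ℂ)⁻¹ * u t k (some j) +
    conv (fun k => u t k (some j)) (sigCoeff (u t)) k)) * h2

lemma syn_flux (h : IsFourierEP ε T s M u) (hε : ε ≠ 0) (t : ℝ) (j : Fin d) (x : Torus d) :
    syn (fluxCoeff ε (u t) j) x = ((ε⁻¹ * (density ε (u t) x * velField (u t) x j) : ℝ) : ℂ) := by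
  have h1 := (h.l1Cont (some j)).1 t
  have h2 := h.l1Cont_sig.1 t
  have hs := syn_add (c := fun k => ((ε⁻¹ : ℝ) : ℂ) * u t k (some j))
    (b := conv (fun k => u t k (some j)) (sigCoeff (u t)))
    (by simpa using h1.mul_left ‖((ε⁻¹ : ℝ) : ℂ)‖) (summable_norm_conv h1 h2) x
  rw [syn_const_mul, ← syn_mul_syn h1 h2, ← ofReal_rsyn (h.real t (some j)),
    ← ofReal_rsyn (isRealSeq_sigCoeff (h.real t none))] at hs
  refine hs.trans ?_
  rw [density, velField]
  have : (ε : ℂ) ≠ 0 := by exact_mod_cast hε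
  push_cast
  field_simp

lemma continuity (h : IsFourierEP ε T s M u) (hε : ε ≠ 0) {ψ : Torus d → ℝ} (hψ : IsTest ψ)
    {t : ℝ} (ht : t ∈ Icc 0 T) :
    HasDerivWithinAt (fun τ => ∫ x, density ε (u τ) x * ψ x ∂torusMeasure d)
      (∫ x, density ε (u t) x * ∑ j, velField (u t) x j * pd j ψ x ∂torusMeasure d)
      (Icc 0 T) t := by
  have hψ1 := hψ.contDiff_one
  have hψc := continuous_of_contDiff_perLift hψ1
  obtain ⟨C0, hC0⟩ := norm_fcoeff_le hψc
  choose C hC using fun j => norm_fcoeff_le (continuous_pd hψ1 j)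
  -- By Parseval the pairing with `ψ` is a series in the coefficients. The symbol of the divergence
  -- moves to the coefficients of `ψ`, so no derivative of the density occurs.
  have hder := hasDerivWithinAt_tsum_of_integral (T := T)
    (c := fun t k => fcoeff ψ (-k) * sigCoeff (u t) k)
    (h := fun t k => ∑ j, fcoeff (pd j ψ) (-k) * fluxCoeff ε (u t) j k)
    (L1Cont.sum _ fun j _ => (h.l1Cont_flux j).mul_bounded (p := fun k => fcoeff (pd j ψ) (-k))
      fun k => hC j (-k))
    (fun t _ => (h.l1Cont_sig.mul_bounded (p := fun k => fcoeff ψ (-k)) fun k => hC0 (-k)).1 t)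
    (fun t ht k => by
      have e : ∀ τ, ∑ j, fcoeff (pd j ψ) (-k) * fluxCoeff ε (u τ) j k =
          fcoeff ψ (-k) * (2 * Real.pi * freqNorm k : ℝ) * epField ε (u τ) k none := by
        intro τ
        rw [mul_assoc, h.freqNorm_mul_epField, ← Finset.sum_neg_distrib, Finset.mul_sum]
        refine Finset.sum_congr rfl fun j _ => ?_
        rw [fcoeff_pd hψ1, dsym_neg]
        ring
      simp only [e]
      rw [intervalIntegral.integral_const_mul, sigCoeff, h.eqn t ht k none, sigCoeff]
      ring) ht
  have hcs := fun t => continuous_rsyn (h.l1Cont_sig.1 t)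
  have hcv := fun t j => continuous_rsyn ((h.l1Cont (some j)).1 t)
  have e1 : ∀ τ, ∫ x, density ε (u τ) x * ψ x ∂torusMeasure d =
      ∫ x, ψ x ∂torusMeasure d + ε * (∑' k, fcoeff ψ (-k) * sigCoeff (u τ) k).re := by
    intro τ
    have h1 := integral_rsyn_mul (h.l1Cont_sig.1 τ) (isRealSeq_sigCoeff (h.real τ none)) hψc
    simp only [mul_comm (fcoeff ψ _)]
    rw [← h1, Complex.ofReal_re, ← integral_const_mul,
      ← integral_add (integrable_of_continuous hψc)
        (integrable_of_continuous (by have := hcs τ; fun_prop))]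
    refine integral_congr_ae (Eventually.of_forall fun x => ?_)
    simp only [density]
    ring
  have e2 : ∑' k, ∑ j, fcoeff (pd j ψ) (-k) * fluxCoeff ε (u t) j k =
      ((ε⁻¹ * ∫ x, density ε (u t) x * ∑ j, velField (u t) x j * pd j ψ x ∂torusMeasure d : ℝ) :
        ℂ) := by
    have hcp := continuous_pd hψ1
    rw [Summable.tsum_finsetSum fun j _ => ((h.l1Cont_flux j).mul_bounded
      (p := fun k => fcoeff (pd j ψ) (-k)) fun k => hC j (-k)).1 t |>.of_norm]
    have h1 : ∀ j, ∑' k, fcoeff (pd j ψ) (-k) * fluxCoeff ε (u t) j k =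
        ((∫ x, ε⁻¹ * (density ε (u t) x * velField (u t) x j) * pd j ψ x ∂torusMeasure d : ℝ) :
          ℂ) := by
      intro j
      have h2 := integral_syn_mul ((h.l1Cont_flux j).1 t) (ψ := fun x => (pd j ψ x : ℂ))
        (by have := hcp j; fun_prop)
      simp only [h.syn_flux hε] at h2
      rw [← integral_complex_ofReal]
      push_cast at h2 ⊢
      rw [h2]
      exact tsum_congr fun k => by rw [fcoeff_eq_integral, neg_neg, mul_comm]
    rw [Finset.sum_congr rfl fun j _ => h1 j, ← Complex.ofReal_sum, ← integral_finsetSum,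
      ← integral_const_mul]
    · congr 1
      refine integral_congr_ae (Eventually.of_forall fun x => ?_)
      simp only [Finset.mul_sum]
      exact Finset.sum_congr rfl fun j _ => by ring
    · intro j _
      apply integrable_of_continuous
      have h1 := hcs t
      have h2 := hcv t j
      have h3 := hcp j
      simp only [density, velField]
      fun_prop
  have hre := Complex.reCLM.hasFDerivAt.comp_hasDerivWithinAt t hder
  rw [e2] at hre
  have := (hre.const_mul ε).const_add (∫ x, ψ x ∂torusMeasure d)
  simp only [Complex.reCLM_apply, Complex.ofReal_re] at this
  rw [mul_inv_cancel_left₀ hε] at this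
  exact this.congr_of_mem (fun τ _ => e1 τ) ht

/-- A solution in Fourier variables is a solution of the Euler–Poisson system. -/
theorem isEulerPoissonSolution (h : IsFourierEP ε T s M u) (hε : ε ≠ 0) {ρ₀ : Torus d → ℝ}
    {v₀ : Torus d → Fin d → ℝ} (hρ : ∀ᵐ x ∂torusMeasure d, density ε (u 0) x = ρ₀ x)
    (hv : ∀ᵐ x ∂torusMeasure d, velField (u 0) x = v₀ x) :
    IsEulerPoissonSolution ε T ρ₀ v₀ (fun t => density ε (u t)) (fun t => velField (u t)) where
  density_continuousOn := by
    have := h.l1Cont_sig.continuous_rsyn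
    simp only [density]
    exact (continuous_const.add (continuous_const.mul this)).continuousOn
  velocity_regular := h.isC1Slab_vel
  density_init := hρ
  velocity_init := hv
  continuity_eq ψ hψ t ht := h.continuity hε hψ ht
  momentum_poisson := ⟨fun t => rsyn (potCoeff (u t)), h.isC1Slab_pot,
    fun t _ => contDiff_perLift_rsyn 2 (h.summable_bra_pot t),
    fun t ht x i => h.momentum ht x i, fun t _ x => h.poisson t x⟩

lemma fcoeff_vel (h : IsFourierEP ε T s M u) (t : ℝ) (i : Fin d) (k : Freq d) :
    fcoeff (fun x => velField (u t) x i) k = u t k (some i) :=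
  fcoeff_rsyn ((h.l1Cont (some i)).1 t) (h.real t _) k

lemma hsNormVec_vel_le (h : IsFourierEP ε T s M u) (t : ℝ) :
    hsNormVec s (velField (u t)) ≤ ENNReal.ofReal √(d * M) := by
  refine hsNormVec_le_of_hsBound (h.bound t).nonneg fun i => ?_
  simp only [HsBound, h.fcoeff_vel]
  exact (h.bound t).component (some i)

lemma hsNorm_density_le (h : IsFourierEP ε T s M u) (hε : ε ≠ 0) (t : ℝ) :
    hsNorm (s - 1) (fun x => ε⁻¹ * (density ε (u t) x - 1)) ≤
      ENNReal.ofReal √((2 * Real.pi) ^ 2 * M) := by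
  have e : (fun x => ε⁻¹ * (density ε (u t) x - 1)) = rsyn (sigCoeff (u t)) := by
    ext x; simp [density, hε]
  rw [e]
  apply hsNorm_le_of_hsBound
  rw [funext (fcoeff_rsyn (h.l1Cont_sig.1 t) (isRealSeq_sigCoeff (h.real t none)))]
  refine ((h.bound t).component none).of_le (by positivity) fun k => ?_
  beta_reduce
  rw [sigCoeff, norm_mul, mul_pow]
  have h1 := pow_le_pow_left₀ (norm_nonneg _) (norm_two_pi_freqNorm_le k) 2
  rw [mul_pow, jap_rpow_half, bra_sq] at h1
  have h2 : jap k ^ (s - 1) * jap k = jap k ^ s := by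
    rw [← Real.rpow_add_one (jap_pos k).ne']; congr 1; ring
  calc _ ≤ jap k ^ (s - 1) * ((2 * Real.pi) ^ 2 * jap k * ‖u t k none‖ ^ 2) :=
        mul_le_mul_of_nonneg_left (mul_le_mul_of_nonneg_right h1 (sq_nonneg _))
          (jap_rpow_nonneg _ _)
    _ = _ := by rw [← h2]; ring

end IsFourierEP

/-! ### Integrals over the torus and nonnegativity of the density -/

lemma continuous_integral_torus {g : ℝ → Torus d → ℝ} (hg : Continuous (Function.uncurry g)) :
    Continuous fun t => ∫ x, g t x ∂torusMeasure d :=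
  continuous_parametric_integral_of_continuous hg isCompact_univ |> fun h => by simpa using h

/-- Integration over the torus of a pointwise time derivative. -/
lemma integral_eq_add_integral_deriv {T : ℝ} {f g : ℝ → Torus d → ℝ}
    (hg : Continuous (Function.uncurry g)) (hfc : ∀ t ∈ Icc 0 T, Continuous (f t))
    (hf : ∀ t ∈ Icc 0 T, ∀ x, HasDerivWithinAt (fun τ => f τ x) (g t x) (Icc 0 T) t)
    {t : ℝ} (ht : t ∈ Icc 0 T) :
    ∫ x, f t x ∂torusMeasure d =
      ∫ x, f 0 x ∂torusMeasure d + ∫ τ in (0)..t, ∫ x, g τ x ∂torusMeasure d := by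
  have h0m : (0 : ℝ) ∈ Icc 0 T := ⟨le_rfl, ht.1.trans ht.2⟩
  have hsub : Icc 0 t ⊆ Icc 0 T := Icc_subset_Icc le_rfl ht.2
  have h1 : ∀ x, ∫ τ in (0)..t, g τ x = f t x - f 0 x := fun x =>
    intervalIntegral.integral_eq_sub_of_hasDerivAt_of_le ht.1
      (fun τ hτ => (hf τ (hsub hτ) x).continuousWithinAt.mono hsub)
      (fun τ hτ => (hf τ (hsub (Ioo_subset_Icc_self hτ)) x).hasDerivAt
        (Icc_mem_nhds hτ.1 (hτ.2.trans_le ht.2)))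
      ((hg.comp (Continuous.prodMk_left x)).intervalIntegrable _ _)
  have h2 : ∫ x, (∫ τ in (0)..t, g τ x) ∂torusMeasure d =
      ∫ τ in (0)..t, ∫ x, g τ x ∂torusMeasure d := by
    rw [intervalIntegral.integral_of_le ht.1]
    simp only [intervalIntegral.integral_of_le ht.1]
    refine integral_integral_swap ?_
    have : Integrable (Function.uncurry fun x τ => g τ x)
        ((torusMeasure d).prod (volume.restrict (Icc 0 t))) := by
      have hc : Continuous (Function.uncurry fun (x : Torus d) (τ : ℝ) => g τ x) :=
        hg.comp continuous_swap
      obtain ⟨C, hC⟩ := (isCompact_univ.prod isCompact_Icc).exists_bound_of_continuousOn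
        (s := (univ : Set (Torus d)) ×ˢ Icc 0 t) hc.continuousOn
      refine Integrable.mono' (integrable_const C) hc.aestronglyMeasurable ?_
      have hm : (torusMeasure d).prod (volume.restrict (Icc 0 t)) =
          ((torusMeasure d).prod volume).restrict (univ ×ˢ Icc 0 t) := by
        rw [← Measure.prod_restrict, Measure.restrict_univ]
      rw [hm]
      refine (ae_restrict_mem (MeasurableSet.univ.prod measurableSet_Icc)).mono fun z hz => hC z hz
    exact this.mono_measure (Measure.prod_mono le_rfl
      (Measure.restrict_mono Ioc_subset_Icc_self le_rfl))
  rw [← h2]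
  simp only [h1]
  rw [integral_sub (integrable_of_continuous (hfc t ht)) (integrable_of_continuous (hfc 0 h0m))]
  ring

lemma hasDerivAt_min_zero_pow (n : ℕ) (z : ℝ) :
    HasDerivAt (fun z : ℝ => min z 0 ^ (n + 2)) ((n + 2) * min z 0 ^ (n + 1)) z := by
  rcases lt_trichotomy z 0 with h | h | h
  · rw [min_eq_left h.le]
    have h1 := hasDerivAt_pow (n + 2) z
    refine HasDerivAt.congr_of_eventuallyEq (by simpa using h1) ?_
    filter_upwards [Iio_mem_nhds h] with y hy
    rw [min_eq_left (le_of_lt hy)]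
  · subst h
    simp only [min_self, ne_eq, Nat.add_eq_zero_iff, one_ne_zero, and_false, not_false_eq_true,
      zero_pow, mul_zero]
    rw [hasDerivAt_iff_isLittleO_nhds_zero]
    have h2 : (fun h : ℝ => min h 0 ^ (n + 2)) =O[𝓝 0] fun h : ℝ => h ^ (n + 2) := by
      refine Asymptotics.IsBigO.of_bound 1 (Eventually.of_forall fun h => ?_)
      rw [one_mul, norm_pow, norm_pow]
      refine pow_le_pow_left₀ (norm_nonneg _) ?_ _
      rcases le_total h 0 with h' | h'
      · rw [min_eq_left h']
      · rw [min_eq_right h']; simp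
    have h3 : (fun h : ℝ => h ^ (n + 2)) =o[𝓝 0] fun h : ℝ => h := by
      simpa using Asymptotics.isLittleO_pow_pow (𝕜 := ℝ) (show 1 < n + 2 by omega)
    simpa using h2.trans_isLittleO h3
  · rw [min_eq_right h.le]
    simp only [ne_eq, Nat.add_eq_zero_iff, one_ne_zero, and_false, not_false_eq_true,
      zero_pow, mul_zero]
    refine (hasDerivAt_const z (0 : ℝ)).congr_of_eventuallyEq ?_
    filter_upwards [Ioi_mem_nhds h] with y hy
    rw [min_eq_right (le_of_lt hy)]; simp

lemma contDiff_min_zero_pow (n : ℕ) : ContDiff ℝ 1 fun z : ℝ => min z 0 ^ (n + 2) := by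
  rw [contDiff_one_iff_deriv]
  refine ⟨fun z => (hasDerivAt_min_zero_pow n z).differentiableAt, ?_⟩
  rw [funext fun z => (hasDerivAt_min_zero_pow n z).deriv]
  fun_prop

lemma pd_comp {f : Torus d → ℝ} (hf : ContDiff ℝ 1 (perLift f)) {G : ℝ → ℝ} {G' : ℝ} (i : Fin d)
    (x : Torus d) (hG : HasDerivAt G G' (f x)) : pd i (fun x => G (f x)) x = G' * pd i f x := by
  have h := hasDerivAt_pd_zero (hf.differentiable one_ne_zero) x i
  have h2 : HasDerivAt G G' (f (x + Pi.single i ((0 : ℝ) : UnitAddCircle))) := by simpa using hG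
  exact (h2.comp (0 : ℝ) h).deriv

/-- Truncation of a sequence of coefficients to a box of frequencies. -/
def trunc (N : ℕ) (c : Freq d → ℂ) (k : Freq d) : ℂ := (if k ∈ freqBox d N then 1 else 0) * c k

lemma norm_trunc_le (N : ℕ) (c : Freq d → ℂ) (k : Freq d) : ‖trunc N c k‖ ≤ ‖c k‖ := by
  unfold trunc; split_ifs <;> simp

lemma summable_trunc (N : ℕ) {c : Freq d → ℂ} (hc : Summable fun k => ‖c k‖) :
    Summable fun k => ‖trunc N c k‖ :=
  Summable.of_nonneg_of_le (fun _ => norm_nonneg _) (norm_trunc_le N c) hc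

lemma isRealSeq_trunc (N : ℕ) {c : Freq d → ℂ} (hc : IsRealSeq c) : IsRealSeq (trunc N c) := by
  intro k
  have : -k ∈ freqBox d N ↔ k ∈ freqBox d N :=
    ⟨fun h => by simpa using neg_mem_freqBox _ h, neg_mem_freqBox k⟩
  simp only [trunc, this, hc k]
  split_ifs <;> simp

lemma summable_bra_trunc (N n : ℕ) (c : Freq d → ℂ) :
    Summable fun k => bra k ^ n * ‖trunc N c k‖ :=
  summable_of_ne_finset_zero (s := freqBox d N) fun k hk => by simp [trunc, hk]

lemma L1Cont.trunc {c : ℝ → Freq d → ℂ} (hc : L1Cont c) (N : ℕ) : L1Cont fun t => trunc N (c t) :=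
  hc.mul_bounded (C := 1) fun k => by split_ifs <;> simp

lemma L1Cont.dsym_trunc {c : ℝ → Freq d → ℂ} (hc : L1Cont c) (N : ℕ) (i : Fin d) :
    L1Cont fun t k => dsym i k * _root_.trunc N (c t) k := by
  have := hc.mul_bounded (p := fun k => dsym i k * (if k ∈ freqBox d N then 1 else 0))
    (C := ∑ k ∈ freqBox d N, ‖dsym i k‖) fun k => by
      split_ifs with h
      · rw [mul_one]
        exact Finset.single_le_sum (f := fun k => ‖dsym i k‖) (fun _ _ => norm_nonneg _) h
      · simpa using Finset.sum_nonneg fun k _ => norm_nonneg (dsym i k)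
  simpa only [_root_.trunc, mul_assoc] using this

lemma tendsto_trunc {c : Freq d → ℂ} (hc : Summable fun k => ‖c k‖) :
    Tendsto (fun N => ∑' k, ‖trunc N c k - c k‖) atTop (𝓝 0) := by
  have := tendsto_tsum_of_dominated_convergence (𝓕 := atTop)
    (f := fun N k => ‖trunc N c k - c k‖) (g := fun _ => (0 : ℝ)) (bound := fun k => ‖c k‖) hc
    (fun k => tendsto_const_nhds.congr' ?_) (Eventually.of_forall fun N k => ?_)
  · simpa using this
  · filter_upwards [eventually_mem_freqBox k] with N hN
    simp [trunc, hN]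
  · rw [norm_norm, trunc]
    split_ifs <;> simp

lemma norm_syn_trunc_sub_le (N : ℕ) {c : Freq d → ℂ} (hc : Summable fun k => ‖c k‖)
    (x : Torus d) : ‖syn (trunc N c) x - syn c x‖ ≤ ∑' k, ‖trunc N c k - c k‖ := by
  rw [← syn_sub (summable_trunc N hc) hc]
  exact norm_syn_le ((summable_trunc N hc).of_norm.sub hc.of_norm).norm x

lemma abs_rsyn_trunc_sub_le (N : ℕ) {c : Freq d → ℂ} (hc : Summable fun k => ‖c k‖)
    (x : Torus d) : |rsyn (trunc N c) x - rsyn c x| ≤ ∑' k, ‖trunc N c k - c k‖ := by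
  rw [rsyn, rsyn, ← Complex.sub_re]
  exact (Complex.abs_re_le_norm _).trans (norm_syn_trunc_sub_le N hc x)

lemma abs_rsyn_le {c : Freq d → ℂ} (hc : Summable fun k => ‖c k‖) (x : Torus d) :
    |rsyn c x| ≤ ∑' k, ‖c k‖ := (Complex.abs_re_le_norm _).trans (norm_syn_le hc x)

lemma abs_rsyn_trunc_le (N : ℕ) {c : Freq d → ℂ} (hc : Summable fun k => ‖c k‖) (x : Torus d) :
    |rsyn (trunc N c) x| ≤ ∑' k, ‖c k‖ :=
  (abs_rsyn_le (summable_trunc N hc) x).trans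
    ((summable_trunc N hc).tsum_le_tsum (norm_trunc_le N c) hc)

/-- Parseval's identity gives an `L²` bound. -/
lemma integral_rsyn_sq_le {c : Freq d → ℂ} (hc : Summable fun k => ‖c k‖) (hr : IsRealSeq c)
    {M : ℝ} (hM : HsBound 0 M c) : ∫ x, rsyn c x ^ 2 ∂torusMeasure d ≤ M := by
  have h := integral_rsyn_mul hc hr (continuous_rsyn hc)
  simp only [fcoeff_rsyn hc hr] at h
  have hs : Summable fun k => ‖c k‖ ^ 2 :=
    summable_of_sum_le (fun _ => sq_nonneg _) (c := M) fun F => by simpa using hM F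
  have h2 : ∀ k, c k * c (-k) = ((‖c k‖ ^ 2 : ℝ) : ℂ) := fun k => by
    rw [hr k, Complex.mul_conj, Complex.normSq_eq_norm_sq]
  simp only [h2, ← Complex.ofReal_tsum] at h
  have h3 : ∫ x, rsyn c x * rsyn c x ∂torusMeasure d = ∑' k, ‖c k‖ ^ 2 := by exact_mod_cast h
  simp only [pow_two (rsyn c _)]
  rw [h3]
  exact hs.tsum_le_of_sum_le fun F => by simpa using hM F

/-- Grönwall's lemma in integral form, with zero initial value. -/
lemma eq_zero_of_le_mul_integral {T c : ℝ} {y : ℝ → ℝ} (hc : Continuous y)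
    (hy : ∀ t ∈ Icc 0 T, 0 ≤ y t) (h : ∀ t ∈ Icc 0 T, y t ≤ c * ∫ τ in (0)..t, y τ) {t : ℝ}
    (ht : t ∈ Icc 0 T) : y t = 0 := by
  have hder : ∀ t, HasDerivAt (fun t => Real.exp (-c * t) * ∫ τ in (0)..t, y τ)
      (Real.exp (-c * t) * (-c) * (∫ τ in (0)..t, y τ) + Real.exp (-c * t) * y t) t := fun t => by
    have h1 : HasDerivAt (fun t => Real.exp (-c * t)) (Real.exp (-c * t) * (-c)) t := by
      simpa using ((hasDerivAt_id t).const_mul (-c)).exp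
    exact h1.mul (intervalIntegral.integral_hasDerivAt_right (hc.intervalIntegrable _ _)
      (hc.stronglyMeasurableAtFilter _ _) hc.continuousAt)
  have hanti : AntitoneOn (fun t => Real.exp (-c * t) * ∫ τ in (0)..t, y τ) (Icc 0 T) := by
    refine antitoneOn_of_deriv_nonpos (convex_Icc 0 T)
      (fun t _ => (hder t).continuousAt.continuousWithinAt)
      (fun t _ => (hder t).differentiableAt.differentiableWithinAt) fun t ht => ?_
    rw [interior_Icc] at ht
    rw [(hder t).deriv]
    have := h t (Ioo_subset_Icc_self ht)
    have := Real.exp_pos (-c * t)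
    nlinarith
  have h1 := hanti ⟨le_rfl, ht.1.trans ht.2⟩ ht ht.1
  simp only [intervalIntegral.integral_same, mul_zero] at h1
  have h2 : ∫ τ in (0)..t, y τ ≤ 0 := by
    by_contra hne
    have := mul_pos (Real.exp_pos (-c * t)) (not_le.1 hne)
    linarith
  have h3 : 0 ≤ ∫ τ in (0)..t, y τ :=
    intervalIntegral.integral_nonneg ht.1 fun τ hτ => hy τ ⟨hτ.1, hτ.2.trans ht.2⟩
  have h4 := h t ht
  rw [le_antisymm h2 h3, mul_zero] at h4
  exact le_antisymm h4 (hy t ht)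

/-- The renormalized form of `∇·(r v)` for the function `(min r 0)^4`. -/
lemma integral_min_pow_mul_pd {r v F : Torus d → ℝ} (hr : ContDiff ℝ 1 (perLift r))
    (hv : ContDiff ℝ 1 (perLift v)) (hF : ContDiff ℝ 1 (perLift F)) (j : Fin d) :
    ∫ x, 4 * min (r x) 0 ^ 3 * pd j F x ∂torusMeasure d =
      3 * ∫ x, min (r x) 0 ^ 4 * pd j v x ∂torusMeasure d -
        ∫ x, 12 * min (r x) 0 ^ 2 * pd j r x * (F x - r x * v x) ∂torusMeasure d := by
  have hrc := continuous_of_contDiff_perLift hr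
  have hvc := continuous_of_contDiff_perLift hv
  have hFc := continuous_of_contDiff_perLift hF
  have hrp := continuous_pd hr j
  have h3 : ContDiff ℝ 1 (perLift fun x => 4 * min (r x) 0 ^ 3) :=
    contDiff_const.mul ((contDiff_min_zero_pow 1).comp hr)
  have h4 : ContDiff ℝ 1 (perLift fun x => min (r x) 0 ^ 4) := (contDiff_min_zero_pow 2).comp hr
  have p3 : ∀ x, pd j (fun x => 4 * min (r x) 0 ^ 3) x = 12 * min (r x) 0 ^ 2 * pd j r x := by
    intro x
    have := pd_comp hr (G := fun z => 4 * min z 0 ^ 3) j x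
      ((hasDerivAt_min_zero_pow 1 (r x)).const_mul 4)
    rw [this]
    push_cast
    ring
  have p4 : ∀ x, pd j (fun x => min (r x) 0 ^ 4) x = 4 * min (r x) 0 ^ 3 * pd j r x := by
    intro x
    have := pd_comp hr (G := fun z => min z 0 ^ 4) j x (hasDerivAt_min_zero_pow 2 (r x))
    rw [this]
    norm_num
  rw [integral_mul_pd h3 hF, integral_mul_pd h4 hv]
  simp only [p3, p4]
  -- After integration by parts `F` is replaced by `r v` plus the error. This identity then makes
  -- the main term `12 m³ ∂r v = 3 ∂(m⁴) v`, with `m = min r 0`, which is integrated by parts back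
  -- onto `v`.
  have hm : ∀ x, min (r x) 0 ^ 2 * r x = min (r x) 0 ^ 3 := by
    intro x
    rcases le_total (r x) 0 with h | h
    · rw [min_eq_left h]; ring
    · rw [min_eq_right h]; simp
  have hi : ∀ f : Torus d → ℝ, Continuous f → Integrable f (torusMeasure d) :=
    fun f hf => integrable_of_continuous hf
  rw [mul_neg, ← integral_const_mul, ← neg_add', ← integral_add (hi _ (by fun_prop))
    (hi _ (by fun_prop))]
  congr 1
  refine integral_congr_ae (Eventually.of_forall fun x => ?_)
  linear_combination (12 * pd j r x * v x) * hm x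

lemma integral_abs_le_of_integral_sq_le {f : Torus d → ℝ} (hf : Continuous f) {K : ℝ}
    (h : ∫ x, f x ^ 2 ∂torusMeasure d ≤ K) : ∫ x, |f x| ∂torusMeasure d ≤ (1 + K) / 2 := by
  have h1 : ∫ x, |f x| ∂torusMeasure d ≤ ∫ x, (1 + f x ^ 2) / 2 ∂torusMeasure d := by
    refine integral_mono (integrable_of_continuous (by fun_prop))
      (integrable_of_continuous (by fun_prop)) fun x => ?_
    have := sq_nonneg (|f x| - 1)
    rw [sub_sq, sq_abs] at this
    show |f x| ≤ (1 + f x ^ 2) / 2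
    linarith
  refine h1.trans ?_
  rw [integral_div, integral_add (integrable_const _) (integrable_of_continuous (by fun_prop))]
  simp
  linarith

/-- Approximate transport estimate for `∫ (min r 0)^4`. -/
lemma neg_integral_min_pow_mul_div_le {r : Torus d → ℝ} {v F : Fin d → Torus d → ℝ}
    (hr : ContDiff ℝ 1 (perLift r)) (hv : ∀ j, ContDiff ℝ 1 (perLift (v j)))
    (hF : ∀ j, ContDiff ℝ 1 (perLift (F j))) {R D K : ℝ} {δ : Fin d → ℝ}
    (hR : ∀ x, |r x| ≤ R) (hD : ∀ x, ∑ j, |pd j (v j) x| ≤ D)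
    (hK : ∀ j, ∫ x, |pd j r x| ∂torusMeasure d ≤ K) (hδ : ∀ j x, |F j x - r x * v j x| ≤ δ j) :
    ∫ x, 4 * min (r x) 0 ^ 3 * -∑ j, pd j (F j) x ∂torusMeasure d ≤
      3 * D * ∫ x, min (r x) 0 ^ 4 ∂torusMeasure d + 12 * R ^ 2 * K * ∑ j, δ j := by
  have hrc := continuous_of_contDiff_perLift hr
  have hvc := fun j => continuous_of_contDiff_perLift (hv j)
  have hFc := fun j => continuous_of_contDiff_perLift (hF j)
  have hrp := fun j => continuous_pd hr j
  have hvp := fun j => continuous_pd (hv j) j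
  have hFp := fun j => continuous_pd (hF j) j
  have hi : ∀ f : Torus d → ℝ, Continuous f → Integrable f (torusMeasure d) :=
    fun f hf => integrable_of_continuous hf
  have e : ∫ x, 4 * min (r x) 0 ^ 3 * -∑ j, pd j (F j) x ∂torusMeasure d =
      -(3 * ∫ x, min (r x) 0 ^ 4 * ∑ j, pd j (v j) x ∂torusMeasure d) +
        ∑ j, ∫ x, 12 * min (r x) 0 ^ 2 * pd j r x * (F j x - r x * v j x) ∂torusMeasure d := by
    simp only [mul_neg, Finset.mul_sum, integral_neg]
    rw [integral_finsetSum _ fun j _ => hi _ (by have := hFp j; fun_prop),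
      integral_finsetSum _ fun j _ => hi _ (by have := hvp j; fun_prop),
      Finset.sum_congr rfl fun j _ => integral_min_pow_mul_pd hr (hv j) (hF j) j,
      Finset.sum_sub_distrib, Finset.mul_sum]
    ring
  rw [e, Finset.mul_sum]
  refine add_le_add ?_ (Finset.sum_le_sum fun j _ => ?_)
  · rw [← mul_neg, mul_assoc, ← integral_neg, ← integral_const_mul D]
    refine mul_le_mul_of_nonneg_left (integral_mono (hi _ ?_) (hi _ (by fun_prop)) fun x => ?_)
      (by norm_num)
    · have : Continuous fun x => ∑ j, pd j (v j) x := continuous_finsetSum _ fun j _ => hvp j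
      fun_prop
    · have h1 : |∑ j, pd j (v j) x| ≤ D := (Finset.abs_sum_le_sum_abs _ _).trans (hD x)
      have h2 : 0 ≤ min (r x) 0 ^ 4 := by positivity
      have := neg_le_of_abs_le h1
      show -(min (r x) 0 ^ 4 * ∑ j, pd j (v j) x) ≤ D * min (r x) 0 ^ 4
      nlinarith
  · have hRn : ∀ x, min (r x) 0 ^ 2 ≤ R ^ 2 := fun x => by
      have h1 : |min (r x) 0| ≤ |r x| := by
        rcases le_total (r x) 0 with h | h
        · rw [min_eq_left h]
        · rw [min_eq_right h]; simp
      rw [← sq_abs (min (r x) 0)]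
      exact pow_le_pow_left₀ (abs_nonneg _) (h1.trans (hR x)) 2
    have hδ0 : 0 ≤ δ j := (abs_nonneg _).trans (hδ j 0)
    -- The flux error is uniform in `x`, so the derivative of `r` is only needed in mean; for
    -- truncated densities a mean bound independent of the truncation is available.
    calc _ ≤ ∫ x, 12 * R ^ 2 * δ j * |pd j r x| ∂torusMeasure d := by
          refine integral_mono (hi _ (by have := hrp j; have := hFc j; have := hvc j; fun_prop))
            (hi _ (by have := hrp j; fun_prop)) fun x => (le_abs_self _).trans ?_
          simp only [abs_mul]
          rw [abs_of_nonneg (show (0 : ℝ) ≤ 12 by norm_num),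
            abs_of_nonneg (show 0 ≤ min (r x) 0 ^ 2 by positivity)]
          have h1 : min (r x) 0 ^ 2 * |F j x - r x * v j x| ≤ R ^ 2 * δ j :=
            mul_le_mul (hRn x) (hδ j x) (abs_nonneg _) (sq_nonneg _)
          have := mul_le_mul_of_nonneg_right h1 (abs_nonneg (pd j r x))
          linarith
      _ ≤ _ := by
          rw [integral_const_mul]
          have := mul_le_mul_of_nonneg_left (hK j) (show 0 ≤ 12 * R ^ 2 * δ j by positivity)
          linarith

lemma abs_min_zero_pow_le {z R : ℝ} (h : |z| ≤ R) : min z 0 ^ 4 ≤ R ^ 4 := by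
  have h1 : |min z 0| ≤ |z| := by
    rcases le_total z 0 with h | h
    · rw [min_eq_left h]
    · rw [min_eq_right h]; simp
  have h2 : min z 0 ^ 4 = |min z 0| ^ 4 := by
    rw [← abs_pow]; exact (abs_of_nonneg (by positivity)).symm
  rw [h2]
  exact pow_le_pow_left₀ (abs_nonneg _) (h1.trans h) 4

lemma exists_forall_tsum_norm_le {c : ℝ → Freq d → ℂ} (hc : L1Cont c) (T : ℝ) :
    ∃ B, 0 ≤ B ∧ ∀ t ∈ Icc 0 T, ∑' k, ‖c t k‖ ≤ B := by
  obtain ⟨B, hB⟩ := isCompact_Icc.exists_bound_of_continuousOn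
    (s := Icc 0 T) hc.continuous_tsum_norm.continuousOn
  exact ⟨|B|, abs_nonneg _, fun t ht => (le_abs_self _).trans ((hB t ht).trans (le_abs_self _))⟩

lemma L1Cont.sub_trunc {c : ℝ → Freq d → ℂ} (hc : L1Cont c) (N : ℕ) :
    L1Cont fun t k => _root_.trunc N (c t) k - c t k := by
  have := hc.mul_bounded (p := fun k => (if k ∈ freqBox d N then 1 else 0) - 1) (C := 1)
    fun k => by split_ifs <;> simp
  simpa only [_root_.trunc, sub_mul, one_mul] using this

lemma tsum_norm_trunc_sub_le (N : ℕ) {c : Freq d → ℂ} (hc : Summable fun k => ‖c k‖) :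
    ∑' k, ‖trunc N c k - c k‖ ≤ ∑' k, ‖c k‖ := by
  have h : ∀ k, ‖trunc N c k - c k‖ ≤ ‖c k‖ := fun k => by
    rw [trunc]; split_ifs <;> simp
  exact (Summable.of_nonneg_of_le (fun _ => norm_nonneg _) h hc).tsum_le_tsum h hc

lemma summable_bra_one_trunc (N : ℕ) (c : Freq d → ℂ) :
    Summable fun k => bra k * ‖trunc N c k‖ := by simpa using summable_bra_trunc N 1 c

lemma contDiff_const_mul_rsyn {c : Freq d → ℂ} (a b : ℝ) (hc : Summable fun k => bra k * ‖c k‖) :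
    ContDiff ℝ 1 (perLift fun x => a + b * rsyn c x) :=
  contDiff_const.add (contDiff_const.mul (contDiff_perLift_rsyn 1 (by simpa using hc)))

lemma pd_const_add_mul_rsyn {c : Freq d → ℂ} (a b : ℝ) (hc : Summable fun k => bra k * ‖c k‖)
    (j : Fin d) (x : Torus d) :
    pd j (fun x => a + b * rsyn c x) x = b * rsyn (fun k => dsym j k * c k) x := by
  rw [pd_comp (contDiff_perLift_rsyn 1 (by simpa using hc)) (G := fun z => a + b * z) (G' := b) j x
    (by simpa using ((hasDerivAt_id (rsyn c x)).const_mul b).const_add a), pd_rsyn hc]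

namespace IsFourierEP

variable {ε T s M : ℝ} {u : ℝ → Freq d → Option (Fin d) → ℂ}

/-- The density, truncated to a box of frequencies. -/
def densityTrunc (ε : ℝ) (u : Freq d → Option (Fin d) → ℂ) (N : ℕ) (x : Torus d) : ℝ :=
  1 + ε * rsyn (trunc N (sigCoeff u)) x

/-- Truncation commutes with the divergence, so the truncated density satisfies an exact continuity
equation with the truncated flux. All the error lies in the difference between that flux and the
truncated density times `v`. -/
lemma hasDerivWithinAt_densityTrunc (h : IsFourierEP ε T s M u) (N : ℕ) {t : ℝ}
    (ht : t ∈ Icc 0 T) (x : Torus d) :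
    HasDerivWithinAt (fun τ => densityTrunc ε (u τ) N x)
      (-∑ j, pd j (fun x => 0 + ε * rsyn (trunc N (fluxCoeff ε (u t) j)) x) x) (Icc 0 T) t := by
  have hd1 := fun j => (h.l1Cont_flux j).dsym_trunc N j
  have hder := hasDerivWithinAt_tsum_of_integral (T := T)
    (c := fun t k => UnitAddTorus.mFourier k x * trunc N (sigCoeff (u t)) k)
    (h := fun t k => UnitAddTorus.mFourier k x *
      (-1 * ∑ j, dsym j k * trunc N (fluxCoeff ε (u t) j) k))
    (((L1Cont.sum _ fun j _ => hd1 j).mul_bounded (p := fun _ => -1) (C := 1)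
      (by simp)).mul_bounded (C := 1) fun k => (norm_mFourier_apply k x).le)
    (fun t _ => ((h.l1Cont_sig.trunc N).mul_bounded (C := 1)
      fun k => (norm_mFourier_apply k x).le).1 t)
    (fun t ht k => by
      have e : ∀ τ, UnitAddTorus.mFourier k x *
          (-1 * ∑ j, dsym j k * trunc N (fluxCoeff ε (u τ) j) k) =
          UnitAddTorus.mFourier k x * (if k ∈ freqBox d N then 1 else 0) *
            (2 * Real.pi * freqNorm k : ℝ) * epField ε (u τ) k none := by
        intro τ
        rw [mul_assoc _ _ (epField _ _ _ _), h.freqNorm_mul_epField, ← Finset.sum_neg_distrib,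
          Finset.mul_sum, Finset.mul_sum, Finset.mul_sum]
        refine Finset.sum_congr rfl fun j _ => ?_
        rw [trunc]; ring
      simp only [e]
      rw [intervalIntegral.integral_const_mul, trunc, sigCoeff, h.eqn t ht k none, trunc, sigCoeff]
      ring) ht
  have hre := (Complex.reCLM.hasFDerivAt.comp_hasDerivWithinAt t hder).const_mul ε |>.const_add 1
  have e1 : ε * Complex.reCLM (∑' k, UnitAddTorus.mFourier k x *
      (-1 * ∑ j, dsym j k * trunc N (fluxCoeff ε (u t) j) k)) =
      -∑ j, pd j (fun x => 0 + ε * rsyn (trunc N (fluxCoeff ε (u t) j)) x) x := by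
    have e2 : ∑' k, UnitAddTorus.mFourier k x *
        (-1 * ∑ j, dsym j k * trunc N (fluxCoeff ε (u t) j) k) =
        syn (fun k => -1 * ∑ j, dsym j k * trunc N (fluxCoeff ε (u t) j) k) x :=
      tsum_congr fun k => mul_comm _ _
    rw [e2, syn_const_mul, syn_sum _ fun j _ => (hd1 j).1 t]
    simp only [pd_const_add_mul_rsyn _ _ (summable_bra_one_trunc N _), ← Finset.mul_sum]
    simp [rsyn]
  rw [e1] at hre
  refine hre.congr_of_mem (fun τ _ => ?_) ht
  simp only [Function.comp, Complex.reCLM_apply, densityTrunc, rsyn, syn]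
  congr 3
  exact tsum_congr fun k => mul_comm _ _

/-- The gradient of `σ` costs two derivatives of the density variable, which is bounded in `H³`;
Parseval gives an `L²` bound uniform in `N`. -/
lemma integral_abs_pd_densityTrunc_le (h : IsFourierEP ε T s M u) (N : ℕ) (t : ℝ) (j : Fin d) :
    ∫ x, |pd j (densityTrunc ε (u t) N) x| ∂torusMeasure d ≤
      (1 + ε ^ 2 * ((2 * Real.pi) ^ 4 * M)) / 2 := by
  have hs := ((h.l1Cont_sig).dsym_trunc N j).1 t
  have hr := isRealSeq_dsym (isRealSeq_trunc N (isRealSeq_sigCoeff (h.real t none))) j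
  have hb : HsBound 0 ((2 * Real.pi) ^ 4 * M)
      (fun k => dsym j k * trunc N (sigCoeff (u t)) k) := by
    intro F
    have h3 := h.bound_comp t none F
    calc _ ≤ ∑ k ∈ F, (2 * Real.pi) ^ 4 * (jap k ^ (3 : ℝ) * ‖u t k none‖ ^ 2) := by
          refine Finset.sum_le_sum fun k _ => ?_
          rw [Real.rpow_zero, one_mul, norm_mul]
          have h1 := norm_dsym_le j k
          have h2 : ‖trunc N (sigCoeff (u t)) k‖ ≤ 2 * Real.pi * bra k * ‖u t k none‖ := by
            refine (norm_trunc_le N _ k).trans ?_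
            rw [sigCoeff, norm_mul]
            refine mul_le_mul_of_nonneg_right ?_ (norm_nonneg _)
            have := norm_two_pi_freqNorm_le k
            rwa [jap_rpow_half] at this
          have hb := one_le_bra k
          have hpi := Real.pi_pos
          calc _ ≤ ((2 * Real.pi * bra k) * (2 * Real.pi * bra k * ‖u t k none‖)) ^ 2 := by
                gcongr
            _ = (2 * Real.pi) ^ 4 * ((bra k ^ 2) ^ 2 * ‖u t k none‖ ^ 2) := by ring
            _ ≤ _ := by
                have hj := one_le_jap k
                rw [bra_sq]
                have : jap k ^ (3 : ℝ) = jap k ^ 3 := by exact_mod_cast Real.rpow_natCast (jap k) 3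
                rw [this]
                gcongr
                · norm_num
      _ ≤ _ := by
          rw [← Finset.mul_sum]
          exact mul_le_mul_of_nonneg_left h3 (by positivity)
  have e : ∀ x, pd j (densityTrunc ε (u t) N) x =
      ε * rsyn (fun k => dsym j k * trunc N (sigCoeff (u t)) k) x :=
    pd_const_add_mul_rsyn 1 ε (summable_bra_one_trunc N (sigCoeff (u t))) j
  simp only [e]
  refine integral_abs_le_of_integral_sq_le ((continuous_rsyn hs).const_mul ε |> fun h => h) ?_
  simp only [mul_pow ε]
  rw [integral_const_mul]
  exact mul_le_mul_of_nonneg_left (integral_rsyn_sq_le hs hr hb) (sq_nonneg _)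

/-- The error in the truncated continuity equation. -/
def fluxError (ε : ℝ) (u : Freq d → Option (Fin d) → ℂ) (N : ℕ) (j : Fin d) : ℝ :=
  |ε| * (∑' k, ‖trunc N (fluxCoeff ε u j) k - fluxCoeff ε u j k‖) +
    |ε| * (∑' k, ‖trunc N (sigCoeff u) k - sigCoeff u k‖) * ∑' k, ‖u k (some j)‖

lemma abs_flux_sub_le (h : IsFourierEP ε T s M u) (hε : ε ≠ 0) (N : ℕ) (t : ℝ) (j : Fin d)
    (x : Torus d) :
    |(0 + ε * rsyn (trunc N (fluxCoeff ε (u t) j)) x) -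
      densityTrunc ε (u t) N x * velField (u t) x j| ≤ fluxError ε (u t) N j := by
  have h1 := abs_rsyn_trunc_sub_le N ((h.l1Cont_flux j).1 t) x
  have h2 := abs_rsyn_trunc_sub_le N (h.l1Cont_sig.1 t) x
  have h3 : |velField (u t) x j| ≤ ∑' k, ‖u t k (some j)‖ := abs_rsyn_le ((h.l1Cont (some j)).1 t) x
  have h4 : ε * rsyn (fluxCoeff ε (u t) j) x = density ε (u t) x * velField (u t) x j := by
    rw [rsyn, h.syn_flux hε, Complex.ofReal_re, mul_inv_cancel_left₀ hε]
  have e : (0 + ε * rsyn (trunc N (fluxCoeff ε (u t) j)) x) -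
      densityTrunc ε (u t) N x * velField (u t) x j =
      ε * (rsyn (trunc N (fluxCoeff ε (u t) j)) x - rsyn (fluxCoeff ε (u t) j) x) -
      ε * (rsyn (trunc N (sigCoeff (u t))) x - rsyn (sigCoeff (u t)) x) * velField (u t) x j := by
    rw [mul_sub ε, h4, density, densityTrunc]; ring
  rw [e, fluxError]
  refine (abs_sub _ _).trans (add_le_add ?_ ?_)
  · rw [abs_mul]; gcongr
  · rw [abs_mul, abs_mul]; gcongr

lemma continuous_fluxError (h : IsFourierEP ε T s M u) (N : ℕ) (j : Fin d) :
    Continuous fun t => fluxError ε (u t) N j := by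
  have h1 := ((h.l1Cont_flux j).sub_trunc N).continuous_tsum_norm
  have h2 := (h.l1Cont_sig.sub_trunc N).continuous_tsum_norm
  have h3 := (h.l1Cont (some j)).continuous_tsum_norm
  unfold fluxError
  exact (continuous_const.mul h1).add ((continuous_const.mul h2).mul h3)

/-- The density stays nonnegative. -/
theorem density_nonneg (h : IsFourierEP ε T s M u) (hε : ε ≠ 0)
    (h0 : ∀ᵐ x ∂torusMeasure d, 0 ≤ density ε (u 0) x) {t : ℝ} (ht : t ∈ Icc 0 T) (x : Torus d) :
    0 ≤ density ε (u t) x := by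
  obtain ⟨Bσ, hBσ0, hBσ⟩ := exists_forall_tsum_norm_le h.l1Cont_sig T
  choose Bd hBd0 hBd using fun j => exists_forall_tsum_norm_le (h.l1Cont_dsym (some j) j) T
  set R := 1 + |ε| * Bσ
  set D := ∑ j, Bd j
  set K := (1 + ε ^ 2 * ((2 * Real.pi) ^ 4 * M)) / 2
  have hcρ : Continuous fun z : ℝ × Torus d => density ε (u z.1) z.2 :=
    continuous_const.add (continuous_const.mul h.l1Cont_sig.continuous_rsyn)
  have hcN : ∀ N, Continuous fun z : ℝ × Torus d => densityTrunc ε (u z.1) N z.2 := fun N =>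
    continuous_const.add (continuous_const.mul (h.l1Cont_sig.trunc N).continuous_rsyn)
  have hRN : ∀ N, ∀ t ∈ Icc 0 T, ∀ x, |densityTrunc ε (u t) N x| ≤ R := fun N t ht x => by
    refine (abs_add_le _ _).trans ?_
    rw [abs_one, abs_mul]
    have := (abs_rsyn_trunc_le N (h.l1Cont_sig.1 t) x).trans (hBσ t ht)
    exact add_le_add le_rfl (mul_le_mul_of_nonneg_left this (abs_nonneg _))
  have hlim : ∀ t x, Tendsto (fun N => densityTrunc ε (u t) N x) atTop (𝓝 (density ε (u t) x)) := by
    intro t x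
    refine tendsto_const_nhds.add (tendsto_const_nhds.mul ?_)
    rw [tendsto_iff_norm_sub_tendsto_zero]
    exact squeeze_zero (fun _ => norm_nonneg _)
      (fun N => abs_rsyn_trunc_sub_le N (h.l1Cont_sig.1 t) x) (tendsto_trunc (h.l1Cont_sig.1 t))
  have hy : ∀ t ∈ Icc 0 T, Tendsto (fun N => ∫ x, min (densityTrunc ε (u t) N x) 0 ^ 4
      ∂torusMeasure d) atTop (𝓝 (∫ x, min (density ε (u t) x) 0 ^ 4 ∂torusMeasure d)) := by
    intro t ht
    refine tendsto_integral_of_dominated_convergence (fun _ => R ^ 4) (fun N => ?_)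
      (integrable_const _) (fun N => Eventually.of_forall fun x => ?_)
      (Eventually.of_forall fun x => ((hlim t x).min tendsto_const_nhds).pow 4)
    · have := (hcN N).comp (Continuous.prodMk_right t)
      exact Continuous.aestronglyMeasurable ((this.min continuous_const).pow 4)
    · rw [Real.norm_of_nonneg (by positivity)]
      exact abs_min_zero_pow_le (hRN N t ht x)
  have hyc : Continuous fun t => ∫ x, min (density ε (u t) x) 0 ^ 4 ∂torusMeasure d :=
    continuous_integral_torus (g := fun t x => min (density ε (u t) x) 0 ^ 4)
      ((hcρ.min continuous_const).pow 4)
  have hycN : ∀ N, Continuous fun t => ∫ x, min (densityTrunc ε (u t) N x) 0 ^ 4 ∂torusMeasure d :=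
    fun N => continuous_integral_torus (g := fun t x => min (densityTrunc ε (u t) N x) 0 ^ 4)
      (((hcN N).min continuous_const).pow 4)
  have hfe : ∀ N, Continuous fun t => ∑ j, fluxError ε (u t) N j := fun N =>
    continuous_finsetSum _ fun j _ => h.continuous_fluxError N j
  -- For each `N` the truncated densities are smooth in space, and the transport estimate applies
  -- with constants `R`, `D`, `K` independent of `N`. Only the flux error depends on `N`.
  have step : ∀ N, ∀ t ∈ Icc 0 T, ∫ x, min (densityTrunc ε (u t) N x) 0 ^ 4 ∂torusMeasure d ≤
      ∫ x, min (densityTrunc ε (u 0) N x) 0 ^ 4 ∂torusMeasure d + ∫ τ in (0)..t,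
        (3 * D * ∫ x, min (densityTrunc ε (u τ) N x) 0 ^ 4 ∂torusMeasure d +
          12 * R ^ 2 * K * ∑ j, fluxError ε (u τ) N j) := by
    intro N t ht
    have hpF : ∀ τ x j, pd j (fun x => 0 + ε * rsyn (trunc N (fluxCoeff ε (u τ) j)) x) x =
        ε * rsyn (fun k => dsym j k * trunc N (fluxCoeff ε (u τ) j) k) x := fun τ x j =>
      pd_const_add_mul_rsyn _ _ (summable_bra_one_trunc N _) j x
    have hcF : Continuous fun z : ℝ × Torus d => ∑ j,
        pd j (fun x => 0 + ε * rsyn (trunc N (fluxCoeff ε (u z.1) j)) x) z.2 := by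
      simp only [hpF]
      exact continuous_finsetSum _ fun j _ => continuous_const.mul
        ((h.l1Cont_flux j).dsym_trunc N j).continuous_rsyn
    have hcg : Continuous (Function.uncurry fun (τ : ℝ) (x : Torus d) =>
        4 * min (densityTrunc ε (u τ) N x) 0 ^ 3 *
          -∑ j, pd j (fun x => 0 + ε * rsyn (trunc N (fluxCoeff ε (u τ) j)) x) x) :=
      (continuous_const.mul (((hcN N).min continuous_const).pow 3)).mul hcF.neg
    rw [integral_eq_add_integral_deriv (f := fun t x => min (densityTrunc ε (u t) N x) 0 ^ 4) hcg
      (fun t _ => (((hcN N).comp (Continuous.prodMk_right t)).min continuous_const).pow 4)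
      (fun t ht x => by
        have := (hasDerivAt_min_zero_pow 2 (densityTrunc ε (u t) N x)).comp_hasDerivWithinAt t
          (h.hasDerivWithinAt_densityTrunc N ht x)
        norm_num at this ⊢
        exact this) ht]
    refine add_le_add_right (intervalIntegral.integral_mono_on ht.1
      ((continuous_integral_torus hcg).intervalIntegrable _ _)
      (((continuous_const.mul (hycN N)).add (continuous_const.mul (hfe N))).intervalIntegrable _ _)
      fun τ hτ => ?_) _
    have hτT : τ ∈ Icc 0 T := ⟨hτ.1, hτ.2.trans ht.2⟩
    refine neg_integral_min_pow_mul_div_le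
      (contDiff_const_mul_rsyn 1 ε (summable_bra_one_trunc N _))
      (v := fun j x => velField (u τ) x j)
      (fun j => (h.isC1Slab_vel j).contDiff τ hτT)
      (fun j => contDiff_const_mul_rsyn 0 ε (summable_bra_one_trunc N _))
      (hRN N τ hτT) (fun x => Finset.sum_le_sum fun j _ => ?_)
      (fun j => h.integral_abs_pd_densityTrunc_le N τ j) (fun j x => h.abs_flux_sub_le hε N τ j x)
    have e : (fun x => velField (u τ) x j) = rsyn fun k => u τ k (some j) := rfl
    rw [e, pd_rsyn (h.summable_bra τ _)]
    exact (abs_rsyn_le ((h.l1Cont_dsym (some j) j).1 τ) x).trans (hBd j τ hτT)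
  have hmain : ∀ t ∈ Icc 0 T, ∫ x, min (density ε (u t) x) 0 ^ 4 ∂torusMeasure d ≤
      3 * D * ∫ τ in (0)..t, ∫ x, min (density ε (u τ) x) 0 ^ 4 ∂torusMeasure d := by
    intro t ht
    have hinteg : Tendsto (fun N => ∫ τ in (0)..t,
        (3 * D * ∫ x, min (densityTrunc ε (u τ) N x) 0 ^ 4 ∂torusMeasure d +
          12 * R ^ 2 * K * ∑ j, fluxError ε (u τ) N j)) atTop (𝓝 (∫ τ in (0)..t,
        3 * D * ∫ x, min (density ε (u τ) x) 0 ^ 4 ∂torusMeasure d)) := by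
      have hD0 : 0 ≤ D := Finset.sum_nonneg fun j _ => hBd0 j
      -- Dominating function: the tails in the flux error are bounded by the full `ℓ¹` norms.
      set bd : ℝ → ℝ := fun τ => 3 * D * R ^ 4 + |12 * R ^ 2 * K| * ∑ j,
        (|ε| * (∑' k, ‖fluxCoeff ε (u τ) j k‖) +
          |ε| * (∑' k, ‖sigCoeff (u τ) k‖) * ∑' k, ‖u τ k (some j)‖)
      have hbd : Continuous bd := by
        refine continuous_const.add (continuous_const.mul (continuous_finsetSum _ fun j _ => ?_))
        exact (continuous_const.mul (h.l1Cont_flux j).continuous_tsum_norm).add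
          ((continuous_const.mul h.l1Cont_sig.continuous_tsum_norm).mul
            (h.l1Cont (some j)).continuous_tsum_norm)
      refine intervalIntegral.tendsto_integral_filter_of_dominated_convergence bd
        (Eventually.of_forall fun N => ?_) (Eventually.of_forall fun N =>
          Eventually.of_forall fun τ hτ => ?_) (hbd.intervalIntegrable _ _)
        (Eventually.of_forall fun τ hτ => ?_)
      · exact ((continuous_const.mul (hycN N)).add
          (continuous_const.mul (hfe N))).aestronglyMeasurable
      · rw [uIoc_of_le ht.1] at hτ
        have hτT : τ ∈ Icc 0 T := ⟨hτ.1.le, hτ.2.trans ht.2⟩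
        refine (norm_add_le _ _).trans (add_le_add ?_ ?_)
        · have h1 : 0 ≤ ∫ x, min (densityTrunc ε (u τ) N x) 0 ^ 4 ∂torusMeasure d :=
            integral_nonneg fun x => by positivity
          rw [Real.norm_of_nonneg (by positivity)]
          refine mul_le_mul_of_nonneg_left ?_ (by positivity)
          have := integral_mono (μ := torusMeasure d) (integrable_of_continuous
            ((((hcN N).comp (Continuous.prodMk_right τ)).min continuous_const).pow 4))
            (integrable_const (R ^ 4)) fun x => abs_min_zero_pow_le (hRN N τ hτT x)
          simpa using this
        · rw [norm_mul]
          refine mul_le_mul_of_nonneg_left ?_ (norm_nonneg _)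
          have hn : ∀ j, 0 ≤ fluxError ε (u τ) N j := fun j => by
            unfold fluxError
            exact add_nonneg (mul_nonneg (abs_nonneg _) (tsum_nonneg fun k => norm_nonneg _))
              (mul_nonneg (mul_nonneg (abs_nonneg _) (tsum_nonneg fun k => norm_nonneg _))
                (tsum_nonneg fun k => norm_nonneg _))
          rw [Real.norm_of_nonneg (Finset.sum_nonneg fun j _ => hn j)]
          refine Finset.sum_le_sum fun j _ => ?_
          have h1 := tsum_norm_trunc_sub_le N ((h.l1Cont_flux j).1 τ)
          have h2 := tsum_norm_trunc_sub_le N (h.l1Cont_sig.1 τ)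
          have h3 : 0 ≤ ∑' k, ‖u τ k (some j)‖ := tsum_nonneg fun k => norm_nonneg _
          unfold fluxError
          gcongr
      · rw [uIoc_of_le ht.1] at hτ
        have hτT : τ ∈ Icc 0 T := ⟨hτ.1.le, hτ.2.trans ht.2⟩
        have h1 : Tendsto (fun N => ∑ j, fluxError ε (u τ) N j) atTop (𝓝 0) := by
          rw [show (0 : ℝ) = ∑ j : Fin d, (|ε| * 0 + |ε| * 0 * ∑' k, ‖u τ k (some j)‖) by simp]
          exact tendsto_finsetSum _ fun j _ =>
            ((tendsto_trunc ((h.l1Cont_flux j).1 τ)).const_mul _).add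
              (((tendsto_trunc (h.l1Cont_sig.1 τ)).const_mul _).mul_const _)
        simpa using ((hy τ hτT).const_mul (3 * D)).add (h1.const_mul (12 * R ^ 2 * K))
    have h0m : (0 : ℝ) ∈ Icc 0 T := ⟨le_rfl, ht.1.trans ht.2⟩
    have := le_of_tendsto_of_tendsto' (hy t ht) ((hy 0 h0m).add hinteg) fun N => step N t ht
    have hz : ∫ x, min (density ε (u 0) x) 0 ^ 4 ∂torusMeasure d = 0 := by
      rw [integral_eq_zero_of_ae]
      filter_upwards [h0] with x hx
      simp [min_eq_right hx]
    rw [hz, zero_add, intervalIntegral.integral_const_mul] at this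
    exact this
  have hz := eq_zero_of_le_mul_integral hyc
    (fun t _ => integral_nonneg fun x => by positivity) hmain ht
  have hct : Continuous fun x => min (density ε (u t) x) 0 ^ 4 :=
    ((hcρ.comp (Continuous.prodMk_right t)).min continuous_const).pow 4
  rw [integral_eq_zero_iff_of_nonneg (fun x => by positivity) (integrable_of_continuous hct)] at hz
  -- Continuity of the density turns an almost everywhere statement into one at every point.
  have hz2 := (Continuous.ae_eq_iff_eq (torusMeasure d) hct continuous_const).1 hz
  have : min (density ε (u t) x) 0 ^ 4 = 0 := congrFun hz2 x
  exact min_eq_right_iff.1 (pow_eq_zero_iff (by norm_num) |>.1 this)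

end IsFourierEP

/-! ### The Helmholtz decomposition in Fourier variables -/

/-- The component of the coefficients of a vector field in the direction of the frequency. -/
def radial (V : Freq d → Fin d → ℂ) (k : Freq d) : ℂ := ∑ l, (dir k l : ℝ) * V k l

/-- The Fourier coefficients of the potential part of a vector field. -/
def potPart (V : Freq d → Fin d → ℂ) (k : Freq d) (j : Fin d) : ℂ := (dir k j : ℝ) * radial V k

/-- The Fourier coefficients of the solenoidal part of a vector field. -/
def solPart (V : Freq d → Fin d → ℂ) (k : Freq d) (j : Fin d) : ℂ := V k j - potPart V k j

lemma solPart_add_potPart (V : Freq d → Fin d → ℂ) (k : Freq d) (j : Fin d) :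
    solPart V k j + potPart V k j = V k j := sub_add_cancel _ _

/-- The zero frequency has no direction, so the potential part vanishes there and the mean of a
field belongs to its solenoidal part, as it must since `q` is periodic. -/
lemma dir_zero (j : Fin d) : dir (0 : Freq d) j = 0 := by simp [dir]

lemma radial_potPart (V : Freq d → Fin d → ℂ) (k : Freq d) : radial (potPart V) k = radial V k := by
  by_cases hk : k = 0
  · subst hk; simp [radial, dir_zero]
  · have h := sum_dir_sq hk
    have h' : ∑ l, ((dir k l : ℝ) : ℂ) * (dir k l : ℝ) = 1 := by
      rw [← Complex.ofReal_one, ← h]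
      push_cast
      exact Finset.sum_congr rfl fun l _ => (pow_two _).symm
    show ∑ l, ((dir k l : ℝ) : ℂ) * ((dir k l : ℝ) * radial V k) = _
    simp only [← mul_assoc, ← Finset.sum_mul, h', one_mul]

lemma radial_sub (V W : Freq d → Fin d → ℂ) (k : Freq d) :
    radial (fun k j => V k j - W k j) k = radial V k - radial W k := by
  simp only [radial, mul_sub, Finset.sum_sub_distrib]

lemma radial_add (V W : Freq d → Fin d → ℂ) (k : Freq d) :
    radial (fun k j => V k j + W k j) k = radial V k + radial W k := by
  simp only [radial, mul_add, Finset.sum_add_distrib]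

lemma radial_solPart (V : Freq d → Fin d → ℂ) (k : Freq d) : radial (solPart V) k = 0 := by
  rw [show solPart V = fun k j => V k j - potPart V k j from rfl, radial_sub, radial_potPart,
    sub_self]

lemma solPart_add (V W : Freq d → Fin d → ℂ) (k : Freq d) (j : Fin d) :
    solPart (fun k j => V k j + W k j) k j = solPart V k j + solPart W k j := by
  simp only [solPart, potPart, radial_add]; ring

lemma solPart_eq_self {V : Freq d → Fin d → ℂ} {k : Freq d} (h : radial V k = 0) (j : Fin d) :
    solPart V k j = V k j := by simp [solPart, potPart, h]

lemma coord_eq_freqNorm_mul_dir (k : Freq d) (j : Fin d) : (k j : ℝ) = freqNorm k * dir k j :=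
  (freqNorm_mul_dir k j).symm

lemma sum_dsym_mul (V : Freq d → Fin d → ℂ) (k : Freq d) :
    ∑ j, dsym j k * V k j = (2 * Real.pi * freqNorm k : ℝ) * Complex.I * radial V k := by
  rw [radial, Finset.mul_sum]
  refine Finset.sum_congr rfl fun j _ => ?_
  rw [dsym, coord_eq_freqNorm_mul_dir]
  push_cast
  ring

lemma radial_eq_zero_of_sum_dsym {V : Freq d → Fin d → ℂ} {k : Freq d}
    (h : ∑ j, dsym j k * V k j = 0) : radial V k = 0 := by
  by_cases hk : k = 0
  · subst hk; simp [radial, dir_zero]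
  · rw [sum_dsym_mul] at h
    have h1 : freqNorm k ≠ 0 := fun h => hk (freqNorm_eq_zero.1 h)
    have h2 : ((2 * Real.pi * freqNorm k : ℝ) : ℂ) ≠ 0 := by
      exact_mod_cast mul_ne_zero Real.two_pi_pos.ne' h1
    simpa [h2, Complex.I_ne_zero, h1, Real.pi_ne_zero] using h

lemma norm_radial_le (V : Freq d → Fin d → ℂ) (k : Freq d) : ‖radial V k‖ ≤ d * ‖V k‖ := by
  refine (norm_sum_le _ _).trans ((Finset.sum_le_card_nsmul _ _ ‖V k‖ fun l _ => ?_).trans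
    (le_of_eq (by simp)))
  rw [norm_mul, Complex.norm_real]
  exact (mul_le_of_le_one_left (norm_nonneg _) (abs_dir_le_one k l)).trans (norm_le_pi_norm _ l)

lemma norm_potPart_le (V : Freq d → Fin d → ℂ) (k : Freq d) : ‖potPart V k‖ ≤ d * ‖V k‖ := by
  refine (pi_norm_le_iff_of_nonneg (by positivity)).2 fun j => ?_
  rw [potPart, norm_mul, Complex.norm_real]
  exact (mul_le_of_le_one_left (norm_nonneg _) (abs_dir_le_one k j)).trans (norm_radial_le V k)

lemma norm_solPart_le (V : Freq d → Fin d → ℂ) (k : Freq d) :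
    ‖solPart V k‖ ≤ (d + 1) * ‖V k‖ := by
  have h : solPart V k = V k - potPart V k := rfl
  rw [h]
  linarith [norm_sub_le (V k) (potPart V k), norm_potPart_le V k]

lemma HsBound.potPart {s M : ℝ} {V : Freq d → Fin d → ℂ} (h : HsBound s M V) :
    HsBound s (d ^ 2 * M) (potPart V) := h.of_norm_le (norm_potPart_le V)

lemma HsBound.solPart {s M : ℝ} {V : Freq d → Fin d → ℂ} (h : HsBound s M V) :
    HsBound s ((d + 1) ^ 2 * M) (solPart V) := h.of_norm_le (norm_solPart_le V)

lemma isRealSeq_potPart {V : Freq d → Fin d → ℂ} (h : ∀ j, IsRealSeq fun k => V k j) (j : Fin d) :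
    IsRealSeq fun k => potPart V k j := by
  intro k
  have h' : ∀ j, V (-k) j = conj (V k j) := fun j => h j k
  simp only [potPart, radial, dir_neg, h', map_mul, map_sum, Complex.conj_ofReal,
    Complex.ofReal_neg, neg_mul, Finset.sum_neg_distrib, mul_neg, neg_neg]

lemma isRealSeq_solPart {V : Freq d → Fin d → ℂ} (h : ∀ j, IsRealSeq fun k => V k j) (j : Fin d) :
    IsRealSeq fun k => solPart V k j := by
  intro k
  have h1 := h j k
  have h2 := isRealSeq_potPart h j k
  simp only [solPart, map_sub] at h1 h2 ⊢
  rw [h1, h2]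

/-- A bounded family in `H^s`, `s ≥ 3`, of coefficients of real vector fields. -/
structure IsHsCurve (s M : ℝ) (V : ℝ → Freq d → Fin d → ℂ) : Prop where
  dim_le : d ≤ 3
  three_le : 3 ≤ s
  real : ∀ t j, IsRealSeq fun k => V t k j
  bound : ∀ t, HsBound s M (V t)
  cont : ∀ k j, Continuous fun t => V t k j

/-- The vector field with Fourier coefficients `V`. -/
def vsyn (V : Freq d → Fin d → ℂ) (x : Torus d) (i : Fin d) : ℝ := rsyn (fun k => V k i) x

lemma IsFourierEP.isHsCurve {ε T s M : ℝ} {u : ℝ → Freq d → Option (Fin d) → ℂ}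
    (h : IsFourierEP ε T s M u) : IsHsCurve s M fun t k j => u t k (some j) where
  dim_le := h.dim_le
  three_le := h.three_le
  real t _ := h.real t _
  bound t := (h.bound t).velocity
  cont k _ := h.cont k _

namespace IsHsCurve

variable {s M : ℝ} {V : ℝ → Freq d → Fin d → ℂ}

lemma potPart (h : IsHsCurve s M V) : IsHsCurve s (d ^ 2 * M) fun t => potPart (V t) where
  dim_le := h.dim_le
  three_le := h.three_le
  real t j := isRealSeq_potPart (h.real t) j
  bound t := (h.bound t).potPart
  cont k _ := continuous_const.mul (continuous_finsetSum _ fun l _ =>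
    continuous_const.mul (h.cont k l))

lemma solPart (h : IsHsCurve s M V) : IsHsCurve s ((d + 1) ^ 2 * M) fun t => solPart (V t) where
  dim_le := h.dim_le
  three_le := h.three_le
  real t j := isRealSeq_solPart (h.real t) j
  bound t := (h.bound t).solPart
  cont k j := (h.cont k j).sub (h.potPart.cont k j)

lemma bound_three (h : IsHsCurve s M V) (t : ℝ) : HsBound 3 M (V t) :=
  (h.bound t).mono_exp h.three_le

lemma l1Cont_mul (h : IsHsCurve s M V) (j : Fin d) {p : Freq d → ℂ} {C : ℝ}
    (hp : ∀ k, ‖p k‖ ≤ C * jap k ^ (1 / 2 : ℝ)) : L1Cont fun t k => p k * V t k j :=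
  L1Cont.of_hsBound h.dim_le (r := 1 / 2) (by norm_num) (fun t => (h.bound_three t).component j)
    (fun k => h.cont k j) hp

lemma l1Cont (h : IsHsCurve s M V) (j : Fin d) : L1Cont fun t k => V t k j := by
  simpa using h.l1Cont_mul j (p := fun _ => 1) (C := 1)
    (fun k => by simpa using one_le_jap_rpow k (s := 1 / 2) (by norm_num))

lemma l1Cont_dsym (h : IsHsCurve s M V) (i j : Fin d) :
    L1Cont fun t k => dsym i k * V t k j :=
  h.l1Cont_mul j (C := 2 * Real.pi) fun k => by rw [jap_rpow_half]; exact norm_dsym_le i k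

lemma summable_bra (h : IsHsCurve s M V) (t : ℝ) (j : Fin d) :
    Summable fun k => bra k * ‖V t k j‖ :=
  ((h.bound_three t).component j).summable_bra h.dim_le (by norm_num)

lemma summable (h : IsHsCurve s M V) (t : ℝ) (j : Fin d) : Summable fun k => ‖V t k j‖ :=
  (h.l1Cont j).1 t

lemma isC1Slab (h : IsHsCurve s M V) (T : ℝ) (i : Fin d) : IsC1Slab T fun t x => vsyn (V t) x i :=
  isC1Slab_rsyn T (c := fun t k => V t k i) (fun t => h.summable_bra t i) (h.l1Cont i)
    fun j => h.l1Cont_dsym j i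

lemma contDiff (h : IsHsCurve s M V) (t : ℝ) (i : Fin d) :
    ContDiff ℝ 1 (perLift fun x => vsyn (V t) x i) :=
  contDiff_perLift_rsyn 1 (by simpa using h.summable_bra t i)

lemma continuous_uncurry (h : IsHsCurve s M V) :
    Continuous fun z : ℝ × Torus d => vsyn (V z.1) z.2 :=
  continuous_pi fun i => (h.l1Cont i).continuous_rsyn

lemma continuous (h : IsHsCurve s M V) (t : ℝ) : Continuous (vsyn (V t)) :=
  h.continuous_uncurry.comp (Continuous.prodMk_right t)

lemma fcoeff_vsyn (h : IsHsCurve s M V) (t : ℝ) (i : Fin d) (k : Freq d) :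
    fcoeff (fun x => vsyn (V t) x i) k = V t k i :=
  fcoeff_rsyn (h.summable t i) (h.real t i) k

lemma pd_vsyn (h : IsHsCurve s M V) (t : ℝ) (i j : Fin d) (x : Torus d) :
    pd j (fun x => vsyn (V t) x i) x = rsyn (fun k => dsym j k * V t k i) x :=
  pd_rsyn (h.summable_bra t i) j x

lemma div_vsyn (h : IsHsCurve s M V) {t : ℝ} (hr : ∀ k, radial (V t) k = 0) (x : Torus d) :
    ∑ i, pd i (fun x => vsyn (V t) x i) x = 0 := by
  simp only [h.pd_vsyn, rsyn]
  rw [← Complex.re_sum, ← syn_sum _ fun i _ => (h.l1Cont_dsym i i).1 t]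
  simp [sum_dsym_mul, hr, syn]

lemma hsNormVec_le (h : IsHsCurve s M V) (t : ℝ) :
    hsNormVec s (vsyn (V t)) ≤ ENNReal.ofReal √(d * M) :=
  hsNormVec_le_of_hsBound (h.bound t).nonneg fun i => by
    rw [show (fcoeff fun x => vsyn (V t) x i) = fun k => V t k i from funext (h.fcoeff_vsyn t i)]
    exact (h.bound t).component i

lemma fcoeff_sub {M' : ℝ} {W : ℝ → Freq d → Fin d → ℂ} (h : IsHsCurve s M V)
    (hW : IsHsCurve s M' W) (t τ : ℝ) (i : Fin d) (k : Freq d) :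
    fcoeff (fun x => (vsyn (V t) - vsyn (W τ)) x i) k = V t k i - W τ k i := by
  rw [← h.fcoeff_vsyn t i k, ← hW.fcoeff_vsyn τ i k]
  simp only [fcoeff_eq_integral]
  have hc : ∀ {f : Torus d → ℝ}, Continuous f →
      Integrable (fun x => UnitAddTorus.mFourier (-k) x * (f x : ℂ)) (torusMeasure d) := fun hf =>
    integrable_of_continuous ((UnitAddTorus.mFourier (-k)).continuous.mul
      (Complex.continuous_ofReal.comp hf))
  have h1 : Continuous fun x => vsyn (V t) x i := (continuous_apply i).comp (h.continuous t)
  have h2 : Continuous fun x => vsyn (W τ) x i := (continuous_apply i).comp (hW.continuous τ)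
  rw [← integral_sub (hc h1) (hc h2)]
  congr 1
  ext x
  simp [mul_sub]

/-- Coefficientwise convergence of bounded families implies convergence in lower norms. -/
lemma tendsto_hsNormVec_sub {ι : Type*} {ℱ : Filter ι} {s' M' : ℝ} (hs : s' < s)
    {V W : ι → ℝ → Freq d → Fin d → ℂ} (hV : ∀ n, IsHsCurve s M (V n))
    (hW : ∀ n, IsHsCurve s M' (W n)) {t τ : ι → ℝ}
    (hlim : ∀ k i, Tendsto (fun n => V n (t n) k i - W n (τ n) k i) ℱ (𝓝 0)) :
    Tendsto (fun n => hsNormVec s' (vsyn (V n (t n)) - vsyn (W n (τ n)))) ℱ (𝓝 0) := by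
  refine tendsto_hsNormVec_zero hs (M := 2 * M + 2 * M') (fun i => Eventually.of_forall fun n => ?_)
    fun i k => ?_
  · rw [show (fcoeff fun x => (vsyn (V n (t n)) - vsyn (W n (τ n))) x i) =
      fun k => V n (t n) k i - W n (τ n) k i from funext ((hV n).fcoeff_sub (hW n) _ _ i)]
    exact (((hV n).bound _).component i).sub (((hW n).bound _).component i)
  · simpa only [(hV _).fcoeff_sub (hW _)] using hlim k i

lemma isContinuousInHs (h : IsHsCurve s M V) {s' : ℝ} (hs : s' < s) (T : ℝ) :
    IsContinuousInHs s' T fun t => vsyn (V t) := by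
  intro t _
  refine ⟨memLp_of_continuous (h.continuous t) 2, ?_, ?_⟩
  · refine lt_of_le_of_lt (hsNormVec_le_of_hsBound (s := s') (M := M) (h.bound t).nonneg fun i => ?_)
      ENNReal.ofReal_lt_top
    rw [show (fcoeff fun x => vsyn (V t) x i) = fun k => V t k i from funext (h.fcoeff_vsyn t i)]
    exact ((h.bound t).component i).mono_exp hs.le
  · refine tendsto_hsNormVec_sub hs (V := fun _ => V) (W := fun _ => V) (fun _ => h) (fun _ => h)
      (t := fun τ : ℝ => τ) (τ := fun _ => t) fun k i => ?_
    have := ((h.cont k i).tendsto t).sub_const (V t k i)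
    rw [sub_self] at this
    exact this.mono_left nhdsWithin_le_nhds

/-- The solenoidal and potential parts, in Fourier variables, form the Helmholtz decomposition. -/
lemma isHelmholtz (h : IsHsCurve s M V) (t : ℝ) :
    IsHelmholtz (vsyn (V t)) (vsyn (_root_.solPart (V t))) (vsyn (_root_.potPart (V t))) where
  memLp_sol := memLp_of_continuous (h.solPart.continuous t) 2
  memLp_pot := memLp_of_continuous (h.potPart.continuous t) 2
  sum_eq := Eventually.of_forall fun x => by
    ext i
    simp only [Pi.add_apply, vsyn, rsyn]
    rw [← Complex.add_re, ← syn_add (h.solPart.summable t i) (h.potPart.summable t i)]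
    simp only [solPart_add_potPart]
  div_free ψ hψ := by
    have hψ1 := hψ.contDiff_one
    have hc := fun i => h.solPart.contDiff t i
    have h1 := fun i => continuous_of_contDiff_perLift (hc i)
    have h2 := fun i => continuous_pd (hc i) i
    have h3 := fun i => continuous_pd hψ1 i
    have h4 := continuous_of_contDiff_perLift hψ1
    have h5 := fun i => integrable_of_continuous (f := fun x =>
      vsyn (_root_.solPart (V t)) x i * pd i ψ x) ((h1 i).mul (h3 i))
    have h6 := fun i => integrable_of_continuous (f := fun x =>
      pd i (fun x => vsyn (_root_.solPart (V t)) x i) x * ψ x) ((h2 i).mul h4)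
    rw [integral_finsetSum _ fun i _ => h5 i,
      Finset.sum_congr rfl fun i _ => integral_mul_pd (hc i) hψ1 i, Finset.sum_neg_distrib,
      ← integral_finsetSum _ fun i _ => h6 i]
    simp only [← Finset.sum_mul, h.solPart.div_vsyn (radial_solPart (V t))]
    simp
  gradient := by
    -- Since `dsym i k = 2πi |k| dir k i`, the potential is the radial component divided by
    -- `2πi|k|`.
    set q : Freq d → ℂ := fun k => ((2 * Real.pi * freqNorm k : ℝ) : ℂ)⁻¹ * -Complex.I *
      radial (V t) k with hq
    have hqn : ∀ k, bra k * ‖q k‖ ≤ d * ‖V t k‖ := by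
      intro k
      have h1 := bra_mul_norm_inv_le k
      have h2 := norm_radial_le (V t) k
      rw [norm_neg] at h1
      simp only [hq, norm_mul, norm_neg, Complex.norm_I, mul_one, ← mul_assoc]
      exact (mul_le_mul_of_nonneg_right h1 (norm_nonneg _)).trans (by linarith)
    have hqs : Summable fun k => bra k * ‖q k‖ :=
      Summable.of_nonneg_of_le (fun k => mul_nonneg (bra_pos k).le (norm_nonneg _)) hqn
        (((h.bound_three t).summable_norm h.dim_le (by norm_num)).mul_left _)
    have hqd : ContDiff ℝ 1 (perLift (rsyn q)) := contDiff_perLift_rsyn 1 (by simpa using hqs)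
    refine ⟨rsyn q, memLp_of_continuous (continuous_of_contDiff_perLift hqd) 2, fun ψ hψ i => ?_⟩
    rw [integral_mul_pd hqd hψ.contDiff_one]
    congr 2
    ext x
    rw [pd_rsyn hqs, vsyn]
    congr 2
    ext k
    rw [hq, _root_.potPart, dsym, coord_eq_freqNorm_mul_dir]
    by_cases hk : freqNorm k = 0
    · have := freqNorm_eq_zero.1 hk
      subst this
      simp [dir_zero]
    · have h1 : (freqNorm k : ℂ) ≠ 0 := by exact_mod_cast hk
      have h2 : (Real.pi : ℂ) ≠ 0 := by exact_mod_cast Real.pi_ne_zero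
      push_cast
      field_simp
      linear_combination (-(dir k i : ℂ) * radial (V t) k) * Complex.I_sq

end IsHsCurve

/-! ### Plane waves as test functions -/

/-- A plane wave. -/
def planeWave (k : Freq d) (z : ℂ) (x : Torus d) : ℝ := (z * UnitAddTorus.mFourier k x).re

lemma planeWave_eq_rsyn (k : Freq d) (z : ℂ) : planeWave k z = rsyn (Pi.single k z) := by
  ext x
  rw [planeWave, rsyn, syn, tsum_eq_single k fun l hl => by simp [hl]]
  simp

lemma summable_single (n : ℕ) (k : Freq d) (z : ℂ) :
    Summable fun l => bra l ^ n * ‖(Pi.single k z : Freq d → ℂ) l‖ :=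
  summable_of_ne_finset_zero (s := {k}) fun l hl => by
    rw [Pi.single_eq_of_ne (by simpa using hl)]; simp

lemma isTest_planeWave (k : Freq d) (z : ℂ) : IsTest (planeWave k z) := by
  rw [planeWave_eq_rsyn]
  exact contDiff_infty.2 fun n => contDiff_perLift_rsyn n (summable_single n k z)

lemma pd_planeWave (k : Freq d) (z : ℂ) (i : Fin d) (x : Torus d) :
    pd i (planeWave k z) x = planeWave k (dsym i k * z) x := by
  rw [planeWave_eq_rsyn, planeWave_eq_rsyn, pd_rsyn (by simpa using summable_single 1 k z)]
  congr 2
  ext l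
  by_cases hl : l = k
  · subst hl; simp
  · simp [hl]

lemma integral_mul_planeWave {f : Torus d → ℝ} (hf : Integrable f (torusMeasure d)) (k : Freq d)
    (z : ℂ) : ∫ x, f x * planeWave k z x ∂torusMeasure d = (z * fcoeff f (-k)).re := by
  have hi : Integrable (fun x => UnitAddTorus.mFourier k x * (f x : ℂ)) (torusMeasure d) :=
    hf.ofReal.bdd_mul (c := 1) (UnitAddTorus.mFourier k).continuous.aestronglyMeasurable
      (Eventually.of_forall fun x => (norm_mFourier_apply k x).le)
  rw [fcoeff_eq_integral, neg_neg, ← integral_const_mul]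
  have := integral_re (hi.const_mul z)
  simp only [RCLike.re_eq_complex_re] at this
  rw [← this]
  congr 1
  ext x
  rw [planeWave, ← mul_assoc, Complex.re_mul_ofReal, mul_comm]

lemma eq_zero_of_forall_re_mul {w : ℂ} (h : ∀ z : ℂ, (z * w).re = 0) : w = 0 := by
  have h1 := h 1
  have h2 := h Complex.I
  apply Complex.ext <;> simp_all

/-- The Fourier coefficients of the solenoidal part of a vector field. -/
lemma IsHelmholtz.fcoeff_eq {v w g : Torus d → Fin d → ℝ} (h : IsHelmholtz v w g) (k : Freq d)
    (j : Fin d) : fcoeff (fun x => w x j) k = solPart (fun k i => fcoeff (fun x => v x i) k) k j := by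
  have hw : ∀ i, Integrable (fun x => w x i) (torusMeasure d) := fun i =>
    (h.memLp_sol.eval i).integrable one_le_two
  have hg : ∀ i, Integrable (fun x => g x i) (torusMeasure d) := fun i =>
    (h.memLp_pot.eval i).integrable one_le_two
  have hwv : ∀ k i, fcoeff (fun x => v x i) k =
      fcoeff (fun x => w x i) k + fcoeff (fun x => g x i) k := by
    intro k i
    have hi : ∀ {f : Torus d → ℝ}, Integrable f (torusMeasure d) →
        Integrable (fun x => UnitAddTorus.mFourier (-k) x * (f x : ℂ)) (torusMeasure d) :=
      fun hf => hf.ofReal.bdd_mul (c := 1)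
        (UnitAddTorus.mFourier (-k)).continuous.aestronglyMeasurable
        (Eventually.of_forall fun x => (norm_mFourier_apply (-k) x).le)
    simp only [fcoeff_eq_integral]
    rw [← integral_add (hi (hw i)) (hi (hg i))]
    refine integral_congr_ae ?_
    filter_upwards [h.sum_eq] with x hx
    rw [hx]
    simp [mul_add]
  -- The weak divergence condition is tested on plane waves of frequency `-k`. Their amplitude `z`
  -- is an arbitrary complex number, so the real identities determine the complex coefficient.
  have hrw : ∀ k, radial (fun k i => fcoeff (fun x => w x i) k) k = 0 := by
    intro k
    refine radial_eq_zero_of_sum_dsym (eq_zero_of_forall_re_mul fun z => ?_)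
    have h1 := h.div_free _ (isTest_planeWave (-k) z)
    simp only [pd_planeWave] at h1
    have hinteg : ∀ i, Integrable (fun x => w x i * planeWave (-k) (dsym i (-k) * z) x)
        (torusMeasure d) := fun i => by
      have hc := continuous_of_contDiff_perLift (isTest_planeWave (-k) (dsym i (-k) * z)).contDiff_one
      obtain ⟨C, hC⟩ := isCompact_univ.exists_bound_of_continuousOn hc.continuousOn
      exact (hw i).mul_bdd (c := C) hc.aestronglyMeasurable
        (Eventually.of_forall fun x => hC x (mem_univ x))
    rw [integral_finsetSum _ fun i _ => hinteg i] at h1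
    simp only [integral_mul_planeWave (hw _), neg_neg, dsym_neg] at h1
    rw [← Complex.re_sum] at h1
    rw [Finset.mul_sum]
    have e : ∑ i, -dsym i k * z * fcoeff (fun x => w x i) k =
        -∑ i, z * (dsym i k * fcoeff (fun x => w x i) k) := by
      rw [← Finset.sum_neg_distrib]
      exact Finset.sum_congr rfl fun i _ => by ring
    rw [e, Complex.neg_re, neg_eq_zero] at h1
    exact h1
  obtain ⟨q, hq, hqg⟩ := h.gradient
  have hgq : ∀ k i, fcoeff (fun x => g x i) k = dsym i k * fcoeff q k := by
    intro k i
    rw [← sub_eq_zero]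
    refine eq_zero_of_forall_re_mul fun z => ?_
    have h1 := hqg _ (isTest_planeWave (-k) z) i
    simp only [pd_planeWave] at h1
    rw [integral_mul_planeWave (hq.integrable one_le_two), integral_mul_planeWave (hg i), neg_neg,
      dsym_neg, eq_neg_iff_add_eq_zero, ← Complex.add_re] at h1
    rw [← h1]
    congr 1
    ring
  simp only [hwv]
  rw [solPart_add (fun k i => fcoeff (fun x => w x i) k) (fun k i => fcoeff (fun x => g x i) k),
    solPart_eq_self (hrw k), left_eq_add]
  -- The coefficients of a gradient are parallel to `k`, hence equal to their own potential part,
  -- and the solenoidal projection kills them.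
  have hp : (fun k i => fcoeff (fun x => g x i) k) = potPart fun k i => dsym i k * fcoeff q k := by
    ext k i
    have e : radial (fun k i => dsym i k * fcoeff q k) k =
        (2 * Real.pi * freqNorm k : ℝ) * Complex.I * fcoeff q k := by
      by_cases hk : k = 0
      · subst hk
        simp [radial, dir_zero, freqNorm_eq_zero.2]
      · have h := sum_dir_sq hk
        have h' : ∑ l, ((dir k l : ℝ) : ℂ) ^ 2 = 1 := by exact_mod_cast h
        calc _ = ∑ l, ((dir k l : ℝ) : ℂ) ^ 2 *
              ((2 * Real.pi * freqNorm k : ℝ) * Complex.I * fcoeff q k) :=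
              Finset.sum_congr rfl fun l _ => by
                simp only [dsym, coord_eq_freqNorm_mul_dir]; push_cast; ring
          _ = _ := by rw [← Finset.sum_mul, h', one_mul]
    rw [hgq, potPart, e]
    simp only [dsym, coord_eq_freqNorm_mul_dir]
    push_cast
    ring
  rw [hp]
  simp only [solPart, potPart]
  exact sub_eq_zero.2 (congrArg _ (radial_potPart (fun k i => dsym i k * fcoeff q k) k).symm)

/-! ### Oscillation in time and weak convergence of the potential part -/

/-- A bounded sequence of continuous functions whose primitives tend to zero uniformly. -/
structure Oscillates (T : ℝ) (f : ℕ → ℝ → ℂ) : Prop where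
  cont : ∀ n, Continuous (f n)
  bound : ∃ B, 0 ≤ B ∧ ∀ n t, ‖f n t‖ ≤ B
  primitive : ∃ δ : ℕ → ℝ, Tendsto δ atTop (𝓝 0) ∧
    ∀ n, ∀ t ∈ Icc 0 T, ‖∫ τ in (0)..t, f n τ‖ ≤ δ n

namespace Oscillates

variable {T : ℝ} {f : ℕ → ℝ → ℂ}

lemma const_mul (h : Oscillates T f) (c : ℂ) : Oscillates T fun n t => c * f n t := by
  obtain ⟨B, hB0, hB⟩ := h.bound
  obtain ⟨δ, hδ, hf⟩ := h.primitive
  refine ⟨fun n => continuous_const.mul (h.cont n), ⟨‖c‖ * B, by positivity, fun n t => ?_⟩,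
    fun n => ‖c‖ * δ n, by simpa using hδ.const_mul ‖c‖, fun n t ht => ?_⟩
  · rw [norm_mul]; exact mul_le_mul_of_nonneg_left (hB n t) (norm_nonneg _)
  · rw [intervalIntegral.integral_const_mul, norm_mul]
    exact mul_le_mul_of_nonneg_left (hf n t ht) (norm_nonneg _)

lemma comp_strictMono (h : Oscillates T f) {φ : ℕ → ℕ} (hφ : StrictMono φ) :
    Oscillates T fun n => f (φ n) := by
  obtain ⟨B, hB0, hB⟩ := h.bound
  obtain ⟨δ, hδ, hf⟩ := h.primitive
  exact ⟨fun n => h.cont _, ⟨B, hB0, fun n => hB _⟩, δ ∘ φ, hδ.comp hφ.tendsto_atTop,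
    fun n => hf _⟩

/-- Integration by parts: the polynomial takes the derivative and the small primitive of `f n`
remains. -/
lemma tendsto_integral_mul_polynomial (h : Oscillates T f) (p : Polynomial ℝ) {t : ℝ}
    (ht : t ∈ Icc 0 T) :
    Tendsto (fun n => ∫ τ in (0)..t, f n τ * ((p.eval τ : ℝ) : ℂ)) atTop (𝓝 0) := by
  obtain ⟨δ, hδ, hf⟩ := h.primitive
  have hp : ∀ τ, HasDerivAt (fun τ => ((p.eval τ : ℝ) : ℂ)) ((p.derivative.eval τ : ℝ) : ℂ) τ :=
    fun τ => (p.hasDerivAt τ).ofReal_comp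
  have hF : ∀ n τ, HasDerivAt (fun t => ∫ τ in (0)..t, f n τ) (f n τ) τ := fun n τ =>
    intervalIntegral.integral_hasDerivAt_right ((h.cont n).intervalIntegrable _ _)
      ((h.cont n).stronglyMeasurableAtFilter _ _) (h.cont n).continuousAt
  have hpc : Continuous fun τ => ((p.derivative.eval τ : ℝ) : ℂ) :=
    Complex.continuous_ofReal.comp p.derivative.continuous
  obtain ⟨C, hC⟩ := isCompact_Icc.exists_bound_of_continuousOn (s := Icc 0 T) hpc.continuousOn
  have hδ0 : ∀ n, 0 ≤ δ n := fun n => (norm_nonneg _).trans (hf n t ht)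
  refine squeeze_zero_norm (a := fun n => δ n * (‖((p.eval t : ℝ) : ℂ)‖ + C * |t - 0|))
    (fun n => ?_) (by simpa using hδ.mul_const _)
  have ibp := intervalIntegral.integral_mul_deriv_eq_deriv_mul_of_hasDerivAt (a := 0) (b := t)
    (u := fun τ => ((p.eval τ : ℝ) : ℂ)) (v := fun t => ∫ τ in (0)..t, f n τ)
    (fun τ _ => (hp τ).continuousAt.continuousWithinAt)
    (fun τ _ => (hF n τ).continuousAt.continuousWithinAt) (fun τ _ => hp τ) (fun τ _ => hF n τ)
    (hpc.intervalIntegrable _ _) ((h.cont n).intervalIntegrable _ _)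
  simp only [mul_comm (f n _)]
  rw [ibp, intervalIntegral.integral_same, mul_zero, sub_zero, mul_add]
  refine (norm_sub_le _ _).trans (add_le_add ?_ ?_)
  · rw [norm_mul, mul_comm]
    exact mul_le_mul_of_nonneg_right (hf n t ht) (norm_nonneg _)
  · rw [← mul_assoc]
    refine intervalIntegral.norm_integral_le_of_norm_le_const fun τ hτ => ?_
    rw [uIoc_of_le ht.1] at hτ
    have hτT : τ ∈ Icc 0 T := ⟨hτ.1.le, hτ.2.trans ht.2⟩
    rw [norm_mul, mul_comm]
    exact mul_le_mul (hf n τ hτT) (hC τ hτT) (norm_nonneg _) (hδ0 n)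

lemma norm_integral_mul_sub_le (h : Oscillates T f) {B : ℝ} (hB : ∀ n t, ‖f n t‖ ≤ B) (n : ℕ)
    {η θ : ℝ → ℂ} (hη : Continuous η) (hθ : Continuous θ) {κ t : ℝ} (ht : t ∈ Icc 0 T)
    (hκ : ∀ τ ∈ Icc 0 T, ‖η τ - θ τ‖ ≤ κ) :
    ‖(∫ τ in (0)..t, f n τ * η τ) - ∫ τ in (0)..t, f n τ * θ τ‖ ≤ B * κ * T := by
  have hκ0 : 0 ≤ κ := (norm_nonneg _).trans (hκ t ht)
  have hB0 : 0 ≤ B := (norm_nonneg _).trans (hB n t)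
  have hc := h.cont n
  rw [← intervalIntegral.integral_sub (Continuous.intervalIntegrable (by fun_prop) _ _)
    (Continuous.intervalIntegrable (by fun_prop) _ _)]
  refine (intervalIntegral.norm_integral_le_of_norm_le_const (C := B * κ) fun τ hτ => ?_).trans ?_
  · rw [uIoc_of_le ht.1] at hτ
    have hτT : τ ∈ Icc 0 T := ⟨hτ.1.le, hτ.2.trans ht.2⟩
    rw [← mul_sub, norm_mul]
    exact mul_le_mul (hB n τ) (hκ τ hτT) (norm_nonneg _) hB0
  · rw [sub_zero, abs_of_nonneg ht.1]
    exact mul_le_mul_of_nonneg_left ht.2 (by positivity)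

/-- The factor `η` need not be differentiable. Weierstrass approximation reduces it to a polynomial,
with an error controlled by the uniform bound on `f n`. -/
lemma tendsto_integral_mul_real (h : Oscillates T f) {η : ℝ → ℝ} (hη : Continuous η) {t : ℝ}
    (ht : t ∈ Icc 0 T) :
    Tendsto (fun n => ∫ τ in (0)..t, f n τ * (η τ : ℂ)) atTop (𝓝 0) := by
  obtain ⟨B, hB0, hB⟩ := h.bound
  have hT0 : 0 ≤ T := ht.1.trans ht.2
  rw [Metric.tendsto_atTop']
  intro r hr
  set κ := r / (2 * (B * T + 1)) with hκ
  have hκ0 : 0 < κ := by positivity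
  obtain ⟨p, hp⟩ := exists_polynomial_near_of_continuousOn 0 T η hη.continuousOn κ hκ0
  obtain ⟨N, hN⟩ := Metric.tendsto_atTop'.1 (h.tendsto_integral_mul_polynomial p ht) (r / 2)
    (by positivity)
  refine ⟨N, fun n hn => ?_⟩
  have h1 := hN n hn
  have h2 := h.norm_integral_mul_sub_le hB n (η := fun τ => (η τ : ℂ))
    (θ := fun τ => ((p.eval τ : ℝ) : ℂ)) (by fun_prop)
    (Complex.continuous_ofReal.comp p.continuous) ht (κ := κ) fun τ hτ => by
      rw [← Complex.ofReal_sub, Complex.norm_real, norm_sub_rev]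
      exact (hp τ hτ).le
  rw [dist_zero_right] at h1 ⊢
  have h3 : B * κ * T ≤ r / 2 := by
    have : κ * (B * T + 1) = r / 2 := by rw [hκ]; field_simp
    nlinarith
  linarith [norm_le_norm_sub_add (∫ τ in (0)..t, f n τ * (η τ : ℂ))
    (∫ τ in (0)..t, f n τ * ((p.eval τ : ℝ) : ℂ))]

lemma tendsto_integral_mul_const (h : Oscillates T f) {η : ℝ → ℂ} (hη : Continuous η) {t : ℝ}
    (ht : t ∈ Icc 0 T) : Tendsto (fun n => ∫ τ in (0)..t, f n τ * η τ) atTop (𝓝 0) := by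
  have hre : Continuous fun τ => (η τ).re := Complex.continuous_re.comp hη
  have him : Continuous fun τ => (η τ).im := Complex.continuous_im.comp hη
  have h1 := (h.tendsto_integral_mul_real hre ht).add
    ((h.tendsto_integral_mul_real him ht).mul_const Complex.I)
  simp only [zero_mul, add_zero] at h1
  refine h1.congr fun n => ?_
  have hc := h.cont n
  rw [← intervalIntegral.integral_mul_const, ← intervalIntegral.integral_add
    (Continuous.intervalIntegrable (by fun_prop) _ _)
    (Continuous.intervalIntegrable (by fun_prop) _ _)]
  congr 1
  ext τ
  conv_rhs => rw [← Complex.re_add_im (η τ)]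
  ring

/-- The integral of an oscillating factor against a strongly convergent one tends to zero. -/
lemma tendsto_integral_mul (h : Oscillates T f) {η : ℕ → ℝ → ℂ} {θ : ℝ → ℂ}
    (hη : ∀ n, Continuous (η n)) (hθ : Continuous θ)
    (hlim : TendstoUniformlyOn η θ atTop (Icc 0 T)) {t : ℝ} (ht : t ∈ Icc 0 T) :
    Tendsto (fun n => ∫ τ in (0)..t, f n τ * η n τ) atTop (𝓝 0) := by
  obtain ⟨B, hB0, hB⟩ := h.bound
  have hT0 : 0 ≤ T := ht.1.trans ht.2
  have h1 : Tendsto (fun n => (∫ τ in (0)..t, f n τ * η n τ) - ∫ τ in (0)..t, f n τ * θ τ) atTop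
      (𝓝 0) := by
    rw [Metric.tendsto_nhds]
    intro r hr
    filter_upwards [Metric.tendstoUniformlyOn_iff.1 hlim (r / (2 * (B * T + 1))) (by positivity)]
      with n hn
    have h2 := h.norm_integral_mul_sub_le hB n (hη n) hθ ht (κ := r / (2 * (B * T + 1)))
      fun τ hτ => by rw [← dist_eq_norm, dist_comm]; exact (hn τ hτ).le
    rw [dist_zero_right]
    refine h2.trans_lt ?_
    have : r / (2 * (B * T + 1)) * (B * T + 1) = r / 2 := by field_simp
    have h3 : 0 < r / (2 * (B * T + 1)) := by positivity
    nlinarith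
  simpa using h1.add (h.tendsto_integral_mul_const hθ ht)

end Oscillates

lemma linTerm_none_eq (u : Freq d → Option (Fin d) → ℂ) (k : Freq d) :
    linTerm u k none = radial (fun k j => u k (some j)) k := rfl

lemma IsFourierEP.continuous_bilin {ε T s M : ℝ} {u : ℝ → Freq d → Option (Fin d) → ℂ}
    (h : IsFourierEP ε T s M u) (k : Freq d) (a : Option (Fin d)) :
    Continuous fun t => bilin a (fun k j => u t k (some j)) (fun k => u t k a) k :=
  continuous_iff_continuousAt.2 fun t => tendsto_bilin h.dim_le (M := M)
    (Eventually.of_forall fun τ => h.isHsCurve.bound_three τ)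
    (Eventually.of_forall fun τ => h.bound_comp τ a)
    (fun k j => (h.cont k (some j)).tendsto t) (fun k => (h.cont k a).tendsto t) a k

lemma IsHsCurve.continuous_radial {s M : ℝ} {V : ℝ → Freq d → Fin d → ℂ} (h : IsHsCurve s M V)
    (k : Freq d) : Continuous fun t => radial (V t) k :=
  continuous_finsetSum _ fun l _ => continuous_const.mul (h.cont k l)

/-- The potential part of the velocity oscillates in time at frequency `1/ε`. -/
lemma IsFourierEP.norm_integral_radial_le {ε T s M : ℝ} {u : ℝ → Freq d → Option (Fin d) → ℂ}
    (h : IsFourierEP ε T s M u) (hε : ε ≠ 0) (k : Freq d) {t : ℝ} (ht : t ∈ Icc 0 T) :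
    ‖∫ τ in (0)..t, radial (fun k j => u τ k (some j)) k‖ ≤
      |ε| * (2 * √M + 2 * Real.pi * bilinBound d M * T) := by
  have hcr := h.isHsCurve.continuous_radial k
  have hcb := h.continuous_bilin k none
  have he := h.eqn t ht k none
  simp only [epField, linTerm_none_eq] at he
  rw [intervalIntegral.integral_add (Continuous.intervalIntegrable (by fun_prop) _ _)
    (Continuous.intervalIntegrable (by fun_prop) _ _), intervalIntegral.integral_const_mul,
    intervalIntegral.integral_const_mul] at he
  set A := ∫ τ in (0)..t, radial (fun k j => u τ k (some j)) k
  set Q := ∫ τ in (0)..t, bilin none (fun k j => u τ k (some j)) (fun k => u τ k none) k with hQ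
  have hεc : (ε : ℂ) ≠ 0 := by exact_mod_cast hε
  -- The integrated density equation is solved for its singular term; everything else in it is
  -- bounded independently of `ε`.
  have e : A = ε * Complex.I * (u t k none - u 0 k none - (2 * Real.pi : ℝ) * Q) := by
    rw [he]
    push_cast
    field_simp
    linear_combination A * Complex.I_sq
  have hb : ∀ t, ‖u t k none‖ ≤ √M := fun t => (h.bound_comp t none).norm_le (by norm_num) k
  have hQb : ‖Q‖ ≤ bilinBound d M * T := by
    refine (intervalIntegral.norm_integral_le_of_norm_le_const (C := bilinBound d M)
      fun τ _ => norm_bilin_le h.dim_le (h.isHsCurve.bound_three τ) (h.bound_comp τ none)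
        none k).trans ?_
    rw [sub_zero, abs_of_nonneg ht.1]
    exact mul_le_mul_of_nonneg_left ht.2 (bilinBound_nonneg M)
  rw [e, norm_mul, norm_mul, Complex.norm_I, mul_one, Complex.norm_real, Real.norm_eq_abs]
  refine mul_le_mul_of_nonneg_left ?_ (abs_nonneg _)
  have h1 : ‖((2 * Real.pi : ℝ) : ℂ) * Q‖ ≤ 2 * Real.pi * (bilinBound d M * T) := by
    rw [norm_mul, Complex.norm_real, Real.norm_of_nonneg Real.two_pi_pos.le]
    exact mul_le_mul_of_nonneg_left hQb Real.two_pi_pos.le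
  linarith [norm_sub_le (u t k none - u 0 k none) ((2 * Real.pi : ℝ) * Q),
    norm_sub_le (u t k none) (u 0 k none), hb t, hb 0]

lemma oscillates_radial {ε : ℕ → ℝ} (hε : ∀ n, ε n ≠ 0) (hε0 : Tendsto ε atTop (𝓝 0))
    {T s M : ℝ} {u : ℕ → ℝ → Freq d → Option (Fin d) → ℂ}
    (h : ∀ n, IsFourierEP (ε n) T s M (u n)) (k : Freq d) :
    Oscillates T fun n t => radial (fun k j => u n t k (some j)) k where
  cont n := (h n).isHsCurve.continuous_radial k
  bound := ⟨d * √M, by positivity, fun n t => (norm_radial_le _ k).trans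
    (mul_le_mul_of_nonneg_left (((h n).isHsCurve.bound_three t).norm_le (by norm_num) k)
      (by positivity))⟩
  primitive := ⟨fun n => |ε n| * (2 * √M + 2 * Real.pi * bilinBound d M * T), by
    simpa using (hε0.abs).mul_const _, fun n t ht => (h n).norm_integral_radial_le (hε n) k ht⟩

lemma IsHsCurve.abs_vsyn_le {s M : ℝ} {V : ℝ → Freq d → Fin d → ℂ} (h : IsHsCurve s M V) (t : ℝ)
    (x : Torus d) (i : Fin d) : |vsyn (V t) x i| ≤ √(latticeConst d) * √M :=
  (abs_rsyn_le (h.summable t i) x).trans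
    (((h.bound_three t).component i).tsum_norm_le h.dim_le (by norm_num))

lemma IsHsCurve.norm_vsyn_le {s M : ℝ} {V : ℝ → Freq d → Fin d → ℂ} (h : IsHsCurve s M V) (t : ℝ)
    (x : Torus d) : ‖vsyn (V t) x‖ ≤ √(latticeConst d) * √M :=
  (pi_norm_le_iff_of_nonneg (by positivity)).2 fun i => h.abs_vsyn_le t x i

lemma continuous_fcoeff {H : ℝ → Torus d → ℝ} (hH : Continuous (Function.uncurry H)) (k : Freq d) :
    Continuous fun t => fcoeff (H t) k := by
  simp only [fcoeff_eq_integral]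
  have := continuous_parametric_integral_of_continuous (μ := torusMeasure d)
    (f := fun (t : ℝ) (x : Torus d) => UnitAddTorus.mFourier (-k) x * (H t x : ℂ))
    (((UnitAddTorus.mFourier (-k)).continuous.comp continuous_snd).mul
      (Complex.continuous_ofReal.comp hH)) isCompact_univ
  simpa using this

lemma integral_rsyn_trunc_mul (N : ℕ) {c : Freq d → ℂ} (hc : Summable fun k => ‖c k‖)
    (hr : IsRealSeq c) {ψ : Torus d → ℝ} (hψ : Continuous ψ) :
    ∫ x, rsyn (trunc N c) x * ψ x ∂torusMeasure d =
      (∑ k ∈ freqBox d N, c k * fcoeff ψ (-k)).re := by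
  rw [← Complex.ofReal_re (∫ x, rsyn (trunc N c) x * ψ x ∂torusMeasure d),
    integral_rsyn_mul (summable_trunc N hc) (isRealSeq_trunc N hr) hψ,
    tsum_eq_sum (s := freqBox d N) fun k hk => by simp [trunc, hk]]
  congr 1
  exact Finset.sum_congr rfl fun k hk => by simp [trunc, hk]

/-- The tails of the coefficients of a bounded set in `H^s` are uniformly small in `ℓ¹`. -/
lemma exists_tail_le (hd : d ≤ 3) {σ M κ : ℝ} (hσ : 7 / 4 < σ) (hκ : 0 < κ) :
    ∃ N, ∀ c : Freq d → ℂ, HsBound σ M c → ∑' k, ‖trunc N c k - c k‖ ≤ κ := by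
  -- The product with the principal filter of the bounded set makes the convergence uniform on that
  -- set.
  have h := tendsto_tsum_norm_zero hd (s := σ) (M := M) hσ
    (ℱ := (atTop : Filter ℕ) ×ˢ 𝓟 {c : Freq d → ℂ | HsBound σ M c})
    (x := fun p k => trunc p.1 p.2 k - p.2 k) ?_ ?_
  · have h1 := (h.eventually (gt_mem_nhds hκ))
    rw [eventually_prod_principal_iff] at h1
    obtain ⟨N, hN⟩ := h1.exists
    exact ⟨N, fun c hc => (hN c hc).le⟩
  · rw [eventually_prod_principal_iff]
    refine Eventually.of_forall fun N c hc => hc.of_norm_le_one fun k => ?_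
    rw [trunc]; split_ifs <;> simp
  · intro k
    refine tendsto_const_nhds.congr' ?_
    filter_upwards [(eventually_mem_freqBox k).prod_inl _] with p hp
    simp [trunc, hp]

/-- On finitely many frequencies this is an oscillating factor against the continuous coefficients
of `H`; the remaining frequencies are small in `ℓ¹` uniformly in `n` and `t`. -/
lemma tendsto_integral_potPart_mul {ε : ℕ → ℝ} (hε : ∀ n, ε n ≠ 0) (hε0 : Tendsto ε atTop (𝓝 0))
    {T s M : ℝ} (hT : 0 ≤ T) {u : ℕ → ℝ → Freq d → Option (Fin d) → ℂ}
    (h : ∀ n, IsFourierEP (ε n) T s M (u n)) {H : ℝ → Torus d → ℝ}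
    (hH : Continuous (Function.uncurry H)) {C : ℝ} (hC : ∀ t x, |H t x| ≤ C) (i : Fin d) :
    Tendsto (fun n => ∫ t in (0)..T, ∫ x, vsyn (potPart fun k j => u n t k (some j)) x i * H t x
      ∂torusMeasure d) atTop (𝓝 0) := by
  have hp := fun n => (h n).isHsCurve.potPart
  have hC0 : 0 ≤ C := (abs_nonneg _).trans (hC 0 0)
  have hHt : ∀ t, Continuous (H t) := fun t => hH.comp (Continuous.prodMk_right t)
  have htr : ∀ N, Tendsto (fun n => ∫ t in (0)..T, ∫ x,
      rsyn (trunc N fun k => potPart (fun k j => u n t k (some j)) k i) x * H t x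
        ∂torusMeasure d) atTop (𝓝 0) := by
    intro N
    have h1 : ∀ k, Tendsto (fun n => ∫ t in (0)..T,
        potPart (fun k j => u n t k (some j)) k i * fcoeff (H t) (-k)) atTop (𝓝 0) := fun k =>
      ((oscillates_radial hε hε0 h k).const_mul (dir k i : ℝ)).tendsto_integral_mul_const
        (continuous_fcoeff hH (-k)) ⟨hT, le_rfl⟩
    have h2 := Complex.continuous_re.tendsto _ |>.comp
      (tendsto_finsetSum (freqBox d N) fun k _ => h1 k)
    simp only [Finset.sum_const_zero, Complex.zero_re] at h2
    refine h2.congr fun n => ?_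
    have hc : ∀ k, Continuous fun t =>
        potPart (fun k j => u n t k (some j)) k i * fcoeff (H t) (-k) := fun k =>
      ((hp n).cont k i).mul (continuous_fcoeff hH (-k))
    simp only [Function.comp]
    rw [← intervalIntegral.integral_finsetSum fun k _ => (hc k).intervalIntegrable _ _]
    have hci : Continuous fun t => ∑ k ∈ freqBox d N,
        potPart (fun k j => u n t k (some j)) k i * fcoeff (H t) (-k) :=
      continuous_finsetSum _ fun k _ => hc k
    rw [← Complex.reCLM_apply, ← Complex.reCLM.intervalIntegral_comp_comm
      (hci.intervalIntegrable _ _)]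
    refine intervalIntegral.integral_congr fun t _ => ?_
    exact (integral_rsyn_trunc_mul N ((hp n).summable t i) ((hp n).real t i) (hHt t)).symm
  rw [Metric.tendsto_nhds]
  intro r hr
  obtain ⟨N, hN⟩ := exists_tail_le (d := d) (h 0).dim_le (σ := 3) (M := d ^ 2 * M)
    (by norm_num) (κ := r / (2 * (C * T + 1))) (by positivity)
  filter_upwards [Metric.tendsto_nhds.1 (htr N) (r / 2) (by positivity)] with n hn
  rw [dist_zero_right] at hn ⊢
  have hcont1 : Continuous fun t => ∫ x, vsyn (potPart fun k j => u n t k (some j)) x i * H t x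
      ∂torusMeasure d := continuous_integral_torus
    (g := fun t x => vsyn (potPart fun k j => u n t k (some j)) x i * H t x)
    ((((hp n).l1Cont i).continuous_rsyn).mul hH)
  have hcont2 : Continuous fun t => ∫ x,
      rsyn (trunc N fun k => potPart (fun k j => u n t k (some j)) k i) x * H t x
      ∂torusMeasure d := continuous_integral_torus
    (g := fun t x => rsyn (trunc N fun k => potPart (fun k j => u n t k (some j)) k i) x * H t x)
    ((((hp n).l1Cont i).trunc N).continuous_rsyn.mul hH)
  have hdiff : ‖(∫ t in (0)..T, ∫ x, vsyn (potPart fun k j => u n t k (some j)) x i * H t x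
      ∂torusMeasure d) - ∫ t in (0)..T, ∫ x,
        rsyn (trunc N fun k => potPart (fun k j => u n t k (some j)) k i) x * H t x
        ∂torusMeasure d‖ ≤ r / (2 * (C * T + 1)) * C * |T - 0| := by
    rw [← intervalIntegral.integral_sub (hcont1.intervalIntegrable _ _)
      (hcont2.intervalIntegrable _ _)]
    refine intervalIntegral.norm_integral_le_of_norm_le_const fun t _ => ?_
    have hs := (hp n).summable t i
    have hc1 : Continuous fun x => vsyn (potPart fun k j => u n t k (some j)) x i :=
      continuous_rsyn hs
    have hc2 := continuous_rsyn (summable_trunc N hs)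
    have hc3 := hHt t
    rw [← integral_sub (integrable_of_continuous (by fun_prop))
      (integrable_of_continuous (by fun_prop))]
    refine (norm_integral_le_of_norm_le_const (C := r / (2 * (C * T + 1)) * C)
      (Eventually.of_forall fun x => ?_)).trans (le_of_eq (by simp))
    rw [← sub_mul, norm_mul]
    refine mul_le_mul ?_ (hC t x) (norm_nonneg _) (by positivity)
    rw [norm_sub_rev]
    exact (abs_rsyn_trunc_sub_le N hs x).trans (hN _ (((hp n).bound_three t).component i))
  rw [sub_zero, abs_of_nonneg hT] at hdiff
  have h3 : r / (2 * (C * T + 1)) * C * T < r / 2 := by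
    have : r / (2 * (C * T + 1)) * (C * T + 1) = r / 2 := by field_simp
    have h3 : 0 < r / (2 * (C * T + 1)) := by positivity
    nlinarith
  linarith [norm_le_norm_sub_add (∫ t in (0)..T, ∫ x,
    vsyn (potPart fun k j => u n t k (some j)) x i * H t x ∂torusMeasure d)
    (∫ t in (0)..T, ∫ x, rsyn (trunc N fun k => potPart (fun k j => u n t k (some j)) k i) x * H t x
      ∂torusMeasure d)]

/-- The potential part of the velocity converges weakly to zero. -/
theorem tendstoWeakL2_potPart {ε : ℕ → ℝ} (hε : ∀ n, ε n ≠ 0) (hε0 : Tendsto ε atTop (𝓝 0))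
    {T s M : ℝ} (hT : 0 ≤ T) {u : ℕ → ℝ → Freq d → Option (Fin d) → ℂ}
    (h : ∀ n, IsFourierEP (ε n) T s M (u n)) :
    TendstoWeakL2 ((volume.restrict (Icc 0 T)).prod (torusMeasure d))
      (fun n (z : ℝ × Torus d) => vsyn (potPart fun k j => u n z.1 k (some j)) z.2)
      (fun _ => 0) := by
  set μ := (volume.restrict (Icc 0 T)).prod (torusMeasure d)
  have hp := fun n => (h n).isHsCurve.potPart
  set G := √(latticeConst d) * √(d ^ 2 * M)
  have hG0 : 0 ≤ G := by positivity
  refine ⟨fun n => MemLp.of_bound (hp n).continuous_uncurry.aestronglyMeasurable G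
    (Eventually.of_forall fun z => (hp n).norm_vsyn_le z.1 z.2), MemLp.zero, fun f hf => ?_⟩
  have hfi : Integrable f μ := hf.integrable one_le_two
  simp only [Pi.zero_apply, zero_mul, Finset.sum_const_zero, integral_zero]
  rw [Metric.tendsto_nhds]
  intro r hr
  -- The potential parts are bounded in the sup norm uniformly in `n`, so it suffices to approximate
  -- the test field by bounded continuous ones in `L¹`.
  obtain ⟨H, hHf, hHi⟩ := hfi.exists_boundedContinuous_integral_sub_le
    (ε := r / (2 * (d * G + 1))) (by positivity)
  have hmain : Tendsto (fun n => ∫ z : ℝ × Torus d,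
      ∑ i, vsyn (potPart fun k j => u n z.1 k (some j)) z.2 i * H z i ∂μ) atTop (𝓝 0) := by
    have h1 := tendsto_finsetSum Finset.univ fun i (_ : i ∈ (Finset.univ : Finset (Fin d))) =>
      tendsto_integral_potPart_mul hε hε0 hT h (H := fun t x => H (t, x) i)
        ((continuous_apply i).comp H.continuous) (C := ‖H‖)
        (fun t x => (norm_le_pi_norm (H (t, x)) i).trans (H.norm_coe_le_norm _)) i
    rw [Finset.sum_const_zero] at h1
    refine h1.congr fun n => ?_
    have hinteg : ∀ i, Integrable (fun z : ℝ × Torus d =>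
        vsyn (potPart fun k j => u n z.1 k (some j)) z.2 i * H z i) μ := fun i => by
      refine Integrable.of_bound (C := G * ‖H‖) (Continuous.aestronglyMeasurable ?_)
        (Eventually.of_forall fun z => ?_)
      · exact (((hp n).l1Cont i).continuous_rsyn).mul ((continuous_apply i).comp H.continuous)
      · rw [norm_mul]
        exact mul_le_mul ((hp n).abs_vsyn_le z.1 z.2 i)
          ((norm_le_pi_norm (H z) i).trans (H.norm_coe_le_norm _)) (norm_nonneg _) hG0
    rw [integral_finsetSum _ fun i _ => hinteg i]
    refine Finset.sum_congr rfl fun i _ => ?_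
    rw [integral_prod _ (hinteg i), intervalIntegral.integral_of_le hT, ← integral_Icc_eq_integral_Ioc]
  filter_upwards [Metric.tendsto_nhds.1 hmain (r / 2) (by positivity)] with n hn
  rw [dist_zero_right] at hn ⊢
  have hbdd : ∀ {φ : ℝ × Torus d → Fin d → ℝ}, Integrable φ μ → Integrable (fun z =>
      ∑ i, vsyn (potPart fun k j => u n z.1 k (some j)) z.2 i * φ z i) μ := fun {φ} hφ =>
    integrable_finsetSum _ fun i _ => (hφ.eval i).bdd_mul (c := G)
      ((((hp n).l1Cont i).continuous_rsyn).aestronglyMeasurable)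
      (Eventually.of_forall fun z => (hp n).abs_vsyn_le z.1 z.2 i)
  have hdiff : ‖(∫ z, ∑ i, vsyn (potPart fun k j => u n z.1 k (some j)) z.2 i * f z i ∂μ) -
      ∫ z, ∑ i, vsyn (potPart fun k j => u n z.1 k (some j)) z.2 i * H z i ∂μ‖ ≤
      d * G * (r / (2 * (d * G + 1))) := by
    rw [← integral_sub (hbdd hfi) (hbdd hHi)]
    refine (norm_integral_le_integral_norm _).trans ?_
    refine (integral_mono (g := fun z => d * G * ‖f z - H z‖) ((hbdd hfi).sub (hbdd hHi)).norm
      ((hfi.sub hHi).norm.const_mul _) fun z => ?_).trans ?_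
    · show ‖∑ i, vsyn _ z.2 i * f z i - ∑ i, vsyn _ z.2 i * H z i‖ ≤ _
      rw [← Finset.sum_sub_distrib]
      simp only [← mul_sub]
      refine (norm_sum_le _ _).trans ((Finset.sum_le_card_nsmul _ _ (G * ‖f z - H z‖)
        fun i _ => ?_).trans (le_of_eq (by simp [mul_assoc])))
      rw [norm_mul]
      exact mul_le_mul ((hp n).abs_vsyn_le z.1 z.2 i) (norm_le_pi_norm (f z - H z) i)
        (norm_nonneg _) hG0
    · rw [integral_const_mul]
      exact mul_le_mul_of_nonneg_left hHf (by positivity)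
  have h3 : d * G * (r / (2 * (d * G + 1))) < r / 2 := by
    have : r / (2 * (d * G + 1)) * (d * G + 1) = r / 2 := by field_simp
    have h3 : 0 < r / (2 * (d * G + 1)) := by positivity
    nlinarith
  linarith [norm_le_norm_sub_add
    (∫ z, ∑ i, vsyn (potPart fun k j => u n z.1 k (some j)) z.2 i * f z i ∂μ)
    (∫ z, ∑ i, vsyn (potPart fun k j => u n z.1 k (some j)) z.2 i * H z i ∂μ)]

/-! ### Uniqueness for the incompressible Euler system -/

lemma pd_sub {f g : Torus d → ℝ} (hf : ContDiff ℝ 1 (perLift f)) (hg : ContDiff ℝ 1 (perLift g))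
    (i : Fin d) (x : Torus d) : pd i (fun x => f x - g x) x = pd i f x - pd i g x :=
  ((hasDerivAt_pd_zero (hf.differentiable one_ne_zero) x i).fun_sub
    (hasDerivAt_pd_zero (hg.differentiable one_ne_zero) x i)).deriv

/-- Transport by a divergence-free field preserves the `L²` norm. -/
lemma sum_integral_mul_transport {u : Fin d → Torus d → ℝ} (hu : ∀ j, ContDiff ℝ 1 (perLift (u j)))
    (hdiv : ∀ x, ∑ j, pd j (u j) x = 0) {z : Torus d → ℝ} (hz : ContDiff ℝ 1 (perLift z)) :
    ∑ j, ∫ x, z x * u j x * pd j z x ∂torusMeasure d = 0 := by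
  have hzc := continuous_of_contDiff_perLift hz
  have hzp := fun j => continuous_pd hz j
  have huc := fun j => continuous_of_contDiff_perLift (hu j)
  have hup := fun j => continuous_pd (hu j) j
  have h1 : ∀ j, 2 * ∫ x, z x * u j x * pd j z x ∂torusMeasure d =
      -∫ x, z x ^ 2 * pd j (u j) x ∂torusMeasure d := by
    intro j
    have h := integral_mul_pd (f := fun x => z x * u j x) (hz.mul (hu j)) hz j
    simp only [pd_mul hz (hu j)] at h
    have hu1 := huc j
    have hu2 := hup j
    have hz1 := hzp j
    have e : ∫ x, (pd j z x * u j x + z x * pd j (u j) x) * z x ∂torusMeasure d =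
        ∫ x, z x * u j x * pd j z x ∂torusMeasure d +
          ∫ x, z x ^ 2 * pd j (u j) x ∂torusMeasure d := by
      rw [← integral_add (integrable_of_continuous (by fun_prop))
        (integrable_of_continuous (by fun_prop))]
      congr 1; ext x; ring
    rw [e] at h
    linarith
  have h2 : 2 * ∑ j, ∫ x, z x * u j x * pd j z x ∂torusMeasure d = 0 := by
    rw [Finset.mul_sum, Finset.sum_congr rfl fun j _ => h1 j, Finset.sum_neg_distrib,
      ← integral_finsetSum _ fun j _ => integrable_of_continuous (by have := hup j; fun_prop)]
    simp [← Finset.mul_sum, hdiv]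
  linarith

/-- Divergence-free fields are orthogonal to gradients. -/
lemma sum_integral_mul_grad {z : Fin d → Torus d → ℝ} (hz : ∀ j, ContDiff ℝ 1 (perLift (z j)))
    (hdiv : ∀ x, ∑ j, pd j (z j) x = 0) {q : Torus d → ℝ} (hq : ContDiff ℝ 1 (perLift q)) :
    ∑ i, ∫ x, z i x * pd i q x ∂torusMeasure d = 0 := by
  have hqc := continuous_of_contDiff_perLift hq
  have hzp := fun j => continuous_pd (hz j) j
  rw [Finset.sum_congr rfl fun i _ => integral_mul_pd (hz i) hq i, Finset.sum_neg_distrib,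
    ← integral_finsetSum _ fun j _ => integrable_of_continuous (by have := hzp j; fun_prop)]
  simp [← Finset.sum_mul, hdiv]

/-- The energy estimate for the difference of two solutions of the Euler system. -/
lemma integral_energy_euler_le {u v z : Fin d → Torus d → ℝ} {q : Torus d → ℝ} {D : ℝ}
    (hu : ∀ j, ContDiff ℝ 1 (perLift (u j))) (hv : ∀ j, ContDiff ℝ 1 (perLift (v j)))
    (hz : ∀ j, ContDiff ℝ 1 (perLift (z j))) (hq : ContDiff ℝ 1 (perLift q))
    (hdu : ∀ x, ∑ j, pd j (u j) x = 0) (hdz : ∀ x, ∑ j, pd j (z j) x = 0)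
    (hD : ∀ i j x, |pd j (v i) x| ≤ D) :
    ∫ x, ∑ i, 2 * z i x * (-(∑ j, u j x * pd j (z i) x) - ∑ j, z j x * pd j (v i) x + pd i q x)
      ∂torusMeasure d ≤ 2 * D * d * ∫ x, ∑ i, z i x ^ 2 ∂torusMeasure d := by
  have huc := fun j => continuous_of_contDiff_perLift (hu j)
  have hzc := fun j => continuous_of_contDiff_perLift (hz j)
  have hqp := fun j => continuous_pd hq j
  have hvp := fun i j => continuous_pd (hv i) j
  have hzp := fun i j => continuous_pd (hz i) j
  have c1 : Continuous fun x => ∑ i, ∑ j, z i x * u j x * pd j (z i) x := by fun_prop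
  have c2 : Continuous fun x => ∑ i, z i x * pd i q x := by fun_prop
  have c3 : Continuous fun x => ∑ i, ∑ j, z i x * z j x * pd j (v i) x := by fun_prop
  have i1 : ∫ x, ∑ i, ∑ j, z i x * u j x * pd j (z i) x ∂torusMeasure d = 0 := by
    rw [integral_finsetSum _ fun i _ => integrable_of_continuous (by fun_prop)]
    refine Finset.sum_eq_zero fun i _ => ?_
    rw [integral_finsetSum _ fun j _ => integrable_of_continuous (by fun_prop)]
    exact sum_integral_mul_transport hu hdu (hz i)
  have i2 : ∫ x, ∑ i, z i x * pd i q x ∂torusMeasure d = 0 := by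
    rw [integral_finsetSum _ fun i _ => integrable_of_continuous (by fun_prop)]
    exact sum_integral_mul_grad hz hdz hq
  have e : ∀ x, ∑ i, 2 * z i x * (-(∑ j, u j x * pd j (z i) x) - ∑ j, z j x * pd j (v i) x +
      pd i q x) = -2 * (∑ i, ∑ j, z i x * u j x * pd j (z i) x) +
        2 * (∑ i, z i x * pd i q x) + -2 * ∑ i, ∑ j, z i x * z j x * pd j (v i) x := by
    intro x
    simp only [Finset.mul_sum, ← Finset.sum_add_distrib]
    refine Finset.sum_congr rfl fun i _ => ?_
    rw [mul_add, mul_sub, mul_neg, Finset.mul_sum, Finset.mul_sum, sub_eq_add_neg,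
      ← Finset.sum_neg_distrib, ← Finset.sum_neg_distrib]
    rw [add_right_comm]
    congr 1
    · congr 1
      · exact Finset.sum_congr rfl fun j _ => by ring
      · ring
    · exact Finset.sum_congr rfl fun j _ => by ring
  simp only [e]
  rw [integral_add (integrable_of_continuous (by fun_prop))
      (integrable_of_continuous (by fun_prop)),
    integral_add (integrable_of_continuous (by fun_prop)) (integrable_of_continuous (by fun_prop)),
    integral_const_mul, integral_const_mul, i1, i2, mul_zero, mul_zero, add_zero, zero_add,
    ← integral_const_mul]
  refine integral_mono (integrable_of_continuous (by fun_prop))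
    (integrable_of_continuous (by fun_prop)) fun x => ?_
  have hCS : (∑ i, |z i x|) ^ 2 ≤ d * ∑ i, z i x ^ 2 := by
    have := sq_sum_le_card_mul_sum_sq (s := Finset.univ) (f := fun i => |z i x|)
    simpa using this
  have hb : |∑ i, ∑ j, z i x * z j x * pd j (v i) x| ≤ D * (∑ i, |z i x|) ^ 2 := by
    rw [pow_two, Finset.sum_mul_sum, Finset.mul_sum]
    refine (Finset.abs_sum_le_sum_abs _ _).trans (Finset.sum_le_sum fun i _ => ?_)
    rw [Finset.mul_sum]
    refine (Finset.abs_sum_le_sum_abs _ _).trans (Finset.sum_le_sum fun j _ => ?_)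
    rw [abs_mul, abs_mul, mul_comm D]
    exact mul_le_mul_of_nonneg_left (hD i j x) (by positivity)
  rcases isEmpty_or_nonempty (Fin d) with hd | ⟨⟨i0⟩⟩
  · simp
  · have hD0 : 0 ≤ D := (abs_nonneg _).trans (hD i0 i0 x)
    have h1 := neg_le_of_abs_le hb
    have h2 := mul_le_mul_of_nonneg_left hCS hD0
    show -2 * (∑ i, ∑ j, z i x * z j x * pd j (v i) x) ≤ 2 * D * d * ∑ i, z i x ^ 2
    linarith

lemma continuous_clamp {T : ℝ} (hT : 0 ≤ T) {F : ℝ × Torus d → ℝ}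
    (hF : ContinuousOn F (Icc 0 T ×ˢ univ)) :
    Continuous fun z : ℝ × Torus d => F ((projIcc 0 T hT z.1 : ℝ), z.2) :=
  hF.comp_continuous (by fun_prop) fun z => ⟨(projIcc 0 T hT z.1).2, mem_univ _⟩

/-- Solutions of the Euler system are unique. -/
theorem IsEulerSolution.unique {s T : ℝ} {v₀ : Torus d → Fin d → ℝ}
    {u v : ℝ → Torus d → Fin d → ℝ} (hu : IsEulerSolution s T v₀ u)
    (hv : IsEulerSolution s T v₀ v) {t : ℝ} (ht : t ∈ Icc 0 T) : u t = v t := by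
  have hT : 0 ≤ T := ht.1.trans ht.2
  have h0m : (0 : ℝ) ∈ Icc 0 T := ⟨le_rfl, hT⟩
  obtain ⟨p, hp, hpe⟩ := hu.momentum
  obtain ⟨q, hq, hqe⟩ := hv.momentum
  have hzC : ∀ t ∈ Icc 0 T, ∀ i, ContDiff ℝ 1 (perLift fun x => u t x i - v t x i) :=
    fun t ht i => ((hu.regular i).contDiff t ht).sub ((hv.regular i).contDiff t ht)
  have hzpd : ∀ t ∈ Icc 0 T, ∀ i j x, pd j (fun x => u t x i - v t x i) x =
      pd j (fun x => u t x i) x - pd j (fun x => v t x i) x := fun t ht i j x =>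
    pd_sub ((hu.regular i).contDiff t ht) ((hv.regular i).contDiff t ht) j x
  have hpqpd : ∀ t ∈ Icc 0 T, ∀ i x, pd i (fun x => p t x - q t x) x =
      pd i (p t) x - pd i (q t) x := fun t ht i x =>
    pd_sub (hp.contDiff t ht) (hq.contDiff t ht) i x
  obtain ⟨D, hD⟩ : ∃ D, ∀ t ∈ Icc 0 T, ∀ i j x, |pd j (fun y => v t y i) x| ≤ D := by
    have h1 := fun i j => (isCompact_Icc.prod isCompact_univ).exists_bound_of_continuousOn
      ((hv.regular i).continuousOn_pd j)
    choose D hD using h1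
    refine ⟨∑ i, ∑ j, |D i j|, fun t ht i j x => ?_⟩
    refine (hD i j (t, x) ⟨ht, mem_univ _⟩).trans ((le_abs_self _).trans ?_)
    refine (Finset.single_le_sum (f := fun j => |D i j|) (fun _ _ => abs_nonneg _)
      (Finset.mem_univ j)).trans ?_
    exact Finset.single_le_sum (f := fun i => ∑ j, |D i j|)
      (fun _ _ => Finset.sum_nonneg fun _ _ => abs_nonneg _) (Finset.mem_univ i)
  set G : ℝ → Torus d → ℝ := fun t x => ∑ i, 2 * (u t x i - v t x i) *
    (-(∑ j, u t x j * pd j (fun x => u t x i - v t x i) x) -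
      ∑ j, (u t x j - v t x j) * pd j (fun y => v t y i) x + pd i (fun x => p t x - q t x) x)
    with hG
  have hGc : ContinuousOn (fun z : ℝ × Torus d => G z.1 z.2) (Icc 0 T ×ˢ univ) := by
    have a1 := fun i => (hu.regular i).continuousOn
    have a2 := fun i => (hv.regular i).continuousOn
    have a3 := fun i j => (hv.regular i).continuousOn_pd j
    have a4 : ∀ i j, ContinuousOn (fun z : ℝ × Torus d =>
        pd j (fun x => u z.1 x i - v z.1 x i) z.2) (Icc 0 T ×ˢ univ) := fun i j =>
      (((hu.regular i).continuousOn_pd j).sub (a3 i j)).congr fun z hz => hzpd z.1 hz.1 i j z.2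
    have a5 : ∀ i, ContinuousOn (fun z : ℝ × Torus d =>
        pd i (fun x => p z.1 x - q z.1 x) z.2) (Icc 0 T ×ˢ univ) := fun i =>
      ((hp.continuousOn_pd i).sub (hq.continuousOn_pd i)).congr fun z hz => hpqpd z.1 hz.1 i z.2
    refine continuousOn_finsetSum _ fun i _ => ContinuousOn.mul
      (continuousOn_const.mul ((a1 i).sub (a2 i))) (ContinuousOn.add (ContinuousOn.sub
        (continuousOn_finsetSum _ fun j _ => (a1 j).mul (a4 i j)).neg
        (continuousOn_finsetSum _ fun j _ => ((a1 j).sub (a2 j)).mul (a3 i j))) (a5 i))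
  -- Times are clamped to `[0, T]`, so that functions continuous on the slab become continuous for
  -- all times.
  set c : ℝ → ℝ := fun t => projIcc 0 T hT t with hc
  have hcm : ∀ t, c t ∈ Icc 0 T := fun t => (projIcc 0 T hT t).2
  have hcid : ∀ t ∈ Icc 0 T, c t = t := fun t ht => by simp [hc, projIcc_of_mem hT ht]
  set E : ℝ → Torus d → ℝ := fun t x => ∑ i, (u t x i - v t x i) ^ 2 with hE
  have hEc : ContinuousOn (fun z : ℝ × Torus d => E z.1 z.2) (Icc 0 T ×ˢ univ) :=
    continuousOn_finsetSum _ fun i _ =>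
      ((hu.regular i).continuousOn.sub (hv.regular i).continuousOn).pow 2
  have hEt : ∀ t ∈ Icc 0 T, Continuous (E t) := fun t ht =>
    continuous_finsetSum _ fun i _ => (continuous_of_contDiff_perLift (hzC t ht i)).pow 2
  have hder : ∀ t ∈ Icc 0 T, ∀ x, HasDerivWithinAt (fun τ => E τ x) (G (c t) x) (Icc 0 T) t := by
    intro t ht x
    rw [hcid t ht]
    have h1 := HasDerivWithinAt.fun_sum (u := Finset.univ) fun i (_ : i ∈ Finset.univ) =>
      ((hpe t ht x i).sub (hqe t ht x i)).pow 2
    refine h1.congr_deriv ?_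
    refine Finset.sum_congr rfl fun i _ => ?_
    simp only [hzpd t ht, hpqpd t ht, Pi.sub_apply]
    -- With `z = u - v`, this is `u·∇u - v·∇v = u·∇z + z·∇v`: the first term is harmless because `u`
    -- is divergence free, the second is bounded by `sup |∇v|`.
    have e : ∑ j, u t x j * (pd j (fun x => u t x i) x - pd j (fun x => v t x i) x) +
        ∑ j, (u t x j - v t x j) * pd j (fun y => v t y i) x =
        (∑ j, u t x j * pd j (fun y => u t y i) x) - ∑ j, v t x j * pd j (fun y => v t y i) x := by
      rw [← Finset.sum_add_distrib, ← Finset.sum_sub_distrib]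
      exact Finset.sum_congr rfl fun j _ => by ring
    push_cast
    linear_combination (2 * (u t x i - v t x i)) * e
  have hest : ∀ t ∈ Icc 0 T, ∫ x, E t x ∂torusMeasure d ≤
      2 * D * d * ∫ τ in (0)..t, ∫ x, E (c τ) x ∂torusMeasure d := by
    intro t ht
    have h1 := integral_eq_add_integral_deriv (f := E) (g := fun t x => G (c t) x)
      (continuous_clamp hT hGc) hEt hder ht
    have h2 : ∫ x, E 0 x ∂torusMeasure d = 0 := by
      refine integral_eq_zero_of_ae ?_
      filter_upwards [hu.init, hv.init] with x hx hy
      simp [hE, hx, hy]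
    rw [h1, h2, zero_add, ← intervalIntegral.integral_const_mul]
    refine intervalIntegral.integral_mono_on ht.1
      ((continuous_integral_torus (g := fun t x => G (c t) x)
        (continuous_clamp hT hGc)).intervalIntegrable _ _)
      ((continuous_const.mul (continuous_integral_torus (g := fun t x => E (c t) x)
        (continuous_clamp hT hEc))).intervalIntegrable _ _) fun τ _ => ?_
    have hτ := hcm τ
    refine integral_energy_euler_le (u := fun j x => u (c τ) x j) (v := fun j x => v (c τ) x j)
      (z := fun j x => u (c τ) x j - v (c τ) x j) (fun j => (hu.regular j).contDiff _ hτ)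
      (fun j => (hv.regular j).contDiff _ hτ) (fun j => hzC _ hτ j)
      ((hp.contDiff _ hτ).sub (hq.contDiff _ hτ)) (hu.div_free _ hτ) (fun x => ?_)
      (fun i j x => hD _ hτ i j x)
    simp only [hzpd _ hτ, Finset.sum_sub_distrib, hu.div_free _ hτ, hv.div_free _ hτ, sub_self]
  have hz := eq_zero_of_le_mul_integral (T := T) (c := 2 * D * d)
    (y := fun t => ∫ x, E (c t) x ∂torusMeasure d)
    (continuous_integral_torus (g := fun t x => E (c t) x) (continuous_clamp hT hEc))
    (fun t _ => integral_nonneg fun x => Finset.sum_nonneg fun i _ => sq_nonneg _)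
    (fun t ht => by rw [hcid t ht]; exact hest t ht) ht
  simp only [hcid t ht] at hz
  rw [integral_eq_zero_iff_of_nonneg (fun x => Finset.sum_nonneg fun i _ => sq_nonneg _)
    (integrable_of_continuous (hEt t ht))] at hz
  have hz2 := (Continuous.ae_eq_iff_eq (torusMeasure d) (hEt t ht) continuous_const).1 hz
  ext x i
  have h3 : ∑ i, (u t x i - v t x i) ^ 2 = 0 := congrFun hz2 x
  have h4 := (Finset.sum_eq_zero_iff_of_nonneg fun i _ => sq_nonneg _).1 h3 i (Finset.mem_univ i)
  exact sub_eq_zero.1 (pow_eq_zero_iff two_ne_zero |>.1 h4)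

/-! ### The solenoidal part of the quadratic term and the limit `ε → 0` -/

/-- The Fourier coefficients of `-X·∇Y`. -/
def advect (X Y : Freq d → Fin d → ℂ) (k : Freq d) (i : Fin d) : ℂ :=
  (2 * Real.pi : ℝ) * bilin (some i) X (fun k => Y k i) k

lemma summable_bilin_term (hd : d ≤ 3) {M : ℝ} {X : Freq d → Fin d → ℂ} {f : Freq d → ℂ}
    (hX : HsBound 3 M X) (hf : HsBound 3 M f) (a : Option (Fin d)) (k : Freq d) :
    Summable fun l => ∑ j, -Complex.I * (mult a k l j : ℝ) * X (k - l) j * f l :=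
  ((hsBound_bilin_term hX hf a k).summable_norm hd (by norm_num)).of_norm

lemma advect_add_left (hd : d ≤ 3) {M : ℝ} {X X' Y : Freq d → Fin d → ℂ} (hX : HsBound 3 M X)
    (hX' : HsBound 3 M X') (hY : HsBound 3 M Y) (k : Freq d) (i : Fin d) :
    advect (fun k j => X k j + X' k j) Y k i = advect X Y k i + advect X' Y k i := by
  simp only [advect, bilin]
  rw [← mul_add, ← (summable_bilin_term hd hX (hY.component i) _ k).tsum_add
    (summable_bilin_term hd hX' (hY.component i) _ k)]
  congr 1
  refine tsum_congr fun l => ?_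
  rw [← Finset.sum_add_distrib]
  exact Finset.sum_congr rfl fun j _ => by ring

lemma advect_add_right (hd : d ≤ 3) {M : ℝ} {X Y Y' : Freq d → Fin d → ℂ} (hX : HsBound 3 M X)
    (hY : HsBound 3 M Y) (hY' : HsBound 3 M Y') (k : Freq d) (i : Fin d) :
    advect X (fun k j => Y k j + Y' k j) k i = advect X Y k i + advect X Y' k i := by
  simp only [advect, bilin]
  rw [← mul_add, ← (summable_bilin_term hd hX (hY.component i) _ k).tsum_add
    (summable_bilin_term hd hX (hY'.component i) _ k)]
  congr 1
  refine tsum_congr fun l => ?_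
  rw [← Finset.sum_add_distrib]
  exact Finset.sum_congr rfl fun j _ => by ring

lemma norm_advect_le (hd : d ≤ 3) {M : ℝ} {X Y : Freq d → Fin d → ℂ} (hX : HsBound 3 M X)
    (hY : HsBound 3 M Y) (k : Freq d) : ‖advect X Y k‖ ≤ 2 * Real.pi * bilinBound d M := by
  refine (pi_norm_le_iff_of_nonneg (mul_nonneg Real.two_pi_pos.le (bilinBound_nonneg M))).2
    fun i => ?_
  rw [advect, norm_mul, Complex.norm_real, Real.norm_of_nonneg Real.two_pi_pos.le]
  exact mul_le_mul_of_nonneg_left (norm_bilin_le hd hX (hY.component i) _ k) Real.two_pi_pos.le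

lemma solPart_eq_zero_of_parallel {B : Freq d → Fin d → ℂ} {k : Freq d} {c : ℂ}
    (h : ∀ i, B k i = (dir k i : ℝ) * c) (i : Fin d) : solPart B k i = 0 := by
  by_cases hk : k = 0
  · subst hk
    simp [solPart, potPart, h, dir_zero]
  · have h' : ∑ l, ((dir k l : ℝ) : ℂ) ^ 2 = 1 := by exact_mod_cast sum_dir_sq hk
    have e : radial B k = c := by
      calc _ = ∑ l, ((dir k l : ℝ) : ℂ) ^ 2 * c :=
            Finset.sum_congr rfl fun l _ => by rw [h]; ring
        _ = c := by rw [← Finset.sum_mul, h', one_mul]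
    rw [solPart, potPart, e, h, sub_self]

/-- For a gradient field `P`, the field `P·∇P` is a gradient. -/
lemma solPart_advect_potPart (hd : d ≤ 3) {M : ℝ} {V : Freq d → Fin d → ℂ} (hV : HsBound 3 M V)
    (k : Freq d) (i : Fin d) : solPart (advect (potPart V) (potPart V)) k i = 0 := by
  have hP := hV.potPart
  set q : Freq d → ℂ := fun l => ((freqNorm l : ℝ) : ℂ)⁻¹ * radial V l with hq
  have hPq : ∀ l j, potPart V l j = (l j : ℝ) * q l := by
    intro l j
    simp only [potPart, hq, dir]
    push_cast
    ring
  set A : Freq d → ℂ := fun l => ∑ j, -Complex.I * (l j : ℝ) * ((k - l) j : ℤ) * q (k - l) * q l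
    with hA
  have hterm : ∀ i l, ∑ j, -Complex.I * (mult (some i) k l j : ℝ) * potPart V (k - l) j *
      potPart V l i = (l i : ℝ) * A l := by
    intro i l
    rw [hA, Finset.mul_sum]
    refine Finset.sum_congr rfl fun j _ => ?_
    rw [hPq, hPq, mult]
    push_cast
    ring
  have hAsymm : ∀ l, A (k - l) = A l := by
    intro l
    simp only [hA]
    refine Finset.sum_congr rfl fun j _ => ?_
    rw [sub_sub_cancel]
    push_cast [Pi.sub_apply]
    ring
  have hs : ∀ i, Summable fun l : Freq d => ((l i : ℝ) : ℂ) * A l := fun i => by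
    simpa only [hterm] using summable_bilin_term hd hP (hP.component i) (some i) k
  have hs' : ∀ i, Summable fun l : Freq d => (((k - l) i : ℤ) : ℂ) * A l := fun i => by
    have := (Equiv.subLeft k).summable_iff.2 (hs i)
    refine this.congr fun l => ?_
    simp [hAsymm]
  -- The Fourier form of `P·∇P = ∇|P|²/2`. The substitution `l ↦ k - l` leaves `A` invariant, and
  -- averaging replaces `l i` by `k i / 2`, which leaves a multiple of `k`.
  have hsum : ∀ i, 2 * bilin (some i) (potPart V) (fun k => potPart V k i) k =
      (k i : ℂ) * (∑' l, A l) := by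
    intro i
    have e1 : bilin (some i) (potPart V) (fun k => potPart V k i) k =
        ∑' l : Freq d, ((l i : ℝ) : ℂ) * A l := tsum_congr (hterm i)
    have e2 : ∑' l : Freq d, ((l i : ℝ) : ℂ) * A l =
        ∑' l : Freq d, (((k - l) i : ℤ) : ℂ) * A l := by
      rw [← (Equiv.subLeft k).tsum_eq]
      refine tsum_congr fun l => ?_
      simp [hAsymm]
    rw [e1, two_mul]
    nth_rewrite 2 [e2]
    rw [← (hs i).tsum_add (hs' i), ← tsum_mul_left]
    refine tsum_congr fun l => ?_
    push_cast [Pi.sub_apply]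
    ring
  refine solPart_eq_zero_of_parallel (c := Real.pi * freqNorm k * ∑' l, A l) (fun i => ?_) i
  have h1 := hsum i
  have h2 : (k i : ℂ) = freqNorm k * dir k i := by exact_mod_cast coord_eq_freqNorm_mul_dir k i
  rw [advect]
  push_cast
  linear_combination Real.pi * h1 + (Real.pi * ∑' l, A l) * h2

/-- Only the interactions with a solenoidal factor contribute to the solenoidal part of the
quadratic term. -/
lemma solPart_advect_eq (hd : d ≤ 3) {M : ℝ} {V : Freq d → Fin d → ℂ} (hV : HsBound 3 M V)
    (k : Freq d) (i : Fin d) : solPart (advect V V) k i =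
      solPart (advect (solPart V) (solPart V)) k i + solPart (advect (potPart V) (solPart V)) k i +
        solPart (advect (solPart V) (potPart V)) k i := by
  have hM := hV.nonneg
  have hd0 : (0 : ℝ) ≤ d := Nat.cast_nonneg d
  have h1 : HsBound 3 ((d + 1) ^ 2 * M) V :=
    hV.mono (by nlinarith [mul_nonneg hd0 hM, mul_nonneg (mul_nonneg hd0 hd0) hM])
  have h2 : HsBound 3 ((d + 1) ^ 2 * M) (solPart V) := hV.solPart
  have h3 : HsBound 3 ((d + 1) ^ 2 * M) (potPart V) := hV.potPart.mono (by nlinarith)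
  have hVe : V = fun k j => solPart V k j + potPart V k j := by
    ext k j; rw [solPart_add_potPart]
  have e : advect V V = fun k i => (advect (solPart V) (solPart V) k i +
      advect (potPart V) (solPart V) k i) + (advect (solPart V) (potPart V) k i +
        advect (potPart V) (potPart V) k i) := by
    ext k i
    conv_lhs => rw [hVe]
    rw [advect_add_right hd (M := (d + 1) ^ 2 * M) (by rwa [← hVe]) h2 h3,
      advect_add_left hd h2 h3 h2, advect_add_left hd h2 h3 h3]
  rw [e, solPart_add (fun k i => _ + _) (fun k i => _ + _), solPart_add (advect _ _) (advect _ _),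
    solPart_add (advect _ _) (advect _ _), solPart_advect_potPart hd hV, add_zero]

namespace IsHsCurve

variable {s M : ℝ} {V : ℝ → Freq d → Fin d → ℂ}

lemma continuous_advect {M' : ℝ} {W : ℝ → Freq d → Fin d → ℂ} (h : IsHsCurve s M V)
    (h' : IsHsCurve s M' W) (k : Freq d) (i : Fin d) : Continuous fun t => advect (V t) (W t) k i :=
  continuous_const.mul (continuous_iff_continuousAt.2 fun t =>
    tendsto_bilin h.dim_le (M := max M M')
      (Eventually.of_forall fun τ => (h.bound_three τ).mono (le_max_left _ _))
      (Eventually.of_forall fun τ => ((h'.bound_three τ).mono (le_max_right _ _)).component i)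
      (fun k j => (h.cont k j).tendsto t) (fun k => (h'.cont k i).tendsto t) _ k)

end IsHsCurve

lemma continuous_solPart {B : ℝ → Freq d → Fin d → ℂ} {k : Freq d}
    (h : ∀ i, Continuous fun t => B t k i) (i : Fin d) : Continuous fun t => solPart (B t) k i :=
  (h i).sub (continuous_const.mul (continuous_finsetSum _ fun l _ => continuous_const.mul (h l)))

lemma integral_solPart {B : ℝ → Freq d → Fin d → ℂ} {k : Freq d}
    (h : ∀ i, Continuous fun t => B t k i) (t : ℝ) (i : Fin d) :
    ∫ τ in (0)..t, solPart (B τ) k i = solPart (fun k i => ∫ τ in (0)..t, B τ k i) k i := by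
  have hi : ∀ i, IntervalIntegrable (fun t => B t k i) volume 0 t :=
    fun i => (h i).intervalIntegrable _ _
  have hr : IntervalIntegrable (fun t => radial (B t) k) volume 0 t :=
    (continuous_finsetSum _ fun l _ => continuous_const.mul (h l)).intervalIntegrable _ _
  simp only [solPart, potPart]
  rw [intervalIntegral.integral_sub (hi i) (hr.const_mul _), intervalIntegral.integral_const_mul]
  congr 2
  simp only [radial]
  rw [intervalIntegral.integral_finsetSum fun l _ => (hi l).const_mul _]
  simp only [intervalIntegral.integral_const_mul]

/-- The singular term does not contribute to the equation for the solenoidal part. -/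
lemma IsFourierEP.solPart_eqn {ε T s M : ℝ} {u : ℝ → Freq d → Option (Fin d) → ℂ}
    (h : IsFourierEP ε T s M u) {t : ℝ} (ht : t ∈ Icc 0 T) (k : Freq d) (i : Fin d) :
    solPart (fun k j => u t k (some j)) k i = solPart (fun k j => u 0 k (some j)) k i +
      ∫ τ in (0)..t, solPart
        (advect (fun k j => u τ k (some j)) fun k j => u τ k (some j)) k i := by
  have hc : ∀ i, Continuous fun τ =>
      advect (fun k j => u τ k (some j)) (fun k j => u τ k (some j)) k i :=
    h.isHsCurve.continuous_advect h.isHsCurve k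
  -- At each frequency the singular term points along `k`; it is isolated as a multiple of `dir k`
  -- so that the projection annihilates it.
  have e : ∀ i, u t k (some i) = (u 0 k (some i) + ∫ τ in (0)..t,
      advect (fun k j => u τ k (some j)) (fun k j => u τ k (some j)) k i) +
        (dir k i : ℝ) * (-Complex.I * (ε⁻¹ : ℝ) * ∫ τ in (0)..t, u τ k none) := by
    intro i
    rw [h.eqn t ht k (some i)]
    have h1 : ∀ τ, epField ε (u τ) k (some i) =
        advect (fun k j => u τ k (some j)) (fun k j => u τ k (some j)) k i +
          (dir k i : ℝ) * (-Complex.I * (ε⁻¹ : ℝ)) * u τ k none := fun τ => by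
      rw [epField, advect, linTerm]; ring
    simp only [h1]
    rw [intervalIntegral.integral_add ((hc i).intervalIntegrable _ _)
      (((h.cont k none).intervalIntegrable _ _).const_mul _), intervalIntegral.integral_const_mul]
    ring
  rw [integral_solPart hc]
  have e2 : solPart (fun k j => u t k (some j)) k i = solPart (fun _ i =>
      (u 0 k (some i) + ∫ τ in (0)..t,
        advect (fun k j => u τ k (some j)) (fun k j => u τ k (some j)) k i) +
        (dir k i : ℝ) * (-Complex.I * (ε⁻¹ : ℝ) * ∫ τ in (0)..t, u τ k none)) k i := by
    simp only [solPart, potPart, radial, ← e]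
  have e3 : solPart (fun _ i => (dir k i : ℝ) * (-Complex.I * (ε⁻¹ : ℝ) *
      ∫ τ in (0)..t, u τ k none)) k i = 0 := solPart_eq_zero_of_parallel (fun _ => rfl) i
  rw [e2, solPart_add (fun _ i => u 0 k (some i) + _) (fun _ i => (dir k i : ℝ) * _), e3, add_zero,
    solPart_add (fun _ i => u 0 k (some i)) (fun _ i => ∫ τ in (0)..t, _)]
  rfl

/-- Passage to the limit in time integrals of series whose terms are bounded in a weighted
`ℓ²` space. -/
lemma tendsto_integral_tsum_zero (hd : d ≤ 3) {σ M T : ℝ} (hσ : 7 / 4 < σ)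
    {c : ℕ → ℝ → Freq d → ℂ} (hc : ∀ n k, Continuous fun t => c n t k)
    (hM : ∀ n t, HsBound σ M (c n t)) (hT : 0 ≤ T)
    (hlim : ∀ k, Tendsto (fun n => ∫ t in (0)..T, c n t k) atTop (𝓝 0)) :
    Tendsto (fun n => ∫ t in (0)..T, ∑' k, c n t k) atTop (𝓝 0) := by
  have hl : ∀ n, L1Cont (c n) := fun n => by
    simpa using L1Cont.of_hsBound hd (r := 0) (p := fun _ => 1) (C := 1) (by linarith) (hM n) (hc n)
      (by simp)
  have htr : ∀ N, Tendsto (fun n => ∫ t in (0)..T, ∑' k, trunc N (c n t) k) atTop (𝓝 0) := by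
    intro N
    have h2 := tendsto_finsetSum (freqBox d N) fun k _ => hlim k
    rw [Finset.sum_const_zero] at h2
    refine h2.congr fun n => ?_
    rw [← intervalIntegral.integral_finsetSum fun k _ => (hc n k).intervalIntegrable _ _]
    refine intervalIntegral.integral_congr fun t _ => ?_
    show _ = ∑' k, trunc N (c n t) k
    rw [tsum_eq_sum (s := freqBox d N) fun k hk => by simp [trunc, hk]]
    exact Finset.sum_congr rfl fun k hk => by simp [trunc, hk]
  rw [Metric.tendsto_nhds]
  intro r hr
  obtain ⟨N, hN⟩ := exists_tail_le (d := d) hd (M := M) hσ (κ := r / (2 * (T + 1))) (by positivity)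
  filter_upwards [Metric.tendsto_nhds.1 (htr N) (r / 2) (by positivity)] with n hn
  rw [dist_zero_right] at hn ⊢
  have hdiff : ‖(∫ t in (0)..T, ∑' k, c n t k) - ∫ t in (0)..T, ∑' k, trunc N (c n t) k‖ ≤
      r / (2 * (T + 1)) * |T - 0| := by
    rw [← intervalIntegral.integral_sub ((hl n).continuous_tsum.intervalIntegrable _ _)
      (((hl n).trunc N).continuous_tsum.intervalIntegrable _ _)]
    refine intervalIntegral.norm_integral_le_of_norm_le_const fun t _ => ?_
    have hs := (hl n).1 t
    rw [norm_sub_rev, ← (summable_trunc N hs).of_norm.tsum_sub hs.of_norm]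
    exact (norm_tsum_le_tsum_norm ((summable_trunc N hs).of_norm.sub hs.of_norm).norm).trans
      (hN _ (hM n t))
  rw [sub_zero, abs_of_nonneg hT] at hdiff
  have h3 : r / (2 * (T + 1)) * T < r / 2 := by
    have : r / (2 * (T + 1)) * (T + 1) = r / 2 := by field_simp
    have h3 : 0 < r / (2 * (T + 1)) := by positivity
    nlinarith
  linarith [norm_le_norm_sub_add (∫ t in (0)..T, ∑' k, c n t k)
    (∫ t in (0)..T, ∑' k, trunc N (c n t) k)]

/-- The summands of the convolution are bounded in `H²` uniformly in `n`, so their tails are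
uniformly negligible and only single products of coefficients have to be examined. -/
lemma tendsto_integral_advect_zero {s M t : ℝ} (ht : 0 ≤ t) {X Y : ℕ → ℝ → Freq d → Fin d → ℂ}
    (hX : ∀ n, IsHsCurve s M (X n)) (hY : ∀ n, IsHsCurve s M (Y n)) (k : Freq d) (i : Fin d)
    (hlim : ∀ l j, Tendsto (fun n => ∫ τ in (0)..t, X n τ (k - l) j * Y n τ l i) atTop (𝓝 0)) :
    Tendsto (fun n => ∫ τ in (0)..t, advect (X n τ) (Y n τ) k i) atTop (𝓝 0) := by
  have h := tendsto_integral_tsum_zero (hX 0).dim_le (σ := 2) (by norm_num) (T := t)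
    (c := fun n τ l => ∑ j, -Complex.I * (mult (some i) k l j : ℝ) * X n τ (k - l) j * Y n τ l i)
    (fun n l => continuous_finsetSum _ fun j _ =>
      (continuous_const.mul ((hX n).cont _ j)).mul ((hY n).cont l i))
    (fun n τ => hsBound_bilin_term ((hX n).bound_three τ) (((hY n).bound_three τ).component i) _ k)
    ht (fun l => by
      have h1 := tendsto_finsetSum Finset.univ fun j (_ : j ∈ (Finset.univ : Finset (Fin d))) =>
        (hlim l j).const_mul (-Complex.I * (mult (some i) k l j : ℝ))
      simp only [mul_zero, Finset.sum_const_zero] at h1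
      refine h1.congr fun n => ?_
      have h1 := fun j => (hX n).cont (k - l) j
      have h2 := (hY n).cont l i
      rw [intervalIntegral.integral_finsetSum fun j _ => Continuous.intervalIntegrable
        (by have := h1 j; fun_prop) _ _]
      refine Finset.sum_congr rfl fun j _ => ?_
      rw [← intervalIntegral.integral_const_mul]
      simp only [mul_assoc])
  have h2 := h.const_mul ((2 * Real.pi : ℝ) : ℂ)
  rw [mul_zero] at h2
  refine h2.congr fun n => ?_
  rw [← intervalIntegral.integral_const_mul]
  rfl

lemma tendsto_solPart {ι : Type*} {ℱ : Filter ι} {B : ι → Freq d → Fin d → ℂ}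
    {B' : Freq d → Fin d → ℂ} {k : Freq d} (h : ∀ i, Tendsto (fun n => B n k i) ℱ (𝓝 (B' k i)))
    (i : Fin d) : Tendsto (fun n => solPart (B n) k i) ℱ (𝓝 (solPart B' k i)) :=
  (h i).sub ((tendsto_finsetSum _ fun l _ => (h l).const_mul _).const_mul _)

lemma integral_add_add {f g h : ℝ → ℂ} (hf : Continuous f) (hg : Continuous g) (hh : Continuous h)
    {a b : ℝ} : ∫ τ in a..b, (f τ + g τ + h τ) =
      (∫ τ in a..b, f τ) + (∫ τ in a..b, g τ) + ∫ τ in a..b, h τ := by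
  rw [intervalIntegral.integral_add (Continuous.intervalIntegrable (by fun_prop) _ _)
    (hh.intervalIntegrable _ _), intervalIntegral.integral_add (hf.intervalIntegrable _ _)
    (hg.intervalIntegrable _ _)]

/-- A family of coefficients that satisfies the Euler system in Fourier variables on `[0,T]`. -/
structure IsFourierEuler (T s M : ℝ) (W : ℝ → Freq d → Fin d → ℂ) : Prop extends
    IsHsCurve s M W where
  radial_eq : ∀ t k, radial (W t) k = 0
  eqn : ∀ t ∈ Icc 0 T, ∀ k i, W t k i = W 0 k i +
    ∫ τ in (0)..t, solPart (advect (W τ) (W τ)) k i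

/-- Compactness: the solenoidal parts of solutions of the Euler–Poisson system have limit points,
and these solve the Euler system. -/
theorem exists_subseq_tendsto_euler {ε : ℕ → ℝ} (hε : ∀ n, ε n ≠ 0) (hε0 : Tendsto ε atTop (𝓝 0))
    {T s M : ℝ} (hT : 0 ≤ T) {u : ℕ → ℝ → Freq d → Option (Fin d) → ℂ}
    (h : ∀ n, IsFourierEP (ε n) T s M (u n)) :
    ∃ (φ : ℕ → ℕ) (W : ℝ → Freq d → Fin d → ℂ), StrictMono φ ∧
      IsFourierEuler T s ((d + 1) ^ 2 * M) W ∧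
      ∀ k i, TendstoUniformlyOn (fun n t => solPart (fun k j => u (φ n) t k (some j)) k i)
        (fun t => W t k i) atTop (Icc 0 T) := by
  have hd := (h 0).dim_le
  have hV := fun n => (h n).isHsCurve
  have hS := fun n => (hV n).solPart
  set M' := (d + 1) ^ 2 * M with hM'
  have hM0 : 0 ≤ M := ((hV 0).bound 0).nonneg
  have hdM : d ^ 2 * M ≤ M' := by
    rw [hM']; have : (0 : ℝ) ≤ d := Nat.cast_nonneg d; nlinarith
  have hP : ∀ n, IsHsCurve s M' fun t => potPart fun k j => u n t k (some j) := fun n =>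
    { (hV n).potPart with bound := fun t => ((hV n).potPart.bound t).mono hdM }
  -- This Lipschitz constant in time is free of `ε`, because the equation for the solenoidal part
  -- has no singular term.
  set L := (d + 1) * (2 * Real.pi * bilinBound d M) with hL
  have hadv : ∀ n τ k i, ‖solPart (advect (fun k j => u n τ k (some j))
      fun k j => u n τ k (some j)) k i‖ ≤ L := fun n τ k i =>
    (norm_le_pi_norm _ i).trans ((norm_solPart_le _ k).trans (mul_le_mul_of_nonneg_left
      (norm_advect_le hd ((hV n).bound_three τ) ((hV n).bound_three τ) k) (by positivity)))
  have hcont : ∀ n k i, Continuous fun τ => solPart (advect (fun k j => u n τ k (some j))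
      fun k j => u n τ k (some j)) k i := fun n k =>
    continuous_solPart ((hV n).continuous_advect (hV n) k)
  obtain ⟨φ, g, hφ, hgc, hgp, hgl⟩ := exists_subseq_tendstoUniformlyOn hT (J := Freq d × Fin d)
    (f := fun n t j => solPart (fun k j => u n t k (some j)) j.1 j.2)
    (B := fun _ => √M') (L := fun _ => L)
    (fun n t _ j => (((hS n).bound_three t).component j.2).norm_le (by norm_num) j.1)
    (fun n t ht t' ht' j => by
      rw [(h n).solPart_eqn ht, (h n).solPart_eqn ht', add_sub_add_left_eq_sub,
        intervalIntegral.integral_interval_sub_left ((hcont n _ _).intervalIntegrable _ _)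
          ((hcont n _ _).intervalIntegrable _ _)]
      exact intervalIntegral.norm_integral_le_of_norm_le_const fun τ _ => hadv n τ _ _)
  set W : ℝ → Freq d → Fin d → ℂ := fun t k i => g t (k, i) with hW
  have hlim : ∀ t ∈ Icc 0 T, ∀ k i, Tendsto (fun n =>
      solPart (fun k j => u (φ n) t k (some j)) k i) atTop (𝓝 (W t k i)) := fun t ht k i =>
    (hgl (k, i)).tendsto_at ht
  have hWp : ∀ t, W t = W (projIcc 0 T hT t) := fun t => by
    ext k i; simp only [hW]; rw [hgp t]
  -- The limit is constant outside `[0, T]`, so any property of its values on the interval holds at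
  -- all times.
  have hall : ∀ {p : (Freq d → Fin d → ℂ) → Prop}, (∀ t ∈ Icc 0 T, p (W t)) → ∀ t, p (W t) :=
    fun hp t => by rw [hWp t]; exact hp _ (projIcc 0 T hT t).2
  have hcurve : IsHsCurve s M' W :=
    { dim_le := hd
      three_le := (h 0).three_le
      real := hall (p := fun w => ∀ j, IsRealSeq fun k => w k j) fun t ht j k =>
        tendsto_nhds_unique (hlim t ht (-k) j) (((Complex.continuous_conj.tendsto _).comp
          (hlim t ht k j)).congr fun n => ((hS (φ n)).real t j k).symm)
      bound := hall (p := fun w => HsBound s M' w) fun t ht =>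
        HsBound.of_tendsto (Eventually.of_forall fun n => (hS (φ n)).bound t)
          fun k => tendsto_pi_nhds.2 (hlim t ht k)
      cont := fun k i => hgc (k, i) }
  refine ⟨φ, W, hφ, { hcurve with radial_eq := ?_, eqn := ?_ }, fun k i => hgl (k, i)⟩
  · refine hall (p := fun w => ∀ k, radial w k = 0) fun t ht k => ?_
    refine tendsto_nhds_unique (tendsto_finsetSum _ fun l _ => (hlim t ht k l).const_mul _)
      (tendsto_const_nhds.congr fun n => ?_)
    exact (radial_solPart (fun k j => u (φ n) t k (some j)) k).symm
  · intro t ht k i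
    have h0m : (0 : ℝ) ∈ Icc 0 T := ⟨le_rfl, hT⟩
    have hosc := fun l => (oscillates_radial hε hε0 h l).comp_strictMono hφ
    have hWc : ∀ i, Continuous fun τ => advect (W τ) (W τ) k i := hcurve.continuous_advect hcurve k
    have t1 : ∀ i, Tendsto (fun n => ∫ τ in (0)..t, advect
        (solPart fun k j => u (φ n) τ k (some j)) (solPart fun k j => u (φ n) τ k (some j)) k i)
        atTop (𝓝 (∫ τ in (0)..t, advect (W τ) (W τ) k i)) := by
      intro i
      refine intervalIntegral.tendsto_integral_filter_of_dominated_convergence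
        (fun _ => 2 * Real.pi * bilinBound d M') (Eventually.of_forall fun n => ?_)
        (Eventually.of_forall fun n => Eventually.of_forall fun τ _ => ?_)
        intervalIntegrable_const (Eventually.of_forall fun τ hτ => ?_)
      · exact ((hS (φ n)).continuous_advect (hS (φ n)) k i).aestronglyMeasurable
      · exact (norm_le_pi_norm _ i).trans
          (norm_advect_le hd ((hS (φ n)).bound_three τ) ((hS (φ n)).bound_three τ) k)
      · rw [uIoc_of_le ht.1] at hτ
        have hτT : τ ∈ Icc 0 T := ⟨hτ.1.le, hτ.2.trans ht.2⟩
        exact (tendsto_bilin hd (Eventually.of_forall fun n => (hS (φ n)).bound_three τ)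
          (Eventually.of_forall fun n => ((hS (φ n)).bound_three τ).component i)
          (hlim τ hτT) (fun k => hlim τ hτT k i) _ k).const_mul _
    -- Mixed interactions: each product pairs an oscillating radial component with a solenoidal
    -- coefficient that converges uniformly in time.
    have t2 : ∀ i, Tendsto (fun n => ∫ τ in (0)..t, advect
        (potPart fun k j => u (φ n) τ k (some j)) (solPart fun k j => u (φ n) τ k (some j)) k i)
        atTop (𝓝 0) := fun i =>
      tendsto_integral_advect_zero ht.1 (fun n => hP (φ n)) (fun n => hS (φ n)) k i fun l j =>
        ((hosc (k - l)).const_mul (dir (k - l) j : ℝ)).tendsto_integral_mul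
          (fun n => (hS (φ n)).cont l i) (hgc (l, i)) (hgl (l, i)) ht
    have t3 : ∀ i, Tendsto (fun n => ∫ τ in (0)..t, advect
        (solPart fun k j => u (φ n) τ k (some j)) (potPart fun k j => u (φ n) τ k (some j)) k i)
        atTop (𝓝 0) := fun i =>
      tendsto_integral_advect_zero ht.1 (fun n => hS (φ n)) (fun n => hP (φ n)) k i fun l j => by
        refine (((hosc l).const_mul (dir l i : ℝ)).tendsto_integral_mul
          (fun n => (hS (φ n)).cont (k - l) j) (hgc (k - l, j)) (hgl (k - l, j)) ht).congr
            fun n => ?_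
        simp only [mul_comm (solPart _ _ _)]
        rfl
    have hc1 := fun n => (hS (φ n)).continuous_advect (hS (φ n)) k
    have hc2 := fun n => (hP (φ n)).continuous_advect (hS (φ n)) k
    have hc3 := fun n => (hS (φ n)).continuous_advect (hP (φ n)) k
    have t4 : Tendsto (fun n => ∫ τ in (0)..t, solPart (advect (fun k j => u (φ n) τ k (some j))
        fun k j => u (φ n) τ k (some j)) k i) atTop
        (𝓝 (∫ τ in (0)..t, solPart (advect (W τ) (W τ)) k i)) := by
      have h1 := tendsto_solPart (k := k) (B := fun n k i => ∫ τ in (0)..t, advect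
        (solPart fun k j => u (φ n) τ k (some j)) (solPart fun k j => u (φ n) τ k (some j)) k i)
        (B' := fun k i => ∫ τ in (0)..t, advect (W τ) (W τ) k i)
        t1 i
      have h2 := tendsto_solPart (k := k) (B := fun n k i => ∫ τ in (0)..t, advect
        (potPart fun k j => u (φ n) τ k (some j)) (solPart fun k j => u (φ n) τ k (some j)) k i)
        (B' := fun _ _ => 0) t2 i
      have h3 := tendsto_solPart (k := k) (B := fun n k i => ∫ τ in (0)..t, advect
        (solPart fun k j => u (φ n) τ k (some j)) (potPart fun k j => u (φ n) τ k (some j)) k i)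
        (B' := fun _ _ => 0) t3 i
      have hz : solPart (fun (_ : Freq d) (_ : Fin d) => (0 : ℂ)) k i = 0 := by
        simp [solPart, potPart, radial]
      rw [hz] at h2 h3
      have h4 := (h1.add h2).add h3
      rw [add_zero, add_zero, ← integral_solPart hWc] at h4
      refine h4.congr fun n => ?_
      have d1 := continuous_solPart (hc1 n) i
      have d2 := continuous_solPart (hc2 n) i
      have d3 := continuous_solPart (hc3 n) i
      rw [← integral_solPart (hc1 n), ← integral_solPart (hc2 n), ← integral_solPart (hc3 n),
        ← integral_add_add d1 d2 d3]
      refine intervalIntegral.integral_congr fun τ _ => ?_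
      exact (solPart_advect_eq hd ((hV (φ n)).bound_three τ) k i).symm
    refine tendsto_nhds_unique (hlim t ht k i) (((hlim 0 h0m k i).add t4).congr fun n => ?_)
    exact ((h (φ n)).solPart_eqn ht k i).symm

/-! ### From Fourier variables to the Euler system; convergence of the whole sequence -/

namespace IsHsCurve

variable {s M : ℝ} {V : ℝ → Freq d → Fin d → ℂ}

lemma advect_eq (h : IsHsCurve s M V) (t : ℝ) (k : Freq d) (i : Fin d) :
    advect (V t) (V t) k i =
      -1 * ∑ j, conv (fun k => V t k j) (fun k => dsym j k * V t k i) k := by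
  rw [advect, bilin_some_eq (fun j => h.summable t j) (fun j => (h.l1Cont_dsym j i).1 t),
    neg_one_mul]

lemma l1Cont_advect (h : IsHsCurve s M V) (i : Fin d) :
    L1Cont fun t k => advect (V t) (V t) k i := by
  simp only [h.advect_eq]
  exact (L1Cont.sum _ fun j _ => (h.l1Cont j).convolution
    (h.l1Cont_dsym j i)).mul_bounded (p := fun _ => -1) (C := 1) (by simp)

lemma syn_advect (h : IsHsCurve s M V) (i : Fin d) (t : ℝ) (x : Torus d) :
    syn (fun k => advect (V t) (V t) k i) x =
      ((-∑ j, vsyn (V t) x j * pd j (fun y => vsyn (V t) y i) x : ℝ) : ℂ) := by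
  simp only [h.advect_eq]
  rw [syn_const_mul, syn_sum _ fun j _ =>
    summable_norm_conv (h.summable t j) ((h.l1Cont_dsym j i).1 t)]
  push_cast
  rw [neg_one_mul]
  congr 1
  refine Finset.sum_congr rfl fun j _ => ?_
  rw [← syn_mul_syn (h.summable t j) ((h.l1Cont_dsym j i).1 t), vsyn, ofReal_rsyn (h.real t _),
    h.pd_vsyn, ofReal_rsyn (isRealSeq_dsym (h.real t _) j)]

end IsHsCurve

lemma l1Cont_radial {B : ℝ → Freq d → Fin d → ℂ} (h : ∀ i, L1Cont fun t k => B t k i) :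
    L1Cont fun t => radial (B t) :=
  L1Cont.sum _ fun l _ => (h l).mul_bounded (p := fun k => (dir k l : ℝ)) (C := 1) fun k => by
    simpa using abs_dir_le_one k l

lemma l1Cont_potPart {B : ℝ → Freq d → Fin d → ℂ} (h : ∀ i, L1Cont fun t k => B t k i)
    (i : Fin d) : L1Cont fun t k => potPart (B t) k i :=
  (l1Cont_radial h).mul_bounded (p := fun k => (dir k i : ℝ)) (C := 1) fun k => by
    simpa using abs_dir_le_one k i

/-- The Fourier coefficients of the pressure: the potential with gradient `-potPart B`. -/
def pressureCoeff (B : Freq d → Fin d → ℂ) (k : Freq d) : ℂ :=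
  -((2 * Real.pi * freqNorm k : ℝ) : ℂ)⁻¹ * (-Complex.I * radial B k)

lemma dsym_mul_pressureCoeff (B : Freq d → Fin d → ℂ) (i : Fin d) (k : Freq d) :
    dsym i k * pressureCoeff B k = -1 * potPart B k i := by
  simp only [dsym, pressureCoeff, potPart, dir]
  by_cases hk : freqNorm k = 0
  · simp [hk]
  · have h1 : (freqNorm k : ℂ) ≠ 0 := by exact_mod_cast hk
    have h2 : (Real.pi : ℂ) ≠ 0 := by exact_mod_cast Real.pi_ne_zero
    push_cast
    field_simp
    linear_combination (k i : ℂ) * radial B k * Complex.I_sq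

lemma l1Cont_pressureCoeff {B : ℝ → Freq d → Fin d → ℂ} (h : ∀ i, L1Cont fun t k => B t k i) :
    L1Cont fun t => pressureCoeff (B t) :=
  ((l1Cont_radial h).mul_bounded (p := fun _ => -Complex.I) (C := 1) (by simp)).mul_bounded
    norm_inv_two_pi_freqNorm_le

lemma summable_bra_pressureCoeff {B : Freq d → Fin d → ℂ}
    (h : Summable fun k => ‖radial B k‖) : Summable fun k => bra k * ‖pressureCoeff B k‖ := by
  refine Summable.of_nonneg_of_le (fun k => mul_nonneg (bra_pos k).le (norm_nonneg _))
    (fun k => ?_) h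
  rw [pressureCoeff, norm_mul, norm_mul (-Complex.I), norm_neg Complex.I, Complex.norm_I, one_mul,
    ← mul_assoc]
  exact mul_le_of_le_one_left (norm_nonneg _) (bra_mul_norm_inv_le k)

namespace IsFourierEuler

variable {T s M : ℝ} {W : ℝ → Freq d → Fin d → ℂ}

/-- The projection removes the potential part of the advection term, and the pressure is the
function whose gradient is minus that part. -/
lemma momentum (h : IsFourierEuler T s M W) {t : ℝ} (ht : t ∈ Icc 0 T) (x : Torus d) (i : Fin d) :
    HasDerivWithinAt (fun τ => vsyn (W τ) x i)
      (-(∑ j, vsyn (W t) x j * pd j (fun y => vsyn (W t) y i) x) +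
        pd i (rsyn (pressureCoeff (advect (W t) (W t)))) x) (Icc 0 T) t := by
  have hA := h.toIsHsCurve.l1Cont_advect
  have hP := (l1Cont_potPart hA i).mul_bounded (p := fun _ => -1) (C := 1) (by simp)
  have hS : L1Cont fun t k => solPart (advect (W t) (W t)) k i := by
    simpa only [solPart, sub_eq_add_neg, neg_one_mul] using (hA i).add hP
  have hder := hasDerivWithinAt_tsum_of_integral (T := T)
    (c := fun t k => UnitAddTorus.mFourier k x * W t k i)
    (h := fun t k => UnitAddTorus.mFourier k x * solPart (advect (W t) (W t)) k i)
    (hS.mul_bounded (C := 1) fun k => (norm_mFourier_apply k x).le)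
    (fun t _ => ((h.l1Cont i).mul_bounded (C := 1) fun k => (norm_mFourier_apply k x).le).1 t)
    (fun t ht k => by
      rw [h.eqn t ht k i, mul_add, intervalIntegral.integral_const_mul]) ht
  have hre := Complex.reCLM.hasFDerivAt.comp_hasDerivWithinAt t hder
  have e1 : (∑' k, UnitAddTorus.mFourier k x * solPart (advect (W t) (W t)) k i).re =
      -(∑ j, vsyn (W t) x j * pd j (fun y => vsyn (W t) y i) x) +
        pd i (rsyn (pressureCoeff (advect (W t) (W t)))) x := by
    have e2 : ∑' k, UnitAddTorus.mFourier k x * solPart (advect (W t) (W t)) k i =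
        syn (fun k => advect (W t) (W t) k i + -1 * potPart (advect (W t) (W t)) k i) x :=
      tsum_congr fun k => by rw [solPart]; ring
    rw [e2, syn_add ((hA i).1 t) (hP.1 t), h.syn_advect, Complex.add_re, Complex.ofReal_re,
      pd_rsyn (summable_bra_pressureCoeff ((l1Cont_radial hA).1 t))]
    simp only [dsym_mul_pressureCoeff]
    rfl
  simp only [Complex.reCLM_apply, e1] at hre
  refine hre.congr_of_mem (fun τ _ => ?_) ht
  simp only [Function.comp, Complex.reCLM_apply, vsyn, rsyn, syn]
  congr 1
  exact tsum_congr fun k => mul_comm _ _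

/-- A solution in Fourier variables is a solution of the Euler system. -/
theorem isEulerSolution (h : IsFourierEuler T s M W) {v₀ : Torus d → Fin d → ℝ}
    (hv₀ : MemLp v₀ 2 (torusMeasure d)) (h0 : ∀ k i, W 0 k i = fcoeff (fun x => v₀ x i) k) :
    IsEulerSolution s T v₀ fun t => vsyn (W t) where
  regular := h.isC1Slab T
  bounded := ⟨(√(d * M)).toNNReal, fun t _ => h.hsNormVec_le t⟩
  init := by
    have h1 : ∀ i, (fun x => vsyn (W 0) x i) =ᵐ[torusMeasure d] fun x => v₀ x i := fun i =>
      ae_eq_of_fcoeff_eq ((memLp_of_continuous (h.continuous 0) 2).eval i) (hv₀.eval i) fun k => by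
        rw [h.fcoeff_vsyn, h0]
    filter_upwards [ae_all_iff.2 h1] with x hx
    exact funext hx
  div_free t _ := h.div_vsyn (h.radial_eq t)
  momentum := by
    have hA := h.toIsHsCurve.l1Cont_advect
    refine ⟨fun t => rsyn (pressureCoeff (advect (W t) (W t))), ?_, fun t ht x i =>
      h.momentum ht x i⟩
    refine isC1Slab_rsyn T (fun t => summable_bra_pressureCoeff ((l1Cont_radial hA).1 t))
      (l1Cont_pressureCoeff hA) fun i => ?_
    simp only [dsym_mul_pressureCoeff]
    exact (l1Cont_potPart hA i).mul_bounded (p := fun _ => -1) (C := 1) (by simp)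

end IsFourierEuler

/-- Coefficientwise convergence, uniform in time, of bounded families implies convergence in
`C([0,T], H^{s'})`. -/
lemma tendsto_iSup_hsNormVec_sub {s s' M M' T : ℝ} (hs : s' < s)
    {V : ℕ → ℝ → Freq d → Fin d → ℂ} {W : ℝ → Freq d → Fin d → ℂ} (hV : ∀ n, IsHsCurve s M (V n))
    (hW : IsHsCurve s M' W) (hlim : ∀ k i,
      TendstoUniformlyOn (fun n t => V n t k i) (fun t => W t k i) atTop (Icc 0 T)) :
    Tendsto (fun n => ⨆ t ∈ Icc 0 T, hsNormVec s' (vsyn (V n t) - vsyn (W t))) atTop (𝓝 0) := by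
  -- Time is treated as part of the index, restricted by a principal filter; convergence along the
  -- product filter is convergence uniform in time, hence of the supremum.
  have h := IsHsCurve.tendsto_hsNormVec_sub hs (ℱ := (atTop : Filter ℕ) ×ˢ 𝓟 (Icc 0 T))
    (V := fun p : ℕ × ℝ => V p.1) (W := fun _ => W) (fun p => hV p.1) (fun _ => hW)
    (t := fun p => p.2) (τ := fun p => p.2) fun k i => by
      rw [Metric.tendsto_nhds]
      intro r hr
      rw [eventually_prod_principal_iff]
      filter_upwards [Metric.tendstoUniformlyOn_iff.1 (hlim k i) r hr] with n hn t ht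
      rw [dist_zero_right, ← dist_eq_norm, dist_comm]
      exact hn t ht
  rw [ENNReal.tendsto_nhds_zero] at h ⊢
  intro r hr
  have h1 := h r hr
  rw [eventually_prod_principal_iff] at h1
  filter_upwards [h1] with n hn
  exact iSup₂_le hn

/-- The solenoidal parts of solutions of the Euler–Poisson system converge to the solution of the
Euler system. -/
theorem exists_euler_limit {ε : ℕ → ℝ} (hε : ∀ n, ε n ≠ 0) (hε0 : Tendsto ε atTop (𝓝 0))
    {T s M : ℝ} (hT : 0 ≤ T) {u : ℕ → ℝ → Freq d → Option (Fin d) → ℂ}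
    (h : ∀ n, IsFourierEP (ε n) T s M (u n)) {v₀ : Torus d → Fin d → ℝ}
    (hv₀ : MemLp v₀ 2 (torusMeasure d))
    (h0 : ∀ k i, Tendsto (fun n => solPart (fun k j => u n 0 k (some j)) k i) atTop
      (𝓝 (fcoeff (fun x => v₀ x i) k))) :
    ∃ vbar : ℝ → Torus d → Fin d → ℝ, IsEulerSolution s T v₀ vbar ∧ ∀ s' < s,
      IsContinuousInHs s' T vbar ∧ Tendsto (fun n => ⨆ t ∈ Icc 0 T,
        hsNormVec s' (vsyn (solPart fun k j => u n t k (some j)) - vbar t)) atTop (𝓝 0) := by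
  -- Compactness is applied to an arbitrary subsequence. Every limit point solves the Euler system
  -- with the same datum, so uniqueness identifies them all and the whole sequence converges.
  have key : ∀ ψ : ℕ → ℕ, Tendsto ψ atTop atTop → ∃ (φ : ℕ → ℕ) (W : ℝ → Freq d → Fin d → ℂ),
      IsHsCurve s ((d + 1) ^ 2 * M) W ∧ IsEulerSolution s T v₀ (fun t => vsyn (W t)) ∧ ∀ s' < s,
        Tendsto (fun n => ⨆ t ∈ Icc 0 T, hsNormVec s'
          (vsyn (solPart fun k j => u (ψ (φ n)) t k (some j)) - vsyn (W t))) atTop (𝓝 0) := by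
    intro ψ hψ
    obtain ⟨φ, W, hφ, hW, hlim⟩ := exists_subseq_tendsto_euler (fun n => hε (ψ n)) (hε0.comp hψ) hT
      (fun n => h (ψ n))
    refine ⟨φ, W, hW.toIsHsCurve, hW.isEulerSolution hv₀ fun k i => ?_, fun s' hs =>
      tendsto_iSup_hsNormVec_sub hs (fun n => (h (ψ (φ n))).isHsCurve.solPart) hW.toIsHsCurve hlim⟩
    exact tendsto_nhds_unique ((hlim k i).tendsto_at ⟨le_rfl, hT⟩)
      ((h0 k i).comp (hψ.comp hφ.tendsto_atTop))
  obtain ⟨-, W, hWc, hW, -⟩ := key id tendsto_id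
  refine ⟨fun t => vsyn (W t), hW, fun s' hs => ⟨hWc.isContinuousInHs hs T, ?_⟩⟩
  refine tendsto_of_subseq_tendsto fun ψ hψ => ?_
  obtain ⟨φ, W', -, hW', hlim⟩ := key ψ hψ
  refine ⟨φ, (hlim s' hs).congr fun n => ?_⟩
  refine iSup_congr fun t => iSup_congr fun ht => ?_
  rw [show vsyn (W' t) = vsyn (W t) from hW'.unique hW ht]

/-! ### Initial data -/

/-- Plane waves in a single component are admissible test fields; the amplitudes `1` and `-i` give
the real and the imaginary part of the coefficient. -/
lemma tendsto_fcoeff_of_tendstoWeakL2 {w : ℕ → Torus d → Fin d → ℝ} {v : Torus d → Fin d → ℝ}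
    (h : TendstoWeakL2 (torusMeasure d) w v) (k : Freq d) (i : Fin d) :
    Tendsto (fun n => fcoeff (fun x => w n x i) k) atTop (𝓝 (fcoeff (fun x => v x i) k)) := by
  have key : ∀ z : ℂ, Tendsto (fun n => (z * fcoeff (fun x => w n x i) k).re) atTop
      (𝓝 (z * fcoeff (fun x => v x i) k).re) := by
    intro z
    have hc := continuous_of_contDiff_perLift (isTest_planeWave (-k) z).contDiff_one
    have h1 := h.2.2 (fun x => Pi.single i (planeWave (-k) z x))
      (memLp_of_continuous ((continuous_single i).comp hc) 2)
    have e : ∀ f : Torus d → Fin d → ℝ, MemLp f 2 (torusMeasure d) →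
        ∫ x, ∑ j, f x j * (Pi.single i (planeWave (-k) z x) : Fin d → ℝ) j ∂torusMeasure d =
          (z * fcoeff (fun x => f x i) k).re := fun f hf => by
      have := integral_mul_planeWave ((hf.eval i).integrable one_le_two) (-k) z
      rw [neg_neg] at this
      rw [← this]
      congr 1
      ext x
      simp [Pi.single_apply]
    rw [e v h.2.1] at h1
    exact h1.congr fun n => e _ (h.1 n)
  have h1 := key 1
  have h2 := key (-Complex.I)
  simp only [one_mul] at h1
  have e : ∀ w : ℂ, (-Complex.I * w).re = w.im := fun w => by simp
  simp only [e] at h2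
  have h3 := ((Complex.continuous_ofReal.tendsto _).comp h1).add
    (((Complex.continuous_ofReal.tendsto _).comp h2).mul_const Complex.I)
  simpa [Function.comp_def, Complex.re_add_im] using h3

lemma isRealSeq_fcoeff (f : Torus d → ℝ) : IsRealSeq (fcoeff f) := by
  intro k
  rw [fcoeff_eq_integral, fcoeff_eq_integral, ← integral_conj]
  congr 1
  ext x
  simp [UnitAddTorus.mFourier_neg]

/-- The initial data in Fourier variables, with `σ` standing for `(ρ - 1)/ε`. -/
def initCoeff (σ : Torus d → ℝ) (v : Torus d → Fin d → ℝ) (k : Freq d) : Option (Fin d) → ℂ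
  | none => -((2 * Real.pi * freqNorm k : ℝ) : ℂ)⁻¹ * -fcoeff σ k
  | some j => fcoeff (fun x => v x j) k

lemma isRealSeq_initCoeff (σ : Torus d → ℝ) (v : Torus d → Fin d → ℝ) (a : Option (Fin d)) :
    IsRealSeq fun k => initCoeff σ v k a := by
  intro k
  cases a with
  | none => simp [initCoeff, freqNorm_neg, isRealSeq_fcoeff σ k, Complex.conj_ofNat]
  | some j => exact isRealSeq_fcoeff _ k

/-- Dividing by `2π|k|` turns the `H^{s-1}` bound on `σ` into an `H^s` bound, which explains why
density and velocity are bounded one derivative apart. -/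
lemma sum_initCoeff_le {σ : Torus d → ℝ} {v : Torus d → Fin d → ℝ} {s : ℝ} {Cσ Cv : ℝ≥0}
    (hσ : hsNorm (s - 1) σ ≤ Cσ) (hv : hsNormVec s v ≤ Cv) (F : Finset (Freq d)) :
    ∑ k ∈ F, ∑ a, jap k ^ s * ‖initCoeff σ v k a‖ ^ 2 ≤ (Cσ : ℝ) ^ 2 + d * (Cv : ℝ) ^ 2 := by
  simp only [Fintype.sum_option, Finset.sum_add_distrib]
  refine add_le_add ?_ ?_
  · refine (Finset.sum_le_sum fun k _ => ?_).trans (hsBound_of_hsNorm_le hσ F)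
    have h1 := pow_le_one₀ (n := 2) (mul_nonneg (bra_pos k).le (norm_nonneg _))
      (bra_mul_norm_inv_le k)
    have e : jap k ^ s = jap k ^ (s - 1) * bra k ^ 2 := by
      rw [bra_sq, ← Real.rpow_add_one (jap_pos k).ne', sub_add_cancel]
    rw [initCoeff, norm_mul, norm_neg (fcoeff σ k), e, mul_pow]
    have h2 : 0 ≤ jap k ^ (s - 1) * ‖fcoeff σ k‖ ^ 2 :=
      mul_nonneg (jap_rpow_nonneg _ _) (sq_nonneg _)
    have := mul_le_mul_of_nonneg_left h1 h2
    rw [mul_pow] at this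
    linarith
  · rw [Finset.sum_comm]
    refine (Finset.sum_le_card_nsmul _ _ _ fun j _ => hsBound_of_hsNormVec_le hv j F).trans
      (le_of_eq (by simp))

lemma fcoeff_zero_eq (f : Torus d → ℝ) :
    fcoeff f 0 = ((∫ x, f x ∂torusMeasure d : ℝ) : ℂ) := by
  rw [fcoeff_eq_integral, ← integral_complex_ofReal]
  simp only [neg_zero, UnitAddTorus.mFourier_zero, ContinuousMap.one_apply, one_mul]

/-- The density variable loses the zero frequency of `σ`; the vanishing mean says that nothing was
there. -/
lemma sigCoeff_initCoeff {σ : Torus d → ℝ} (v : Torus d → Fin d → ℝ)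
    (hσ : ∫ x, σ x ∂torusMeasure d = 0) : sigCoeff (initCoeff σ v) = fcoeff σ := by
  ext k
  rw [sigCoeff, initCoeff]
  by_cases hk : k = 0
  · subst hk
    rw [fcoeff_zero_eq, hσ]
    simp
  · have h1 : freqNorm k ≠ 0 := fun h => hk (freqNorm_eq_zero.1 h)
    have h2 : ((2 * Real.pi * freqNorm k : ℝ) : ℂ) ≠ 0 := by
      exact_mod_cast mul_ne_zero Real.two_pi_pos.ne' h1
    rw [neg_mul_neg, mul_inv_cancel_left₀ h2]

/-- Solutions of the Euler–Poisson system in Fourier variables, on a time interval that depends only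
on the size of the data. -/
theorem exists_isFourierEP (hd : d ≤ 3) {s : ℝ} (hs : 3 ≤ s) (Cσ Cv : ℝ≥0) :
    ∃ T M : ℝ, 0 < T ∧ ∀ (ε : ℝ) (σ : Torus d → ℝ) (v : Torus d → Fin d → ℝ),
      hsNorm (s - 1) σ ≤ Cσ → hsNormVec s v ≤ Cv → ∃ u, IsFourierEP ε T s M u ∧
        u 0 = initCoeff σ v := by
  -- The final `1` is the shift of the Riccati variable. In the time `(2 * growthConst d s * Y +
  -- 1)⁻¹` below, the other `1` covers a vanishing growth constant.
  set Y : ℝ := (Cσ : ℝ) ^ 2 + d * (Cv : ℝ) ^ 2 + 1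
  have hg := growthConst_nonneg d (s := s) (by linarith)
  have hY : 0 < Y := by positivity
  have hpos : 0 < 2 * growthConst d s * Y + 1 := by positivity
  refine ⟨(2 * growthConst d s * Y + 1)⁻¹, 2 * Y, inv_pos.2 hpos, fun ε σ v hσ hv => ?_⟩
  obtain ⟨u, hr, hb, hc, h0, he⟩ := exists_epField_solution hd hs ε (u₀ := initCoeff σ v)
    (isRealSeq_initCoeff σ v) (Y := Y) (T := (2 * growthConst d s * Y + 1)⁻¹)
    (fun F => add_le_add (sum_initCoeff_le hσ hv F) le_rfl) (inv_pos.2 hpos).le (by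
      rw [← div_eq_mul_inv, div_le_one hpos]; linarith)
  exact ⟨u, ⟨hd, hs, hr, hb, hc, fun t ht k a => by rw [h0]; exact he t ht k a⟩, h0⟩

namespace IsFourierEP

variable {ε T s M : ℝ} {u : ℝ → Freq d → Option (Fin d) → ℂ}

lemma density_init (h : IsFourierEP ε T s M u) {σ : Torus d → ℝ} {v : Torus d → Fin d → ℝ}
    (h0 : u 0 = initCoeff σ v) (hσ : MemLp σ 2 (torusMeasure d))
    (hm : ∫ x, σ x ∂torusMeasure d = 0) :
    ∀ᵐ x ∂torusMeasure d, density ε (u 0) x = 1 + ε * σ x := by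
  have hs : Summable fun k => ‖sigCoeff (u 0) k‖ := h.l1Cont_sig.1 0
  have h1 : rsyn (sigCoeff (u 0)) =ᵐ[torusMeasure d] σ :=
    ae_eq_of_fcoeff_eq (memLp_of_continuous (continuous_rsyn hs) 2) hσ fun k => by
      rw [fcoeff_rsyn hs (isRealSeq_sigCoeff (h.real 0 none)), h0, sigCoeff_initCoeff v hm]
  filter_upwards [h1] with x hx
  rw [density, hx]

lemma velocity_init (h : IsFourierEP ε T s M u) {σ : Torus d → ℝ} {v : Torus d → Fin d → ℝ}
    (h0 : u 0 = initCoeff σ v) (hv : MemLp v 2 (torusMeasure d)) :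
    ∀ᵐ x ∂torusMeasure d, velField (u 0) x = v x := by
  have h1 : ∀ i, (fun x => velField (u 0) x i) =ᵐ[torusMeasure d] fun x => v x i := fun i =>
    ae_eq_of_fcoeff_eq (memLp_of_continuous (continuous_rsyn ((h.l1Cont (some i)).1 0)) 2)
      (hv.eval i) fun k => by rw [h.fcoeff_vel, h0]; rfl
  filter_upwards [ae_all_iff.2 h1] with x hx
  exact funext hx

end IsFourierEP

end

/-! ### The theorem -/

theorem theorem2p7 (d : ℕ) (hd : d = 2 ∨ d = 3) (s : ℝ) (hs : ((d / 2 : ℕ) : ℝ) + 2 ≤ s)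
    (ε : ℕ → ℝ) (hε : ∀ n, 0 < ε n) (hε0 : Tendsto ε atTop (𝓝 0))
    (ρ₀ : ℕ → Torus d → ℝ) (v₀ : ℕ → Torus d → Fin d → ℝ)
    (hρ₀ : ∀ n, MemLp (ρ₀ n) 2 (torusMeasure d))
    (hv₀ : ∀ n, MemLp (v₀ n) 2 (torusMeasure d))
    (hmass : ∀ n, ∫ x, ρ₀ n x ∂torusMeasure d = 1)
    (hvbound : ∃ C : ℝ≥0, ∀ n, hsNormVec s (v₀ n) ≤ C)
    (hρbound : ∃ C : ℝ≥0, ∀ n, hsNorm (s - 1) (fun x => (ε n)⁻¹ * (ρ₀ n x - 1)) ≤ C) :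
    ∃ T : ℝ, 0 < T ∧
    ∃ (ρ : ℕ → ℝ → Torus d → ℝ) (v w g : ℕ → ℝ → Torus d → Fin d → ℝ),
      -- existence on a uniform time interval, and uniform bounds
      (∀ n, IsEulerPoissonSolution (ε n) T (ρ₀ n) (v₀ n) (ρ n) (v n)) ∧
      (∀ n, (∀ᵐ x ∂torusMeasure d, 0 ≤ ρ₀ n x) → ∀ t ∈ Icc 0 T, ∀ x, 0 ≤ ρ n t x) ∧
      (∃ M : ℝ≥0, ∀ n, ∀ t ∈ Icc 0 T,
        hsNorm (s - 1) (fun x => (ε n)⁻¹ * (ρ n t x - 1)) ≤ M ∧ hsNormVec s (v n t) ≤ M) ∧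
      -- `w n t` and `g n t` are the solenoidal and the potential part of `v n t`
      (∀ n, ∀ t ∈ Icc 0 T, IsHelmholtz (v n t) (w n t) (g n t)) ∧
      -- the potential part converges weakly to zero in `L²([0,T] × 𝕋^d)`
      TendstoWeakL2 ((volume.restrict (Icc 0 T)).prod (torusMeasure d))
        (fun n (z : ℝ × Torus d) => g n z.1 z.2) (fun _ => 0) ∧
      -- the solenoidal part converges to the solution of the incompressible Euler system
      (∀ (w₀ g₀ : ℕ → Torus d → Fin d → ℝ) (vbar₀ : Torus d → Fin d → ℝ),
        (∀ n, IsHelmholtz (v₀ n) (w₀ n) (g₀ n)) →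
        TendstoWeakL2 (torusMeasure d) w₀ vbar₀ →
        ∃ vbar : ℝ → Torus d → Fin d → ℝ,
          IsEulerSolution s T vbar₀ vbar ∧
          (∀ u : ℝ → Torus d → Fin d → ℝ, IsEulerSolution s T vbar₀ u →
            ∀ t ∈ Icc 0 T, u t = vbar t) ∧
          ∀ s' : ℝ, s' < s →
            (∀ n, IsContinuousInHs s' T (w n)) ∧ IsContinuousInHs s' T vbar ∧
            Tendsto (fun n => ⨆ t ∈ Icc 0 T, hsNormVec s' (w n t - vbar t)) atTop (𝓝 0)) := by
  have hdim : d ≤ 3 := by omega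
  -- In both dimensions the integer part of `d/2` is `1`.
  have hs3 : 3 ≤ s := by
    have h1 : d / 2 = 1 := by omega
    rw [h1] at hs
    norm_num at hs
    linarith
  have hεne : ∀ n, ε n ≠ 0 := fun n => (hε n).ne'
  obtain ⟨Cv, hCv⟩ := hvbound
  obtain ⟨Cρ, hCρ⟩ := hρbound
  obtain ⟨T, M, hT, hex⟩ := exists_isFourierEP hdim hs3 Cρ Cv
  choose u hu hu0 using fun n => hex (ε n) _ _ (hCρ n) (hCv n)
  have hσ : ∀ n, MemLp (fun x => (ε n)⁻¹ * (ρ₀ n x - 1)) 2 (torusMeasure d) := fun n =>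
    ((hρ₀ n).sub (memLp_const 1)).const_mul _
  -- Unit mass is what allows the initial density to be recovered from `|∇|⁻¹ σ`.
  have hσm : ∀ n, ∫ x, (ε n)⁻¹ * (ρ₀ n x - 1) ∂torusMeasure d = 0 := fun n => by
    rw [integral_const_mul, integral_sub ((hρ₀ n).integrable one_le_two) (integrable_const 1),
      hmass n]
    simp
  have hρi : ∀ n, ∀ᵐ x ∂torusMeasure d, density (ε n) (u n 0) x = ρ₀ n x := fun n => by
    filter_upwards [(hu n).density_init (hu0 n) (hσ n) (hσm n)] with x hx
    rw [hx, mul_inv_cancel_left₀ (hεne n)]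
    ring
  have hvi := fun n => (hu n).velocity_init (hu0 n) (hv₀ n)
  refine ⟨T, hT, fun n t => density (ε n) (u n t), fun n t => velField (u n t),
    fun n t => vsyn (solPart fun k j => u n t k (some j)),
    fun n t => vsyn (potPart fun k j => u n t k (some j)),
    fun n => (hu n).isEulerPoissonSolution (hεne n) (hρi n) (hvi n), fun n hpos t ht x => ?_,
    ⟨max (√((2 * Real.pi) ^ 2 * M)).toNNReal (√(d * M)).toNNReal, fun n t _ => ⟨?_, ?_⟩⟩,
    fun n t _ => (hu n).isHsCurve.isHelmholtz t, tendstoWeakL2_potPart hεne hε0 hT.le hu,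
    fun w₀ g₀ vbar₀ hH hw => ?_⟩
  · refine (hu n).density_nonneg (hεne n) ?_ ht x
    filter_upwards [hpos, hρi n] with y hy hy'
    rwa [hy']
  · exact ((hu n).hsNorm_density_le (hεne n) t).trans (ENNReal.coe_le_coe.2 (le_max_left _ _))
  · exact ((hu n).hsNormVec_vel_le t).trans (ENNReal.coe_le_coe.2 (le_max_right _ _))
  -- Whichever Helmholtz decomposition of the data is given, its solenoidal coefficients are
  -- `solPart` of the initial coefficients of `u n`, so the assumed weak convergence is the one
  -- needed here.
  · obtain ⟨vbar, hvbar, hlim⟩ := exists_euler_limit hεne hε0 hT.le hu hw.2.1 fun k i => by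
      refine (tendsto_fcoeff_of_tendstoWeakL2 hw k i).congr fun n => ?_
      rw [(hH n).fcoeff_eq, hu0 n]
      rfl
    exact ⟨vbar, hvbar, fun v hv t ht => hv.unique hvbar ht, fun s' hs' =>
      ⟨fun n => (hu n).isHsCurve.solPart.isContinuousInHs hs' T, hlim s' hs'⟩⟩
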